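/- **Definitions.** A *constant power circuit* $\mathcal P$ is a finite non-empty directed acyclic graph without multiple edges, with edge labels $\mu(e)\in\{1,-1\}$ and a non-empty set $M(\mathcal P)\subseteq V(\mathcal P)$ of marked vertices with signs $\nu(v)\in\{1,-1\}$. Put $\mathcal E(v)=0$ if $v$ is a leaf (no outgoing edge), $\mathcal E(v)=2^{p_v}$ with $p_v=\sum_{e=(v\to w)}\mu(e)\,\mathcal E(w)$ otherwise, and $\mathcal E(\mathcal P)=\sum_{v\in M(\mathcal P)}\nu(v)\,\mathcal E(v)$. The circuit *properly represents* $N\in\mathbb Z$ if $\mathcal E(\mathcal P)=N$ and it is *proper*, i.e. $\mathcal E(v)\in\mathbb N$ for all $v$. It is *normal* if * it is proper; every vertex is reachable from a marked one; either $\mathcal P$ consists of one vertex only, or it has exactly one leaf and this leaf is unmarked; a vertex with an edge to a leaf has no other outgoing edge; * different vertices have different values $\mathcal E(v)$; there are no edges $v\to v_1$, $v\to v_2$ with opposite labels and $\mathcal E(v_1)=\mathcal E(v_2)$ or $\mathcal E(v_1)=2\,\mathcal E(v_2)$; * $|p_u-p_w|\ge 2$ for any two different non-leaf vertices $u,w$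 that are both marked or are both termini of edges leaving one and the same vertex. Terms are built from $0$, $1$ and variables with the binary operations $+$, $-$, $x\cdot 2^{y}$, $x\cdot 2^{-y}$; the last two are partial operations on $\mathbb Z$, defined if and only if the result is an integer, and a term is defined if and only if all its operations are. For a term $t$ let $|t|$ be the number of operations in $t$, and $\sigma_x(t),\sigma_0(t),\sigma_1(t)$ the numbers of occurrences of the variable $x$ and of the constants $0,1$. **Theorem.** There are an algorithm (a program for a random access machine with integer registers and memory cells, whose arithmetic instructions are addition and subtraction, every instruction and every test counting as one step) and a constant $C$ with the following property. Let $t$ be a term in variables from a finite set $X$, and let $\eta$ assign to each $x\in X$ a normal circuit $\eta(x)$; write $t(\eta(X))$ for the value of $t$ when each $x$ takes the value $\mathcal E(\eta(x))$. On input $(t,\eta)$ the algorithm halts. It outputs "Failure" if $t(\eta(X))$ is not defined in $\mathbb Z$; if $t(\eta(X))$ is defined, it outputs a normal circuit $\mathcal P_t$ that properly represents $t(\eta(X))$, and $$|M(\mathcal P_t)|\le \max\Bigl(1,\ \sum_{x\in X}\sigma_x(t)\,|M(\eta(x))|+\sigma_1(t)\Bigr),$$ $$|V(\mathcal P_t)|\le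 2(|t|+1)\Bigl(\sum_{x\in X}\sigma_x(t)\,|V(\eta(x))|+2\sigma_1(t)+\sigma_0(t)\Bigr).$$ In all cases the number of steps is at most $$C\cdot \max(1,|t|)^4\cdot\Bigl(\sum_{x\in X}\sigma_x(t)\,|V(\eta(x))|+2\sigma_1(t)+\sigma_0(t)\Bigr)^3 .$$ (Here a circuit is given by its number of vertices, its marks and its matrix of edge labels, the term is given in reverse Polish notation, and the input contains a table with the addresses of the circuits $\eta(x)$.) -/

import Mathlib

namespace PowerCircuits

/-! ### Constant power circuits -/

/-- A constant power circuit on the vertex set `Fin n`: a finite directed acyclic graph without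
multiple edges, with edge labels `±1`, and with a non-empty set of marked vertices, each carrying a
sign `±1`.  `edge v w = 0` means that there is no edge from `v` to `w`, otherwise `edge v w` is the
label of that edge; `mark v = 0` means that `v` is unmarked, otherwise `mark v` is its sign.
All leaves carry the constant `0`. -/
structure Circuit where
  n : ℕ
  edge : Fin n → Fin n → SignType
  mark : Fin n → SignType
  acyclic : ∀ v, ¬ Relation.TransGen (fun a b => edge a b ≠ 0) v v
  exists_marked : ∃ v, mark v ≠ 0

namespace Circuit

variable (P : Circuit)

/-- There is an edge from `v` to `w`. -/
def Adj (v w : Fin P.n) : Prop := P.edge v w ≠ 0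

/-- A vertex without outgoing edges; in a constant circuit these are the zero vertices. -/
def IsLeaf (v : Fin P.n) : Prop := ∀ w, ¬ P.Adj v w

theorem wellFounded_adj : WellFounded (fun w v => P.Adj v w) := by
  have h : WellFounded (fun w v => Relation.TransGen P.Adj v w) := by
    have h₁ : Std.Irrefl (fun w v => Relation.TransGen P.Adj v w) := ⟨P.acyclic⟩
    have h₂ : IsTrans (Fin P.n) (fun w v => Relation.TransGen P.Adj v w) :=
      ⟨fun _ _ _ hab hbc => hbc.trans hab⟩
    exact Finite.wellFounded_of_trans_of_irrefl _
  exact Subrelation.wf (fun h => Relation.TransGen.single h) h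

open Classical in
/-- The real number `ℰ(v)` represented by a vertex: `0` at a leaf, and otherwise
`2 ^ (∑ μ(e) ℰ(β(e)))`, the sum being over the edges `e` with origin `v` and terminus `β(e)`
(see `vertexValue_eq`). -/
noncomputable def vertexValue : Fin P.n → ℝ :=
  P.wellFounded_adj.fix fun v ih =>
    if P.IsLeaf v then 0
    else (2 : ℝ) ^ (∑ w, if h : P.Adj v w then (P.edge v w : ℝ) * ih w h else 0)

/-- The exponent `∑ μ(e) ℰ(β(e))` over the edges `e` leaving `v`. -/
noncomputable def exponent (v : Fin P.n) : ℝ := ∑ w, (P.edge v w : ℝ) * P.vertexValue w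

open Classical in
theorem vertexValue_eq (v : Fin P.n) :
    P.vertexValue v = if P.IsLeaf v then 0 else (2 : ℝ) ^ P.exponent v := by
  unfold vertexValue exponent
  rw [WellFounded.fix_eq]
  congr 2
  refine Finset.sum_congr rfl fun w _ => ?_
  by_cases h : P.Adj v w
  · rw [dif_pos h]; rfl
  · rw [dif_neg h, not_not.mp h]; simp

/-- The real number `ℰ(P) = ∑ ν(v) ℰ(v)` over the marked vertices. -/
noncomputable def value : ℝ := ∑ v, (P.mark v : ℝ) * P.vertexValue v

/-- `P` is proper: every vertex represents a natural number. -/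
def IsProper : Prop := ∀ v, ∃ m : ℕ, P.vertexValue v = m

/-- `P` properly represents the integer `N`. -/
def Represents (N : ℤ) : Prop := P.IsProper ∧ P.value = N

/-- The number `|V(P)|` of vertices. -/
def numVertices : ℕ := P.n

/-- The number `|M(P)|` of marked vertices. -/
def numMarked : ℕ := (Finset.univ.filter fun v => P.mark v ≠ 0).card

/-- Every vertex is reachable from a marked vertex. -/
def IsTrimmed : Prop := ∀ v, ∃ m, P.mark m ≠ 0 ∧ Relation.ReflTransGen P.Adj m v

/-- `P` consists of a single (then necessarily marked) vertex. -/
def IsTrivial : Prop := P.n = 1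

/-- Standard form: trimmed; a unique zero vertex, which is unmarked (unless the circuit is the
trivial one); and no edge to a zero vertex from a vertex which has further outgoing edges. -/
def IsStandard : Prop :=
  P.IsTrimmed ∧
  (P.IsTrivial ∨ ∃ z, P.IsLeaf z ∧ P.mark z = 0 ∧ ∀ z', P.IsLeaf z' → z' = z) ∧
  ∀ v z, P.IsLeaf z → P.Adj v z → ∀ w, P.Adj v w → w = z

/-- Reduced: standard, different vertices have different values, and there are no redundant and no
superfluous pairs of edges. -/
def IsReduced : Prop :=
  P.IsStandard ∧
  (∀ v₁ v₂, P.vertexValue v₁ = P.vertexValue v₂ → v₁ = v₂) ∧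
  (∀ v v₁ v₂, P.Adj v v₁ → P.Adj v v₂ → P.edge v v₁ = - P.edge v v₂ →
    P.vertexValue v₁ ≠ P.vertexValue v₂ ∧ P.vertexValue v₁ ≠ 2 * P.vertexValue v₂)

/-- The (signed) binary sum formed by the vertices in `S` is compact: any two different summands
`± 2 ^ q` and `± 2 ^ q'` have `|q - q'| ≥ 2`.  Zero vertices contribute no summand. -/
def IsCompactOn (S : Set (Fin P.n)) : Prop :=
  ∀ u ∈ S, ∀ w ∈ S, u ≠ w → ¬ P.IsLeaf u → ¬ P.IsLeaf w → 2 ≤ |P.exponent u - P.exponent w|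

/-- Normal form: proper and reduced, all the binary sums `∑ μ(e) ℰ(β(e))` over the edges leaving a
vertex are compact, and the binary sum `∑ ν(v) ℰ(v)` over the marked vertices is compact. -/
def IsNormal : Prop :=
  P.IsProper ∧ P.IsReduced ∧ (∀ v, P.IsCompactOn {w | P.Adj v w}) ∧
  P.IsCompactOn {v | P.mark v ≠ 0}

/-- The circuit as a sequence of integers: the number of vertices, the marks, and the rows of the
matrix of edge labels. -/
def encode : List ℤ :=
  (P.n : ℤ) :: List.ofFn (fun v => (P.mark v : ℤ)) ++
    (List.ofFn fun v => List.ofFn fun w => (P.edge v w : ℤ)).flatten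

end Circuit

/-! ### Terms without multiplication -/

/-- Terms over `0`, `1`, the variables in `X`, and the binary operations `+`, `-`, `x·2^y`,
`x·2^(-y)`. -/
inductive Term (X : Type) : Type
  | zero : Term X
  | one : Term X
  | var (x : X) : Term X
  | add (s t : Term X) : Term X
  | sub (s t : Term X) : Term X
  | mulPow (s t : Term X) : Term X
  | divPow (s t : Term X) : Term X

namespace Term

variable {X : Type}

/-- `Value ρ t N`: the term `t` is defined in `ℤ` under the assignment `ρ` of its variables, and
its value is `N`.  The partial operations `x·2^y` and `x·2^(-y)` are defined exactly when the
result is an integer. -/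
inductive Value (ρ : X → ℤ) : Term X → ℤ → Prop
  | zero : Value ρ zero 0
  | one : Value ρ one 1
  | var (x : X) : Value ρ (var x) (ρ x)
  | add {s t : Term X} {a b : ℤ} : Value ρ s a → Value ρ t b → Value ρ (add s t) (a + b)
  | sub {s t : Term X} {a b : ℤ} : Value ρ s a → Value ρ t b → Value ρ (sub s t) (a - b)
  | mulPow {s t : Term X} {a b c : ℤ} : Value ρ s a → Value ρ t b →
      (c : ℚ) = (a : ℚ) * (2 : ℚ) ^ b → Value ρ (mulPow s t) c
  | divPow {s t : Term X} {a b c : ℤ} : Value ρ s a → Value ρ t b →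
      (c : ℚ) = (a : ℚ) * (2 : ℚ) ^ (-b) → Value ρ (divPow s t) c

/-- The number `|t|` of operations that occur in `t`. -/
def size : Term X → ℕ
  | zero => 0
  | one => 0
  | var _ => 0
  | add s t => size s + size t + 1
  | sub s t => size s + size t + 1
  | mulPow s t => size s + size t + 1
  | divPow s t => size s + size t + 1

/-- The number `σ₀(t)` of occurrences of the constant `0`. -/
def countZero : Term X → ℕ
  | zero => 1
  | one => 0
  | var _ => 0
  | add s t => countZero s + countZero t
  | sub s t => countZero s + countZero t
  | mulPow s t => countZero s + countZero t
  | divPow s t => countZero s + countZero t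

/-- The number `σ₁(t)` of occurrences of the constant `1`. -/
def countOne : Term X → ℕ
  | zero => 0
  | one => 1
  | var _ => 0
  | add s t => countOne s + countOne t
  | sub s t => countOne s + countOne t
  | mulPow s t => countOne s + countOne t
  | divPow s t => countOne s + countOne t

/-- The number `σ_x(t)` of occurrences of the variable `x`. -/
def countVar [DecidableEq X] (x : X) : Term X → ℕ
  | zero => 0
  | one => 0
  | var y => if y = x then 1 else 0
  | add s t => countVar x s + countVar x t
  | sub s t => countVar x s + countVar x t
  | mulPow s t => countVar x s + countVar x t
  | divPow s t => countVar x s + countVar x t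

/-- Reverse Polish notation of a term, one integer for each symbol. -/
def encode {k : ℕ} : Term (Fin k) → List ℤ
  | zero => [0]
  | one => [1]
  | var x => [6 + (x : ℤ)]
  | add s t => encode s ++ encode t ++ [2]
  | sub s t => encode s ++ encode t ++ [3]
  | mulPow s t => encode s ++ encode t ++ [4]
  | divPow s t => encode s ++ encode t ++ [5]

end Term

/-- `∑ₓ σ_x(t) |V(η(x))| + 2 σ₁(t) + σ₀(t)`. -/
def vertexWeight {k : ℕ} (t : Term (Fin k)) (η : Fin k → Circuit) : ℕ :=
  ∑ x, t.countVar x * (η x).numVertices + 2 * t.countOne + t.countZero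

/-- `∑ₓ σ_x(t) |M(η(x))| + σ₁(t)`. -/
def markedWeight {k : ℕ} (t : Term (Fin k)) (η : Fin k → Circuit) : ℕ :=
  ∑ x, t.countVar x * (η x).numMarked + t.countOne

/-! ### Random access machines with unit costs

The machine has registers and a memory, both holding integers; the only arithmetic instructions
are addition and subtraction. -/

/-- Programs of a random access machine, in structured form. -/
inductive Prog : Type
  | set (r : ℕ) (c : ℤ) : Prog
  | add (r a b : ℕ) : Prog
  | sub (r a b : ℕ) : Prog
  | load (r a : ℕ) : Prog
  | store (a r : ℕ) : Prog
  | seq (p q : Prog) : Prog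
  | cond (r : ℕ) (p q : Prog) : Prog
  | loop (r : ℕ) (p : Prog) : Prog

/-- The contents of the registers and of the memory. -/
structure State where
  reg : ℕ → ℤ
  mem : ℤ → ℤ

namespace State

/-- Write `c` into the register `r`. -/
def setReg (s : State) (r : ℕ) (c : ℤ) : State := { s with reg := Function.update s.reg r c }

/-- Write `c` into the memory cell with address `a`. -/
def setMem (s : State) (a c : ℤ) : State := { s with mem := Function.update s.mem a c }

/-- The list `l` is stored in consecutive memory cells from address `a` on. -/
def Holds (s : State) (a : ℤ) (l : List ℤ) : Prop :=
  ∀ i : Fin l.length, s.mem (a + ((i : ℕ) : ℤ)) = l.get i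

/-- The initial state: the input is stored from address `0` on, everything else is `0`. -/
def start (input : List ℤ) : State where
  reg := fun _ => 0
  mem := fun a => if 0 ≤ a then input.getD a.toNat 0 else 0

/-- Reading off the result of a computation: `none` (failure) if register `0` holds `0`; the
circuit stored at the address held by register `1` if register `0` holds `1`. -/
def Outputs (s : State) : Option Circuit → Prop
  | none => s.reg 0 = 0
  | some P => s.reg 0 = 1 ∧ s.Holds (s.reg 1) P.encode

end State

/-- `Exec p s s' T`: started in the state `s`, the program `p` halts after exactly `T` steps, in the
state `s'`.  Each instruction and each evaluation of a condition (`reg r > 0`) is one step. -/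
inductive Exec : Prog → State → State → ℕ → Prop
  | set (s : State) (r : ℕ) (c : ℤ) : Exec (.set r c) s (s.setReg r c) 1
  | add (s : State) (r a b : ℕ) : Exec (.add r a b) s (s.setReg r (s.reg a + s.reg b)) 1
  | sub (s : State) (r a b : ℕ) : Exec (.sub r a b) s (s.setReg r (s.reg a - s.reg b)) 1
  | load (s : State) (r a : ℕ) : Exec (.load r a) s (s.setReg r (s.mem (s.reg a))) 1
  | store (s : State) (a r : ℕ) : Exec (.store a r) s (s.setMem (s.reg a) (s.reg r)) 1
  | seq {p q : Prog} {s s' s'' : State} {m n : ℕ} :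
      Exec p s s' m → Exec q s' s'' n → Exec (.seq p q) s s'' (m + n)
  | cond_true {r : ℕ} {p q : Prog} {s s' : State} {m : ℕ} :
      0 < s.reg r → Exec p s s' m → Exec (.cond r p q) s s' (m + 1)
  | cond_false {r : ℕ} {p q : Prog} {s s' : State} {m : ℕ} :
      s.reg r ≤ 0 → Exec q s s' m → Exec (.cond r p q) s s' (m + 1)
  | loop_done {r : ℕ} {p : Prog} {s : State} : s.reg r ≤ 0 → Exec (.loop r p) s s 1
  | loop_step {r : ℕ} {p : Prog} {s s' s'' : State} {m n : ℕ} :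
      0 < s.reg r → Exec p s s' m → Exec (.loop r p) s' s'' n →
      Exec (.loop r p) s s'' (m + n + 1)

/-- The input for a term `t` in the variables `x₀, …, x_{k-1}` and an assignment `η` of circuits.
Cell `0` holds the total length of the input, cell `1` the number of symbols of `t`; then follow
the symbols of `t`, a table with the addresses of the `k` circuits, and the circuits. -/
def encodeInput {k : ℕ} (t : Term (Fin k)) (η : Fin k → Circuit) : List ℤ :=
  let blocks : List (List ℤ) := List.ofFn fun x => (η x).encode
  let base : ℕ := 2 + t.encode.length + k
  let table : List ℤ :=
    List.ofFn fun x : Fin k => ((base + ((blocks.take x).map List.length).sum : ℕ) : ℤ)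
  [((base + blocks.flatten.length : ℕ) : ℤ), (t.encode.length : ℤ)] ++ t.encode ++ table ++
    blocks.flatten

end PowerCircuits

/-! A normal circuit is determined by the integer it represents. Compactness of its binary sums
means that the labels leaving a vertex, and likewise the marks, are the digits of non-adjacent
forms, and non-adjacent forms are unique. The non-leaf vertices of the normal circuit for `N` are
therefore the exponents reached from `N` by repeatedly passing to the exponents of nonzero digits
(`Occurs`). Conversely, for `N ≠ 0`, these exponents and digits always form a normal circuit
(`IsNormal.exists_hasExp`, `isNormal_nafCircuit`). The task is thus to calculate with non-adjacent
forms whose exponents are too large to be written down and are known only through their own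
non-adjacent forms.

The algorithm keeps one pool of exponents, ordered by size; row `i` of a matrix holds the digits of
exponent `i` at all exponents of the pool, and any other number is a vector of digits. An addition
runs upwards through the pool with a carry. A digit of the sum depends on the carry, the digits at
the current place and those one place higher, so it only has to be known whether the next exponent
of the pool is the successor of the current one. A carry into a missing exponent inserts that
exponent. A product `a · 2 ^ c` moves each digit of `a` from `q` to `q + c`: one addition, one sign
test, one search. It is an integer exactly if no `q + c` is negative.

The number of nonzero digits is subadditive (`card_supp_add`) and does not grow under shifts, which
bounds the marked vertices. For all vertices the exponents must be counted, and here non-adjacent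
forms are too rigid. Instead one uses sets `B` whose elements are signed sums of powers of two with
distinct exponents in `B` (`IsClosedBase`). Whatever is such a sum over `B` has its non-adjacent
form supported in `B` and the successors of `B` (`SSum.supp_subset`). With the first missing
exponent added, all `b + 1` and `b + 2` become representable too (`IsClosedBase.exists_insert`), and
to represent all `q + c` for one fixed `c` it suffices to add as many exponents as `c` has nonzero
digits (`exists_carrySet`). An operation hence enlarges the base by at most one plus the weights of
its operands, which sums up to a bound quadratic in the term (`Term.exists_base`). One last
enlargement gives the bound for the vertices (`exists_occurs_subset`).

For the time bound, the exponents `0, …, K` are put into the pool at the outset, with `K` so large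
that adding `1` to an exponent changes no digit from place `K` on (`incCarry_eq_zero_of_mem`). The
digits of a successor then cost one pass over a row. The matrices have dimension `N = O(|t| W)`,
where `W` is the vertex weight, and each symbol costs at most three nested loops of length `N`; this
is the bound `|t| ^ 4 W ^ 3`. The program is written in a small command language with a calculus of
weakest preconditions, whose compilation to the machine is proved sound (`Cmd.wp_sound`). -/

namespace PowerCircuits

/-! ### Non-adjacent forms -/

/-- The lowest digit of the non-adjacent form of `z`. -/
def dig (z : ℤ) : ℤ := if z % 2 = 0 then 0 else if z % 4 = 1 then 1 else -1

/-- What remains of `N` after the removal of the `m` lowest digits of its non-adjacent form. -/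
def rest (N : ℤ) : ℕ → ℤ
  | 0 => N
  | m + 1 => (rest N m - dig (rest N m)) / 2

/-- The digits of the non-adjacent form of `N`. -/
def naf (N : ℤ) (p : ℕ) : ℤ := dig (rest N p)

theorem dig_cases (z : ℤ) : (dig z = 0 ∧ z % 2 = 0) ∨ (dig z = 1 ∧ z % 4 = 1) ∨
    (dig z = -1 ∧ z % 4 = 3) := by
  unfold dig; split_ifs <;> omega

theorem dig_congr {a b : ℤ} (h : a % 4 = b % 4) : dig a = dig b := by
  unfold dig; split_ifs <;> omega

theorem dig_neg (z : ℤ) : dig (-z) = -dig z := by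
  unfold dig; split_ifs <;> omega

theorem rest_succ (N : ℤ) (m : ℕ) : rest N m = naf N m + 2 * rest N (m + 1) := by
  have := dig_cases (rest N m)
  simp only [naf, rest]; omega

theorem naf_cases (N : ℤ) (p : ℕ) : naf N p = 0 ∨ naf N p = 1 ∨ naf N p = -1 := by
  have := dig_cases (rest N p)
  unfold naf; omega

/-- A nonzero digit is chosen so that the remainder minus the digit is divisible by 4; the next
remainder is then even. -/
theorem naf_succ_eq_zero {N : ℤ} {p : ℕ} (h : naf N p ≠ 0) : naf N (p + 1) = 0 := by
  have h1 := dig_cases (rest N p)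
  have h2 := dig_cases (rest N (p + 1))
  have h3 := rest_succ N p
  unfold naf at *; omega

theorem rest_eq_zero_of_le {N : ℤ} {m p : ℕ} (h : rest N m = 0) (hp : m ≤ p) : rest N p = 0 := by
  induction p, hp using Nat.le_induction with
  | base => exact h
  | succ p _ ih => simp [rest, ih, dig]

theorem abs_rest_le {N : ℤ} {m : ℕ} (h : |N| ≤ 2 ^ m) : ∀ j ≤ m, |rest N j| ≤ 2 ^ (m - j) := by
  intro j
  induction j with
  | zero => intro _; simpa [rest] using h
  | succ j ih =>
    intro hj
    have h1 := ih (by omega)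
    obtain ⟨d, rfl⟩ : ∃ d, m = j + 1 + d := ⟨m - (j + 1), by omega⟩
    rw [show j + 1 + d - j = d + 1 by omega, pow_succ] at h1
    rw [show j + 1 + d - (j + 1) = d by omega]
    have h2 := rest_succ N j
    have h3 := dig_cases (rest N j)
    unfold naf at h2
    rw [abs_le] at h1 ⊢
    generalize (2 : ℤ) ^ d = w at *
    omega

theorem rest_eq_zero {N : ℤ} {m p : ℕ} (h : |N| ≤ 2 ^ m) (hp : m < p) : rest N p = 0 := by
  refine rest_eq_zero_of_le ?_ hp
  have h1 := abs_rest_le h m le_rfl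
  have h2 := rest_succ N m
  have h3 := dig_cases (rest N m)
  unfold naf at h2
  rw [Nat.sub_self, pow_zero, abs_le] at h1
  simp only [Nat.succ_eq_add_one]
  omega

theorem rest_zero (p : ℕ) : rest 0 p = 0 := rest_eq_zero_of_le (m := 0) rfl (Nat.zero_le p)

theorem naf_eq_zero_of_rest {N : ℤ} {p : ℕ} (h : rest N p = 0) : naf N p = 0 := by
  simp [naf, h, dig]

@[simp] theorem naf_zero (p : ℕ) : naf 0 p = 0 := naf_eq_zero_of_rest (rest_zero p)

theorem rest_natAbs (N : ℤ) {p : ℕ} (h : N.natAbs < p) : rest N p = 0 := by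
  refine rest_eq_zero (m := N.natAbs) ?_ h
  rw [Int.abs_eq_natAbs]
  exact_mod_cast Nat.lt_two_pow_self.le

/-- The support of the non-adjacent form. -/
def supp (N : ℤ) : Finset ℕ := (Finset.range (N.natAbs + 1)).filter fun p => naf N p ≠ 0

-- The range in the definition of `supp` is no restriction: all digits beyond place `|N|` vanish.
@[simp] theorem mem_supp {N : ℤ} {p : ℕ} : p ∈ supp N ↔ naf N p ≠ 0 := by
  simp only [supp, Finset.mem_filter, Finset.mem_range, and_iff_right_iff_imp]
  intro h
  by_contra hp
  exact h (naf_eq_zero_of_rest (rest_natAbs N (by omega)))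

@[simp] theorem supp_zero : supp 0 = ∅ := by ext p; simp

/-- Exponents strictly decrease along edges. This makes the constructed circuits acyclic and allows
induction on the exponent. -/
theorem lt_of_mem_supp {g p : ℕ} (h : p ∈ supp (g : ℤ)) : p < g := by
  by_contra hp
  rcases g with _ | g
  · simp at h
  · refine mem_supp.1 h (naf_eq_zero_of_rest (rest_eq_zero (m := g) ?_ (by omega)))
    rw [abs_of_nonneg (by positivity)]
    exact_mod_cast Nat.lt_two_pow_self

theorem sum_naf_add (N : ℤ) (m : ℕ) :
    N = ∑ p ∈ Finset.range m, naf N p * 2 ^ p + 2 ^ m * rest N m := by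
  induction m with
  | zero => simp [rest]
  | succ m ih =>
    rw [Finset.sum_range_succ, pow_succ]
    have := rest_succ N m
    rw [this] at ih
    linarith

theorem sum_naf {N : ℤ} {m : ℕ} (h : N.natAbs < m) :
    ∑ p ∈ Finset.range m, naf N p * 2 ^ p = N := by
  have := sum_naf_add N m
  rw [rest_natAbs N h] at this
  linarith

theorem sum_supp (N : ℤ) {S : Finset ℕ} (hS : supp N ⊆ S) : ∑ p ∈ S, naf N p * 2 ^ p = N := by
  rw [← Finset.sum_subset hS (fun p _ hp => by simp [not_not.1 (mt mem_supp.2 hp)])]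
  conv_rhs => rw [← sum_naf (Nat.lt_succ_self N.natAbs)]
  refine Finset.sum_subset ?_ (fun p _ hp => by simp [not_not.1 (mt mem_supp.2 hp)])
  exact Finset.filter_subset _ _

/-! #### Carries -/

/-- The principle behind all carry arguments. If `τ p` is the tail from place `p` on of some
expansion with digits `c`, the carry into `p` is `rest N p - τ p`. Modulo 4 the tail only involves
`c p` and `c (p + 1)`, so the digit of the non-adjacent form depends on the carry and on a
look-ahead by one place. -/
theorem naf_of_tail {τ c : ℕ → ℤ} (h : ∀ p, τ p = c p + 2 * τ (p + 1)) (N : ℤ) (p : ℕ) :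
    naf N p = dig (rest N p - τ p + c p + 2 * c (p + 1)) := by
  refine dig_congr ?_
  have h1 := h p
  have h2 := h (p + 1)
  omega

theorem carry_of_tail {τ c : ℕ → ℤ} (h : ∀ p, τ p = c p + 2 * τ (p + 1)) (N : ℤ) (p : ℕ) :
    2 * (rest N (p + 1) - τ (p + 1)) = rest N p - τ p + c p - naf N p := by
  have h1 := h p
  have h2 := rest_succ N p
  omega

theorem exists_tail {f : ℕ → ℤ} {m : ℕ} (hf : ∀ p, m ≤ p → f p = 0) :
    ∃ τ : ℕ → ℤ, (∀ p, τ p = f p + 2 * τ (p + 1)) ∧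
      τ 0 = ∑ p ∈ Finset.range m, f p * 2 ^ p := by
  refine ⟨fun p => ∑ a ∈ Finset.range (m + 1), f (p + a) * 2 ^ a, fun p => ?_, ?_⟩
  · simp only
    rw [Finset.sum_range_succ', Finset.sum_range_succ (fun a => f (p + 1 + a) * 2 ^ a),
      hf (p + 1 + m) (by omega)]
    simp only [zero_mul, add_zero, pow_zero, mul_one]
    rw [add_comm, Finset.mul_sum]
    congr 1
    refine Finset.sum_congr rfl fun a _ => ?_
    rw [show p + (a + 1) = p + 1 + a by omega]; ring
  · simp only [zero_add]
    rw [Finset.sum_range_succ, hf m le_rfl]; simp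

/-- Uniqueness of the non-adjacent form. -/
theorem naf_unique {f : ℕ → ℤ} {m : ℕ} (hf : ∀ p, m ≤ p → f p = 0)
    (h1 : ∀ p, f p = 0 ∨ f p = 1 ∨ f p = -1) (h2 : ∀ p, f p ≠ 0 → f (p + 1) = 0) (p : ℕ) :
    naf (∑ p ∈ Finset.range m, f p * 2 ^ p) p = f p := by
  obtain ⟨τ, hτ, h0⟩ := exists_tail hf
  have key : ∀ p, rest (τ 0) p = τ p ∧ naf (τ 0) p = f p := by
    -- Since `f (p + 1) = 0` whenever `f p ≠ 0`, the look-ahead does not disturb the digit; hence no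
    -- carry ever arises.
    have hd : ∀ p, dig (f p + 2 * f (p + 1)) = f p := by
      intro p
      have a := h1 p; have b := h2 p; have c := h1 (p + 1)
      have := dig_cases (f p + 2 * f (p + 1))
      omega
    intro p
    induction p with
    | zero =>
      refine ⟨rfl, ?_⟩
      rw [naf_of_tail hτ]; simpa [rest] using hd 0
    | succ p ih =>
      have a := carry_of_tail hτ (τ 0) p
      have : rest (τ 0) (p + 1) = τ (p + 1) := by omega
      refine ⟨this, ?_⟩
      rw [naf_of_tail hτ, this]; simpa using hd (p + 1)
  rw [← h0]; exact (key p).2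

/-- The carry into position `p` in the addition of `x` and `y`. -/
def carry (x y : ℤ) (p : ℕ) : ℤ := rest (x + y) p - rest x p - rest y p

@[simp] theorem carry_zero (x y : ℤ) : carry x y 0 = 0 := by simp [carry, rest]

theorem add_tail (x y : ℤ) (p : ℕ) :
    rest x p + rest y p = (naf x p + naf y p) + 2 * (rest x (p + 1) + rest y (p + 1)) := by
  have := rest_succ x p; have := rest_succ y p; omega

theorem naf_add (x y : ℤ) (p : ℕ) :
    naf (x + y) p = dig (carry x y p + (naf x p + naf y p) +
      2 * (naf x (p + 1) + naf y (p + 1))) := by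
  rw [naf_of_tail (τ := fun p => rest x p + rest y p) (c := fun p => naf x p + naf y p)
    (add_tail x y)]
  congr 1; unfold carry; ring

theorem carry_succ (x y : ℤ) (p : ℕ) :
    2 * carry x y (p + 1) = carry x y p + (naf x p + naf y p) - naf (x + y) p := by
  have := carry_of_tail (τ := fun p => rest x p + rest y p) (c := fun p => naf x p + naf y p)
    (add_tail x y) (x + y) p
  unfold carry; omega

/-- Both claims need each other in the induction. If the digits at `p + 1` add up to `±2`, both
summands have a zero digit at `p`, and the look-ahead is `±4`, invisible modulo 4; so the carry into
`p` becomes the digit there and nothing is passed on. -/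
theorem carry_bound (x y : ℤ) (p : ℕ) : (carry x y p = 0 ∨ carry x y p = 1 ∨ carry x y p = -1) ∧
    (naf x p + naf y p = 2 ∨ naf x p + naf y p = -2 → carry x y p = 0) := by
  induction p with
  | zero => simp
  | succ p ih =>
    have a1 := naf_cases x p; have a2 := naf_cases x (p + 1)
    have b1 := naf_cases y p; have b2 := naf_cases y (p + 1)
    have a3 := @naf_succ_eq_zero x p
    have b3 := @naf_succ_eq_zero y p
    have c1 := naf_add x y p
    have c2 := carry_succ x y p
    have c3 := dig_cases (carry x y p + (naf x p + naf y p) + 2 * (naf x (p + 1) + naf y (p + 1)))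
    omega

/-- Where there is neither a carry nor a digit, the sum has the digit `0`. -/
theorem carry_gap {x y : ℤ} {p q : ℕ} (hpq : p ≤ q) (hc : carry x y p = 0)
    (h : ∀ i, p ≤ i → i < q → naf x i = 0 ∧ naf y i = 0) :
    carry x y q = 0 ∧ ∀ i, p ≤ i → i < q → naf (x + y) i = 0 := by
  induction q, hpq using Nat.le_induction with
  | base => exact ⟨hc, fun i h1 h2 => by omega⟩
  | succ q hq ih =>
    obtain ⟨h1, h2⟩ := ih fun i a b => h i a (by omega)
    obtain ⟨h3, h4⟩ := h q hq (by omega)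
    have c1 := naf_add x y q
    have c2 := carry_succ x y q
    have c3 := dig_cases (carry x y q + (naf x q + naf y q) + 2 * (naf x (q + 1) + naf y (q + 1)))
    have a2 := naf_cases x (q + 1)
    have b2 := naf_cases y (q + 1)
    refine ⟨by omega, fun i a b => ?_⟩
    rcases Nat.lt_succ_iff_lt_or_eq.1 b with b | rfl
    · exact h2 i a b
    · omega

/-- The carry into position `p` in the addition of `1`. -/
def incCarry (q : ℤ) (p : ℕ) : ℤ := rest (q + 1) p - rest q p

@[simp] theorem incCarry_zero (q : ℤ) : incCarry q 0 = 1 := by simp [incCarry, rest]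

theorem naf_inc (q : ℤ) (p : ℕ) :
    naf (q + 1) p = dig (incCarry q p + naf q p + 2 * naf q (p + 1)) :=
  naf_of_tail (rest_succ q) (q + 1) p

theorem incCarry_succ (q : ℤ) (p : ℕ) :
    2 * incCarry q (p + 1) = incCarry q p + naf q p - naf (q + 1) p :=
  carry_of_tail (rest_succ q) (q + 1) p

theorem incCarry_cases (q : ℤ) (p : ℕ) : incCarry q p = 0 ∨ incCarry q p = 1 := by
  induction p with
  | zero => simp
  | succ p ih =>
    have a1 := naf_cases q p; have a2 := naf_cases q (p + 1)
    have a3 := @naf_succ_eq_zero q p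
    have c1 := naf_inc q p
    have c2 := incCarry_succ q p
    have c3 := dig_cases (incCarry q p + naf q p + 2 * naf q (p + 1))
    omega

theorem naf_inc_of_carry {q : ℤ} {p : ℕ} (h : incCarry q p = 0) : naf (q + 1) p = naf q p := by
  have : rest (q + 1) p = rest q p := by unfold incCarry at h; omega
  unfold naf; rw [this]

theorem incCarry_eq_zero_of_le {q : ℤ} {p m : ℕ} (h : incCarry q p = 0) (hm : p ≤ m) :
    incCarry q m = 0 := by
  induction m, hm using Nat.le_induction with
  | base => exact h
  | succ m _ ih =>
    have := incCarry_succ q m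
    have := naf_inc_of_carry ih
    omega

/-- A carry that meets two zero digits in a row turns into the digit `1` and dies. To survive, it
must meet a nonzero digit in each of the pairs `2 i, 2 i + 1`. -/
theorem le_card_of_incCarry {q : ℤ} {j : ℕ} (h : incCarry q (2 * j) ≠ 0) :
    j ≤ ((supp q).filter (· < 2 * j)).card := by
  induction j with
  | zero => simp
  | succ j ih =>
    have h0 : incCarry q (2 * j) ≠ 0 := fun h0 => h (incCarry_eq_zero_of_le h0 (by omega))
    have h1 : ∃ i, 2 * j ≤ i ∧ i < 2 * j + 2 ∧ i ∈ supp q := by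
      by_contra hne
      have a : ∀ i, 2 * j ≤ i → i < 2 * j + 2 → naf q i = 0 := fun i h1 h2 => by
        by_contra h3; exact hne ⟨i, h1, h2, mem_supp.2 h3⟩
      have a1 := a (2 * j) le_rfl (by omega)
      have a2 := a (2 * j + 1) (by omega) (by omega)
      have b1 := naf_inc q (2 * j)
      have b2 := incCarry_succ q (2 * j)
      have b3 := incCarry_cases q (2 * j)
      have b4 := dig_cases (incCarry q (2 * j) + naf q (2 * j) + 2 * naf q (2 * j + 1))
      exact h (incCarry_eq_zero_of_le (p := 2 * j + 1) (by omega) (by omega))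
    obtain ⟨i, hi1, hi2, hi3⟩ := h1
    have : insert i ((supp q).filter (· < 2 * j)) ⊆ (supp q).filter (· < 2 * (j + 1)) := by
      intro p hp
      rw [Finset.mem_insert, Finset.mem_filter] at hp
      rw [Finset.mem_filter]
      rcases hp with rfl | hp
      · exact ⟨hi3, by omega⟩
      · exact ⟨hp.1, by omega⟩
    have h2 := Finset.card_le_card this
    rw [Finset.card_insert_of_notMem (by simp; omega)] at h2
    have := ih h0
    omega

theorem incCarry_eq_zero_of_card {q : ℤ} {K : ℕ} (h : 2 * (supp q).card + 2 ≤ K) :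
    incCarry q K = 0 := by
  by_contra hne
  have h1 : incCarry q (2 * ((supp q).card + 1)) ≠ 0 := fun h0 =>
    hne (incCarry_eq_zero_of_le h0 (by omega))
  have := le_card_of_incCarry h1
  have := Finset.card_filter_le (supp q) (· < 2 * ((supp q).card + 1))
  omega

/-! #### Order, shifts, weights -/

/-- Removing a digit is a rounded halving, hence monotone. This is why non-adjacent forms are
compared lexicographically from the top. -/
theorem rest_mono {x y : ℤ} (h : x ≤ y) (m : ℕ) : rest x m ≤ rest y m := by
  induction m with
  | zero => exact h
  | succ m ih =>
    have := dig_cases (rest x m); have := dig_cases (rest y m)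
    simp only [rest]; omega

theorem rest_eq_of_naf_eq {x y : ℤ} {m : ℕ} (h : ∀ p, m ≤ p → naf x p = naf y p) :
    rest x m = rest y m := by
  have key : ∀ d m, (∀ p, m ≤ p → naf x p = naf y p) →
      rest x (m + d) = 0 → rest y (m + d) = 0 → rest x m = rest y m := by
    intro d
    induction d with
    | zero => intro m _ h1 h2; simp_all
    | succ d ih =>
      intro m h h1 h2
      have := ih (m + 1) (fun p hp => h p (by omega)) (by rw [← h1]; congr 1; omega)
        (by rw [← h2]; congr 1; omega)
      rw [rest_succ x m, rest_succ y m, this, h m le_rfl]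
  exact key (x.natAbs + y.natAbs + 1) m h (rest_natAbs x (by omega)) (rest_natAbs y (by omega))

theorem naf_ext {x y : ℤ} (h : ∀ p, naf x p = naf y p) : x = y :=
  rest_eq_of_naf_eq (m := 0) fun p _ => h p

theorem lt_of_naf_lt {x y : ℤ} {p : ℕ} (h : ∀ q, p < q → naf x q = naf y q)
    (hp : naf x p < naf y p) : x < y := by
  by_contra hxy
  have h1 := rest_mono (not_lt.1 hxy) p
  have h2 := rest_eq_of_naf_eq (m := p + 1) fun q hq => h q hq
  have := rest_succ x p; have := rest_succ y p
  omega

theorem rest_neg (x : ℤ) (m : ℕ) : rest (-x) m = -rest x m := by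
  induction m with
  | zero => rfl
  | succ m ih =>
    have := dig_neg (rest x m)
    have := dig_cases (rest x m)
    simp only [rest, ih]; omega

theorem naf_neg (x : ℤ) (p : ℕ) : naf (-x) p = -naf x p := by
  unfold naf; rw [rest_neg, dig_neg]

@[simp] theorem supp_neg (x : ℤ) : supp (-x) = supp x := by ext p; simp [naf_neg]

theorem rest_two_mul (x : ℤ) (m : ℕ) : rest (2 * x) (m + 1) = rest x m := by
  induction m with
  | zero => simp [rest, dig]
  | succ m ih => simp only [rest] at *; rw [ih]

theorem naf_mul_two_pow (x : ℤ) (b p : ℕ) :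
    naf (x * 2 ^ b) p = if p < b then 0 else naf x (p - b) := by
  induction b generalizing p with
  | zero => simp
  | succ b ih =>
    rw [pow_succ, show x * (2 ^ b * 2) = 2 * (x * 2 ^ b) by ring]
    rcases p with _ | p
    · simp [naf, rest, dig]
    · have : naf (2 * (x * 2 ^ b)) (p + 1) = naf (x * 2 ^ b) p := by
        unfold naf; rw [rest_two_mul]
      rw [this, ih]
      simp

theorem supp_one : supp 1 = {0} := by
  have := naf_mul_two_pow 1 0
  ext p
  rcases p with _ | p
  · simp [naf, rest, dig]
  · simp only [mem_supp, ne_eq, Finset.mem_singleton, Nat.add_eq_zero_iff, one_ne_zero, and_false,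
      iff_false, not_not]
    exact naf_eq_zero_of_rest (rest_eq_zero_of_le (m := 1) (by simp [rest, dig]) (by omega))

theorem naf_one (p : ℕ) : naf 1 p = if p = 0 then 1 else 0 := by
  split_ifs with h
  · subst h; simp [naf, rest, dig]
  · have := supp_one
    by_contra h1
    have h2 := mem_supp.2 h1
    rw [this] at h2
    exact h (Finset.mem_singleton.1 h2)

theorem sum_abs_naf (N : ℤ) {m : ℕ} (h : N.natAbs < m) :
    ∑ p ∈ Finset.range m, |naf N p| = (supp N).card := by
  have h1 : supp N ⊆ Finset.range m := fun p hp => by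
    rw [supp, Finset.mem_filter, Finset.mem_range] at hp
    exact Finset.mem_range.2 (by omega)
  rw [← Finset.sum_subset h1 (fun p _ hp => by simp [not_not.1 (mt mem_supp.2 hp)])]
  rw [Finset.sum_congr rfl (g := fun _ => (1 : ℤ))]
  · simp
  · intro p hp
    have := mem_supp.1 hp
    rcases naf_cases N p with h | h | h <;> simp_all

/-- The non-adjacent form has few nonzero digits: the weight is subadditive. -/
theorem card_supp_add (x y : ℤ) : (supp (x + y)).card ≤ (supp x).card + (supp y).card := by
  -- A pending carry counts as one digit in advance, except where it meets an odd digit sum. In that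
  -- case the place gets digit `0`, and the summands' digit there, not counted yet, can pay for the
  -- carry passed on. Otherwise a nonzero carry meets digit sum `0` and produces a digit not paid by
  -- the summands.
  have key : ∀ m, ∑ p ∈ Finset.range m, |naf (x + y) p| + |carry x y m| ≤
      ∑ p ∈ Finset.range m, (|naf x p| + |naf y p|) +
        (if (carry x y m + (naf x m + naf y m)) % 2 = 0 then |carry x y m| else 0) := by
    intro m
    induction m with
    | zero => simp
    | succ m ih =>
      rw [Finset.sum_range_succ, Finset.sum_range_succ]
      have a1 := naf_cases x m; have a2 := naf_cases x (m + 1)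
      have b1 := naf_cases y m; have b2 := naf_cases y (m + 1)
      have a3 := @naf_succ_eq_zero x m
      have b3 := @naf_succ_eq_zero y m
      have c1 := naf_add x y m
      have c2 := carry_succ x y m
      have c4 := carry_bound x y m
      have c5 := carry_bound x y (m + 1)
      have c3 := dig_cases (carry x y m + (naf x m + naf y m) + 2 * (naf x (m + 1) + naf y (m + 1)))
      simp only [abs_eq_max_neg] at *
      split_ifs at * <;> omega
  set m := x.natAbs + y.natAbs + (x + y).natAbs + 1 with hm
  have h := key m
  have hc : carry x y m = 0 := by
    unfold carry
    rw [rest_natAbs _ (by omega), rest_natAbs _ (by omega), rest_natAbs _ (by omega)]; rfl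
  rw [hc, Finset.sum_add_distrib, sum_abs_naf x (by omega), sum_abs_naf y (by omega),
    sum_abs_naf (x + y) (by omega)] at h
  simp at h
  exact_mod_cast h

/-! ### A command language over variables and matrices, compiled to the random access machine -/

/-- The variables of commands. -/
inductive Var | N | K | n | L | sp | fail | idx | sym | i | p | c | d | j | fl | q | k | w | t | s
  | u | g | pos | fnd | z | r | h | e | cy | m | adr | nv | row | v | cand | good | leaf | rd
  | f | cnt | tot
  deriving DecidableEq

/-- The names of the matrices. -/
inductive Arr | E | ord | stk | U | R | X | Y | S | Z | map | tab | hlf | reach | back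
  deriving DecidableEq

theorem Var.ctorIdx_inj {x y : Var} (h : x.ctorIdx = y.ctorIdx) : x = y := by
  cases x <;> cases y <;> first | rfl | (exact absurd h (by decide))

theorem Arr.ctorIdx_inj {x y : Arr} (h : x.ctorIdx = y.ctorIdx) : x = y := by
  cases x <;> cases y <;> first | rfl | (exact absurd h (by decide))

/-- Entries of different matrices are kept apart by the residues of their addresses modulo 32; the
bound leaves the residue `0` free for the table of multiples. -/
theorem Arr.ctorIdx_lt (x : Arr) : x.ctorIdx < 31 := by cases x <;> decide

/-- The states of commands: variables, matrices, and the part of the memory used for input and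
output. -/
structure St where
  v : Var → ℤ
  a : Arr → ℕ → ℕ → ℤ
  io : ℤ → ℤ

namespace St

def setv (σ : St) (x : Var) (z : ℤ) : St := { σ with v := Function.update σ.v x z }

def seta (σ : St) (b : Arr) (i j : ℕ) (z : ℤ) : St :=
  { σ with a := Function.update σ.a b (Function.update (σ.a b) i (Function.update (σ.a b i) j z)) }

def seto (σ : St) (x z : ℤ) : St := { σ with io := Function.update σ.io x z }

@[simp] theorem v_setv (σ : St) (x y : Var) (z : ℤ) :
    (σ.setv x z).v y = if y = x then z else σ.v y := by simp [setv, Function.update_apply]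
@[simp] theorem a_setv (σ : St) (x : Var) (z : ℤ) : (σ.setv x z).a = σ.a := rfl
@[simp] theorem io_setv (σ : St) (x : Var) (z : ℤ) : (σ.setv x z).io = σ.io := rfl
@[simp] theorem v_seta (σ : St) (b : Arr) (i j : ℕ) (z : ℤ) : (σ.seta b i j z).v = σ.v := rfl
@[simp] theorem io_seta (σ : St) (b : Arr) (i j : ℕ) (z : ℤ) : (σ.seta b i j z).io = σ.io := rfl
theorem a_seta_ne (σ : St) {b b' : Arr} (i j : ℕ) (z : ℤ) (h : b' ≠ b) :
    (σ.seta b i j z).a b' = σ.a b' := by simp [seta, Function.update_of_ne h]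
theorem a_seta_self (σ : St) (b : Arr) (i j : ℕ) (z : ℤ) (i' j' : ℕ) :
    (σ.seta b i j z).a b i' j' = if i' = i ∧ j' = j then z else σ.a b i' j' := by
  simp only [seta, Function.update_self, Function.update_apply]
  by_cases h : i' = i
  · subst h; simp [Function.update_apply]
  · simp [h]
@[simp] theorem a_seta (σ : St) (b b' : Arr) (i j : ℕ) (z : ℤ) (i' j' : ℕ) :
    (σ.seta b i j z).a b' i' j' = if b' = b ∧ i' = i ∧ j' = j then z else σ.a b' i' j' := by
  by_cases h : b' = b
  · subst h; simp [a_seta_self]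
  · simp [a_seta_ne σ i j z h, h]
@[simp] theorem v_seto (σ : St) (x z : ℤ) : (σ.seto x z).v = σ.v := rfl
@[simp] theorem a_seto (σ : St) (x z : ℤ) : (σ.seto x z).a = σ.a := rfl
@[simp] theorem io_seto (σ : St) (x z y : ℤ) :
    (σ.seto x z).io y = if y = x then z else σ.io y := by simp [seto, Function.update_apply]

end St

/-- Expressions. -/
inductive Ex
  | num (z : ℤ)
  | var (x : Var)
  | add (e f : Ex)
  | sub (e f : Ex)
  | io (e : Ex)
  | get (b : Arr) (i j : Ex)

namespace Ex

instance : Add Ex := ⟨.add⟩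
instance : Sub Ex := ⟨.sub⟩

def eval (σ : St) : Ex → ℤ
  | num z => z
  | var x => σ.v x
  | add e f => e.eval σ + f.eval σ
  | sub e f => e.eval σ - f.eval σ
  | io e => σ.io (e.eval σ)
  | .get b i j => σ.a b (i.eval σ).toNat (j.eval σ).toNat

/-- All indices that occur are in range; `M` is the dimension of the matrices. -/
def Ok (M : ℕ) (σ : St) : Ex → Prop
  | num _ => True
  | var _ => True
  | add e f => e.Ok M σ ∧ f.Ok M σ
  | sub e f => e.Ok M σ ∧ f.Ok M σ
  | io e => e.Ok M σ ∧ (M = 0 ∨ 0 ≤ e.eval σ)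
  | .get _ i j => i.Ok M σ ∧ j.Ok M σ ∧ (0 ≤ i.eval σ ∧ i.eval σ < M) ∧ 0 ≤ j.eval σ ∧ j.eval σ < M

section simp
variable (σ : St) (M : ℕ) (e f i j : Ex) (b : Arr)
@[simp] theorem eval_num (z : ℤ) : (num z).eval σ = z := rfl
@[simp] theorem eval_var (x : Var) : (var x).eval σ = σ.v x := rfl
@[simp] theorem eval_add : (e + f).eval σ = e.eval σ + f.eval σ := rfl
@[simp] theorem eval_sub : (e - f).eval σ = e.eval σ - f.eval σ := rfl
@[simp] theorem eval_io : (io e).eval σ = σ.io (e.eval σ) := rfl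
@[simp] theorem eval_get : (Ex.get b i j).eval σ = σ.a b (i.eval σ).toNat (j.eval σ).toNat := rfl
@[simp] theorem ok_num (z : ℤ) : (num z).Ok M σ := trivial
@[simp] theorem ok_var (x : Var) : (var x).Ok M σ := trivial
@[simp] theorem ok_add : (e + f).Ok M σ ↔ e.Ok M σ ∧ f.Ok M σ := Iff.rfl
@[simp] theorem ok_sub : (e - f).Ok M σ ↔ e.Ok M σ ∧ f.Ok M σ := Iff.rfl
@[simp] theorem ok_io : (io e).Ok M σ ↔ e.Ok M σ ∧ (M = 0 ∨ 0 ≤ e.eval σ) := Iff.rfl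
@[simp] theorem ok_get : (Ex.get b i j).Ok M σ ↔ i.Ok M σ ∧ j.Ok M σ ∧
    (0 ≤ i.eval σ ∧ i.eval σ < M) ∧ 0 ≤ j.eval σ ∧ j.eval σ < M := Iff.rfl
end simp

end Ex

/-- The machine state `s` represents the state `σ`, with matrices of dimension `M`. The entries of
the matrices are kept at negative addresses, and so is a table of the multiples of `M`. -/
structure Rep (M : ℕ) (s : State) (σ : St) : Prop where
  var : ∀ x : Var, s.reg (2 * x.ctorIdx) = σ.v x
  -- In dimension `0` there are no matrices and every cell counts as input or output. The
  -- preparatory phase needs this to write its table at negative addresses.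
  io : ∀ z : ℤ, M = 0 ∨ 0 ≤ z → s.mem z = σ.io z
  arr : ∀ (b : Arr) (i j : ℕ), i < M → j < M →
    s.mem (-(b.ctorIdx + 1 : ℤ) - 32 * (i * M + j : ℤ)) = σ.a b i j
  tab : ∀ i : ℕ, i < M → s.mem (-32 - 32 * (i : ℤ)) = i * M

namespace Ex

/-- Multiplication of a register by `32`. -/
def dbl (r : ℕ) : Prog :=
  .seq (.add r r r) (.seq (.add r r r) (.seq (.add r r r) (.seq (.add r r r) (.add r r r))))

/-- The code which computes the address of a matrix entry, from the codes for its indices. -/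
def addr (b : Arr) (pi pj : Prog) (t : ℕ) : Prog :=
  .seq pi <| .seq (dbl (2 * t + 1)) <| .seq (.set (2 * t + 3) (-32)) <|
    .seq (.sub (2 * t + 1) (2 * t + 3) (2 * t + 1)) <| .seq (.load (2 * t + 1) (2 * t + 1)) <|
    .seq pj <| .seq (.add (2 * t + 1) (2 * t + 1) (2 * t + 3)) <|
    .seq (dbl (2 * t + 1)) <| .seq (.set (2 * t + 3) (-(b.ctorIdx + 1 : ℤ))) <|
    .sub (2 * t + 1) (2 * t + 3) (2 * t + 1)

/-- The code which computes an expression in the register `2 * t + 1`. -/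
def comp : Ex → ℕ → Prog
  | num z, t => .set (2 * t + 1) z
  | var x, t => .seq (.set (2 * t + 1) 0) (.add (2 * t + 1) (2 * t + 1) (2 * x.ctorIdx))
  | add e f, t => .seq (comp e t) (.seq (comp f (t + 1)) (.add (2 * t + 1) (2 * t + 1) (2 * t + 3)))
  | sub e f, t => .seq (comp e t) (.seq (comp f (t + 1)) (.sub (2 * t + 1) (2 * t + 1) (2 * t + 3)))
  | io e, t => .seq (comp e t) (.load (2 * t + 1) (2 * t + 1))
  | .get b i j, t => .seq (addr b (comp i t) (comp j (t + 1)) t) (.load (2 * t + 1) (2 * t + 1))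

/-- The number of steps of the computation of an expression. -/
def cost : Ex → ℕ
  | num _ => 1
  | var _ => 2
  | add e f => e.cost + f.cost + 1
  | sub e f => e.cost + f.cost + 1
  | io e => e.cost + 1
  | .get _ i j => i.cost + j.cost + 17

end Ex

/-- `s'` arises from `s` by a computation with the auxiliary register `2 * t + 1` and those after
it. -/
structure Scratch (t : ℕ) (s s' : State) : Prop where
  mem : s'.mem = s.mem
  reg : ∀ r, r % 2 = 0 ∨ r < 2 * t + 1 → s'.reg r = s.reg r

theorem Scratch.rep {t M : ℕ} {s s' : State} {σ : St} (h : Scratch t s s') (hs : Rep M s σ) :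
    Rep M s' σ :=
  ⟨fun x => (h.reg _ (by omega)).trans (hs.var x), by rw [h.mem]; exact hs.io,
    by rw [h.mem]; exact hs.arr, by rw [h.mem]; exact hs.tab⟩

theorem Scratch.trans {t t' : ℕ} {s s' s'' : State} (h : Scratch t s s') (h' : Scratch t' s' s'')
    (ht : t ≤ t') : Scratch t s s'' :=
  ⟨h'.mem.trans h.mem, fun r hr => (h'.reg r (by omega)).trans (h.reg r hr)⟩

theorem Scratch.setReg (t : ℕ) (s : State) {r : ℕ} (hr : 2 * t + 1 ≤ r ∧ r % 2 = 1) (z : ℤ) :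
    Scratch t s (s.setReg r z) :=
  ⟨rfl, fun r' h => by simp only [State.setReg]; exact Function.update_of_ne (by omega) _ _⟩

@[simp] theorem State.reg_setReg (s : State) (r r' : ℕ) (z : ℤ) :
    (s.setReg r z).reg r' = if r' = r then z else s.reg r' := by
  simp [State.setReg, Function.update_apply]

theorem exec_dbl (s : State) (t : ℕ) : ∃ s', Exec (Ex.dbl (2 * t + 1)) s s' 5 ∧ Scratch t s s' ∧
    s'.reg (2 * t + 1) = 32 * s.reg (2 * t + 1) := by
  refine ⟨_, .seq (.add _ _ _ _) (.seq (.add _ _ _ _) (.seq (.add _ _ _ _)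
    (.seq (.add _ _ _ _) (.add _ _ _ _)))), ?_, ?_⟩
  · refine ⟨rfl, fun r h => ?_⟩
    have : r ≠ 2 * t + 1 := by omega
    simp [this]
  · simp; ring

/-- Computing a matrix address, given that the indices are computed correctly. -/
theorem exec_addr {M : ℕ} {σ : St} (b : Arr) {i j : Ex}
    (hi : ∀ t s, Rep M s σ → ∃ s', Exec (i.comp t) s s' i.cost ∧ Scratch t s s' ∧
      s'.reg (2 * t + 1) = i.eval σ)
    (hj : ∀ t s, Rep M s σ → ∃ s', Exec (j.comp t) s s' j.cost ∧ Scratch t s s' ∧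
      s'.reg (2 * t + 1) = j.eval σ)
    (hi' : 0 ≤ i.eval σ ∧ i.eval σ < M) (t : ℕ) (s : State) (hs : Rep M s σ) :
    ∃ s', Exec (Ex.addr b (i.comp t) (j.comp (t + 1)) t) s s' (i.cost + j.cost + 16) ∧ Scratch t s s' ∧
      s'.reg (2 * t + 1) = -(b.ctorIdx + 1 : ℤ) - 32 * (i.eval σ * M + j.eval σ) := by
  obtain ⟨s₁, e₁, f₁, r₁⟩ := hi t s hs
  obtain ⟨s₂, e₂, f₂, r₂⟩ := exec_dbl s₁ t
  set s₃ := s₂.setReg (2 * t + 3) (-32) with h₃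
  have f₃ := Scratch.setReg t s₂ (r := 2 * t + 3) (by omega) (-32)
  set s₄ := s₃.setReg (2 * t + 1) (s₃.reg (2 * t + 3) - s₃.reg (2 * t + 1)) with h₄
  have f₄ := Scratch.setReg t s₃ (r := 2 * t + 1) (by omega)
    (s₃.reg (2 * t + 3) - s₃.reg (2 * t + 1))
  set s₅ := s₄.setReg (2 * t + 1) (s₄.mem (s₄.reg (2 * t + 1))) with h₅
  have f₅ := Scratch.setReg t s₄ (r := 2 * t + 1) (by omega) (s₄.mem (s₄.reg (2 * t + 1)))
  have F₅ := (((f₁.trans f₂ le_rfl).trans f₃ le_rfl).trans f₄ le_rfl).trans f₅ le_rfl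
  -- The machine cannot multiply, so the offset of row `i` is looked up among the tabulated
  -- multiples of `M`.
  have r₅ : s₅.reg (2 * t + 1) = i.eval σ * M := by
    have hm : s₄.mem = s.mem := ((((f₁.trans f₂ le_rfl).trans f₃ le_rfl).trans f₄ le_rfl)).mem
    have := hs.tab (i.eval σ).toNat (by omega)
    rw [Int.toNat_of_nonneg hi'.1] at this
    rw [← this, h₅, State.reg_setReg, if_pos rfl, hm]
    congr 1
    simp [h₄, h₃, r₂, r₁]
  obtain ⟨s₆, e₆, f₆, r₆⟩ := hj (t + 1) s₅ (F₅.rep hs)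
  set s₇ := s₆.setReg (2 * t + 1) (s₆.reg (2 * t + 1) + s₆.reg (2 * t + 3)) with h₇
  have f₇ := Scratch.setReg t s₆ (r := 2 * t + 1) (by omega)
    (s₆.reg (2 * t + 1) + s₆.reg (2 * t + 3))
  obtain ⟨s₈, e₈, f₈, r₈⟩ := exec_dbl s₇ t
  set s₉ := s₈.setReg (2 * t + 3) (-(b.ctorIdx + 1 : ℤ)) with h₉
  have f₉ := Scratch.setReg t s₈ (r := 2 * t + 3) (by omega) (-(b.ctorIdx + 1 : ℤ))
  have f₁₀ := Scratch.setReg t s₉ (r := 2 * t + 1) (by omega)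
    (s₉.reg (2 * t + 3) - s₉.reg (2 * t + 1))
  refine ⟨_, ?_, (((((F₅.trans f₆ (by omega)).trans f₇ le_rfl).trans f₈ le_rfl).trans f₉
    le_rfl).trans f₁₀ le_rfl), ?_⟩
  · have := Exec.seq e₁ <| .seq e₂ <| .seq (.set _ (2 * t + 3) (-32)) <|
      .seq (.sub _ (2 * t + 1) (2 * t + 3) (2 * t + 1)) <|
      .seq (.load _ (2 * t + 1) (2 * t + 1)) <| .seq e₆ <|
      .seq (.add _ (2 * t + 1) (2 * t + 1) (2 * t + 3)) <| .seq e₈ <|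
      .seq (.set _ (2 * t + 3) (-(b.ctorIdx + 1 : ℤ))) <|
      .sub _ (2 * t + 1) (2 * t + 3) (2 * t + 1)
    rw [show i.cost + j.cost + 16 =
      i.cost + (5 + (1 + (1 + (1 + (j.cost + (1 + (5 + (1 + 1)))))))) by omega]
    exact this
  · have r₆' : s₆.reg (2 * t + 3) = j.eval σ := r₆
    have r₆'' : s₆.reg (2 * t + 1) = i.eval σ * M := (f₆.reg _ (by omega)).trans r₅
    simp [h₉, r₈, h₇, r₆', r₆'']

theorem exec_comp {M : ℕ} {σ : St} (e : Ex) (he : e.Ok M σ) (t : ℕ) (s : State) (hs : Rep M s σ) :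
    ∃ s', Exec (e.comp t) s s' e.cost ∧ Scratch t s s' ∧ s'.reg (2 * t + 1) = e.eval σ := by
  induction e generalizing t s with
  | num z =>
    rw [Ex.comp]
    exact ⟨_, .set _ _ _, Scratch.setReg t s (by omega) z, by simp⟩
  | var x =>
    rw [Ex.comp]
    refine ⟨_, .seq (.set _ _ _) (.add _ _ _ _), ?_, ?_⟩
    · exact (Scratch.setReg t _ (r := 2 * t + 1) (by omega) _).trans (Scratch.setReg t _ (r := 2 * t + 1) (by omega) _) le_rfl
    · have : ¬ 2 * x.ctorIdx = 2 * t + 1 := by omega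
      simp [hs.var x, this]
  | add e f ihe ihf =>
    rw [Ex.comp]
    obtain ⟨s₁, e₁, f₁, r₁⟩ := ihe he.1 t s hs
    obtain ⟨s₂, e₂, f₂, r₂⟩ := ihf he.2 (t + 1) s₁ (f₁.rep hs)
    refine ⟨_, by rw [Ex.cost, add_assoc]; exact .seq e₁ (.seq e₂ (.add _ _ _ _)),
      (f₁.trans f₂ (by omega)).trans (Scratch.setReg t _ (r := 2 * t + 1) (by omega) _) le_rfl, ?_⟩
    · have r₂' : s₂.reg (2 * t + 3) = f.eval σ := r₂
      simp [r₂', f₂.reg (2 * t + 1) (by omega), r₁, Ex.eval]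
  | sub e f ihe ihf =>
    rw [Ex.comp]
    obtain ⟨s₁, e₁, f₁, r₁⟩ := ihe he.1 t s hs
    obtain ⟨s₂, e₂, f₂, r₂⟩ := ihf he.2 (t + 1) s₁ (f₁.rep hs)
    refine ⟨_, by rw [Ex.cost, add_assoc]; exact .seq e₁ (.seq e₂ (.sub _ _ _ _)),
      (f₁.trans f₂ (by omega)).trans (Scratch.setReg t _ (r := 2 * t + 1) (by omega) _) le_rfl, ?_⟩
    · have r₂' : s₂.reg (2 * t + 3) = f.eval σ := r₂
      simp [r₂', f₂.reg (2 * t + 1) (by omega), r₁, Ex.eval]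
  | io e ih =>
    rw [Ex.comp]
    obtain ⟨s₁, e₁, f₁, r₁⟩ := ih he.1 t s hs
    refine ⟨_, .seq e₁ (.load _ _ _), f₁.trans (Scratch.setReg t _ (r := 2 * t + 1) (by omega) _) le_rfl, ?_⟩
    simp [r₁, f₁.mem, Ex.eval, hs.io _ he.2]
  | get b i j ihi ihj =>
    rw [Ex.comp]
    obtain ⟨hi, hj, hi', hj'⟩ := he
    obtain ⟨s₁, e₁, f₁, r₁⟩ := exec_addr b (ihi hi) (ihj hj) hi' t s hs
    refine ⟨_, .seq (n := 1) e₁ (.load _ _ _),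
      f₁.trans (Scratch.setReg t _ (r := 2 * t + 1) (by omega) _) le_rfl, ?_⟩
    have := hs.arr b (i.eval σ).toNat (j.eval σ).toNat (by omega) (by omega)
    rw [Int.toNat_of_nonneg hi'.1, Int.toNat_of_nonneg hj'.1] at this
    rw [State.reg_setReg, if_pos rfl, r₁, f₁.mem, this]; rfl

/-- Commands. A loop `loop big x y p` executes `p` for `x = 0, 1, …, y - 1`. -/
inductive Cmd
  | skip
  | asg (x : Var) (e : Ex)
  | put (b : Arr) (i j e : Ex)
  | out (e f : Ex)
  | seq (p q : Cmd)
  | ifz (e : Ex) (p q : Cmd)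
  | ifp (e : Ex) (p q : Cmd)
  | loop (big : Bool) (x y : Var) (p : Cmd)

/-- Bounds: the dimension of the matrices, and those for the number of rounds of loops. -/
structure Dims where
  lay : ℕ
  small : ℕ
  large : ℕ

def Dims.bound (D : Dims) (big : Bool) : ℕ := if big then D.large else D.small

namespace Cmd

def compile : Cmd → Prog
  | skip => .set 1 0
  | asg x e => .seq (e.comp 0) (.seq (.set (2 * x.ctorIdx) 0)
      (.add (2 * x.ctorIdx) (2 * x.ctorIdx) 1))
  | put b i j e => .seq (Ex.addr b (i.comp 0) (j.comp 1) 0) (.seq (e.comp 1) (.store 1 3))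
  | out e f => .seq (e.comp 0) (.seq (f.comp 1) (.store 1 3))
  | seq p q => .seq p.compile q.compile
  | ifz e p q => .seq (e.comp 0) <| .seq (.cond 1 (.set 1 1) <| .seq (.set 3 0) <|
      .seq (.sub 1 3 1) (.cond 1 (.set 1 1) (.set 1 0))) (.cond 1 q.compile p.compile)
  | ifp e p q => .seq (e.comp 0) (.cond 1 p.compile q.compile)
  | loop _ x y p => .seq (.set (2 * x.ctorIdx) 0) <|
      .seq (.sub 1 (2 * y.ctorIdx) (2 * x.ctorIdx)) <|
      .loop 1 (.seq p.compile <| .seq (.set 1 1) <|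
        .seq (.add (2 * x.ctorIdx) (2 * x.ctorIdx) 1) (.sub 1 (2 * y.ctorIdx) (2 * x.ctorIdx)))

/-- A bound for the number of steps. -/
def cost (D : Dims) : Cmd → ℕ
  | skip => 1
  | asg _ e => e.cost + 2
  | put _ i j e => i.cost + j.cost + e.cost + 17
  | out e f => e.cost + f.cost + 1
  | seq p q => p.cost D + q.cost D
  | ifz e p q => e.cost + 6 + p.cost D + q.cost D
  | ifp e p q => e.cost + 1 + p.cost D + q.cost D
  | loop big _ _ p => D.bound big * (p.cost D + 4) + 3

/-- The rounds `k, …, k + m - 1` of a loop. -/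
def iter (b : St → (St → Prop) → Prop) (x y : Var) (n : ℕ) : ℕ → ℕ → St → (St → Prop) → Prop
  | 0, _, σ, Q => Q σ
  | m + 1, k, σ, Q => b σ fun τ => τ.v x = k ∧ τ.v y = n ∧
      iter b x y n m (k + 1) (τ.setv x (k + 1)) Q

/-- Weakest preconditions. -/
def wp (D : Dims) : Cmd → St → (St → Prop) → Prop
  | skip, σ, Q => Q σ
  | asg x e, σ, Q => e.Ok D.lay σ ∧ Q (σ.setv x (e.eval σ))
  | put b i j e, σ, Q => (Ex.get b i j).Ok D.lay σ ∧ e.Ok D.lay σ ∧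
      Q (σ.seta b (i.eval σ).toNat (j.eval σ).toNat (e.eval σ))
  | out e f, σ, Q => (Ex.io e).Ok D.lay σ ∧ f.Ok D.lay σ ∧ Q (σ.seto (e.eval σ) (f.eval σ))
  | seq p q, σ, Q => p.wp D σ fun τ => q.wp D τ Q
  | ifz e p q, σ, Q => e.Ok D.lay σ ∧ (e.eval σ = 0 → p.wp D σ Q) ∧ (e.eval σ ≠ 0 → q.wp D σ Q)
  | ifp e p q, σ, Q => e.Ok D.lay σ ∧ (0 < e.eval σ → p.wp D σ Q) ∧ (e.eval σ ≤ 0 → q.wp D σ Q)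
  | loop big x y p, σ, Q => ∃ n : ℕ, σ.v y = n ∧ n ≤ D.bound big ∧ x ≠ y ∧
      iter (p.wp D) x y n n 0 (σ.setv x 0) Q

end Cmd

theorem Rep.setv {M : ℕ} {s : State} {σ : St} (h : Rep M s σ) (x : Var) (z : ℤ) :
    Rep M (s.setReg (2 * x.ctorIdx) z) (σ.setv x z) := by
  refine ⟨fun y => ?_, h.io, h.arr, h.tab⟩
  by_cases hy : y = x
  · simp [hy]
  · have : ¬ y.ctorIdx = x.ctorIdx := fun h => hy (Var.ctorIdx_inj h)
    simp [hy, this, h.var]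

theorem Rep.setOdd {M : ℕ} {s : State} {σ : St} (h : Rep M s σ) {r : ℕ} (hr : r % 2 = 1) (z : ℤ) :
    Rep M (s.setReg r z) σ :=
  (Scratch.setReg 0 s (r := r) (by omega) z).rep h

theorem Rep.seto {M : ℕ} {s : State} {σ : St} (h : Rep M s σ) {x : ℤ} (hx : M = 0 ∨ 0 ≤ x)
    (z : ℤ) : Rep M (s.setMem x z) (σ.seto x z) := by
  refine ⟨h.var, fun y hy => ?_, fun b i j hi hj => ?_, fun i hi => ?_⟩
  · simp [State.setMem, Function.update_apply, h.io y hy]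
  · rw [St.a_seto, ← h.arr b i j hi hj]
    have : (0 : ℤ) ≤ i * M + j := by positivity
    exact Function.update_of_ne (by omega) _ _
  · rw [← h.tab i hi]
    exact Function.update_of_ne (by omega) _ _

theorem index_inj {M i i' j j' : ℕ} (hj : j < M) (hj' : j' < M)
    (h : (i * M + j : ℤ) = i' * M + j') : i = i' ∧ j = j' := by
  have h : i * M + j = i' * M + j' := by exact_mod_cast h
  have h1 : (i * M + j) / M = i := by
    rw [mul_comm, Nat.mul_add_div (by omega), Nat.div_eq_of_lt hj]; rfl
  have h2 : (i' * M + j') / M = i' := by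
    rw [mul_comm, Nat.mul_add_div (by omega), Nat.div_eq_of_lt hj']; rfl
  have h3 : i = i' := by rw [← h1, ← h2, h]
  subst h3
  exact ⟨rfl, by omega⟩

theorem Rep.seta {M : ℕ} {s : State} {σ : St} (h : Rep M s σ) (b : Arr) {i j : ℕ} (hi : i < M)
    (hj : j < M) (z : ℤ) :
    Rep M (s.setMem (-(b.ctorIdx + 1 : ℤ) - 32 * (i * M + j : ℤ)) z) (σ.seta b i j z) := by
  have hp : (0 : ℤ) ≤ i * M + j := by positivity
  refine ⟨h.var, fun y hy => ?_, fun b' i' j' hi' hj' => ?_, fun i' hi' => ?_⟩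
  · rw [St.io_seta, ← h.io y hy]
    exact Function.update_of_ne (by omega) _ _
  · simp only [State.setMem, Function.update_apply, St.a_seta, h.arr b' i' j' hi' hj']
    refine if_congr ?_ rfl rfl
    have h1 := b.ctorIdx_lt
    have h2 := b'.ctorIdx_lt
    constructor
    · intro he
      have hb : b'.ctorIdx = b.ctorIdx := by omega
      exact ⟨Arr.ctorIdx_inj hb, index_inj hj' hj (by omega)⟩
    · rintro ⟨rfl, rfl, rfl⟩; rfl
  · rw [← h.tab i' hi']
    have h1 := b.ctorIdx_lt
    exact Function.update_of_ne (by omega) _ _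

namespace Cmd

/-- Soundness of weakest preconditions. -/
theorem wp_sound {D : Dims} (c : Cmd) {σ : St} {Q : St → Prop} (h : c.wp D σ Q) {s : State}
    (hs : Rep D.lay s σ) :
    ∃ s' t σ', Exec c.compile s s' t ∧ t ≤ c.cost D ∧ Rep D.lay s' σ' ∧ Q σ' := by
  induction c generalizing σ Q s with
  | skip => exact ⟨_, _, σ, .set _ _ _, le_rfl, hs.setOdd rfl 0, h⟩
  | asg x e =>
    obtain ⟨s₁, e₁, f₁, r₁⟩ := exec_comp e h.1 0 s hs
    refine ⟨_, _, _, .seq e₁ (.seq (.set _ _ _) (.add _ _ _ _)), by simp [cost], ?_, h.2⟩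
    have := ((f₁.rep hs).setv x 0).setv x (e.eval σ)
    convert this using 1
    · have r₁ : s₁.reg 1 = e.eval σ := r₁
      simp [r₁, show ¬ 1 = 2 * x.ctorIdx by omega]
    · simp [St.setv]
  | put b i j e =>
    obtain ⟨⟨hi, hj, hi', hj'⟩, he, hQ⟩ := h
    obtain ⟨s₁, e₁, f₁, r₁⟩ :=
      exec_addr b (fun t s => exec_comp i hi t s) (fun t s => exec_comp j hj t s) hi' 0 s hs
    obtain ⟨s₂, e₂, f₂, r₂⟩ := exec_comp e he 1 s₁ (f₁.rep hs)
    refine ⟨_, _, _, .seq e₁ (.seq e₂ (.store _ _ _)), by simp only [cost]; omega, ?_, hQ⟩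
    have := (f₂.rep (f₁.rep hs)).seta b (i := (i.eval σ).toNat) (j := (j.eval σ).toNat) (by omega)
      (by omega) (e.eval σ)
    rw [Int.toNat_of_nonneg hi'.1, Int.toNat_of_nonneg hj'.1] at this
    convert this using 2
    · exact (f₂.reg 1 (by omega)).trans r₁
  | out e f =>
    obtain ⟨⟨he, hx⟩, hf, hQ⟩ := h
    obtain ⟨s₁, e₁, f₁, r₁⟩ := exec_comp e he 0 s hs
    obtain ⟨s₂, e₂, f₂, r₂⟩ := exec_comp f hf 1 s₁ (f₁.rep hs)
    refine ⟨_, _, _, .seq e₁ (.seq e₂ (.store _ _ _)), by simp only [cost]; omega, ?_, hQ⟩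
    convert (f₂.rep (f₁.rep hs)).seto hx (f.eval σ) using 2
    · exact (f₂.reg 1 (by omega)).trans r₁
  | seq p q ihp ihq =>
    obtain ⟨s₁, t₁, σ₁, e₁, c₁, r₁, h₁⟩ := ihp h hs
    obtain ⟨s₂, t₂, σ₂, e₂, c₂, r₂, h₂⟩ := ihq h₁ r₁
    exact ⟨_, _, σ₂, .seq e₁ e₂, by simp only [cost]; omega, r₂, h₂⟩
  | ifz e p q ihp ihq =>
    obtain ⟨he, hp, hq⟩ := h
    obtain ⟨s₁, e₁, f₁, r₁⟩ := exec_comp e he 0 s hs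
    have r₁ : s₁.reg 1 = e.eval σ := r₁
    have R₁ := f₁.rep hs
    by_cases h0 : e.eval σ = 0
    · set s₂ := ((s₁.setReg 3 0).setReg 1 0).setReg 1 0
      obtain ⟨s₃, t₃, σ₃, e₃, c₃, r₃, h₃⟩ := ihp (hp h0) (s := s₂)
        (((R₁.setOdd rfl 0).setOdd rfl 0).setOdd rfl 0)
      have e₂ : Exec (.cond 1 (.set 1 1) <| .seq (.set 3 0) <|
          .seq (.sub 1 3 1) (.cond 1 (.set 1 1) (.set 1 0))) s₁ s₂ 5 := by
        refine .cond_false (by omega) (.seq (n := 3) (.set _ _ _) (.seq (n := 2) (.sub _ _ _ _) ?_))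
        simp only [State.reg_setReg, r₁, h0]
        exact .cond_false (by simp) (.set _ _ _)
      exact ⟨_, _, σ₃, .seq e₁ (.seq e₂ (.cond_false (by simp [s₂]) e₃)),
        by simp only [cost]; omega, r₃, h₃⟩
    · by_cases h1 : 0 < e.eval σ
      · obtain ⟨s₃, t₃, σ₃, e₃, c₃, r₃, h₃⟩ := ihq (hq h0) (R₁.setOdd (r := 1) rfl 1)
        exact ⟨_, _, σ₃, .seq e₁ (.seq (.cond_true (by omega) (.set _ _ _))
          (.cond_true (by simp) e₃)), by simp only [cost]; omega, r₃, h₃⟩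
      · set s₂ := ((s₁.setReg 3 0).setReg 1 (0 - e.eval σ)).setReg 1 1
        obtain ⟨s₃, t₃, σ₃, e₃, c₃, r₃, h₃⟩ := ihq (hq h0) (s := s₂)
          (((R₁.setOdd rfl 0).setOdd rfl _).setOdd rfl 1)
        have e₂ : Exec (.cond 1 (.set 1 1) <| .seq (.set 3 0) <|
            .seq (.sub 1 3 1) (.cond 1 (.set 1 1) (.set 1 0))) s₁ s₂ 5 := by
          refine .cond_false (by omega)
            (.seq (n := 3) (.set _ _ _) (.seq (n := 2) (.sub _ _ _ _) ?_))
          have h3 : (s₁.setReg 3 0).reg 3 - (s₁.setReg 3 0).reg 1 = 0 - e.eval σ := by simp [r₁]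
          rw [h3]
          exact .cond_true (by simp; omega) (.set _ _ _)
        exact ⟨_, _, σ₃, .seq e₁ (.seq e₂ (.cond_true (by simp [s₂]) e₃)),
          by simp only [cost]; omega, r₃, h₃⟩
  | ifp e p q ihp ihq =>
    obtain ⟨he, hp, hq⟩ := h
    obtain ⟨s₁, e₁, f₁, r₁⟩ := exec_comp e he 0 s hs
    have r₁ : s₁.reg 1 = e.eval σ := r₁
    by_cases h0 : 0 < e.eval σ
    · obtain ⟨s₃, t₃, σ₃, e₃, c₃, r₃, h₃⟩ := ihp (hp h0) (f₁.rep hs)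
      exact ⟨_, _, σ₃, .seq e₁ (.cond_true (by omega) e₃), by simp only [cost]; omega, r₃, h₃⟩
    · obtain ⟨s₃, t₃, σ₃, e₃, c₃, r₃, h₃⟩ := ihq (hq (by omega)) (f₁.rep hs)
      exact ⟨_, _, σ₃, .seq e₁ (.cond_false (by omega) e₃), by simp only [cost]; omega, r₃, h₃⟩
  | loop big x y p ih =>
    obtain ⟨n, hn, hb, hxy, h⟩ := h
    -- Register `1`, which controls the compiled loop, holds the number of rounds still to be made.
    have key : ∀ m k (σ : St) (s : State), k + m = n → σ.v x = k → σ.v y = n →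
        iter (p.wp D) x y n m k σ Q → Rep D.lay s σ → s.reg 1 = m →
        ∃ s' t σ', Exec (.loop 1 (.seq p.compile <| .seq (.set 1 1) <|
          .seq (.add (2 * x.ctorIdx) (2 * x.ctorIdx) 1) (.sub 1 (2 * y.ctorIdx) (2 * x.ctorIdx))))
          s s' t ∧ t ≤ m * (p.cost D + 4) + 1 ∧ Rep D.lay s' σ' ∧ Q σ' := by
      intro m
      induction m with
      | zero =>
        intro k σ s _ _ _ h hs hr
        exact ⟨_, _, σ, .loop_done (by omega), by omega, hs, h⟩
      | succ m ihm =>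
        intro k σ s hk hx hy h hs hr
        obtain ⟨s₁, t₁, σ₁, e₁, c₁, r₁, h₁, h₂, h₃⟩ := ih h hs
        have R := ((r₁.setOdd (r := 1) rfl 1).setv x (k + 1)).setOdd (r := 1) rfl (n - (k + 1))
        obtain ⟨s₂, t₂, σ₂, e₂, c₂, r₂, q₂⟩ := ihm (k + 1) (σ₁.setv x (k + 1)) _ (by omega)
          (by simp) (by simp [Ne.symm hxy, h₂]) h₃ R (by simp; omega)
        refine ⟨s₂, _, σ₂, .loop_step (n := t₂) (by omega) (.seq e₁ (.seq (.set _ _ _)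
          (.seq (.add _ _ _ _) (.sub _ _ _ _)))) ?_, ?_, r₂, q₂⟩
        · convert e₂ using 1
          have a := r₁.var x
          have b := r₁.var y
          have c : ¬ y.ctorIdx = x.ctorIdx := fun h => hxy (Var.ctorIdx_inj h).symm
          simp [a, b, h₁, h₂, c, show ¬ 2 * x.ctorIdx = 1 by omega,
            show ¬ 2 * y.ctorIdx = 1 by omega]
        · rw [add_mul]; omega
    obtain ⟨s₁, t₁, σ₁, e₁, c₁, r₁, q₁⟩ := key n 0 (σ.setv x 0) _ (by omega) (by simp)
      (by simp [Ne.symm hxy, hn]) h ((hs.setv x 0).setOdd (r := 1) rfl (n - 0)) (by simp)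
    have hc : ¬ y.ctorIdx = x.ctorIdx := fun h => hxy (Var.ctorIdx_inj h).symm
    refine ⟨s₁, _, σ₁, .seq (.set _ _ _) (.seq (.sub _ _ _ _) (n := t₁) ?_), ?_, r₁, q₁⟩
    · convert e₁ using 1
      simp [hs.var y, hn, hc]
    · simp only [cost]
      have := Nat.mul_le_mul_right (p.cost D + 4) hb
      omega

/-! #### Bounds for the number of steps -/

def size : Cmd → ℕ
  | skip => 1
  | asg _ e => e.cost + 2
  | put _ i j e => i.cost + j.cost + e.cost + 17
  | out e f => e.cost + f.cost + 1
  | seq p q => p.size + q.size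
  | ifz e p q => e.cost + 6 + p.size + q.size
  | ifp e p q => e.cost + 1 + p.size + q.size
  | loop _ _ _ p => p.size + 7

/-- The depth of nesting of loops of one of the two kinds. -/
def depth (b : Bool) : Cmd → ℕ
  | seq p q => max (p.depth b) (q.depth b)
  | ifz _ p q => max (p.depth b) (q.depth b)
  | ifp _ p q => max (p.depth b) (q.depth b)
  | loop big _ _ p => if big = b then p.depth b + 1 else p.depth b
  | _ => 0

/-- Consecutive commands add and nested loops multiply, so the depths of nesting are the exponents
of the bound. The `+ 1` in the bases absorbs the overhead of the loops. -/
theorem cost_le (D : Dims) (c : Cmd) : c.cost D ≤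
    c.size * ((D.small + 1) ^ c.depth false * (D.large + 1) ^ c.depth true) := by
  have two : ∀ p q : Cmd,
      p.cost D ≤ p.size * ((D.small + 1) ^ p.depth false * (D.large + 1) ^ p.depth true) →
      q.cost D ≤ q.size * ((D.small + 1) ^ q.depth false * (D.large + 1) ^ q.depth true) →
      ∀ k, k + p.cost D + q.cost D ≤ (k + p.size + q.size) *
        ((D.small + 1) ^ max (p.depth false) (q.depth false) *
          (D.large + 1) ^ max (p.depth true) (q.depth true)) := by
    intro p q hp hq k
    have h1 : (D.small + 1) ^ p.depth false * (D.large + 1) ^ p.depth true ≤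
      (D.small + 1) ^ max (p.depth false) (q.depth false) *
          (D.large + 1) ^ max (p.depth true) (q.depth true) :=
      Nat.mul_le_mul (Nat.pow_le_pow_right (by omega) (le_max_left _ _))
        (Nat.pow_le_pow_right (by omega) (le_max_left _ _))
    have h2 : (D.small + 1) ^ q.depth false * (D.large + 1) ^ q.depth true ≤
      (D.small + 1) ^ max (p.depth false) (q.depth false) *
          (D.large + 1) ^ max (p.depth true) (q.depth true) :=
      Nat.mul_le_mul (Nat.pow_le_pow_right (by omega) (le_max_right _ _))
        (Nat.pow_le_pow_right (by omega) (le_max_right _ _))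
    have h3 : 1 ≤ (D.small + 1) ^ max (p.depth false) (q.depth false) *
          (D.large + 1) ^ max (p.depth true) (q.depth true) := Nat.one_le_iff_ne_zero.2 (by positivity)
    have := hp.trans (Nat.mul_le_mul_left _ h1)
    have := hq.trans (Nat.mul_le_mul_left _ h2)
    have := Nat.mul_le_mul_left k h3
    rw [add_mul, add_mul]; omega
  induction c with
  | skip | asg | put | out => simp [cost, size, depth]
  | seq p q ihp ihq => simpa [cost, size, depth] using two p q ihp ihq 0
  | ifz e p q ihp ihq => exact two p q ihp ihq _
  | ifp e p q ihp ihq => exact two p q ihp ihq _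
  | loop big x y p ih =>
    simp only [cost, size]
    set w := (D.small + 1) ^ p.depth false * (D.large + 1) ^ p.depth true with hw
    have h1 : 1 ≤ w := Nat.one_le_iff_ne_zero.2 (by positivity)
    have h2 : (D.small + 1) ^ (loop big x y p).depth false *
        (D.large + 1) ^ (loop big x y p).depth true = w * (D.bound big + 1) := by
      cases big <;> simp [depth, Dims.bound, hw, pow_succ] <;> ring
    rw [h2]
    have h3 : D.bound big * (p.cost D + 4) ≤ D.bound big * (p.size * w + 4 * w) :=
      Nat.mul_le_mul_left _ (by omega)
    have h4 : (p.size + 7) * (w * (D.bound big + 1)) =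
      D.bound big * (p.size * w + 4 * w) + 3 * (w * D.bound big) + p.size * w + 7 * w := by ring
    have h5 : 0 ≤ 3 * (w * D.bound big) + p.size * w := by positivity
    omega

/-! #### Frames -/

/-- The variables that a command may change. -/
def wv : Cmd → Var → Bool
  | asg x _, y => decide (x = y)
  | seq p q, y => p.wv y || q.wv y
  | ifz _ p q, y => p.wv y || q.wv y
  | ifp _ p q, y => p.wv y || q.wv y
  | loop _ x _ p, y => decide (x = y) || p.wv y
  | _, _ => false

/-- The matrices that a command may change. -/
def wa : Cmd → Arr → Bool
  | put b _ _ _, b' => decide (b = b')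
  | seq p q, y => p.wa y || q.wa y
  | ifz _ p q, y => p.wa y || q.wa y
  | ifp _ p q, y => p.wa y || q.wa y
  | loop _ _ _ p, y => p.wa y
  | _, _ => false

/-- Whether a command may write into the memory for input and output. -/
def wo : Cmd → Bool
  | out _ _ => true
  | seq p q => p.wo || q.wo
  | ifz _ p q => p.wo || q.wo
  | ifp _ p q => p.wo || q.wo
  | loop _ _ _ p => p.wo
  | _ => false

/-- The states `σ` and `τ` differ only where the command `c` writes. -/
structure Frame (c : Cmd) (σ τ : St) : Prop where
  v : ∀ x, c.wv x = false → τ.v x = σ.v x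
  a : ∀ b, c.wa b = false → τ.a b = σ.a b
  io : c.wo = false → τ.io = σ.io

theorem Frame.refl (c : Cmd) (σ : St) : Frame c σ σ := ⟨fun _ _ => rfl, fun _ _ => rfl, fun _ => rfl⟩

theorem Frame.trans {c : Cmd} {σ τ υ : St} (h : Frame c σ τ) (h' : Frame c τ υ) : Frame c σ υ :=
  ⟨fun x hx => (h'.v x hx).trans (h.v x hx), fun x hx => (h'.a x hx).trans (h.a x hx),
    fun hx => (h'.io hx).trans (h.io hx)⟩

theorem Frame.mono {c c' : Cmd} {σ τ : St} (h : Frame c σ τ)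
    (hv : ∀ x, c'.wv x = false → c.wv x = false) (ha : ∀ x, c'.wa x = false → c.wa x = false)
    (ho : c'.wo = false → c.wo = false) : Frame c' σ τ :=
  ⟨fun x hx => h.v x (hv x hx), fun x hx => h.a x (ha x hx), fun hx => h.io (ho hx)⟩

theorem iter_mono {b : St → (St → Prop) → Prop} {x y : Var} {n : ℕ}
    (hb : ∀ σ Q R, b σ Q → (∀ τ, Q τ → R τ) → b σ R) (m : ℕ) :
    ∀ (k : ℕ) (σ : St) (Q R : St → Prop), iter b x y n m k σ Q → (∀ τ, Q τ → R τ) →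
      iter b x y n m k σ R := by
  induction m with
  | zero => intro k σ Q R h hQ; exact hQ _ h
  | succ m ih => exact fun k σ Q R h hQ => hb _ _ _ h fun τ ⟨h1, h2, h3⟩ => ⟨h1, h2, ih _ _ _ _ h3 hQ⟩

theorem wp_mono {D : Dims} {c : Cmd} {σ : St} {Q R : St → Prop} (h : c.wp D σ Q)
    (hQ : ∀ τ, Q τ → R τ) : c.wp D σ R := by
  induction c generalizing σ Q R with
  | skip => exact hQ _ h
  | asg => exact ⟨h.1, hQ _ h.2⟩
  | put => exact ⟨h.1, h.2.1, hQ _ h.2.2⟩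
  | out => exact ⟨h.1, h.2.1, hQ _ h.2.2⟩
  | seq p q ihp ihq => exact ihp h fun τ hτ => ihq hτ hQ
  | ifz e p q ihp ihq => exact ⟨h.1, fun a => ihp (h.2.1 a) hQ, fun a => ihq (h.2.2 a) hQ⟩
  | ifp e p q ihp ihq => exact ⟨h.1, fun a => ihp (h.2.1 a) hQ, fun a => ihq (h.2.2 a) hQ⟩
  | loop big x y p ih =>
    obtain ⟨n, h1, h2, h3, h4⟩ := h
    exact ⟨n, h1, h2, h3, iter_mono (b := p.wp D) (fun σ Q R h hQ => ih h hQ) _ _ _ _ _ h4 hQ⟩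

theorem wp_frame {D : Dims} {c : Cmd} {σ : St} {Q : St → Prop} (h : c.wp D σ Q) :
    c.wp D σ fun τ => Frame c σ τ ∧ Q τ := by
  induction c generalizing σ Q with
  | skip => exact ⟨.refl _ _, h⟩
  | asg x e =>
    refine ⟨h.1, ⟨fun y hy => ?_, fun _ _ => rfl, fun _ => rfl⟩, h.2⟩
    have : ¬ y = x := fun h => by simp [wv, h] at hy
    simp [this]
  | put b i j e =>
    refine ⟨h.1, h.2.1, ⟨fun y hy => rfl, fun b' hb => St.a_seta_ne _ _ _ _ fun h => ?_,
      fun _ => rfl⟩, h.2.2⟩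
    simp [wa, h] at hb
  | out => exact ⟨h.1, h.2.1, ⟨fun _ _ => rfl, fun _ _ => rfl, fun h => by simp [wo] at h⟩, h.2.2⟩
  | seq p q ihp ihq =>
    refine wp_mono (c := p) (ihp h) fun τ ⟨h1, h2⟩ => wp_mono (c := q) (ihq h2) fun υ ⟨h3, h4⟩ => ⟨?_, h4⟩
    exact (h1.mono (c' := seq p q) (by simp +contextual [wv]) (by simp +contextual [wa])
      (by simp +contextual [wo])).trans (h3.mono (by simp +contextual [wv])
      (by simp +contextual [wa]) (by simp +contextual [wo]))
  | ifz e p q ihp ihq =>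
    refine ⟨h.1, fun a => wp_mono (ihp (h.2.1 a)) fun τ ht => ⟨ht.1.mono ?_ ?_ ?_, ht.2⟩,
      fun a => wp_mono (ihq (h.2.2 a)) fun τ ht => ⟨ht.1.mono ?_ ?_ ?_, ht.2⟩⟩ <;>
    simp +contextual [wv, wa, wo]
  | ifp e p q ihp ihq =>
    refine ⟨h.1, fun a => wp_mono (ihp (h.2.1 a)) fun τ ht => ⟨ht.1.mono ?_ ?_ ?_, ht.2⟩,
      fun a => wp_mono (ihq (h.2.2 a)) fun τ ht => ⟨ht.1.mono ?_ ?_ ?_, ht.2⟩⟩ <;>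
    simp +contextual [wv, wa, wo]
  | loop big x y p ih =>
    obtain ⟨n, h1, h2, h3, h4⟩ := h
    have set : ∀ (τ : St) z, Frame (loop big x y p) τ (τ.setv x z) := fun τ z =>
      ⟨fun y hy => by
        have : ¬ y = x := fun h => by simp [wv, h] at hy
        simp [this], fun _ _ => rfl, fun _ => rfl⟩
    have key : ∀ m k τ, Frame (loop big x y p) σ τ → iter (p.wp D) x y n m k τ Q →
        iter (p.wp D) x y n m k τ fun υ => Frame (loop big x y p) σ υ ∧ Q υ := by
      intro m
      induction m with
      | zero => exact fun k τ h1 h2 => ⟨h1, h2⟩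
      | succ m ihm =>
        intro k τ h1 h2
        refine wp_mono (ih h2) fun υ ⟨h3, h4, h5, h6⟩ => ⟨h4, h5, ihm _ _ ?_ h6⟩
        exact (h1.trans (h3.mono (by simp +contextual [wv]) (by simp [wa]) (by simp [wo]))).trans
          (set _ _)
    exact ⟨n, h1, h2, h3, key _ _ _ (set _ _) h4⟩

/-- The form in which specifications of subroutines are applied: they mention only what is computed,
and everything that is not written is preserved by the frame. -/
theorem wp_call {D : Dims} {c : Cmd} {σ : St} {Q R : St → Prop} (h : c.wp D σ Q)
    (hQ : ∀ τ, Frame c σ τ → Q τ → R τ) : c.wp D σ R :=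
  wp_mono (wp_frame h) fun τ hτ => hQ τ hτ.1 hτ.2

/-- Used to cut the main loop, which runs over the symbols of a term, at the ends of subterms. -/
theorem iter_add {b : St → (St → Prop) → Prop} {x y : Var} {n : ℕ} (m m' : ℕ)
    (hb : ∀ σ Q R, b σ Q → (∀ τ, Q τ → R τ) → b σ R) :
    ∀ (k : ℕ) (σ : St) (Q : St → Prop),
      iter b x y n m k σ (fun τ => iter b x y n m' (k + m) τ Q) → iter b x y n (m + m') k σ Q := by
  induction m with
  | zero => intro k σ Q h; simpa [iter] using h
  | succ m ih =>
    intro k σ Q h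
    rw [show m + 1 + m' = (m + m') + 1 by omega]
    refine hb _ _ _ h fun τ ⟨h1, h2, h3⟩ => ⟨h1, h2, ih _ _ _ ?_⟩
    rwa [show k + (m + 1) = k + 1 + m by omega] at h3

/-- The rule for loops, with an invariant `I`. -/
theorem wp_loop {D : Dims} {big : Bool} {x y : Var} {p : Cmd} {σ : St} {Q : St → Prop}
    (I : ℕ → St → Prop) (n : ℕ) (hn : σ.v y = n) (hb : n ≤ D.bound big)
    (h0 : I 0 (σ.setv x 0))
    (step : ∀ k < n, ∀ τ : St, τ.v x = k → Frame (loop big x y p) σ τ → I k τ →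
      p.wp D τ fun υ => I (k + 1) (υ.setv x (k + 1)))
    (post : ∀ τ, Frame (loop big x y p) σ τ → I n τ → Q τ)
    (hc : (decide (x = y) || p.wv x || p.wv y) = false := by rfl) :
    (loop big x y p).wp D σ Q := by
  simp only [Bool.or_eq_false_iff, decide_eq_false_iff_not] at hc
  obtain ⟨⟨hxy, hpx⟩, hpy⟩ := hc
  have set : ∀ (τ : St) z, Frame (loop big x y p) τ (τ.setv x z) := fun τ z =>
    ⟨fun y hy => by
      have : ¬ y = x := fun h => by simp [wv, h] at hy
      simp [this], fun _ _ => rfl, fun _ => rfl⟩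
  have key : ∀ (m k : ℕ) (τ : St), k + m = n → τ.v x = k → Frame (loop big x y p) σ τ → I k τ →
      iter (p.wp D) x y n m k τ Q := by
    intro m
    induction m with
    | zero =>
      intro k τ hk _ h1 h2
      obtain rfl : k = n := by omega
      exact post τ h1 h2
    | succ m ihm =>
      intro k τ hk hx h1 h2
      refine wp_call (step k (by omega) τ hx h1 h2) fun υ h3 h4 => ⟨?_, ?_, ?_⟩
      · rw [h3.v x hpx, hx]
      · rw [h3.v y hpy, h1.v y (by simp [wv, hxy, hpy]), hn]
      · refine ihm (k + 1) _ (by omega) (by simp) ?_ h4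
        exact (h1.trans (h3.mono (by simp +contextual [wv]) (by simp [wa]) (by simp [wo]))).trans
          (set _ _)
  exact ⟨n, hn, hb, hxy, key n 0 _ (by omega) (by simp) (set _ _) h0⟩

section simp
variable (D : Dims) (σ : St) (Q : St → Prop)
@[simp] theorem wp_skip : skip.wp D σ Q ↔ Q σ := Iff.rfl
@[simp] theorem wp_asg (x : Var) (e : Ex) :
    (asg x e).wp D σ Q ↔ e.Ok D.lay σ ∧ Q (σ.setv x (e.eval σ)) := Iff.rfl
@[simp] theorem wp_put (b : Arr) (i j e : Ex) :
    (put b i j e).wp D σ Q ↔ (Ex.get b i j).Ok D.lay σ ∧ e.Ok D.lay σ ∧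
      Q (σ.seta b (i.eval σ).toNat (j.eval σ).toNat (e.eval σ)) := Iff.rfl
@[simp] theorem wp_out (e f : Ex) : (out e f).wp D σ Q ↔ (Ex.io e).Ok D.lay σ ∧ f.Ok D.lay σ ∧
    Q (σ.seto (e.eval σ) (f.eval σ)) := Iff.rfl
@[simp] theorem wp_ifz (e : Ex) (p q : Cmd) : (ifz e p q).wp D σ Q ↔
    e.Ok D.lay σ ∧ (e.eval σ = 0 → p.wp D σ Q) ∧ (e.eval σ ≠ 0 → q.wp D σ Q) := Iff.rfl
@[simp] theorem wp_ifp (e : Ex) (p q : Cmd) : (ifp e p q).wp D σ Q ↔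
    e.Ok D.lay σ ∧ (0 < e.eval σ → p.wp D σ Q) ∧ (e.eval σ ≤ 0 → q.wp D σ Q) := Iff.rfl
end simp

end Cmd

/-! ### Signed sums of powers of two -/

/-- `N` is a sum of summands `± 2 ^ p` for different exponents `p ∈ B`. -/
def SSum (B : Finset ℕ) (N : ℤ) : Prop :=
  ∃ ε : ℕ → ℤ, (∀ p, ε p = 0 ∨ ε p = 1 ∨ ε p = -1) ∧ (∀ p, p ∉ B → ε p = 0) ∧
    N = ∑ p ∈ B, ε p * 2 ^ p

theorem SSum.mono {B C : Finset ℕ} {N : ℤ} (h : SSum B N) (hBC : B ⊆ C) : SSum C N := by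
  obtain ⟨ε, h1, h2, rfl⟩ := h
  exact ⟨ε, h1, fun p hp => h2 p fun hB => hp (hBC hB),
    Finset.sum_subset hBC fun p _ hp => by simp [h2 p hp]⟩

theorem SSum.of_supp {B : Finset ℕ} {N : ℤ} (h : supp N ⊆ B) : SSum B N :=
  ⟨naf N, naf_cases N, fun p hp => not_not.1 fun h1 => hp (h (mem_supp.2 h1)), (sum_supp N h).symm⟩

theorem SSum.zero (B : Finset ℕ) : SSum B 0 := .of_supp (by simp)

theorem SSum.neg {B : Finset ℕ} {N : ℤ} (h : SSum B N) : SSum B (-N) := by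
  obtain ⟨ε, h1, h2, rfl⟩ := h
  refine ⟨fun p => -ε p, fun p => ?_, fun _ hp => by simp [h2 _ hp], by simp⟩
  have := h1 p; simp only; omega

theorem SSum.union {B C : Finset ℕ} {M N : ℤ} (h : SSum B M) (h' : SSum C N) (hd : Disjoint B C) :
    SSum (B ∪ C) (M + N) := by
  obtain ⟨ε, h1, h2, rfl⟩ := h
  obtain ⟨δ, k1, k2, rfl⟩ := h'
  have hB : ∀ p ∈ B, δ p = 0 := fun p hp => k2 p (Finset.disjoint_left.1 hd hp)
  have hC : ∀ p ∈ C, ε p = 0 := fun p hp => h2 p (Finset.disjoint_right.1 hd hp)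
  refine ⟨fun p => ε p + δ p, fun p => ?_, fun p hp => ?_, ?_⟩
  · by_cases hp : p ∈ B
    · simpa [hB p hp] using h1 p
    · simpa [h2 p hp] using k1 p
  · simp only [Finset.mem_union, not_or] at hp
    simp [h2 p hp.1, k2 p hp.2]
  · rw [Finset.sum_union hd]
    congr 1 <;> refine Finset.sum_congr rfl fun p hp => ?_
    · simp [hB p hp]
    · simp [hC p hp]

theorem SSum.split {B C : Finset ℕ} {N : ℤ} (h : SSum (B ∪ C) N) (hd : Disjoint B C) :
    ∃ x y, SSum B x ∧ SSum C y ∧ N = x + y := by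
  obtain ⟨ε, h1, h2, rfl⟩ := h
  have key : ∀ D ⊆ B ∪ C, SSum D (∑ p ∈ D, ε p * 2 ^ p) := fun D _ =>
    ⟨fun p => if p ∈ D then ε p else 0, fun p => by simp only; split_ifs <;> simp [h1 p],
      fun p hp => by simp [hp], Finset.sum_congr rfl fun p hp => by simp [hp]⟩
  exact ⟨_, _, key B Finset.subset_union_left, key C Finset.subset_union_right,
    Finset.sum_union hd⟩

theorem SSum.abs_lt {m : ℕ} {N : ℤ} (h : SSum (Finset.range m) N) : |N| < 2 ^ m := by
  obtain ⟨ε, h1, -, rfl⟩ := h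
  induction m with
  | zero => simp
  | succ m ih =>
    rw [Finset.sum_range_succ, pow_succ]
    rw [_root_.abs_lt] at ih ⊢
    have := h1 m
    have hp : (0 : ℤ) < 2 ^ m := by positivity
    rcases h1 m with h | h | h <;> rw [h] <;> constructor <;> linarith

/-- Greedy choice from the top: taking the sign of `N` as the digit at `m` leaves a number of
absolute value below `2 ^ m`. -/
theorem SSum.of_abs_lt {m : ℕ} {N : ℤ} (h : |N| < 2 ^ m) : SSum (Finset.range m) N := by
  induction m generalizing N with
  | zero =>
    have : N = 0 := by simpa using h
    subst this; exact .zero _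
  | succ m ih =>
    have hp : (0 : ℤ) < 2 ^ m := by positivity
    rw [pow_succ, _root_.abs_lt] at h
    have hd : Disjoint {m} (Finset.range m) := by simp
    have hs : ∀ e : ℤ, (e = 0 ∨ e = 1 ∨ e = -1) → SSum {m} (e * 2 ^ m) := fun e he =>
      ⟨fun p => if p = m then e else 0, fun p => by simp only; split_ifs <;> simp [he],
        fun p hp => by simp at hp; simp [hp], by simp⟩
    have key : ∀ e : ℤ, (e = 0 ∨ e = 1 ∨ e = -1) → |N - e * 2 ^ m| < 2 ^ m →
        SSum (Finset.range (m + 1)) N := fun e he hN => by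
      have := (hs e he).union (ih hN) hd
      rw [Finset.range_add_one, Finset.insert_eq]
      convert this using 1; ring
    rcases lt_trichotomy N 0 with h0 | h0 | h0
    · exact key (-1) (by simp) (by rw [_root_.abs_lt]; constructor <;> linarith)
    · exact key 0 (by simp) (by simp [h0])
    · exact key 1 (by simp) (by rw [_root_.abs_lt]; constructor <;> linarith)

/-- The successors of the elements of `B`. -/
def up (B : Finset ℕ) : Finset ℕ := B.image (· + 1)

theorem mem_up {B : Finset ℕ} {p : ℕ} : p ∈ up B ↔ ∃ b ∈ B, b + 1 = p := by simp [up]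

theorem up_mono {B C : Finset ℕ} (h : B ⊆ C) : up B ⊆ up C := Finset.image_subset_image h

theorem card_up_le (B : Finset ℕ) : (up B).card ≤ B.card := Finset.card_image_le

/-- A nonzero digit at a place outside `B` can only come from a carry. If the place directly below
is outside `B` as well, that lower place and the look-ahead from it are empty, so a carry arriving
there becomes a digit and goes no further. The place below therefore belongs to `B`. -/
theorem SSum.supp_subset {B : Finset ℕ} {N : ℤ} (h : SSum B N) : supp N ⊆ B ∪ up B := by
  obtain ⟨ε, h1, h2, hN⟩ := h
  obtain ⟨m, hm⟩ := B.exists_nat_subset_range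
  have hf : ∀ p, m ≤ p → ε p = 0 := fun p hp => h2 p fun hB => by
    have := Finset.mem_range.1 (hm hB); omega
  obtain ⟨τ, hτ, h0⟩ := exists_tail hf
  have hN : τ 0 = N := by
    rw [h0, hN]
    exact (Finset.sum_subset hm fun p _ hp => by simp [h2 p hp]).symm
  have hk : ∀ p, rest N p - τ p = 0 ∨ rest N p - τ p = 1 ∨ rest N p - τ p = -1 := by
    intro p
    induction p with
    | zero => simp [rest, hN]
    | succ p ih =>
      have := carry_of_tail hτ N p
      have := h1 p; have := naf_cases N p
      omega
  intro p hp
  rw [mem_supp] at hp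
  rw [Finset.mem_union, mem_up]
  by_cases hpB : p ∈ B
  · exact Or.inl hpB
  · right
    have a1 := h2 p hpB
    have a2 := naf_of_tail hτ N p
    have a3 := dig_cases (rest N p - τ p + ε p + 2 * ε (p + 1))
    rcases p with _ | p
    · simp only [rest, hN] at a3 a2; omega
    · refine ⟨p, ?_, rfl⟩
      by_contra hp1
      have b1 := h2 p hp1
      have b2 := naf_of_tail hτ N p
      have b3 := dig_cases (rest N p - τ p + ε p + 2 * ε (p + 1))
      have b4 := carry_of_tail hτ N p
      have := hk p; have := hk (p + 1)
      omega

/-- All elements of `B` are signed sums of powers of two with exponents in `B`. -/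
def IsClosedBase (B : Finset ℕ) : Prop := ∀ b ∈ B, SSum B (b : ℤ)

theorem IsClosedBase.union {B C : Finset ℕ} (hB : IsClosedBase B) (hC : IsClosedBase C) :
    IsClosedBase (B ∪ C) := fun b hb => by
  rcases Finset.mem_union.1 hb with h | h
  · exact (hB b h).mono Finset.subset_union_left
  · exact (hC b h).mono Finset.subset_union_right

/-- The least element `m` is a sum of multiples of `2 ^ m`; since `m < 2 ^ m`, it is `0`. -/
theorem IsClosedBase.zero_mem {B : Finset ℕ} (hB : IsClosedBase B) (hne : B.Nonempty) : 0 ∈ B := by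
  by_contra h0
  set m := B.min' hne with hm
  obtain ⟨ε, -, h2, h3⟩ := hB m (B.min'_mem hne)
  have hd : (2 : ℤ) ^ m ∣ m := by
    rw [h3]
    exact Finset.dvd_sum fun p hp => Dvd.dvd.mul_left (pow_dvd_pow 2 (B.min'_le p hp)) _
  have hpos : 0 < m := Nat.pos_of_ne_zero fun h => h0 (h ▸ B.min'_mem hne)
  have := Nat.le_of_dvd hpos (by exact_mod_cast hd)
  exact absurd this (not_le.2 Nat.lt_two_pow_self)

theorem exists_gap (B : Finset ℕ) : ∃ z, z ∉ B ∧ ∀ p < z, p ∈ B := by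
  obtain ⟨z, hz⟩ := Infinite.exists_notMem_finset B
  have h : ∃ z, z ∉ B := ⟨z, hz⟩
  exact ⟨Nat.find h, Nat.find_spec h, fun p hp => not_not.1 (Nat.find_min h hp)⟩

/-- As all exponents below the gap `z` are available, the part of `b` below `z` is just an integer
of absolute value less than `2 ^ z`. Adding `j` keeps it below `2 ^ (z + 1)`, within reach of the
exponents `0, …, z`; the part above `z` is untouched because `z` was missing. -/
theorem SSum.add_small {B : Finset ℕ} {z : ℕ} (hzB : z ∉ B) (hz : ∀ p < z, p ∈ B) {b j : ℤ}
    (hb : SSum B b) (hj : |j| ≤ 2 ^ z) : SSum (insert z B) (b + j) := by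
  set C := B \ Finset.range z with hC
  have hB : SSum (Finset.range z ∪ C) b := hb.mono fun p hp => by
    simp only [hC, Finset.mem_union, Finset.mem_sdiff, Finset.mem_range, hp, true_and]; omega
  obtain ⟨x, y, hx, hy, rfl⟩ := hB.split (by rw [hC]; exact Finset.disjoint_sdiff)
  have hx := hx.abs_lt
  have hxj : SSum (Finset.range (z + 1)) (x + j) := .of_abs_lt <| by
    rw [pow_succ]; have := abs_add_le x j; linarith
  have hd : Disjoint (Finset.range (z + 1)) C := by
    rw [Finset.disjoint_left]; intro p hp hpC
    simp only [hC, Finset.mem_sdiff, Finset.mem_range] at hp hpC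
    obtain rfl : p = z := by omega
    exact hzB hpC.1
  have := (hxj.union hy hd).mono (C := insert z B) fun p hp => by
    simp only [hC, Finset.mem_union, Finset.mem_sdiff, Finset.mem_range, Finset.mem_insert] at hp ⊢
    rcases hp with hp | hp
    · rcases Nat.lt_succ_iff_lt_or_eq.1 hp with hp | hp
      · exact Or.inr (hz p hp)
      · exact Or.inl hp
    · exact Or.inr hp.1
  convert this using 1; ring

theorem SSum.of_small {B : Finset ℕ} {z : ℕ} (hz : ∀ p < z, p ∈ B) {j : ℤ} (hj : |j| < 2 ^ z) :
    SSum B j :=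
  (SSum.of_abs_lt hj).mono fun p hp => hz p (Finset.mem_range.1 hp)

/-- Adding the first missing exponent to a closed set, all numbers close to represented ones become
represented. -/
theorem IsClosedBase.exists_insert {U : Finset ℕ} (hU : IsClosedBase U) (hne : U.Nonempty) :
    ∃ z, 0 ∈ U ∧ 1 ∈ insert z U ∧ IsClosedBase (insert z U) ∧
      (∀ b : ℤ, SSum U b → SSum (insert z U) (b + 1) ∧ SSum (insert z U) (b + 2)) ∧
      ∀ b ∈ insert z U, SSum (insert z U) ((b : ℤ) + 1) ∧ SSum (insert z U) ((b : ℤ) + 2) := by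
  obtain ⟨z, hz, hz'⟩ := exists_gap U
  have h0 := hU.zero_mem hne
  have hz1 : 1 ≤ z := Nat.one_le_iff_ne_zero.2 fun h => hz (h ▸ h0)
  have hp : (2 : ℤ) ≤ 2 ^ z := by
    calc (2 : ℤ) = 2 ^ 1 := by norm_num
      _ ≤ 2 ^ z := pow_le_pow_right₀ (by norm_num) hz1
  have hz2 : ∀ p < z + 1, p ∈ insert z U := fun p hp => by
    rcases Nat.lt_succ_iff_lt_or_eq.1 hp with hp | hp
    · exact Finset.mem_insert_of_mem (hz' p hp)
    · exact hp ▸ Finset.mem_insert_self _ _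
  -- Thus `z`, `z + 1` and `z + 2` are sums over `0, …, z` alone, all of which now belong to the
  -- set; this needs `z ≥ 1`, that is, `0 ∈ U`.
  have hzz : (z : ℤ) + 2 < 2 ^ (z + 1) := by
    have : ∀ n : ℕ, 1 ≤ n → n + 2 < 2 ^ (n + 1) := fun n hn => by
      induction n, hn using Nat.le_induction with
      | base => norm_num
      | succ n _ ih => rw [pow_succ]; omega
    exact_mod_cast this z hz1
  have key : ∀ b : ℤ, SSum U b → SSum (insert z U) (b + 1) ∧ SSum (insert z U) (b + 2) := fun b hb =>
    ⟨hb.add_small hz hz' (by rw [abs_one]; linarith),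
      hb.add_small hz hz' (by rw [abs_two]; exact hp)⟩
  refine ⟨z, h0, hz2 1 (by omega), fun b hb => ?_, key, fun b hb => ?_⟩
  · rcases Finset.mem_insert.1 hb with rfl | hb
    · exact .of_small hz2 (by rw [abs_of_nonneg (by positivity)]; linarith)
    · exact (hU b hb).mono (Finset.subset_insert _ _)
  · rcases Finset.mem_insert.1 hb with rfl | hb
    · constructor <;> refine .of_small hz2 ?_ <;> rw [abs_of_nonneg (by positivity)] <;> linarith
    · exact key b (hU b hb)

/-- Whether a carry into position `p` may occur when adding a signed sum over `B` and one over
`Y`. -/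
def carryIn (B Y : Finset ℕ) : ℕ → ℕ
  | 0 => 0
  | p + 1 => if 2 ≤ (if p ∈ B then 1 else 0) + (if p ∈ Y then 1 else 0) + carryIn B Y p then 1 else 0

theorem carryIn_le (B Y : Finset ℕ) (p : ℕ) : carryIn B Y p ≤ 1 := by
  rcases p with _ | p
  · exact Nat.zero_le 1
  · unfold carryIn; split_ifs <;> decide

/-- Any `x` over `B` can be added to any `y` over `Y` with signed digits; the only new exponents
needed are the places outside `B` that lie in `Y` or may receive a carry. The set `A` does not
depend on `x`, so all sums `q + c` with the same `c` share it. This is what keeps a multiplication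
by a power of two cheap. -/
theorem exists_carrySet (B Y : Finset ℕ) (hY : Y ⊆ B ∪ up B) :
    ∃ A : Finset ℕ, A.card ≤ Y.card ∧ (∀ a ∈ A, ∃ b ∈ B, a = b + 1 ∨ a = b + 2) ∧
      ∀ x y : ℤ, SSum B x → supp y ⊆ Y → SSum (B ∪ A) (x + y) := by
  obtain ⟨M, hM⟩ := (B ∪ Y).exists_nat_subset_range
  have hM' : ∀ p ≥ M, p ∉ B ∧ p ∉ Y := fun p hp => by
    by_contra h
    have := Finset.mem_range.1 (hM (Finset.mem_union.2 (by tauto : p ∈ B ∨ p ∈ Y)))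
    omega
  let A : ℕ → Finset ℕ := fun m =>
    (Finset.range m).filter fun p => p ∉ B ∧ (p ∈ Y ∨ carryIn B Y p = 1)
  -- Each element of `Y` pays either for one element of `A` or for one carry that is still on its
  -- way. A carry arriving outside `B` and `Y` costs an element of `A` but ends there.
  have hcard : ∀ m, (A m).card + carryIn B Y m ≤ (Y.filter (· < m)).card := by
    intro m
    induction m with
    | zero => simp [A, carryIn]
    | succ m ih =>
      have e1 : (A (m + 1)).card =
          (A m).card + if m ∉ B ∧ (m ∈ Y ∨ carryIn B Y m = 1) then 1 else 0 := by
        simp only [A]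
        rw [Finset.range_add_one, Finset.filter_insert]
        split_ifs
        · rw [Finset.card_insert_of_notMem (by simp)]
        · rfl
      have e2 : (Y.filter (· < m + 1)).card =
          (Y.filter (· < m)).card + if m ∈ Y then 1 else 0 := by
        split_ifs with h
        · rw [show Y.filter (· < m + 1) = insert m (Y.filter (· < m)) by
            ext p; simp only [Finset.mem_filter, Finset.mem_insert]
            constructor
            · rintro ⟨h1, h2⟩
              rcases Nat.lt_succ_iff_lt_or_eq.1 h2 with h3 | h3
              · exact Or.inr ⟨h1, h3⟩
              · exact Or.inl h3
            · rintro (rfl | h1)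
              · exact ⟨h, by omega⟩
              · exact ⟨h1.1, by omega⟩]
          rw [Finset.card_insert_of_notMem (by simp)]
        · congr 1; ext p; simp only [Finset.mem_filter]
          constructor
          · rintro ⟨h1, h2⟩
            exact ⟨h1, lt_of_le_of_ne (by omega) fun h3 => h (h3 ▸ h1)⟩
          · rintro ⟨h1, h2⟩; exact ⟨h1, by omega⟩
      have := carryIn_le B Y m
      rw [e1, e2, carryIn]
      by_cases h1 : m ∈ B <;> by_cases h2 : m ∈ Y <;> simp only [h1, h2, if_true, if_false,
        not_true, not_false_iff, false_and, true_and, true_or, false_or] <;> split_ifs <;> omega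
  refine ⟨A (M + 1), (Nat.le_add_right _ _).trans ((hcard _).trans (Finset.card_filter_le _ _)),
    fun a ha => ?_, fun x y hx hy => ?_⟩
  · simp only [A, Finset.mem_filter] at ha
    have hYa : ∀ p ∈ Y, p ∉ B → ∃ b ∈ B, p = b + 1 := fun p hp hpB => by
      have := hY hp
      rw [Finset.mem_union, mem_up] at this
      obtain ⟨b, hb, rfl⟩ := this.resolve_left hpB
      exact ⟨b, hb, rfl⟩
    rcases ha.2.2 with h | h
    · obtain ⟨b, hb, h⟩ := hYa a h ha.2.1
      exact ⟨b, hb, Or.inl h⟩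
    · rcases a with _ | a
      · simp [carryIn] at h
      · by_cases haB : a ∈ B
        · exact ⟨a, haB, Or.inl rfl⟩
        · have haY : a ∈ Y := by
            by_contra haY
            have := carryIn_le B Y a
            simp only [carryIn, haB, haY, if_false] at h
            split_ifs at h <;> omega
          obtain ⟨b, hb, rfl⟩ := hYa a haY haB
          exact ⟨b, hb, Or.inr rfl⟩
  · obtain ⟨ε, h1, h2, rfl⟩ := hx
    -- Schoolbook addition with digits `0, ±1`: the actual carry can be nonzero only where `carryIn`
    -- permits one, and a place at which no carry and no digit can occur gets the digit `0`.
    have key : ∀ m, ∃ δ : ℕ → ℤ, ∃ c : ℤ, (∀ p, δ p = 0 ∨ δ p = 1 ∨ δ p = -1) ∧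
        (∀ p, p ∉ B ∪ A m → δ p = 0) ∧ (|c| ≤ carryIn B Y m) ∧
        ∑ p ∈ Finset.range m, ε p * 2 ^ p + ∑ p ∈ Finset.range m, naf y p * 2 ^ p =
          ∑ p ∈ Finset.range m, δ p * 2 ^ p + c * 2 ^ m := by
      intro m
      induction m with
      | zero => exact ⟨fun _ => 0, 0, by simp, by simp, by simp, by simp⟩
      | succ m ih =>
        obtain ⟨δ, c, k1, k2, k3, k4⟩ := ih
        have a1 := h1 m
        have a2 := naf_cases y m
        have a3 := h2 m
        have a4 : m ∉ Y → naf y m = 0 := fun h => not_not.1 fun h' => h (hy (mem_supp.2 h'))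
        have a5 := carryIn_le B Y m
        obtain ⟨d, c', e1, e2, e3, e4⟩ : ∃ d c' : ℤ, (d = 0 ∨ d = 1 ∨ d = -1) ∧
            (m ∉ B ∪ A (m + 1) → d = 0) ∧ |c'| ≤ carryIn B Y (m + 1) ∧
            ε m + naf y m + c = d + 2 * c' := by
          have hmA : m ∈ A (m + 1) ↔ m ∉ B ∧ (m ∈ Y ∨ carryIn B Y m = 1) := by
            simp [A]
          rw [Finset.mem_union, hmA, carryIn]
          simp only [abs_le] at k3 ⊢
          have hs : -3 ≤ ε m + naf y m + c ∧ ε m + naf y m + c ≤ 3 := by omega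
          rw [not_or, not_and, not_or]
          generalize hS : ε m + naf y m + c = S at hs ⊢
          generalize carryIn B Y m = v at *
          by_cases hS2 : 2 ≤ S
          · refine ⟨S - 2, 1, by omega, ?_, ?_, by omega⟩ <;>
            by_cases b1 : m ∈ B <;> by_cases b2 : m ∈ Y <;>
              simp only [b1, b2, if_true, if_false, not_true, not_false_iff, true_imp_iff,
                false_imp_iff, false_and, true_and] at * <;> first | omega | (split <;> omega)
          · by_cases hS3 : S ≤ -2
            · refine ⟨S + 2, -1, by omega, ?_, ?_, by omega⟩ <;>
              by_cases b1 : m ∈ B <;> by_cases b2 : m ∈ Y <;>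
                simp only [b1, b2, if_true, if_false, not_true, not_false_iff, true_imp_iff,
                  false_imp_iff, false_and, true_and] at * <;> first | omega | (split <;> omega)
            · refine ⟨S, 0, by omega, ?_, ?_, by omega⟩
              · by_cases b1 : m ∈ B <;> by_cases b2 : m ∈ Y <;>
                  simp only [b1, b2, if_true, if_false, not_true, not_false_iff, true_imp_iff,
                    false_imp_iff, false_and, true_and] at * <;> omega
              · exact ⟨neg_nonpos.2 (Nat.cast_nonneg _), Nat.cast_nonneg _⟩
        refine ⟨Function.update δ m d, c', fun p => ?_, fun p hp => ?_, e3, ?_⟩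
        · by_cases h : p = m
          · subst h; simpa using e1
          · simpa [h] using k1 p
        · by_cases h : p = m
          · subst h; simpa using e2 hp
          · rw [Function.update_of_ne h]
            refine k2 p fun h' => hp ?_
            rw [Finset.mem_union] at h' ⊢
            refine h'.imp id fun h'' => ?_
            simp only [A, Finset.mem_filter, Finset.mem_range] at h'' ⊢
            exact ⟨by omega, h''.2⟩
        · have e5 : ∑ p ∈ Finset.range m, Function.update δ m d p * 2 ^ p =
              ∑ p ∈ Finset.range m, δ p * 2 ^ p := Finset.sum_congr rfl fun p hp => by
            rw [Function.update_of_ne (by have := Finset.mem_range.1 hp; omega)]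
          rw [Finset.sum_range_succ, Finset.sum_range_succ, Finset.sum_range_succ, e5,
            Function.update_self, pow_succ]
          linear_combination k4 + 2 ^ m * e4
    obtain ⟨δ, c, k1, k2, k3, k4⟩ := key (M + 1)
    have hc : c = 0 := by
      have : carryIn B Y (M + 1) = 0 := by
        have := carryIn_le B Y M
        simp only [carryIn, (hM' M le_rfl).1, (hM' M le_rfl).2, if_false]
        split_ifs <;> omega
      rw [this] at k3
      simpa using k3
    have s1 : ∑ p ∈ Finset.range (M + 1), ε p * 2 ^ p = ∑ p ∈ B, ε p * 2 ^ p := by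
      refine (Finset.sum_subset (fun p hp => ?_) fun p _ hp => by simp [h2 p hp]).symm
      exact Finset.range_mono (Nat.le_succ M) (hM (Finset.mem_union_left _ hp))
    have s2 : ∑ p ∈ Finset.range (M + 1), naf y p * 2 ^ p = y := by
      refine sum_supp y fun p hp => ?_
      exact Finset.range_mono (Nat.le_succ M) (hM (Finset.mem_union_right _ (hy hp)))
    rw [s1, s2, hc, zero_mul, add_zero] at k4
    refine ⟨δ, k1, k2, ?_⟩
    rw [k4]
    refine (Finset.sum_subset (fun p hp => ?_) fun p _ hp => by simp [k2 p hp]).symm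
    rcases Finset.mem_union.1 hp with hp | hp
    · exact Finset.range_mono (Nat.le_succ M) (hM (Finset.mem_union_left _ hp))
    · exact (Finset.filter_subset _ _) hp

/-! ### Evaluation of terms and the exponents that occur -/

/-- As for `SSum.supp_subset`, but the two summands may share exponents: a carry that reaches an
empty place becomes a digit and stops, unless the next place is occupied. -/
theorem supp_add_subset (x y : ℤ) : supp (x + y) ⊆ (supp x ∪ supp y) ∪ up (supp x ∪ supp y) := by
  intro p hp
  rw [mem_supp] at hp
  simp only [Finset.mem_union, mem_up, mem_supp]
  by_contra hne
  push Not at hne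
  obtain ⟨⟨h1, h2⟩, h3⟩ := hne
  have a1 := naf_add x y p
  have a2 := dig_cases (carry x y p + (naf x p + naf y p) + 2 * (naf x (p + 1) + naf y (p + 1)))
  rcases p with _ | p
  · simp only [carry_zero] at a1 a2; omega
  · have h4 : naf x p = 0 ∧ naf y p = 0 := by
      by_contra h; exact h3 p (by tauto) rfl
    have b1 := naf_add x y p
    have b2 := dig_cases (carry x y p + (naf x p + naf y p) + 2 * (naf x (p + 1) + naf y (p + 1)))
    have b3 := carry_succ x y p
    have b4 := carry_bound x y p
    have b5 := carry_bound x y (p + 1)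
    omega

/-- The result of the operation `a · 2 ^ c`, if it is an integer. -/
def shift (a c : ℤ) : Option ℤ :=
  if ∀ q ∈ supp a, 0 ≤ (q : ℤ) + c then some (if 0 ≤ c then a * 2 ^ c.toNat else a / 2 ^ (-c).toNat)
  else none

theorem dvd_of_supp {a : ℤ} {m : ℕ} (h : ∀ q ∈ supp a, m ≤ q) : (2 : ℤ) ^ m ∣ a := by
  rw [← sum_supp a subset_rfl]
  exact Finset.dvd_sum fun p hp => Dvd.dvd.mul_left (pow_dvd_pow 2 (h p hp)) _

/-- An integral shift moves the non-adjacent form as a whole. In the case `c < 0`, divisibility by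
`2 ^ (-c)` follows from the condition on the exponents, and the claim is read off from the reverse
shift. -/
theorem shift_eq_some {a c z : ℤ} (h : shift a c = some z) :
    (∀ q ∈ supp a, 0 ≤ (q : ℤ) + c) ∧ (z : ℚ) = a * (2 : ℚ) ^ c ∧
      (∀ q ∈ supp a, naf z (q + c).toNat = naf a q) ∧
      ∀ p, naf z p ≠ 0 → ∃ q ∈ supp a, (p : ℤ) = q + c := by
  unfold shift at h
  split_ifs at h with h1 h2
  · obtain rfl := Option.some.inj h
    lift c to ℕ using h2
    simp only [Int.toNat_natCast, naf_mul_two_pow]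
    refine ⟨h1, by push_cast; rw [zpow_natCast], fun q _ => ?_, fun p hp => ?_⟩
    · rw [show ((q : ℤ) + c).toNat = q + c by omega, if_neg (by omega), Nat.add_sub_cancel]
    · have hpc : c ≤ p := by
        by_contra h; exact hp (if_pos (by omega))
      rw [if_neg (by omega)] at hp
      exact ⟨p - c, mem_supp.2 hp, by omega⟩
  · have h := Option.some.inj h
    obtain ⟨d, hd⟩ : ∃ d : ℕ, c = -d := ⟨(-c).toNat, by omega⟩
    subst hd
    rw [show (- -(d : ℤ)).toNat = d by omega] at h
    have hz : a = z * 2 ^ d := by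
      rw [← h, Int.ediv_mul_cancel (dvd_of_supp fun q hq => by have := h1 q hq; omega)]
    refine ⟨h1, ?_, fun q hq => ?_, fun p hp => ⟨p + d, ?_, by push_cast; ring⟩⟩
    · rw [hz]; push_cast
      rw [zpow_neg, zpow_natCast, mul_assoc, mul_inv_cancel₀ (by positivity), mul_one]
    · have := h1 q hq
      rw [hz, naf_mul_two_pow, if_neg (by omega)]
      congr 1; omega
    · rw [mem_supp, hz, naf_mul_two_pow, if_neg (by omega), Nat.add_sub_cancel]; exact hp

theorem shift_of_eq {a c z : ℤ} (h : (z : ℚ) = a * (2 : ℚ) ^ c) : shift a c = some z := by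
  have key : ∀ q ∈ supp a, 0 ≤ (q : ℤ) + c := fun q hq => by
    by_contra hq'
    obtain ⟨d, hd⟩ : ∃ d : ℕ, c = -d := ⟨(-c).toNat, by omega⟩
    subst hd
    have hz : a = z * 2 ^ d := by
      have : (a : ℚ) = z * 2 ^ d := by
        rw [h, zpow_neg, zpow_natCast, mul_assoc, inv_mul_cancel₀ (by positivity), mul_one]
      exact_mod_cast this
    rw [mem_supp, hz, naf_mul_two_pow, if_pos (by omega)] at hq
    exact hq rfl
  have h1 : ∃ w, shift a c = some w := ⟨_, if_pos key⟩
  obtain ⟨w, hw⟩ := h1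
  have := (shift_eq_some hw).2.1
  rw [hw, show w = z by exact_mod_cast this.trans h.symm]

namespace Term

variable {X : Type}

/-- The value of a term, if it is defined. -/
def ev (ρ : X → ℤ) : Term X → Option ℤ
  | zero => some 0
  | one => some 1
  | var x => some (ρ x)
  | add s t => (ev ρ s).bind fun a => (ev ρ t).bind fun b => some (a + b)
  | sub s t => (ev ρ s).bind fun a => (ev ρ t).bind fun b => some (a - b)
  | mulPow s t => (ev ρ s).bind fun a => (ev ρ t).bind fun b => shift a b
  | divPow s t => (ev ρ s).bind fun a => (ev ρ t).bind fun b => shift a (-b)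

theorem value_iff {ρ : X → ℤ} {t : Term X} {N : ℤ} : t.Value ρ N ↔ t.ev ρ = some N := by
  constructor
  · intro h
    induction h with
    | zero => rfl
    | one => rfl
    | var x => rfl
    | add _ _ ih ih' => simp [ev, ih, ih']
    | sub _ _ ih ih' => simp [ev, ih, ih']
    | mulPow _ _ h ih ih' => simp [ev, ih, ih', shift_of_eq h]
    | divPow _ _ h ih ih' => simp [ev, ih, ih', shift_of_eq h]
  · intro h
    induction t generalizing N with
    | zero => cases h; exact .zero
    | one => cases h; exact .one
    | var x => cases h; exact .var x
    | add s t ih ih' =>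
      simp only [ev, Option.bind_eq_some_iff] at h
      obtain ⟨a, ha, b, hb, h⟩ := h; cases h
      exact .add (ih ha) (ih' hb)
    | sub s t ih ih' =>
      simp only [ev, Option.bind_eq_some_iff] at h
      obtain ⟨a, ha, b, hb, h⟩ := h; cases h
      exact .sub (ih ha) (ih' hb)
    | mulPow s t ih ih' =>
      simp only [ev, Option.bind_eq_some_iff] at h
      obtain ⟨a, ha, b, hb, h⟩ := h
      exact .mulPow (ih ha) (ih' hb) (shift_eq_some h).2.1
    | divPow s t ih ih' =>
      simp only [ev, Option.bind_eq_some_iff] at h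
      obtain ⟨a, ha, b, hb, h⟩ := h
      exact .divPow (ih ha) (ih' hb) (shift_eq_some h).2.1

/-- All exponents that occur in the evaluation of a term belong to `G`; the exponents in the
circuit for the variable `x` are those in `b x`. -/
def Within (ρ : X → ℤ) (b : X → Finset ℕ) (G : Finset ℕ) : Term X → Prop
  | zero => True
  | one => True
  | var x => b x ⊆ G
  | add s t => Within ρ b G s ∧ Within ρ b G t ∧
      ∀ a c, s.ev ρ = some a → t.ev ρ = some c → supp (a + c) ⊆ G
  | sub s t => Within ρ b G s ∧ Within ρ b G t ∧
      ∀ a c, s.ev ρ = some a → t.ev ρ = some c → supp (a - c) ⊆ G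
  -- The algorithm forms `q + c` before it can test the sign, so the support of the sum has to be
  -- available even if the sum is negative.
  | mulPow s t => Within ρ b G s ∧ Within ρ b G t ∧
      ∀ a c, s.ev ρ = some a → t.ev ρ = some c → ∀ q ∈ supp a,
        supp (q + c) ⊆ G ∧ (0 ≤ q + c → (q + c).toNat ∈ G)
  | divPow s t => Within ρ b G s ∧ Within ρ b G t ∧
      ∀ a c, s.ev ρ = some a → t.ev ρ = some c → ∀ q ∈ supp a,
        supp (q + -c) ⊆ G ∧ (0 ≤ q + -c → (q + -c).toNat ∈ G)

theorem Within.mono {ρ : X → ℤ} {b : X → Finset ℕ} {G H : Finset ℕ} (hGH : G ⊆ H) {t : Term X}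
    (h : t.Within ρ b G) : t.Within ρ b H := by
  induction t with
  | zero => trivial
  | one => trivial
  | var x => exact h.trans hGH
  | add s t ih ih' =>
    exact ⟨ih h.1, ih' h.2.1, fun a c ha hc => (h.2.2 a c ha hc).trans hGH⟩
  | sub s t ih ih' =>
    exact ⟨ih h.1, ih' h.2.1, fun a c ha hc => (h.2.2 a c ha hc).trans hGH⟩
  | mulPow s t ih ih' =>
    exact ⟨ih h.1, ih' h.2.1, fun a c ha hc q hq =>
      ⟨(h.2.2 a c ha hc q hq).1.trans hGH, fun h0 => hGH ((h.2.2 a c ha hc q hq).2 h0)⟩⟩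
  | divPow s t ih ih' =>
    exact ⟨ih h.1, ih' h.2.1, fun a c ha hc q hq =>
      ⟨(h.2.2 a c ha hc q hq).1.trans hGH, fun h0 => hGH ((h.2.2 a c ha hc q hq).2 h0)⟩⟩

end Term

/-- The exponents of `a` and `c` lie in `U` or directly above it, so those of `a + c` have the form
`u`, `u + 1` or `u + 2` with `u ∈ U`. All of these become representable when the first missing
exponent is added, hence `supp (a + c)` can be joined without losing closedness. -/
theorem exists_base_add {U : Finset ℕ} (hU : IsClosedBase U) {a c : ℤ} (ha : SSum U a)
    (hc : SSum U c) : ∃ B, U ⊆ B ∧ IsClosedBase B ∧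
      B.card ≤ U.card + 1 + (supp a).card + (supp c).card ∧ supp (a + c) ⊆ B := by
  -- Only a nonempty closed set is known to contain `0`; over the empty set all values are `0`.
  rcases U.eq_empty_or_nonempty with rfl | hne
  · have h0 : ∀ {x : ℤ}, SSum ∅ x → x = 0 := fun ⟨ε, _, _, h⟩ => by simpa using h
    rw [h0 ha, h0 hc]
    exact ⟨∅, by simp, hU, by simp, by simp⟩
  · obtain ⟨z, -, -, hz1, hz2, -⟩ := hU.exists_insert hne
    refine ⟨insert z U ∪ supp (a + c), (Finset.subset_insert _ _).trans Finset.subset_union_left,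
      fun p hp => ?_, ?_, Finset.subset_union_right⟩
    · refine SSum.mono ?_ Finset.subset_union_left
      rcases Finset.mem_union.1 hp with hp | hp
      · exact hz1 p hp
      · have hS : supp a ∪ supp c ⊆ U ∪ up U := Finset.union_subset ha.supp_subset hc.supp_subset
        have h1 : ∀ q ∈ U ∪ up U, SSum (insert z U) (q : ℤ) ∧ SSum (insert z U) ((q : ℤ) + 1) := by
          intro q hq
          rcases Finset.mem_union.1 hq with hq | hq
          · exact ⟨(hU q hq).mono (Finset.subset_insert _ _), (hz2 _ (hU q hq)).1⟩
          · obtain ⟨u, hu, rfl⟩ := mem_up.1 hq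
            have := hz2 _ (hU u hu)
            push_cast
            rw [add_assoc, one_add_one_eq_two]
            exact this
        rcases Finset.mem_union.1 (supp_add_subset a c hp) with hp | hp
        · exact (h1 p (hS hp)).1
        · obtain ⟨u, hu, rfl⟩ := mem_up.1 hp
          exact_mod_cast (h1 u (hS hu)).2
    · have := Finset.card_union_le (insert z U) (supp (a + c))
      have := Finset.card_insert_le z U
      have := card_supp_add a c
      omega

/-- Three enlargements: the first missing exponent, so that every `q ∈ supp a` is representable; a
carry set for `c`, so that every `q + c` is; and the nonnegative numbers `q + c` themselves. They
cost at most `1`, the weight of `c` and the weight of `a`. -/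
theorem exists_base_mul {U : Finset ℕ} (hU : IsClosedBase U) {a c : ℤ} (ha : SSum U a)
    (hc : SSum U c) : ∃ B, U ⊆ B ∧ IsClosedBase B ∧
      B.card ≤ U.card + 1 + (supp a).card + (supp c).card ∧
      (∀ q ∈ supp a, SSum B ((q : ℤ) + c) ∧ (0 ≤ (q : ℤ) + c → ((q : ℤ) + c).toNat ∈ B)) := by
  rcases U.eq_empty_or_nonempty with rfl | hne
  · have h0 : ∀ {x : ℤ}, SSum ∅ x → x = 0 := fun ⟨ε, _, _, h⟩ => by simpa using h
    rw [h0 ha, h0 hc]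
    exact ⟨∅, by simp, hU, by simp, by simp⟩
  · obtain ⟨z, -, -, hz1, hz2, hz3⟩ := hU.exists_insert hne
    set V := insert z U with hV
    have hUV : U ⊆ V := Finset.subset_insert _ _
    obtain ⟨A, hA1, hA2, hA3⟩ := exists_carrySet V (supp c) (hc.mono hUV).supp_subset
    set T := ((supp a).filter fun q : ℕ => 0 ≤ (q : ℤ) + c).image
      fun q : ℕ => ((q : ℤ) + c).toNat with hT
    have hq : ∀ q ∈ supp a, SSum (V ∪ A) ((q : ℤ) + c) := by
      intro q hq
      refine hA3 _ _ ?_ subset_rfl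
      rcases Finset.mem_union.1 (ha.supp_subset hq) with hq | hq
      · exact hz1 q (hUV hq)
      · obtain ⟨u, hu, rfl⟩ := mem_up.1 hq
        exact_mod_cast (hz2 _ (hU u hu)).1
    refine ⟨V ∪ A ∪ T, ?_, fun p hp => ?_, ?_, fun q hq' => ⟨?_, fun h0 => ?_⟩⟩
    · exact hUV.trans (Finset.subset_union_left.trans Finset.subset_union_left)
    · refine SSum.mono ?_ Finset.subset_union_left
      rcases Finset.mem_union.1 hp with hp | hp
      · refine SSum.mono ?_ Finset.subset_union_left
        rcases Finset.mem_union.1 hp with hp | hp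
        · exact hz1 p hp
        · obtain ⟨b, hb, rfl | rfl⟩ := hA2 p hp
          · exact_mod_cast (hz3 b hb).1
          · exact_mod_cast (hz3 b hb).2
      · rw [hT, Finset.mem_image] at hp
        obtain ⟨q, hq', rfl⟩ := hp
        rw [Finset.mem_filter] at hq'
        rw [Int.toNat_of_nonneg hq'.2]
        exact hq q hq'.1
    · have h1 := Finset.card_union_le (V ∪ A) T
      have h2 := Finset.card_union_le V A
      have h3 := Finset.card_insert_le z U
      have h4 : T.card ≤ (supp a).card := Finset.card_image_le.trans (Finset.card_filter_le _ _)
      rw [← hV] at h3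
      omega
    · exact (hq q hq').mono Finset.subset_union_left
    · refine Finset.mem_union_right _ (Finset.mem_image.2 ⟨q, Finset.mem_filter.2 ⟨hq', h0⟩, rfl⟩)

/-- The exponents of variable circuits: `b` is closed under passing to the exponents in a
non-adjacent form. -/
def IsNafClosed (b : Finset ℕ) : Prop := ∀ p ∈ b, supp (p : ℤ) ⊆ b

/-- The weight `∑ₓ σ_x(t) |b x| + σ₁(t)`. -/
def Term.weight {k : ℕ} (b : Fin k → Finset ℕ) (t : Term (Fin k)) : ℕ :=
  ∑ x, t.countVar x * (b x).card + t.countOne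

/-- The properties of a set which controls the exponents in the evaluation of a term. -/
structure Term.IsBase {k : ℕ} (ρ : Fin k → ℤ) (b : Fin k → Finset ℕ) (t : Term (Fin k))
    (B : Finset ℕ) : Prop where
  closed : IsClosedBase B
  card : B.card ≤ (t.size + 1) * t.weight b + t.size
  sum : ∀ N, t.ev ρ = some N → SSum B N
  supp : ∀ N, t.ev ρ = some N → (supp N).card ≤ t.weight b
  within : t.Within ρ b (B ∪ up B)

/-- The induction step common to the four operations: unite the bases of the operands and enlarge
the union once. The relation `W` stands for what `Within` requires of the operation. -/
theorem Term.exists_base_step {k : ℕ} {ρ : Fin k → ℤ} {b : Fin k → Finset ℕ}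
    {s t r : Term (Fin k)} (f : ℤ → ℤ → Option ℤ) (W : Finset ℕ → ℤ → ℤ → Prop)
    (hs : ∃ B, s.IsBase ρ b B) (ht : ∃ B, t.IsBase ρ b B) (hsize : r.size = s.size + t.size + 1)
    (hweight : r.weight b = s.weight b + t.weight b)
    (hev : r.ev ρ = (s.ev ρ).bind fun a => (t.ev ρ).bind fun c => f a c)
    (hW : ∀ G, s.Within ρ b G → t.Within ρ b G →
      (∀ a c, s.ev ρ = some a → t.ev ρ = some c → W G a c) → r.Within ρ b G)
    (step : ∀ U a c, IsClosedBase U → SSum U a → SSum U c → ∃ D, U ⊆ D ∧ IsClosedBase D ∧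
      D.card ≤ U.card + 1 + (PowerCircuits.supp a).card + (PowerCircuits.supp c).card ∧
      (∀ N, f a c = some N → SSum D N ∧ (PowerCircuits.supp N).card ≤
        (PowerCircuits.supp a).card + (PowerCircuits.supp c).card) ∧ W (D ∪ up D) a c) :
    ∃ B, r.IsBase ρ b B := by
  obtain ⟨B, hB⟩ := hs
  obtain ⟨C, hC⟩ := ht
  have hup : ∀ {B C : Finset ℕ}, B ⊆ C → B ∪ up B ⊆ C ∪ up C := fun h =>
    Finset.union_subset_union h (up_mono h)
  have hcard := Finset.card_union_le B C
  -- The bound is superadditive with enough room: for sizes `p`, `q` and weights `w`, `w'` of the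
  -- operands, it exceeds the sum of their bounds by `1 + w + w'` and the mixed products `p w' + q
  -- w`.
  have arith : ∀ c : ℕ, c ≤ B.card + C.card + 1 + s.weight b + t.weight b →
      c ≤ (r.size + 1) * r.weight b + r.size := fun c hc => by
    have h1 := hB.card
    have h2 := hC.card
    have : (s.size + t.size + 1 + 1) * (s.weight b + t.weight b) + (s.size + t.size + 1) =
      ((s.size + 1) * s.weight b + s.size) + ((t.size + 1) * t.weight b + t.size) + 1 +
        s.weight b + t.weight b + (s.size * t.weight b + t.size * s.weight b) := by ring
    rw [hsize, hweight]; omega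
  -- If an operand is undefined, the operation is never carried out and the union of the bases
  -- suffices.
  have undef : (∀ a c, s.ev ρ = some a → t.ev ρ = some c → False) → ∃ B, r.IsBase ρ b B := by
    intro h
    have hr : ∀ N, r.ev ρ ≠ some N := fun N hN => by
      simp only [hev, Option.bind_eq_some_iff] at hN
      obtain ⟨a, ha, c, hc, -⟩ := hN
      exact h a c ha hc
    exact ⟨B ∪ C, hB.closed.union hC.closed, arith _ (by omega), fun N hN => absurd hN (hr N),
      fun N hN => absurd hN (hr N), hW _ (hB.within.mono (hup Finset.subset_union_left))
        (hC.within.mono (hup Finset.subset_union_right)) fun a c ha hc => (h a c ha hc).elim⟩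
  cases hs : s.ev ρ with
  | none => exact undef fun a c ha => by simp [hs] at ha
  | some a =>
  cases ht : t.ev ρ with
  | none => exact undef fun a c _ hc => by simp [ht] at hc
  | some c =>
    obtain ⟨D, d1, d2, d3, d4, d5⟩ := step _ a c (hB.closed.union hC.closed)
      ((hB.sum a hs).mono Finset.subset_union_left) ((hC.sum c ht).mono Finset.subset_union_right)
    have h1 := hB.supp a hs
    have h2 := hC.supp c ht
    have hf : r.ev ρ = f a c := by simp [hev, hs, ht]
    refine ⟨D, d2, arith _ (by omega), fun N hN => (d4 N (hf ▸ hN)).1,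
      fun N hN => ((d4 N (hf ▸ hN)).2).trans (by omega),
      hW _ (hB.within.mono (hup (Finset.subset_union_left.trans d1)))
        (hC.within.mono (hup (Finset.subset_union_right.trans d1))) fun a' c' ha hc => ?_⟩
    rw [hs] at ha; rw [ht] at hc; cases ha; cases hc
    exact d5

theorem supp_shift_subset {a c N : ℤ} (h : shift a c = some N) :
    supp N ⊆ (supp a).image fun q : ℕ => ((q : ℤ) + c).toNat := fun p hp => by
  obtain ⟨q, hq, h⟩ := (shift_eq_some h).2.2.2 p (mem_supp.1 hp)
  exact Finset.mem_image.2 ⟨q, hq, by omega⟩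

theorem exists_base_shift {U : Finset ℕ} (hU : IsClosedBase U) {a c : ℤ} (ha : SSum U a)
    (hc : SSum U c) : ∃ D, U ⊆ D ∧ IsClosedBase D ∧
      D.card ≤ U.card + 1 + (supp a).card + (supp c).card ∧
      (∀ N, shift a c = some N → SSum D N ∧ (supp N).card ≤ (supp a).card + (supp c).card) ∧
      ∀ q ∈ supp a, supp (q + c) ⊆ D ∪ up D ∧ (0 ≤ q + c → (q + c).toNat ∈ D ∪ up D) := by
  obtain ⟨D, d1, d2, d3, d4⟩ := exists_base_mul hU ha hc
  refine ⟨D, d1, d2, d3, fun N hN => ?_, fun q hq => ⟨(d4 q hq).1.supp_subset, fun h0 =>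
    Finset.mem_union_left _ ((d4 q hq).2 h0)⟩⟩
  have h1 := (shift_eq_some hN).1
  have hsub := supp_shift_subset hN
  refine ⟨.of_supp fun p hp => ?_, ?_⟩
  · obtain ⟨q, hq, rfl⟩ := Finset.mem_image.1 (hsub hp)
    exact (d4 q hq).2 (h1 q hq)
  · have := (Finset.card_le_card hsub).trans Finset.card_image_le
    omega

theorem Term.exists_base {k : ℕ} {ρ : Fin k → ℤ} {b : Fin k → Finset ℕ}
    (hb : ∀ x, IsNafClosed (b x)) (hρ : ∀ x, PowerCircuits.supp (ρ x) ⊆ b x) (t : Term (Fin k)) :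
    ∃ B, t.IsBase ρ b B := by
  have comb : ∀ s t : Term (Fin k), ∑ x, (s.countVar x + t.countVar x) * (b x).card +
      (s.countOne + t.countOne) = s.weight b + t.weight b := fun s t => by
    simp only [Term.weight, add_mul, Finset.sum_add_distrib]; ring
  induction t with
  | zero =>
    refine ⟨∅, fun p hp => by simp at hp, by simp, fun N hN => ?_, fun N hN => ?_, trivial⟩ <;>
      cases hN
    · exact .zero _
    · simp
  | one =>
    refine ⟨{0}, fun p hp => ?_, by simp [weight, countOne, countVar, size], fun N hN => ?_,
      fun N hN => ?_, trivial⟩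
    · rw [Finset.mem_singleton.1 hp]; exact .zero _
    · cases hN; exact .of_supp (by rw [supp_one])
    · cases hN; simp [supp_one, weight, countOne, countVar]
  | var x =>
    have hw : (var x).weight b = (b x).card := by
      simp [weight, countOne, countVar, ite_mul]
    refine ⟨b x, fun p hp => .of_supp (hb x p hp), by simp [hw, size], fun N hN => ?_,
      fun N hN => ?_, Finset.subset_union_left⟩
    · cases hN; exact .of_supp (hρ x)
    · cases hN; rw [hw]; exact Finset.card_le_card (hρ x)
  | add s t ih ih' =>
    refine exists_base_step (fun a c => some (a + c)) (fun G a c => PowerCircuits.supp (a + c) ⊆ G)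
      ih ih' rfl (comb s t) rfl (fun G h1 h2 h3 => ⟨h1, h2, h3⟩) fun U a c hU ha hc => ?_
    obtain ⟨D, d1, d2, d3, d4⟩ := exists_base_add hU ha hc
    refine ⟨D, d1, d2, d3, fun N hN => ?_, d4.trans Finset.subset_union_left⟩
    cases hN
    exact ⟨.of_supp d4, card_supp_add a c⟩
  | sub s t ih ih' =>
    refine exists_base_step (fun a c => some (a - c)) (fun G a c => PowerCircuits.supp (a - c) ⊆ G)
      ih ih' rfl (comb s t) rfl (fun G h1 h2 h3 => ⟨h1, h2, h3⟩) fun U a c hU ha hc => ?_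
    obtain ⟨D, d1, d2, d3, d4⟩ := exists_base_add hU ha hc.neg
    have := card_supp_add a (-c)
    rw [supp_neg] at d3 this
    rw [← sub_eq_add_neg] at d4 this
    refine ⟨D, d1, d2, d3, fun N hN => ?_, d4.trans Finset.subset_union_left⟩
    cases hN
    exact ⟨.of_supp d4, this⟩
  | mulPow s t ih ih' =>
    exact exists_base_step shift _ ih ih' rfl (comb s t) rfl (fun G h1 h2 h3 => ⟨h1, h2, h3⟩)
      fun U a c hU ha hc => exists_base_shift hU ha hc
  | divPow s t ih ih' =>
    refine exists_base_step (fun a c => shift a (-c)) _ ih ih' rfl (comb s t) rfl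
      (fun G h1 h2 h3 => ⟨h1, h2, h3⟩) fun U a c hU ha hc => ?_
    have := exists_base_shift hU ha hc.neg
    rwa [supp_neg] at this

/-- The exponents that occur in the normal circuit representing `N`. -/
inductive Occurs (N : ℤ) : ℕ → Prop
  | mark {p : ℕ} : naf N p ≠ 0 → Occurs N p
  | edge {q p : ℕ} : Occurs N q → naf (q : ℤ) p ≠ 0 → Occurs N p

/-- Let `V` be `U` with its first missing exponent. Then `V` and its successors form a set closed
under passing to non-adjacent forms, because every `u` and every `u + 1` with `u ∈ V` is a signed
sum over `V`. -/
theorem exists_occurs_subset {U : Finset ℕ} (hU : IsClosedBase U) {N : ℤ} (hN : SSum U N) :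
    ∃ H : Finset ℕ, H.card + 1 ≤ 2 * (U.card + 1) ∧ ∀ p, Occurs N p → p ∈ H := by
  rcases U.eq_empty_or_nonempty with rfl | hne
  · have h0 : N = 0 := by obtain ⟨ε, _, _, h⟩ := hN; simpa using h
    subst h0
    refine ⟨∅, by simp, fun p hp => ?_⟩
    induction hp with
    | mark h => simp at h
    | edge _ _ ih => simp at ih
  · obtain ⟨z, h0, h1, hz1, hz2, hz3⟩ := hU.exists_insert hne
    set V := insert z U
    refine ⟨V ∪ up V, ?_, fun p hp => ?_⟩
    · have a1 := Finset.card_union_add_card_inter V (up V)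
      have a2 := card_up_le V
      -- The number `1` belongs both to `V` and to its successors. The one element saved makes room
      -- for the leaf.
      have a3 : 0 < (V ∩ up V).card := Finset.card_pos.2
        ⟨1, Finset.mem_inter.2 ⟨h1, mem_up.2 ⟨0, Finset.mem_insert_of_mem h0, rfl⟩⟩⟩
      have a4 : V.card ≤ U.card + 1 := Finset.card_insert_le z U
      omega
    · induction hp with
      | mark h => exact (hN.mono (Finset.subset_insert z U)).supp_subset (mem_supp.2 h)
      | edge _ h ih =>
        rcases Finset.mem_union.1 ih with ih | ih
        · exact (hz1 _ ih).supp_subset (mem_supp.2 h)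
        · obtain ⟨u, hu, rfl⟩ := mem_up.1 ih
          exact (hz3 u hu).1.supp_subset (mem_supp.2 (by exact_mod_cast h))

/-- In the set of all exponents that are ever used, carries stop before `K`. -/
theorem incCarry_eq_zero_of_mem {B : Finset ℕ} (hB : IsClosedBase B) {K p : ℕ}
    (hK : 4 * (B.card + 1) ≤ K) (hp : p ∈ (B ∪ up B) ∪ Finset.range (K + 1)) :
    incCarry p K = 0 := by
  -- An element of `B` has at most `2 |B|` nonzero digits and its successor at most one more. By
  -- `incCarry_eq_zero_of_card`, carries then stop before `2 (2 |B| + 1) + 2`, which is where the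
  -- constant `4` comes from.
  have hc : ∀ b ∈ B, (supp (b : ℤ)).card ≤ 2 * B.card := fun b hb => by
    have := Finset.card_le_card (hB b hb).supp_subset
    have := Finset.card_union_le B (up B)
    have := card_up_le B
    omega
  rcases Finset.mem_union.1 hp with hp | hp
  · rcases Finset.mem_union.1 hp with hp | hp
    · have := hc p hp
      exact incCarry_eq_zero_of_card (by omega)
    · obtain ⟨b, hb, rfl⟩ := mem_up.1 hp
      have := hc b hb
      have := card_supp_add (b : ℤ) 1
      rw [supp_one, Finset.card_singleton] at this
      push_cast
      exact incCarry_eq_zero_of_card (by omega)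
  · have hp := Finset.mem_range.1 hp
    obtain ⟨m, rfl⟩ : ∃ m, K = m + 1 := ⟨K - 1, by omega⟩
    -- The exponents up to `K` may have many nonzero digits relative to `|B|`, but they and their
    -- successors are at most `2 ^ (K - 1)` and so have no digits from place `K` on.
    have h2 : m + 2 ≤ 2 ^ m := by
      have : ∀ n : ℕ, 2 ≤ n → n + 2 ≤ 2 ^ n := fun n hn => by
        induction n, hn using Nat.le_induction with
        | base => norm_num
        | succ n _ ih => rw [pow_succ]; omega
      exact this m (by omega)
    unfold incCarry
    rw [rest_eq_zero (m := m) ?_ (by omega), rest_eq_zero (m := m) ?_ (by omega), sub_zero]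
    · rw [abs_of_nonneg (by positivity)]; exact_mod_cast (by omega : p ≤ 2 ^ m)
    · rw [abs_of_nonneg (by positivity)]; exact_mod_cast (by omega : p + 1 ≤ 2 ^ m)

/-! ### Normal circuits and non-adjacent forms -/

namespace Circuit

variable {P : Circuit}

/-- `ex v` is the exponent of the vertex `v`, for all vertices that are not leaves, and the labels
and the marks are the digits of the non-adjacent forms of these exponents and of `N`. -/
structure HasExp (P : Circuit) (ex : Fin P.n → ℕ) (N : ℤ) : Prop where
  inj : ∀ v w, ¬ P.IsLeaf v → ¬ P.IsLeaf w → ex v = ex w → v = w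
  edge : ∀ v w, ¬ P.IsLeaf v → ¬ P.IsLeaf w → naf (ex v) (ex w) = P.edge v w
  exists_edge : ∀ v p, ¬ P.IsLeaf v → naf (ex v) p ≠ 0 → ∃ w, ¬ P.IsLeaf w ∧ ex w = p
  mark : ∀ w, ¬ P.IsLeaf w → naf N (ex w) = P.mark w
  exists_mark : ∀ p, naf N p ≠ 0 → ∃ w, ¬ P.IsLeaf w ∧ ex w = p

theorem exists_leaf (P : Circuit) : ∃ v, P.IsLeaf v := by
  obtain ⟨v, -⟩ := P.exists_marked
  obtain ⟨z, -, hz⟩ := P.wellFounded_adj.has_min Set.univ ⟨v, trivial⟩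
  exact ⟨z, fun w h => hz w trivial h⟩

/-- The exponent is an integer combination of natural numbers. If it were negative, the vertex value
would lie strictly between `0` and `1`. -/
theorem IsProper.exists_exponent (h : P.IsProper) :
    ∃ ex : Fin P.n → ℕ, ∀ v, ¬ P.IsLeaf v → P.exponent v = ex v := by
  have key : ∀ v, ∃ e : ℕ, ¬ P.IsLeaf v → P.exponent v = e := by
    intro v
    by_cases hv : P.IsLeaf v
    · exact ⟨0, fun h => absurd hv h⟩
    choose f hf using h
    have h1 : P.exponent v = ((∑ w, (P.edge v w : ℤ) * f w : ℤ) : ℝ) := by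
      unfold exponent
      push_cast
      refine Finset.sum_congr rfl fun w _ => ?_
      rw [hf w]
    set z := ∑ w, (P.edge v w : ℤ) * f w
    have h2 := P.vertexValue_eq v
    rw [if_neg hv, h1, Real.rpow_intCast, hf v] at h2
    have hz : 0 ≤ z := by
      by_contra hz
      have h3 : (0 : ℝ) < f v := by rw [h2]; positivity
      have h4 : (1 : ℝ) ≤ f v := by exact_mod_cast h3
      have h5 : (2 : ℝ) ^ z < 1 := zpow_lt_one_of_neg₀ (by norm_num) (by omega)
      linarith
    exact ⟨z.toNat, fun _ => by rw [h1]; exact_mod_cast (Int.toNat_of_nonneg hz).symm⟩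
  choose ex hex using key
  exact ⟨ex, hex⟩

/-- Collecting the signs by exponent gives a sequence of digits `0, ±1` without two adjacent nonzero
ones and with value `N`; by `naf_unique` it is the non-adjacent form. This is applied both to the
edges leaving a vertex and to the marks. -/
theorem naf_signedSum {n : ℕ} {L : Fin n → Prop} {ex : Fin n → ℕ} {s : Fin n → SignType}
    {val : Fin n → ℝ} (h0 : ∀ v, L v → val v = 0) (h1 : ∀ v, ¬ L v → val v = 2 ^ ex v)
    (hinj : ∀ v w, ¬ L v → ¬ L w → ex v = ex w → v = w)
    (hc : ∀ v w, s v ≠ 0 → s w ≠ 0 → ¬ L v → ¬ L w → ex v ≠ ex w + 1) {N : ℤ}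
    (hN : (N : ℝ) = ∑ v, (s v : ℝ) * val v) :
    (∀ w, ¬ L w → naf N (ex w) = s w) ∧ ∀ p, naf N p ≠ 0 → ∃ w, ¬ L w ∧ ex w = p := by
  classical
  set f : ℕ → ℤ := fun p => ∑ w with ¬ L w ∧ ex w = p, (s w : ℤ) with hf
  have f1 : ∀ w, ¬ L w → f (ex w) = s w := fun w hw => by
    have : (Finset.univ.filter fun v => ¬ L v ∧ ex v = ex w) = {w} := by
      ext v
      simp only [Finset.mem_filter, Finset.mem_univ, true_and, Finset.mem_singleton]
      exact ⟨fun h => hinj v w h.1 hw h.2, fun h => by subst h; exact ⟨hw, rfl⟩⟩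
    simp only [hf]; rw [this, Finset.sum_singleton]
  have f2 : ∀ p, f p ≠ 0 → ∃ w, ¬ L w ∧ ex w = p := fun p hp => by
    obtain ⟨w, hw, -⟩ := Finset.exists_ne_zero_of_sum_ne_zero hp
    exact ⟨w, (Finset.mem_filter.1 hw).2⟩
  have f3 : ∀ p, f p = 0 ∨ f p = 1 ∨ f p = -1 := fun p => by
    by_cases hp : f p = 0
    · exact Or.inl hp
    · obtain ⟨w, hw, rfl⟩ := f2 p hp
      rw [f1 w hw]; cases s w <;> simp
  have f4 : ∀ p, f p ≠ 0 → f (p + 1) = 0 := fun p hp => by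
    by_contra hp'
    obtain ⟨w, hw, rfl⟩ := f2 p hp
    obtain ⟨v, hv, hvw⟩ := f2 _ hp'
    rw [← hvw, f1 v hv] at hp'
    rw [f1 w hw] at hp
    exact hc v w (fun h => hp' (by simp [h])) (fun h => hp (by simp [h])) hv hw hvw
  -- A crude common upper bound for all exponents.
  set m := ∑ w, (ex w + 1)
  have hm : ∀ w, ex w < m := fun w =>
    Nat.lt_of_succ_le (Finset.single_le_sum (f := fun w => ex w + 1) (fun _ _ => by omega)
      (Finset.mem_univ w))
  have f5 : ∀ p, m ≤ p → f p = 0 := fun p hp => by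
    by_contra h
    obtain ⟨w, -, rfl⟩ := f2 p h
    have := hm w; omega
  have f6 : ∑ p ∈ Finset.range m, f p * 2 ^ p = N := by
    have h : ((∑ p ∈ Finset.range m, f p * 2 ^ p : ℤ) : ℝ) = N := by
      rw [hN, ← Finset.sum_filter_add_sum_filter_not Finset.univ (fun v => ¬ L v)]
      rw [Finset.sum_eq_zero (s := Finset.univ.filter fun v => ¬ ¬ L v) (fun v hv => by
        rw [h0 v (not_not.1 (Finset.mem_filter.1 hv).2), mul_zero]), add_zero]
      rw [← Finset.sum_fiberwise_of_maps_to (t := Finset.range m) (g := ex)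
        (fun v _ => Finset.mem_range.2 (hm v))]
      push_cast
      refine Finset.sum_congr rfl fun p _ => ?_
      rw [hf, Finset.filter_filter]
      push_cast
      rw [Finset.sum_mul]
      refine Finset.sum_congr rfl fun w hw => ?_
      obtain ⟨hw1, hw2⟩ := (Finset.mem_filter.1 hw).2
      rw [h1 w hw1, hw2]
    exact_mod_cast h
  have f7 := naf_unique f5 f3 f4
  rw [f6] at f7
  exact ⟨fun w hw => by rw [f7, f1 w hw], fun p hp => f2 p (by rwa [f7] at hp)⟩

/-- Different values give different exponents, and compactness excludes exponents that differ by
one; so all signed sums in the circuit are non-adjacent forms. -/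
theorem IsNormal.exists_hasExp (hP : P.IsNormal) {N : ℤ} (hN : P.Represents N) :
    ∃ ex, P.HasExp ex N := by
  obtain ⟨hp, ⟨-, hv, -⟩, he, hm⟩ := hP
  obtain ⟨ex, hex⟩ := hp.exists_exponent
  have h0 : ∀ v, P.IsLeaf v → P.vertexValue v = 0 := fun v h => by rw [vertexValue_eq, if_pos h]
  have h1 : ∀ v, ¬ P.IsLeaf v → P.vertexValue v = 2 ^ ex v := fun v h => by
    rw [vertexValue_eq, if_neg h, hex v h, Real.rpow_natCast]
  have hinj : ∀ v w, ¬ P.IsLeaf v → ¬ P.IsLeaf w → ex v = ex w → v = w := fun v w a b c =>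
    hv v w (by rw [h1 v a, h1 w b, c])
  have hc : ∀ S, P.IsCompactOn S → ∀ v w, v ∈ S → w ∈ S → ¬ P.IsLeaf v → ¬ P.IsLeaf w →
      ex v ≠ ex w + 1 := fun S hS v w a b c d h => by
    have := hS v a w b (fun h' => by subst h'; omega) c d
    rw [hex v c, hex w d, h] at this
    push_cast at this
    rw [add_sub_cancel_left] at this
    norm_num at this
  have key : ∀ v, ¬ P.IsLeaf v → _ := fun v hv' =>
    naf_signedSum (s := P.edge v) (N := ex v) h0 h1 hinj (hc _ (he v))
      ((Int.cast_natCast _).trans (hex v hv').symm)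
  have key' := naf_signedSum (s := P.mark) (N := N) h0 h1 hinj (hc _ hm) (by rw [← hN.2]; rfl)
  exact ⟨ex, hinj, fun v w a b => (key v a).1 w b, fun v p a b => (key v a).2 p b, key'.1, key'.2⟩

open Classical in
/-- The exponents of the vertices of a circuit. -/
noncomputable def exps (P : Circuit) (ex : Fin P.n → ℕ) : Finset ℕ :=
  (Finset.univ.filter fun v => ¬ P.IsLeaf v).image ex

theorem mem_exps {ex : Fin P.n → ℕ} {p : ℕ} :
    p ∈ P.exps ex ↔ ∃ v, ¬ P.IsLeaf v ∧ ex v = p := by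
  simp [exps]

theorem HasExp.isNafClosed {ex : Fin P.n → ℕ} {N : ℤ} (h : P.HasExp ex N) :
    IsNafClosed (P.exps ex) := fun p hp q hq => by
  obtain ⟨v, hv, rfl⟩ := mem_exps.1 hp
  exact mem_exps.2 (h.exists_edge v q hv (mem_supp.1 hq))

theorem HasExp.supp_subset {ex : Fin P.n → ℕ} {N : ℤ} (h : P.HasExp ex N) :
    supp N ⊆ P.exps ex := fun p hp => mem_exps.2 (h.exists_mark p (mem_supp.1 hp))

/-- The leaf has no exponent. The strict inequality is used in `weight_add_le`, where it gains one
unit for each occurrence of a variable. -/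
theorem card_exps_lt (ex : Fin P.n → ℕ) : (P.exps ex).card < P.n := by
  classical
  obtain ⟨z, hz⟩ := P.exists_leaf
  refine Finset.card_image_le.trans_lt ?_
  conv_rhs => rw [← Fintype.card_fin P.n, ← Finset.card_univ]
  exact Finset.card_lt_card (Finset.filter_ssubset.2 ⟨z, Finset.mem_univ _, not_not.2 hz⟩)

theorem HasExp.card_supp_le {ex : Fin P.n → ℕ} {N : ℤ} (h : P.HasExp ex N) :
    (supp N).card ≤ P.numMarked := by
  classical
  refine (Finset.card_le_card (t := (Finset.univ.filter fun v => P.mark v ≠ 0).image ex)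
    fun p hp => ?_).trans Finset.card_image_le
  obtain ⟨w, hw, rfl⟩ := h.exists_mark p (mem_supp.1 hp)
  rw [mem_supp, h.mark w hw] at hp
  exact Finset.mem_image.2 ⟨w, Finset.mem_filter.2 ⟨Finset.mem_univ _, fun h => hp (by simp [h])⟩,
    rfl⟩

/-! ### The normal circuit with given exponents -/

/-- The circuit which consists of one vertex. -/
def trivialCircuit : Circuit where
  n := 1
  edge _ _ := 0
  mark _ := 1
  acyclic v h := by
    obtain ⟨_, h, _⟩ := Relation.TransGen.head'_iff.1 h
    exact h rfl
  exists_marked := ⟨0, by decide⟩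

theorem isLeaf_trivialCircuit (v) : trivialCircuit.IsLeaf v := fun _ h => h rfl

theorem vertexValue_trivialCircuit (v) : trivialCircuit.vertexValue v = 0 := by
  rw [vertexValue_eq, if_pos (isLeaf_trivialCircuit v)]

theorem isNormal_trivialCircuit : trivialCircuit.IsNormal :=
  ⟨fun v => ⟨0, by simp [vertexValue_trivialCircuit]⟩,
    ⟨⟨fun v => ⟨v, by simp [trivialCircuit], .refl⟩, Or.inl rfl, fun v z _ h => absurd rfl h⟩,
      fun v w _ => Subsingleton.elim (α := Fin 1) v w, fun v w _ h => absurd rfl h⟩,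
    fun v u hu => absurd rfl hu, fun u _ w _ h => absurd (Subsingleton.elim (α := Fin 1) u w) h⟩

theorem represents_trivialCircuit : trivialCircuit.Represents 0 :=
  ⟨isNormal_trivialCircuit.1, by simp [value, vertexValue_trivialCircuit]⟩

/-- The edge labels of the circuit with the exponents `g`; the vertex `0` is the leaf. -/
noncomputable def nafEdge {m : ℕ} (g : Fin m → ℕ) (v w : Fin (m + 1)) : SignType :=
  -- The exponent `0` has no digits, but a vertex without edges would be a leaf; so it receives an
  -- edge to the leaf, which contributes `0`.
  Fin.cases 0 (fun i => Fin.cases (if g i = 0 then 1 else 0)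
    (fun j => SignType.sign (naf (g i) (g j))) w) v

theorem sign_naf (N : ℤ) (p : ℕ) : ((SignType.sign (naf N p) : SignType) : ℤ) = naf N p := by
  rcases naf_cases N p with h | h | h <;> rw [h] <;> rfl

theorem sign_naf_ne {N : ℤ} {p : ℕ} : SignType.sign (naf N p) ≠ 0 ↔ naf N p ≠ 0 := by
  simp [sign_eq_zero_iff]

/-- The exponent of a vertex, increased by one, for comparison with the leaf. -/
def nafHeight {m : ℕ} (g : Fin m → ℕ) (v : Fin (m + 1)) : ℕ := Fin.cases 0 (fun i => g i + 1) v

theorem nafHeight_lt {m : ℕ} {g : Fin m → ℕ} {v w : Fin (m + 1)} (h : nafEdge g v w ≠ 0) :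
    nafHeight g w < nafHeight g v := by
  cases v using Fin.cases with
  | zero => exact absurd rfl h
  | succ i =>
    cases w using Fin.cases with
    | zero => exact Nat.succ_pos _
    | succ j =>
      exact Nat.succ_lt_succ (lt_of_mem_supp (mem_supp.2 (sign_naf_ne.1 h)))

/-- The circuit with the exponents `g` which represents `N`. -/
@[reducible] noncomputable def nafCircuit {m : ℕ} (g : Fin m → ℕ) (N : ℤ) (hN : ∃ i, naf N (g i) ≠ 0) : Circuit where
  n := m + 1
  edge := nafEdge g
  mark := Fin.cases 0 fun i => SignType.sign (naf N (g i))
  acyclic v h := by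
    have : ∀ w, Relation.TransGen (fun a b => nafEdge g a b ≠ 0) v w →
        nafHeight g w < nafHeight g v := fun w h => by
      induction h with
      | single h => exact nafHeight_lt h
      | tail _ h ih => exact (nafHeight_lt h).trans ih
    exact lt_irrefl _ (this v h)
  exists_marked := by
    obtain ⟨i, hi⟩ := hN
    exact ⟨i.succ, sign_naf_ne.2 hi⟩

section
variable {m : ℕ} {g : Fin m → ℕ} {N : ℤ} {hN : ∃ i, naf N (g i) ≠ 0}

theorem exists_naf_ne {N : ℤ} (h : N ≠ 0) : ∃ p, naf N p ≠ 0 := by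
  by_contra hne
  push Not at hne
  exact h (naf_ext fun p => by rw [hne p, naf_zero])

theorem isLeaf_nafCircuit_zero : (nafCircuit g N hN).IsLeaf (0 : Fin (m + 1)) :=
  fun _ h => h rfl

variable (hg : Function.Injective g) (hocc : ∀ p, Occurs N p ↔ ∃ i, g i = p)
include hocc

theorem isLeaf_nafCircuit_succ (i : Fin m) : ¬ (nafCircuit g N hN).IsLeaf i.succ := by
  intro h
  by_cases hi : g i = 0
  · refine h (0 : Fin (m + 1)) ?_
    change (if g i = 0 then (1 : SignType) else 0) ≠ 0
    simp [hi]
  · obtain ⟨p, hp⟩ := exists_naf_ne (N := g i) (by exact_mod_cast hi)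
    obtain ⟨j, rfl⟩ := (hocc p).1 (.edge ((hocc _).2 ⟨i, rfl⟩) hp)
    exact h j.succ (sign_naf_ne.2 hp)

include hg

theorem sum_naf_image (M : ℤ) (hM : ∀ p, naf M p ≠ 0 → Occurs N p) :
    ∑ i, naf M (g i) * 2 ^ g i = M := by
  classical
  rw [← Finset.sum_image (s := Finset.univ) (g := g) (f := fun p => naf M p * 2 ^ p) hg.injOn]
  refine sum_supp M fun p hp => ?_
  obtain ⟨i, rfl⟩ := (hocc p).1 (hM p (mem_supp.1 hp))
  exact Finset.mem_image_of_mem _ (Finset.mem_univ i)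

theorem exponent_nafCircuit_of {i : Fin m}
    (h : ∀ j, naf (g i) (g j) ≠ 0 → (nafCircuit g N hN).vertexValue j.succ = 2 ^ g j) :
    (nafCircuit g N hN).exponent i.succ = g i := by
  have h0 : (nafCircuit g N hN).vertexValue (0 : Fin (m + 1)) = 0 :=
    (vertexValue_eq _ _).trans (if_pos isLeaf_nafCircuit_zero)
  refine (Fin.sum_univ_succ _).trans ?_
  rw [h0, mul_zero, zero_add]
  have := sum_naf_image hg hocc (g i) fun p hp => .edge ((hocc _).2 ⟨i, rfl⟩) hp
  have h2 : ((∑ j, naf (g i) (g j) * 2 ^ g j : ℤ) : ℝ) = ((g i : ℤ) : ℝ) := by rw [this]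
  rw [← Int.cast_natCast, ← h2]
  push_cast
  refine Finset.sum_congr rfl fun j _ => ?_
  have e : (((nafCircuit g N hN).edge i.succ j.succ : SignType) : ℝ) = (naf (g i) (g j) : ℤ) := by
    rw [← sign_naf]
    change ((SignType.sign (naf (g i) (g j)) : SignType) : ℝ) = _
    cases SignType.sign (naf (g i) (g j)) <;> simp
  rw [e]
  by_cases hj : naf (g i) (g j) = 0
  · simp [hj]
  · rw [h j hj]

/-- Induction on the exponent: the digits of `g i` sit at smaller exponents, all of which are
vertices since they occur as well. -/
theorem vertexValue_nafCircuit (i : Fin m) :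
    (nafCircuit g N hN).vertexValue i.succ = 2 ^ g i := by
  induction hq : g i using Nat.strong_induction_on generalizing i with
  | _ q ih =>
    subst hq
    rw [vertexValue_eq, if_neg (isLeaf_nafCircuit_succ hocc i),
      exponent_nafCircuit_of hg hocc fun j hj =>
        ih _ (lt_of_mem_supp (mem_supp.2 hj)) j rfl, Real.rpow_natCast]

theorem exponent_nafCircuit (i : Fin m) : (nafCircuit g N hN).exponent i.succ = g i :=
  exponent_nafCircuit_of hg hocc fun j _ => vertexValue_nafCircuit hg hocc j

theorem isCompactOn_nafCircuit {S : Set (Fin (m + 1))} {M : ℤ}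
    (h : ∀ i : Fin m, i.succ ∈ S → naf M (g i) ≠ 0) : (nafCircuit g N hN).IsCompactOn S := by
  intro u hu w hw huw hu' hw'
  cases u using Fin.cases with
  | zero => exact absurd isLeaf_nafCircuit_zero hu'
  | succ i =>
    cases w using Fin.cases with
    | zero => exact absurd isLeaf_nafCircuit_zero hw'
    | succ j =>
      rw [exponent_nafCircuit hg hocc, exponent_nafCircuit hg hocc]
      have h1 : g i ≠ g j := fun h => huw (by rw [hg h])
      have h2 : g i ≠ g j + 1 := fun h' => h i hu (by rw [h']; exact naf_succ_eq_zero (h j hw))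
      have h3 : g j ≠ g i + 1 := fun h' => h j hw (by rw [h']; exact naf_succ_eq_zero (h i hu))
      have h4 : (2 : ℤ) ≤ |(g i : ℤ) - g j| := by rw [le_abs]; omega
      exact_mod_cast h4

theorem represents_nafCircuit : (nafCircuit g N hN).Represents N := by
  have h0 : (nafCircuit g N hN).vertexValue (0 : Fin (m + 1)) = 0 :=
    (vertexValue_eq _ _).trans (if_pos isLeaf_nafCircuit_zero)
  refine ⟨fun v => ?_, ?_⟩
  · cases v using Fin.cases with
    | zero => exact ⟨0, by simpa using h0⟩
    | succ i => exact ⟨2 ^ g i, by rw [vertexValue_nafCircuit hg hocc]; push_cast; rfl⟩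
  · refine (Fin.sum_univ_succ _).trans ?_
    rw [h0, mul_zero, zero_add]
    have h2 : ((∑ j, naf N (g j) * 2 ^ g j : ℤ) : ℝ) = N := by
      rw [sum_naf_image hg hocc N fun p hp => .mark hp]
    rw [← h2]
    push_cast
    refine Finset.sum_congr rfl fun j _ => ?_
    rw [vertexValue_nafCircuit hg hocc]
    congr 1
    rw [← sign_naf]
    change ((SignType.sign (naf N (g j)) : SignType) : ℝ) = _
    cases SignType.sign (naf N (g j)) <;> simp

theorem isNormal_nafCircuit : (nafCircuit g N hN).IsNormal := by
  have h0 : (nafCircuit g N hN).vertexValue (0 : Fin (m + 1)) = 0 :=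
    (vertexValue_eq _ _).trans (if_pos isLeaf_nafCircuit_zero)
  have reach : ∀ p, Occurs N p → ∀ i, g i = p → ∃ u, (nafCircuit g N hN).mark u ≠ 0 ∧
      Relation.ReflTransGen (nafCircuit g N hN).Adj u i.succ := by
    intro p hp
    induction hp with
    | mark h => exact fun i hi => ⟨i.succ, sign_naf_ne.2 (by rwa [hi]), .refl⟩
    | edge hq h ih =>
      intro i hi
      obtain ⟨j, hj⟩ := (hocc _).1 hq
      obtain ⟨u, hu, hp⟩ := ih j hj
      exact ⟨u, hu, hp.tail (sign_naf_ne.2 (by rwa [hj, hi]))⟩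
  -- The least exponent that occurs is `0`, because the exponents of its digits would be smaller and
  -- occur too. Through its vertex the leaf is reachable.
  have hmin : Occurs N 0 := by
    have h1 : ∃ p, Occurs N p := let ⟨i, hi⟩ := hN; ⟨_, .mark hi⟩
    classical
    by_cases hz : Nat.find h1 = 0
    · have := Nat.find_spec h1
      rwa [hz] at this
    · obtain ⟨p, hp⟩ := exists_naf_ne (N := (Nat.find h1 : ℕ)) (by exact_mod_cast hz)
      exact absurd (.edge (Nat.find_spec h1) hp)
        (Nat.find_min h1 (lt_of_mem_supp (mem_supp.2 hp)))
  have leaf : ∀ {z : Fin (m + 1)}, (nafCircuit g N hN).IsLeaf z → z = 0 := fun {z} hz => by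
    cases z using Fin.cases with
    | zero => rfl
    | succ i => exact absurd hz (isLeaf_nafCircuit_succ hocc i)
  have inj : ∀ {i j : Fin m}, (nafCircuit g N hN).vertexValue i.succ =
      (nafCircuit g N hN).vertexValue j.succ → i = j := fun {i j} h => by
    rw [vertexValue_nafCircuit hg hocc, vertexValue_nafCircuit hg hocc] at h
    exact hg (Nat.pow_right_injective le_rfl (by exact_mod_cast h))
  refine ⟨(represents_nafCircuit hg hocc).1, ⟨⟨fun v => ?_, Or.inr ⟨(0 : Fin (m + 1)),
    isLeaf_nafCircuit_zero, rfl, fun _ => leaf⟩, fun v z hz hvz w hvw => ?_⟩, fun v w h => ?_,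
    fun v v₁ v₂ h1 h2 h => ?_⟩, fun v => ?_, ?_⟩
  · cases v using Fin.cases with
    | zero =>
      obtain ⟨i, hi⟩ := (hocc 0).1 hmin
      obtain ⟨u, hu, hp⟩ := reach 0 hmin i hi
      refine ⟨u, hu, hp.tail ?_⟩
      change (if g i = 0 then (1 : SignType) else 0) ≠ 0
      simp [hi]
    | succ i => exact reach _ ((hocc _).2 ⟨i, rfl⟩) i rfl
  · obtain rfl := leaf hz
    cases v using Fin.cases with
    | zero => exact absurd rfl hvz
    | succ i =>
      cases w using Fin.cases with
      | zero => rfl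
      | succ j =>
        have hi : g i = 0 := by
          by_contra h
          exact hvz (if_neg h)
        have := sign_naf_ne.1 hvw
        rw [hi] at this
        simp at this
  · cases v using Fin.cases with
    | zero =>
      cases w using Fin.cases with
      | zero => rfl
      | succ j =>
        rw [h0, vertexValue_nafCircuit hg hocc] at h
        exact absurd h (by positivity)
    | succ i =>
      cases w using Fin.cases with
      | zero =>
        rw [h0, vertexValue_nafCircuit hg hocc] at h
        exact absurd h (by positivity)
      | succ j => rw [inj h]
  · have hs : ∀ a : SignType, a ≠ 0 → a ≠ -a := by decide
    have hne : v₁ ≠ v₂ := fun h' => hs _ h2 (by rwa [h'] at h)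
    cases v using Fin.cases with
    | zero => exact absurd rfl h1
    | succ i =>
      cases v₁ using Fin.cases with
      | zero =>
        cases v₂ using Fin.cases with
        | zero => exact absurd rfl hne
        | succ j =>
          rw [h0, vertexValue_nafCircuit hg hocc]
          exact ⟨by positivity, by positivity⟩
      | succ j =>
        cases v₂ using Fin.cases with
        | zero =>
          rw [h0, vertexValue_nafCircuit hg hocc]
          exact ⟨by positivity, by simp⟩
        | succ l =>
          refine ⟨fun h => hne (by rw [inj h]), fun h => ?_⟩
          rw [vertexValue_nafCircuit hg hocc, vertexValue_nafCircuit hg hocc, ← pow_succ'] at h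
          -- One value being twice the other means that the exponents are adjacent, which is
          -- impossible for two nonzero digits.
          have : g j = g l + 1 := Nat.pow_right_injective le_rfl (by exact_mod_cast h)
          refine sign_naf_ne.1 h1 ?_
          rw [this]
          exact naf_succ_eq_zero (sign_naf_ne.1 h2)
  · cases v using Fin.cases with
    | zero => exact fun u hu => absurd rfl hu
    | succ i => exact isCompactOn_nafCircuit hg hocc (M := g i) fun j hj => sign_naf_ne.1 hj
  · exact isCompactOn_nafCircuit hg hocc (M := N) fun j hj => sign_naf_ne.1 hj

omit hocc in
theorem numMarked_nafCircuit : (nafCircuit g N hN).numMarked ≤ (supp N).card := by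
  classical
  refine Finset.card_le_card_of_injOn (fun v : Fin (m + 1) => Fin.cases 0 g v) (fun v hv => ?_) ?_
  · have hv := (Finset.mem_filter.1 (Finset.mem_coe.1 hv)).2
    cases v using Fin.cases with
    | zero => exact absurd rfl hv
    | succ i => exact mem_supp.2 (sign_naf_ne.1 hv)
  · intro v hv w hw h
    have hv := (Finset.mem_filter.1 (Finset.mem_coe.1 hv)).2
    have hw := (Finset.mem_filter.1 (Finset.mem_coe.1 hw)).2
    cases v using Fin.cases with
    | zero => exact absurd rfl hv
    | succ i =>
      cases w using Fin.cases with
      | zero => exact absurd rfl hw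
      | succ j => exact congrArg Fin.succ (hg h)

end

end Circuit

/-! ### A pool of exponents on the machine -/

/-- The parameters of a computation: the dimension `N` of the matrices, the number `K` below which
carries stop, the number `L` of symbols, and the set `G` of the exponents that may be used. -/
structure Ctx where
  N : ℕ
  K : ℕ
  L : ℕ
  G : Finset ℕ
  card_lt : G.card < N
  le_N : 16 ≤ N
  K_lt : K < N
  L_lt : L < N
  mem_G : ∀ p ≤ K, p ∈ G
  carry : ∀ p ∈ G, incCarry p K = 0

def Ctx.dims (C : Ctx) : Dims := ⟨C.N, C.N, C.L⟩

/-- A numbering of `n` exponents, `x i` being the exponent with the number `i` and `o r` the number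
of the exponent of rank `r`. -/
structure Pl where
  n : ℕ
  x : ℕ → ℕ
  o : ℕ → ℕ

/-- `v` is the vector of the digits of `z` at the exponents of the pool, and all nonzero digits of
`z` occur. -/
structure Pl.Vec (P : Pl) (N : ℕ) (v : ℕ → ℤ) (z : ℤ) : Prop where
  mem : ∀ p, naf z p ≠ 0 → ∃ i < P.n, P.x i = p
  dig : ∀ i < P.n, v i = naf z (P.x i)
  zero : ∀ i, P.n ≤ i → i < N → v i = 0

structure Pl.Valid (P : Pl) (G : Finset ℕ) : Prop where
  inj : ∀ i < P.n, ∀ j < P.n, P.x i = P.x j → i = j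
  mem : ∀ i < P.n, P.x i ∈ G
  olt : ∀ r < P.n, P.o r < P.n
  srt : ∀ r s, r < s → s < P.n → P.x (P.o r) < P.x (P.o s)

/-- The first `J` exponents are `0, …, J - 1`. -/
def Pl.Base (P : Pl) (J : ℕ) : Prop := J ≤ P.n ∧ ∀ i < J, P.x i = i

/-- Insertion of a new exponent `u` at the rank `q`. -/
def Pl.ins (P : Pl) (q u : ℕ) : Pl where
  n := P.n + 1
  x := Function.update P.x P.n u
  o r := if r < q then P.o r else if r = q then P.n else P.o (r - 1)

/-- One pool extends another one. -/
def Pl.Le (P P' : Pl) : Prop := P.n ≤ P'.n ∧ ∀ i < P.n, P'.x i = P.x i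

namespace Pl

variable {P P' P'' : Pl} {G : Finset ℕ} {N : ℕ} {v : ℕ → ℤ} {z : ℤ}

theorem Le.refl (P : Pl) : P.Le P := ⟨le_rfl, fun _ _ => rfl⟩

theorem Le.trans (h : P.Le P') (h' : P'.Le P'') : P.Le P'' :=
  ⟨h.1.trans h'.1, fun i hi => (h'.2 i (hi.trans_le h.1)).trans (h.2 i hi)⟩

theorem Base.mono {J : ℕ} (h : P.Base J) (hP : P.Le P') : P'.Base J :=
  ⟨h.1.trans hP.1, fun i hi => (hP.2 i (hi.trans_le h.1)).trans (h.2 i hi)⟩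

theorem Valid.card_le (h : P.Valid G) : P.n ≤ G.card := by
  have : ((Finset.range P.n).image P.x).card = P.n := by
    rw [Finset.card_image_of_injOn, Finset.card_range]
    intro i hi j hj hij
    exact h.inj i (Finset.mem_range.1 hi) j (Finset.mem_range.1 hj) hij
  rw [← this]
  refine Finset.card_le_card fun p hp => ?_
  obtain ⟨i, hi, rfl⟩ := Finset.mem_image.1 hp
  exact h.mem i (Finset.mem_range.1 hi)

/-- Being sorted makes `o` injective on the ranks, hence bijective by finiteness. -/
theorem Valid.exists_rank (h : P.Valid G) {i : ℕ} (hi : i < P.n) : ∃ r < P.n, P.o r = i := by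
  have hinj : Function.Injective fun r : Fin P.n => (⟨P.o r, h.olt r r.2⟩ : Fin P.n) := by
    intro r s hrs
    have hrs : P.o r = P.o s := congrArg Fin.val hrs
    rcases lt_trichotomy (r : ℕ) s with h' | h' | h'
    · have := h.srt r s h' s.2; rw [hrs] at this; omega
    · exact Fin.ext h'
    · have := h.srt s r h' r.2; rw [hrs] at this; omega
  obtain ⟨r, hr⟩ := Finite.surjective_of_injective hinj ⟨i, hi⟩
  exact ⟨r, r.2, congrArg Fin.val hr⟩

theorem Valid.rank_lt (h : P.Valid G) {r s : ℕ} (hr : r < P.n)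
    (hx : P.x (P.o r) < P.x (P.o s)) : r < s := by
  by_contra h'
  rcases (not_lt.1 h').lt_or_eq with h' | h'
  · have := h.srt s r h' hr; omega
  · subst h'; omega

/-- Vectors need no update when the pool grows: all nonzero digits were already listed, so a new
exponent has digit `0`, and the entries beyond the old pool are stored as `0`. -/
theorem Vec.mono (h : P.Vec N v z) (hP : P.Le P') (hv : P'.Valid G) (hN : P'.n ≤ N) :
    P'.Vec N v z where
  mem p hp := by
    obtain ⟨i, hi, rfl⟩ := h.mem p hp
    exact ⟨i, hi.trans_le hP.1, hP.2 i hi⟩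
  dig i hi := by
    by_cases hin : i < P.n
    · rw [h.dig i hin, hP.2 i hin]
    · rw [h.zero i (by omega) (by omega)]
      by_contra hne
      obtain ⟨j, hj, hij⟩ := h.mem _ (Ne.symm hne)
      rw [← hP.2 j hj] at hij
      have := hv.inj j (hj.trans_le hP.1) i hi hij
      omega
  zero i hi hiN := h.zero i (hP.1.trans hi) hiN

theorem Vec.congr {v' : ℕ → ℤ} (h : P.Vec N v z) (hv : ∀ i < N, v' i = v i) (hN : P.n ≤ N) :
    P.Vec N v' z :=
  ⟨h.mem, fun i hi => (hv i (by omega)).trans (h.dig i hi),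
    fun i hi hi' => (hv i hi').trans (h.zero i hi hi')⟩

theorem vec_zero (hv : ∀ i < N, v i = 0) (hN : P.n ≤ N) : P.Vec N v 0 :=
  ⟨fun p hp => absurd (naf_zero p) hp, fun i hi => by rw [hv i (by omega), naf_zero],
    fun i _ hi => hv i hi⟩

theorem Vec.naf_eq_zero (h : P.Vec N v z) {p : ℕ} (hp : ∀ i < P.n, P.x i ≠ p) : naf z p = 0 := by
  by_contra hne
  obtain ⟨i, hi, h'⟩ := h.mem p hne
  exact hp i hi h'

theorem Vec.lt_of_ne (h : P.Vec N v z) {i : ℕ} (hi : i < N) (hv : v i ≠ 0) : i < P.n := by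
  by_contra hin
  exact hv (h.zero i (by omega) hi)

theorem Vec.ext {v' : ℕ → ℤ} {z' : ℤ} (h : P.Vec N v z) (h' : P.Vec N v' z')
    (hv : ∀ i < P.n, v i = v' i) : z = z' := by
  refine naf_ext fun p => ?_
  by_cases hp : ∃ i < P.n, P.x i = p
  · obtain ⟨i, hi, rfl⟩ := hp
    rw [← h.dig i hi, hv i hi, h'.dig i hi]
  · push Not at hp
    rw [h.naf_eq_zero hp, h'.naf_eq_zero hp]

theorem le_ins (q u : ℕ) : P.Le (P.ins q u) :=
  ⟨Nat.le_succ _, fun _ hi => Function.update_of_ne hi.ne _ _⟩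

theorem Valid.ins (h : P.Valid G) {q u : ℕ} (hu : u ∈ G) (hq : q ≤ P.n)
    (h1 : ∀ r < q, P.x (P.o r) < u) (h2 : ∀ r, q ≤ r → r < P.n → u < P.x (P.o r)) :
    (P.ins q u).Valid G := by
  have hn : ∀ i < P.n, P.x i ≠ u := fun i hi hiu => by
    obtain ⟨r, hr, rfl⟩ := h.exists_rank hi
    rcases lt_or_ge r q with hrq | hrq
    · have := h1 r hrq; omega
    · have := h2 r hrq hr; omega
  have hx : ∀ i < P.n, (P.ins q u).x i = P.x i := (le_ins q u).2
  have hx' : (P.ins q u).x P.n = u := Function.update_self _ _ _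
  have hlt : ∀ i, i < (P.ins q u).n ↔ i < P.n ∨ i = P.n := fun i => by
    simp only [Pl.ins]; omega
  constructor
  · intro i hi j hj hij
    rcases (hlt i).1 hi with hi | rfl <;> rcases (hlt j).1 hj with hj | rfl
    · rw [hx i hi, hx j hj] at hij; exact h.inj i hi j hj hij
    · rw [hx i hi, hx'] at hij; exact absurd hij (hn i hi)
    · rw [hx j hj, hx'] at hij; exact absurd hij.symm (hn j hj)
    · rfl
  · intro j hj
    rcases (hlt j).1 hj with hj | rfl
    · rw [hx j hj]; exact h.mem j hj
    · rw [hx']; exact hu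
  · intro r hr
    have hr : r < P.n + 1 := hr
    rw [hlt]
    simp only [Pl.ins]
    split_ifs with a b
    · exact Or.inl (h.olt r (by omega))
    · exact Or.inr rfl
    · exact Or.inl (h.olt _ (by omega))
  · intro r s hrs hs
    have hs : s < P.n + 1 := hs
    have key : ∀ r, r < P.n + 1 → (P.ins q u).x ((P.ins q u).o r) =
        if r < q then P.x (P.o r) else if r = q then u else P.x (P.o (r - 1)) := fun r hr => by
      by_cases a : r < q
      · rw [if_pos a, show (P.ins q u).o r = P.o r from if_pos a, hx _ (h.olt r (by omega))]
      · rw [if_neg a]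
        by_cases b : r = q
        · rw [if_pos b, show (P.ins q u).o r = P.n from (if_neg a).trans (if_pos b), hx']
        · rw [if_neg b, show (P.ins q u).o r = P.o (r - 1) from (if_neg a).trans (if_neg b),
            hx _ (h.olt _ (by omega))]
    rw [key r (by omega), key s hs]
    split_ifs with a b c d e f
    all_goals first
      | omega
      | exact h.srt _ _ (by omega) (by omega)
      | exact h1 _ (by omega)
      | exact h2 _ (by omega) (by omega)

end Pl

/-- The state `σ` holds the pool `P`: the rows of the matrix `E` are the digits of the exponents, and
there are tables for `dig` and for the division by two. -/
structure Pool (C : Ctx) (P : Pl) (σ : St) : Prop where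
  N : σ.v .N = C.N
  n : σ.v .n = P.n
  valid : P.Valid C.G
  row : ∀ i < P.n, P.Vec C.N (σ.a .E i) (P.x i)
  ord : ∀ r < P.n, σ.a .ord 0 r = P.o r
  tab : ∀ k : ℕ, k ≤ 14 → σ.a .tab 0 k = dig (k - 7)
  hlf : σ.a .hlf 0 0 = -1 ∧ σ.a .hlf 0 2 = 0 ∧ σ.a .hlf 0 4 = 1

/-- The command `c` does not change the pool. -/
def Cmd.keeps (c : Cmd) : Bool :=
  !c.wv .N && !c.wv .n && !c.wa .E && !c.wa .ord && !c.wa .tab && !c.wa .hlf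

section
variable {C : Ctx} {P : Pl} {σ τ : St}

theorem Pool.frame (h : Pool C P σ) {c : Cmd} (f : c.Frame σ τ) (hc : c.keeps = true := by rfl) :
    Pool C P τ := by
  simp only [Cmd.keeps, Bool.and_eq_true, Bool.not_eq_true'] at hc
  obtain ⟨⟨⟨⟨⟨h1, h2⟩, h3⟩, h4⟩, h5⟩, h6⟩ := hc
  exact ⟨(f.v _ h1).trans h.N, (f.v _ h2).trans h.n, h.valid, by rw [f.a _ h3]; exact h.row,
    by rw [f.a _ h4]; exact h.ord, by rw [f.a _ h5]; exact h.tab, by rw [f.a _ h6]; exact h.hlf⟩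

theorem Pool.setv (h : Pool C P σ) (x : Var) (z : ℤ)
    (hx : (decide (x = .N) || decide (x = .n)) = false := by rfl) : Pool C P (σ.setv x z) := by
  simp only [Bool.or_eq_false_iff, decide_eq_false_iff_not] at hx
  exact ⟨by simp [Ne.symm hx.1, h.N], by simp [Ne.symm hx.2, h.n], h.valid, h.row, h.ord, h.tab, h.hlf⟩

theorem Pool.seta (h : Pool C P σ) (b : Arr) (i j : ℕ) (z : ℤ)
    (hb : (decide (b = .E) || decide (b = .ord) || decide (b = .tab) || decide (b = .hlf)) = false :=
      by rfl) : Pool C P (σ.seta b i j z) := by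
  simp only [Bool.or_eq_false_iff, decide_eq_false_iff_not] at hb
  obtain ⟨⟨⟨h1, h2⟩, h3⟩, h4⟩ := hb
  exact ⟨h.N, h.n, h.valid, by simpa [St.a_seta_ne, Ne.symm h1] using h.row,
    by simpa [Ne.symm h2] using h.ord, by simpa [Ne.symm h3] using h.tab,
    by simpa [Ne.symm h4] using h.hlf⟩

theorem Pool.n_lt (h : Pool C P σ) : P.n < C.N := h.valid.card_le.trans_lt C.card_lt

theorem Pool.vec_mono (h : Pool C P τ) {P' : Pl} {v : ℕ → ℤ} {z : ℤ} (hv : P'.Vec C.N v z)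
    (hP : P'.Le P) : P.Vec C.N v z :=
  hv.mono hP h.valid h.n_lt.le

@[simp] theorem Ctx.dims_lay : C.dims.lay = C.N := rfl

end

/-! ### Successors, insertion, comparison and search in the pool -/

namespace Cmd

def block : List Cmd → Cmd
  | [] => skip
  | [c] => c
  | c :: d :: l => seq c (block (d :: l))

@[simp] theorem wp_block_single {D : Dims} {c : Cmd} {σ : St} {Q : St → Prop} :
    (block [c]).wp D σ Q ↔ c.wp D σ Q := Iff.rfl
@[simp] theorem wp_block_cons {D : Dims} {c d : Cmd} {l : List Cmd} {σ : St} {Q : St → Prop} :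
    (block (c :: d :: l)).wp D σ Q ↔ c.wp D σ fun τ => (block (d :: l)).wp D τ Q := Iff.rfl

/-- Computes the digits of the successor of the exponent `i`. -/
def inc : Cmd :=
  block [asg .c (.num 1), loop false .p .N <| ifp (.var .c)
    (block [asg .d (.get .tab (.num 0) (.var .c + .get .E (.var .i) (.var .p) +
        .get .E (.var .i) (.var .p + (.num 1)) + .get .E (.var .i) (.var .p + (.num 1)) + (.num 7))),
      put .U (.num 0) (.var .p) (.var .d),
      ifp (.var .c + .get .E (.var .i) (.var .p) - .var .d) (asg .c (.num 1)) (asg .c (.num 0))])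
    (put .U (.num 0) (.var .p) (.get .E (.var .i) (.var .p)))]

/-- Compares the vector `U` with the digits of the exponent `j`. -/
def eqU : Cmd :=
  block [asg .fl (.num 1), loop false .p .N <|
    ifz (.get .U (.num 0) (.var .p) - .get .E (.var .j) (.var .p)) skip (asg .fl (.num 0))]

/-- Inserts the exponent with the digits `U` at the rank `q`. -/
def ins : Cmd :=
  block [asg .w (.var .n), loop false .k .N <| ifp (.var .q - .var .k) skip
      (block [asg .t (.get .ord (.num 0) (.var .k)), put .ord (.num 0) (.var .k) (.var .w), asg .w (.var .t)]),
    loop false .p .N <| put .E (.var .n) (.var .p) (.get .U (.num 0) (.var .p)),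
    asg .n (.var .n + (.num 1))]

/-- Compares the exponent `i` with the number with the digits `U`. -/
def cmp : Cmd :=
  block [asg .s (.num 0), loop false .g .N <| ifp (.var .n - .var .g)
    (block [asg .h (.get .ord (.num 0) (.var .g)),
      asg .d (.get .E (.var .i) (.var .h) - .get .U (.num 0) (.var .h)),
      ifz (.var .d) skip (asg .s (.var .d))]) skip]

/-- Finds the number of the exponent with the digits `U`; it is added to the pool if it is new. -/
def find : Cmd :=
  block [asg .fnd (.num 0), asg .pos (.num 0), loop false .r .N <| ifp (.var .n - .var .r)
      (block [asg .i (.get .ord (.num 0) (.var .r)), cmp,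
        ifz (.var .s) (block [asg .z (.var .i), asg .fnd (.num 1)])
          (ifp (.var .s) skip (asg .pos (.var .r + (.num 1))))]) skip,
    ifz (.var .fnd) (block [asg .z (.var .n), asg .q (.var .pos), ins]) skip]

section
variable {C : Ctx} {P : Pl} {σ : St}

/-- Column `p < J` belongs to the exponent `p`, so the low digits can be treated in their natural
order; from `J` on the carry is dead and the row is copied. The look-ahead at `J - 1` reads column
`J`, which need not belong to the exponent `J` while the pool is being set up; hence the separate
hypothesis `hE`. -/
theorem wp_inc (hP : Pool C P σ) {i : ℕ} (hi : i < P.n) (hi' : σ.v .i = i) {J : ℕ} (hJ : P.Base J)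
    (hE : σ.a .E i J = naf (P.x i) J) (hc : incCarry (P.x i) J = 0) :
    inc.wp C.dims σ fun τ => P.Vec C.N (τ.a .U 0) ((P.x i + 1 : ℕ) : ℤ) := by
  have hn := hP.n_lt
  have hlow : ∀ j < J, σ.a .E i j = naf (P.x i) j := fun j hj => by
    rw [(hP.row i hi).dig j (by have := hJ.1; omega), hJ.2 j hj]
  have hJn := hJ.1
  rw [inc, wp_block_cons, wp_asg, wp_block_single]
  refine ⟨trivial, ?_⟩
  refine wp_loop (fun k τ => τ.v .c = (if k ≤ J then incCarry (P.x i) k else 0) ∧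
    ∀ j < k, τ.a .U 0 j = if j < J then naf (P.x i + 1) j else σ.a .E i j) C.N
    (by simpa using hP.N) le_rfl (by simp) ?_ ?_
  · intro k hk τ hkτ f ⟨h1, h2⟩
    have e1 : τ.a .E = σ.a .E := f.a _ rfl
    have e2 : τ.a .tab = σ.a .tab := f.a _ rfl
    have e3 : τ.v .i = i := (f.v .i rfl).trans (by simpa using hi')
    have c1 := incCarry_cases (P.x i) k
    rw [wp_ifp]
    refine ⟨trivial, fun hpos => ?_, fun hneg => ?_⟩
    · have hkJ : k < J := by
        by_contra hkJ
        simp only [Ex.eval_var, h1] at hpos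
        split_ifs at hpos with h
        · rw [show k = J by omega, hc] at hpos; omega
        · omega
      have hcv : τ.v .c = incCarry (P.x i) k := by rw [h1, if_pos hkJ.le]
      have hc1 : incCarry (P.x i) k = 1 := by
        simp only [Ex.eval_var, hcv] at hpos; omega
      rw [hc1] at hcv
      have hd := naf_inc (P.x i) k
      have hs := incCarry_succ (P.x i) k
      rw [hc1] at hd hs
      have hk1 : σ.a .E i (k + 1) = naf (P.x i) (k + 1) := by
        rcases (show k + 1 < J ∨ k + 1 = J by omega) with h | h
        · exact hlow _ h
        · rw [h, hE]
      have n1 := naf_cases (P.x i) k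
      have n2 := naf_cases (P.x i) (k + 1)
      have hnk : (((k : ℤ) + 1).toNat) = k + 1 := by omega
      -- The table of `dig` is shifted by `7`, so that its index is not negative.
      obtain ⟨m, hm, hm'⟩ : ∃ m : ℕ, m ≤ 14 ∧
          (m : ℤ) = 1 + naf (P.x i) k + naf (P.x i) (k + 1) + naf (P.x i) (k + 1) + 7 :=
        ⟨(1 + naf (P.x i) k + naf (P.x i) (k + 1) + naf (P.x i) (k + 1) + 7).toNat,
          by omega, by omega⟩
      have ht := hP.tab m hm
      have hdm : dig ((m : ℤ) - 7) = naf (P.x i + 1) k := by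
        rw [hd, hm']; congr 1; ring
      have hC := C.le_N
      simp [e1, e2, e3, hkτ, hcv, hnk, hlow k hkJ, hk1, ← hm', ht, hdm]
      have hs2 := incCarry_cases (P.x i) (k + 1)
      refine ⟨by omega, by omega, by omega, fun h => ?_, fun h => ?_⟩
      all_goals
        refine ⟨by grind, fun j hj => ?_⟩
        rcases (show j < k ∨ j = k by omega) with h' | rfl
        · rw [if_neg (by omega), h2 j h']
        · simp [hkJ]
    · have hc0 : τ.v .c = 0 := by
        simp only [Ex.eval_var, h1] at hneg ⊢
        split_ifs at hneg ⊢ with h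
        · omega
        · rfl
      have hk0 : k ≤ J → incCarry (P.x i) k = 0 := fun h => by rwa [h1, if_pos h] at hc0
      simp [e1, e3, hkτ, hc0]
      have hC := C.le_N
      refine ⟨by omega, by omega, ?_, fun j hj => ?_⟩
      · exact fun h => (incCarry_eq_zero_of_le (hk0 (by omega)) (by omega)).symm
      · rcases (show j < k ∨ j = k by omega) with h' | rfl
        · rw [if_neg (by omega), h2 j h']
        · rw [if_pos rfl]
          split_ifs with h
          · rw [hlow _ h, naf_inc_of_carry (hk0 h.le)]
          · rfl
  · intro τ f hI
    have h2 := hI.2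
    -- The exponents below `J` have their own values as numbers, so later numbers belong to
    -- exponents at least `J`, where no digit changes.
    have hbase : ∀ j < P.n, J ≤ j → J ≤ P.x j := fun j hj hJj => by
      by_contra hlt
      have := hP.valid.inj (P.x j) (by omega) j hj (hJ.2 _ (by omega))
      omega
    have hhigh : ∀ p, J ≤ p → naf (P.x i + 1) p = naf (P.x i) p := fun p hp =>
      naf_inc_of_carry (incCarry_eq_zero_of_le hc hp)
    refine ⟨fun p hp => ?_, fun j hj => ?_, fun j hj hj' => ?_⟩
    · push_cast at hp
      rcases lt_or_ge p J with h | h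
      · exact ⟨p, by omega, hJ.2 p h⟩
      · rw [hhigh p h] at hp
        exact (hP.row i hi).mem p hp
    · push_cast
      rw [h2 j (by omega)]
      split_ifs with h
      · rw [hJ.2 j h]
      · rw [(hP.row i hi).dig j hj, hhigh _ (hbase j hj (by omega))]
    · rw [h2 j hj', if_neg (by omega)]
      exact (hP.row i hi).zero j hj hj'

theorem wp_eqU (hP : Pool C P σ) {j : ℕ} (hj : j < P.n) (hj' : σ.v .j = j) {z : ℤ}
    (hU : P.Vec C.N (σ.a .U 0) z) :
    eqU.wp C.dims σ fun τ => τ.v .fl = if (P.x j : ℤ) = z then 1 else 0 := by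
  have hn := hP.n_lt
  rw [eqU, wp_block_cons, wp_asg, wp_block_single]
  refine ⟨trivial, ?_⟩
  refine wp_loop (fun k τ => (τ.v .fl = 1 ∨ τ.v .fl = 0) ∧
    (τ.v .fl = 1 ↔ ∀ p < k, σ.a .U 0 p = σ.a .E j p)) C.N
    (by simpa using hP.N) le_rfl (by simp) ?_ ?_
  · intro k hk τ hkτ f ⟨h1, h2⟩
    have e1 : τ.a .E = σ.a .E := f.a _ rfl
    have e2 : τ.a .U = σ.a .U := f.a _ rfl
    have e3 : τ.v .j = j := (f.v .j rfl).trans (by simpa using hj')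
    have hC := C.le_N
    simp [e1, e2, e3, hkτ]
    refine ⟨by omega, fun h => ⟨h1, h2.trans ?_⟩, fun h => ⟨k, by omega, by omega⟩⟩
    · refine ⟨fun h3 p hp => ?_, fun h3 p hp => h3 p (by omega)⟩
      rcases (show p < k ∨ p = k by omega) with h' | rfl
      · exact h3 p h'
      · omega
  · intro τ _ ⟨h1, h2⟩
    split_ifs with h
    · refine h2.2 fun p hp => ?_
      by_cases hpn : p < P.n
      · rw [hU.dig p hpn, (hP.row j hj).dig p hpn, h]
      · rw [hU.zero p (by omega) hp, (hP.row j hj).zero p (by omega) hp]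
    · rcases h1 with h1 | h1
      · exact absurd ((hP.row j hj).ext hU fun p hp => (h2.1 h1 p (by omega)).symm) h
      · exact h1

end

end Cmd

namespace Cmd

section
variable {C : Ctx} {P : Pl} {σ : St}

/-- Only a new row and its place in the order have to be written: the new column of the old rows
already contains zeros, as required by `Vec.mono`. -/
theorem wp_ins (hP : Pool C P σ) {q u : ℕ} (hq : σ.v .q = q) (hqn : q ≤ P.n) (hu : u ∈ C.G)
    (h1 : ∀ r < q, P.x (P.o r) < u) (h2 : ∀ r, q ≤ r → r < P.n → u < P.x (P.o r))
    (hU : P.Vec C.N (σ.a .U 0) u) : ins.wp C.dims σ fun τ => Pool C (P.ins q u) τ := by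
  have hval := hP.valid.ins hu hqn h1 h2
  have hn : P.n + 1 < C.N := hval.card_le.trans_lt C.card_lt
  have hC := C.le_N
  rw [ins, wp_block_cons, wp_asg, wp_block_cons]
  refine ⟨trivial, ?_⟩
  -- From rank `q` on, `w` holds the entry displaced in the previous round, starting with the new
  -- number `P.n`.
  refine wp_loop (fun k τ => (τ.v .w = if k ≤ q then (P.n : ℤ) else σ.a .ord 0 (k - 1)) ∧
    ∀ j, τ.a .ord 0 j = if j < k then (if j < q then σ.a .ord 0 j else if j = q then (P.n : ℤ)
      else σ.a .ord 0 (j - 1)) else σ.a .ord 0 j) C.N (by simpa using hP.N) le_rfl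
    (by simp [hP.n]) ?_ ?_
  · intro k hk τ hkτ f ⟨i1, i2⟩
    have e1 : τ.v .q = q := (f.v .q rfl).trans (by simpa using hq)
    simp [e1, hkτ, hk]
    refine ⟨fun h => ⟨by grind, fun j => ?_⟩, fun h => ⟨by omega, by grind, fun j => ?_⟩⟩ <;>
    · rw [i2 j]
      grind
  · intro τ f hI
    have i2 := hI.2
    have e1 : τ.a .E = σ.a .E := f.a _ rfl
    have e2 : τ.a .U = σ.a .U := f.a _ rfl
    have e3 : τ.v .n = P.n := (f.v .n rfl).trans (by simpa using hP.n)
    have e4 : τ.v .N = C.N := (f.v .N rfl).trans (by simpa using hP.N)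
    have e5 : τ.a .tab = σ.a .tab := f.a _ rfl
    have e6 : τ.a .hlf = σ.a .hlf := f.a _ rfl
    rw [wp_block_cons]
    refine wp_loop (fun k υ => ∀ i j, υ.a .E i j =
      if i = P.n ∧ j < k then σ.a .U 0 j else σ.a .E i j) C.N e4 le_rfl (by simp [e1]) ?_ ?_
    · intro k hk υ hkυ f' i3
      have e7 : υ.v .n = P.n := (f'.v .n rfl).trans (by simpa using e3)
      have e8 : υ.a .U = τ.a .U := f'.a _ rfl
      simp [e7, e8, e2, hkυ]
      refine ⟨by omega, by omega, fun i j => ?_⟩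
      rw [i3 i j]
      grind
    · intro υ f' i3
      have d1 : υ.v .n = P.n := (f'.v .n rfl).trans (by simpa using e3)
      have d2 : υ.v .N = C.N := (f'.v .N rfl).trans (by simpa using e4)
      have d3 : υ.a .ord = τ.a .ord := f'.a _ rfl
      have d4 : υ.a .tab = σ.a .tab := (f'.a _ rfl).trans (by simpa using e5)
      have d5 : υ.a .hlf = σ.a .hlf := (f'.a _ rfl).trans (by simpa using e6)
      simp only [wp_block_single, wp_asg]
      refine ⟨by simp, ?_⟩
      refine ⟨by simpa using d2, by simp [d1, Pl.ins], hval, fun i hi => ?_, fun r hr => ?_,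
        by simpa [d4] using hP.tab, by simpa [d5] using hP.hlf⟩
      · have hi : i < P.n + 1 := hi
        refine Pl.Vec.mono (P := P) ?_ (P.le_ins q u) hval hn.le
        simp only [St.a_setv]
        by_cases hin : i = P.n
        · have : (P.ins q u).x i = u := by rw [hin]; exact Function.update_self _ _ _
          rw [this]
          refine hU.congr (fun j hj => ?_) (by omega)
          rw [i3, if_pos ⟨hin, hj⟩]
        · rw [(P.le_ins q u).2 i (by omega)]
          refine (hP.row i (by omega)).congr (fun j hj => ?_) (by omega)
          rw [i3, if_neg (by tauto)]
      · have hr : r < P.n + 1 := hr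
        simp only [St.a_setv, d3, i2 r]
        rw [if_pos (by omega)]
        simp only [Pl.ins]
        split_ifs
        · exact hP.ord r (by omega)
        · rfl
        · exact hP.ord _ (by omega)

/-- The ranks are traversed upwards, so the last nonzero difference recorded belongs to the highest
exponent at which the digits differ; its sign decides by `lt_of_naf_lt`. -/
theorem wp_cmp (hP : Pool C P σ) {i : ℕ} (hi : i < P.n) (hi' : σ.v .i = i) {u : ℤ}
    (hU : P.Vec C.N (σ.a .U 0) u) : cmp.wp C.dims σ fun τ => (τ.v .s = 0 → (P.x i : ℤ) = u) ∧
      (τ.v .s < 0 → P.x i < u) ∧ (0 < τ.v .s → u < P.x i) := by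
  have hn := hP.n_lt
  have hC := C.le_N
  rw [cmp, wp_block_cons, wp_asg, wp_block_single]
  refine ⟨trivial, ?_⟩
  have hrow := hP.row i hi
  set dif : ℕ → ℤ := fun p => naf (P.x i) p - naf u p with hdif
  refine wp_loop (fun k τ =>
    (τ.v .s = 0 ∧ ∀ r < k, r < P.n → dif (P.x (P.o r)) = 0) ∨ ∃ r < k, r < P.n ∧
      τ.v .s = dif (P.x (P.o r)) ∧ τ.v .s ≠ 0 ∧
      ∀ s, r < s → s < k → s < P.n → dif (P.x (P.o s)) = 0) C.N
    (by simpa using hP.N) le_rfl (by simp) ?_ ?_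
  · intro k hk τ hkτ f hI
    have e1 : τ.a .E = σ.a .E := f.a _ rfl
    have e2 : τ.a .U = σ.a .U := f.a _ rfl
    have e3 : τ.v .i = i := (f.v .i rfl).trans (by simpa using hi')
    have e4 : τ.v .n = P.n := (f.v .n rfl).trans (by simpa using hP.n)
    have e5 : τ.a .ord = σ.a .ord := f.a _ rfl
    by_cases hkn : k < P.n
    · have ho := hP.valid.olt k hkn
      have hd : σ.a .E i (P.o k) - σ.a .U 0 (P.o k) = dif (P.x (P.o k)) := by
        rw [hrow.dig _ ho, hU.dig _ ho]
      have h0 : ∀ s, (s < k + 1 → s < P.n → dif (P.x (P.o s)) = 0) ↔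
          (s < k → s < P.n → dif (P.x (P.o s)) = 0) ∧ (s = k → dif (P.x (P.o k)) = 0) := by
        intro s
        refine ⟨fun h => ⟨fun h1 h2 => h (by omega) h2, fun h1 => by subst h1; exact h (by omega) hkn⟩,
          fun h h1 h2 => ?_⟩
        rcases (show s < k ∨ s = k by omega) with h' | rfl
        · exact h.1 h' h2
        · exact h.2 rfl
      clear_value dif
      simp [e1, e2, e3, e4, e5, hkτ, hP.ord k hkn, hd]
      refine ⟨fun _ => ⟨by omega, by omega, fun h => ?_, fun h => ?_⟩, by omega⟩
      · rcases hI with ⟨i1, i2⟩ | ⟨r, r1, r2, r3, r4, r5⟩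
        · exact Or.inl ⟨i1, fun r hr => (h0 r).2 ⟨i2 r, fun _ => h⟩ (by omega)⟩
        · exact Or.inr ⟨r, by omega, r2, r3, r4, fun s hs hs' => (h0 s).2 ⟨r5 s hs, fun _ => h⟩ (by omega)⟩
      · exact Or.inr ⟨k, by omega, hkn, rfl, h, fun s _ _ => by omega⟩
    · simp [e4, hkτ]
      refine ⟨by omega, fun _ => ?_⟩
      rcases hI with ⟨i1, i2⟩ | ⟨r, r1, r2, r3, r4, r5⟩
      · exact Or.inl ⟨i1, fun r _ h => i2 r (by omega) h⟩
      · exact Or.inr ⟨r, by omega, r2, r3, r4, fun s h _ h' => r5 s h (by omega) h'⟩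
  · intro τ _ hI
    have hout : ∀ p, (∀ j < P.n, P.x j ≠ p) → naf (P.x i) p = naf u p := fun p hp => by
      rw [hrow.naf_eq_zero hp, hU.naf_eq_zero hp]
    rcases hI with ⟨i1, i2⟩ | ⟨r, r1, r2, r3, r4, r5⟩
    · have : (P.x i : ℤ) = u := naf_ext fun p => by
        by_cases hp : ∃ j < P.n, P.x j = p
        · obtain ⟨j, hj, rfl⟩ := hp
          obtain ⟨r, hr, rfl⟩ := hP.valid.exists_rank hj
          have := i2 r (by omega) hr
          simp only [hdif] at this; omega
        · push Not at hp; exact hout p hp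
      exact ⟨fun _ => this, by omega, by omega⟩
    · have heq : ∀ p, P.x (P.o r) < p → naf (P.x i) p = naf u p := fun p hp => by
        by_cases hp' : ∃ j < P.n, P.x j = p
        · obtain ⟨j, hj, rfl⟩ := hp'
          obtain ⟨s, hs, rfl⟩ := hP.valid.exists_rank hj
          have := r5 s (hP.valid.rank_lt r2 hp) (by omega) hs
          simp only [hdif] at this; omega
        · push Not at hp'; exact hout p hp'
      refine ⟨fun h => absurd h r4, fun h => ?_, fun h => ?_⟩
      · exact lt_of_naf_lt heq (by simp only [r3, hdif] at h; omega)
      · exact lt_of_naf_lt (fun p hp => (heq p hp).symm) (by simp only [r3, hdif] at h; omega)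

/-- The result of a command which may enlarge the pool. -/
def Grows (C : Ctx) (P : Pl) (Q : Pl → St → Prop) (τ : St) : Prop :=
  ∃ P', P.Le P' ∧ Pool C P' τ ∧ Q P' τ

theorem wp_find (hP : Pool C P σ) {u : ℕ} (hu : u ∈ C.G) (hU : P.Vec C.N (σ.a .U 0) u) :
    find.wp C.dims σ (Grows C P fun P' τ => ∃ i < P'.n, P'.x i = u ∧ τ.v .z = i) := by
  have hn := hP.n_lt
  have hC := C.le_N
  rw [find, wp_block_cons, wp_asg, wp_block_cons, wp_asg, wp_block_cons]
  refine ⟨trivial, trivial, ?_⟩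
  -- Either the exponent has been found, or `pos` is the rank at which it would have to be inserted
  -- among the exponents seen so far.
  refine wp_loop (fun k τ => (τ.v .fnd = 1 ∧ ∃ i < P.n, P.x i = u ∧ τ.v .z = i) ∨
      (τ.v .fnd = 0 ∧ ∃ q : ℕ, τ.v .pos = q ∧ q ≤ k ∧ q ≤ P.n ∧ (∀ r < q, P.x (P.o r) < u) ∧
        ∀ r, q ≤ r → r < k → r < P.n → u < P.x (P.o r))) C.N
    (by simpa using hP.N) le_rfl ?_ ?_ ?_
  · exact Or.inr ⟨by simp, 0, by simp, by omega, by omega, fun r hr => by omega,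
      fun r _ hr => by omega⟩
  · intro k hk τ hkτ f hI
    have hPτ : Pool C P τ := ((hP.setv _ _).setv _ _).frame f
    have e2 : τ.a .U = σ.a .U := f.a _ rfl
    rw [wp_ifp]
    refine ⟨by simp, fun hlt => ?_, fun hge => ?_⟩
    · have hkn : k < P.n := by simp [hPτ.n, hkτ] at hlt; exact hlt
      have ho := hP.valid.olt k hkn
      rw [wp_block_cons, wp_asg, wp_block_cons]
      refine ⟨by simp [hkτ]; omega, ?_⟩
      refine wp_call (wp_cmp (u := u) (hPτ.setv _ _) ho (by simp [hkτ, hPτ.ord k hkn]) (by simpa [e2] using hU))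
        fun υ f' ⟨s1, s2, s3⟩ => ?_
      have d1 : υ.v .i = P.o k := (f'.v .i rfl).trans (by simp [hkτ, hPτ.ord k hkn])
      have d2 : υ.v .r = k := (f'.v .r rfl).trans (by simpa using hkτ)
      have d3 : υ.v .fnd = τ.v .fnd := f'.v .fnd rfl
      have d4 : υ.v .pos = τ.v .pos := f'.v .pos rfl
      have d5 : υ.v .z = τ.v .z := f'.v .z rfl
      simp only [wp_block_single, wp_ifz, wp_ifp, wp_block_cons, wp_asg, wp_skip, Ex.ok_var,
        Ex.ok_num, Ex.ok_add, Ex.eval_var, Ex.eval_num, Ex.eval_add, St.v_setv, d1, d2, d3, d4, d5,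
        true_and, reduceCtorEq, if_true, if_false]
      refine ⟨fun h => Or.inl ⟨P.o k, ho, by exact_mod_cast s1 h, rfl⟩, fun h => ⟨fun h => ?_, fun h' => ?_⟩⟩
      · refine hI.imp_right fun ⟨i1, q, i2, i3, i4, i5, i6⟩ =>
          ⟨i1, q, i2, by omega, i4, i5, fun r h1 h2 h3 => ?_⟩
        rcases (show r < k ∨ r = k by omega) with h' | rfl
        · exact i6 r h1 h' h3
        · exact_mod_cast s3 h
      · refine hI.imp_right fun ⟨i1, q, i2, i3, i4, i5, i6⟩ =>
          ⟨i1, k + 1, by simp, by omega, by omega, fun r hr => ?_, fun r h1 h2 => by omega⟩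
        have hxk : P.x (P.o k) < u := by exact_mod_cast s2 (by omega)
        rcases (show r < k ∨ r = k by omega) with h' | rfl
        · exact (hP.valid.srt r k h' hkn).trans hxk
        · exact hxk
    · have hkn : P.n ≤ k := by simp [hPτ.n, hkτ] at hge; exact hge
      rw [wp_skip]
      simp only [St.v_setv, reduceCtorEq, if_false]
      exact hI.imp_right fun ⟨i1, q, i2, i3, i4, i5, i6⟩ =>
        ⟨i1, q, i2, by omega, i4, i5, fun r h1 _ h3 => i6 r h1 (by omega) h3⟩
  · intro τ f hI
    have hPτ : Pool C P τ := ((hP.setv _ _).setv _ _).frame f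
    have e2 : τ.a .U = σ.a .U := f.a _ rfl
    rw [wp_block_single, wp_ifz]
    rcases hI with ⟨i1, i, hi, h1, h2⟩ | ⟨i1, q, i2, i3, i4, i5, i6⟩
    · exact ⟨by simp, fun h => by simp [i1] at h, fun _ => ⟨P, .refl P, hPτ, i, hi, h1, h2⟩⟩
    · refine ⟨by simp, fun _ => ?_, fun h => absurd i1 h⟩
      rw [wp_block_cons, wp_asg, wp_block_cons, wp_asg, wp_block_single]
      refine ⟨trivial, trivial, ?_⟩
      refine wp_call (wp_ins ((hPτ.setv _ _).setv _ _) (q := q) (by simp [i2]) i4 hu i5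
        (fun r h1 h2 => i6 r h1 (by omega) h2) (by simpa [e2] using hU)) fun υ f' hQ => ?_
      exact ⟨_, P.le_ins q u, hQ, P.n, Nat.lt_succ_self _, Function.update_self _ _ _,
        (f'.v .z rfl).trans (by simp [hPτ.n])⟩

end
end Cmd

/-! ### Addition -/

namespace Pl

variable {P : Pl} {G : Finset ℕ}

theorem Valid.not_between (h : P.Valid G) {k : ℕ} (hk : k < P.n) {j : ℕ} (hj : j < P.n)
    (h1 : P.x (P.o k) < P.x j) : k + 1 < P.n ∧ P.x (P.o (k + 1)) ≤ P.x j := by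
  obtain ⟨s, hs, rfl⟩ := h.exists_rank hj
  have := h.rank_lt hk h1
  refine ⟨by omega, ?_⟩
  rcases (show s = k + 1 ∨ k + 1 < s by omega) with rfl | h'
  · exact le_rfl
  · exact (h.srt _ _ h' hs).le

theorem carry_gap {N : ℕ} {v w : ℕ → ℤ} {a b : ℤ} (hv : P.Vec N v a) (hw : P.Vec N w b) {p q : ℕ}
    (hpq : p ≤ q) (hc : carry a b p = 0) (h : ∀ j < P.n, p ≤ P.x j → q ≤ P.x j) :
    carry a b q = 0 ∧ ∀ i, p ≤ i → i < q → naf (a + b) i = 0 := by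
  refine PowerCircuits.carry_gap hpq hc fun i h1 h2 => ?_
  have : ∀ j < P.n, P.x j ≠ i := fun j hj hji => by have := h j hj (by omega); omega
  exact ⟨hv.naf_eq_zero this, hw.naf_eq_zero this⟩

end Pl

namespace Cmd

/-- Looks for the successor of the exponent of rank `r`, whose digits are in `U`; `h` is the sum of
the digits at this successor. -/
def look : Cmd :=
  block [asg .fl (.num 0), asg .h (.num 0), ifp (.var .n - .var .r - .num 1)
    (block [asg .j (.get .ord (.num 0) (.var .r + .num 1)), eqU,
      ifz (.var .fl) skip
        (asg .h (.get .X (.num 0) (.var .j) + .get .Y (.num 0) (.var .j)))]) skip]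

/-- Computes a digit of the sum, and the carry. -/
def addDigit : Cmd :=
  block [asg .t (.var .cy + .get .X (.num 0) (.var .i) + .get .Y (.num 0) (.var .i)),
    asg .d (.get .tab (.num 0) (.var .t + .var .h + .var .h + .num 7)),
    put .R (.num 0) (.var .i) (.var .d),
    asg .cy (.get .hlf (.num 0) (.var .t - .var .d + .num 2))]

/-- Fills the row `i` of a matrix with the values of the expression `e`, which depends on `p`. -/
def fill (b : Arr) (i e : Ex) : Cmd := loop false .p .N (put b i (.var .p) e)

/-- Computes in `R` the sum of `X` and `Y`. -/
def add : Cmd :=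
  block [fill .R (.num 0) (.num 0), asg .cy (.num 0), loop false .r .N <| ifp (.var .n - .var .r)
    (block [asg .i (.get .ord (.num 0) (.var .r)), inc, look, addDigit,
      ifz (.var .cy) skip (ifz (.var .fl) (block [asg .q (.var .r + .num 1), ins]) skip)]) skip]

section
variable {C : Ctx} {P : Pl} {σ : St}

/-- Only the exponent of the next rank can be `e + 1`. If it is not, neither summand has a digit
there, and `h = 0` is the correct look-ahead. -/
theorem wp_look (hP : Pool C P σ) {k e : ℕ} (hk : k < P.n) (hr : σ.v .r = k)
    (he : P.x (P.o k) = e) (hU : P.Vec C.N (σ.a .U 0) ((e + 1 : ℕ) : ℤ)) {a b : ℤ}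
    (hX : P.Vec C.N (σ.a .X 0) a) (hY : P.Vec C.N (σ.a .Y 0) b) :
    look.wp C.dims σ fun τ => (τ.v .fl ≠ 0 ↔ ∃ j < P.n, P.x j = e + 1) ∧
      τ.v .h = naf a (e + 1) + naf b (e + 1) := by
  have hn := hP.n_lt
  have hC := C.le_N
  have key : (∃ j < P.n, P.x j = e + 1) → k + 1 < P.n ∧ P.x (P.o (k + 1)) = e + 1 := by
    rintro ⟨j, hj, hje⟩
    obtain ⟨h1, h2⟩ := hP.valid.not_between hk hj (by omega)
    have := hP.valid.srt k (k + 1) (by omega) h1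
    exact ⟨h1, by omega⟩
  have hzero : (¬ ∃ j < P.n, P.x j = e + 1) → naf a (e + 1) = 0 ∧ naf b (e + 1) = 0 := fun h => by
    push Not at h
    exact ⟨hX.naf_eq_zero h, hY.naf_eq_zero h⟩
  rw [look, wp_block_cons, wp_asg, wp_block_cons, wp_asg, wp_block_single, wp_ifp]
  refine ⟨trivial, trivial, by simp, fun hlt => ?_, fun hge => ?_⟩
  · have hk1 : k + 1 < P.n := by simp [hP.n, hr] at hlt; omega
    have ho := hP.valid.olt _ hk1
    have hkz : ((k : ℤ) + 1).toNat = k + 1 := by omega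
    rw [wp_block_cons, wp_asg, wp_block_cons]
    refine ⟨by simp [hr]; omega, ?_⟩
    refine wp_call (wp_eqU (((hP.setv _ _).setv _ _).setv _ _) ho
      (by simp [hr, hkz, hP.ord _ hk1]) (by simpa using hU)) fun υ f hfl => ?_
    have e1 : υ.a .X = σ.a .X := f.a _ rfl
    have e2 : υ.a .Y = σ.a .Y := f.a _ rfl
    have e3 : υ.v .j = P.o (k + 1) := (f.v .j rfl).trans (by simp [hr, hkz, hP.ord _ hk1])
    have e4 : υ.v .h = 0 := (f.v .h rfl).trans (by simp)
    have hX' := hX.dig _ ho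
    have hY' := hY.dig _ ho
    by_cases hx : P.x (P.o (k + 1)) = e + 1
    · rw [if_pos (by exact_mod_cast hx)] at hfl
      rw [hx] at hX' hY'
      simp [hfl, e1, e2, e3, hX', hY']
      exact ⟨by omega, _, ho, hx⟩
    · rw [if_neg (by exact_mod_cast hx)] at hfl
      have hne : ¬ ∃ j < P.n, P.x j = e + 1 := fun h => hx (key h).2
      obtain ⟨z1, z2⟩ := hzero hne
      simp [hfl, e4, z1, z2]
      simpa using hne
  · have hne : ¬ ∃ j < P.n, P.x j = e + 1 := fun h => by
      have := (key h).1
      simp [hP.n, hr] at hge; omega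
    obtain ⟨z1, z2⟩ := hzero hne
    simp [z1, z2]
    simpa using hne

/-- The argument of `dig` lies between `-6` and `6`, hence in the table. Twice the new carry is one
of `-2, 0, 2`; these are the entries of the table for halving, shifted by `2`. -/
theorem wp_addDigit (hP : Pool C P σ) {i e : ℕ} (hi : i < P.n) (hi' : σ.v .i = i)
    (he : P.x i = e) {a b : ℤ} (hX : P.Vec C.N (σ.a .X 0) a) (hY : P.Vec C.N (σ.a .Y 0) b)
    (hcy : σ.v .cy = carry a b e) (hh : σ.v .h = naf a (e + 1) + naf b (e + 1)) :
    addDigit.wp C.dims σ fun τ => τ.v .cy = carry a b (e + 1) ∧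
      ∀ j, τ.a .R 0 j = if j = i then naf (a + b) e else σ.a .R 0 j := by
  have hn := hP.n_lt
  have hC := C.le_N
  have s1 : -2 ≤ carry a b e + naf a e + naf b e ∧ carry a b e + naf a e + naf b e ≤ 2 := by
    have := carry_bound a b e; have := naf_cases a e; have := naf_cases b e
    omega
  have s2 : -2 ≤ naf a (e + 1) + naf b (e + 1) ∧ naf a (e + 1) + naf b (e + 1) ≤ 2 := by
    have := naf_cases a (e + 1); have := naf_cases b (e + 1)
    omega
  have hX' := hX.dig i hi
  have hY' := hY.dig i hi
  rw [he] at hX' hY'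
  obtain ⟨m, hm, hm'⟩ : ∃ m : ℕ, m ≤ 14 ∧ (m : ℤ) = carry a b e + naf a e + naf b e +
      (naf a (e + 1) + naf b (e + 1)) + (naf a (e + 1) + naf b (e + 1)) + 7 :=
    ⟨(carry a b e + naf a e + naf b e +
      (naf a (e + 1) + naf b (e + 1)) + (naf a (e + 1) + naf b (e + 1)) + 7).toNat,
      by omega, by omega⟩
  have ht := hP.tab m hm
  have hdm : dig ((m : ℤ) - 7) = naf (a + b) e := by
    rw [naf_add, hm']; congr 1; ring
  obtain ⟨l, hl, hl', hl2⟩ : ∃ l : ℕ, l ≤ 4 ∧ (l : ℤ) = carry a b e + naf a e + naf b e -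
      naf (a + b) e + 2 ∧ σ.a .hlf 0 l = carry a b (e + 1) := by
    have := hP.hlf
    have h2 := carry_succ a b e
    rcases (carry_bound a b (e + 1)).1 with h | h | h
    · exact ⟨2, by omega, by push_cast; omega, by rw [h]; exact this.2.1⟩
    · exact ⟨4, by omega, by push_cast; omega, by rw [h]; exact this.2.2⟩
    · exact ⟨0, by omega, by push_cast; omega, by rw [h]; exact this.1⟩
  simp [addDigit, hi', hcy, hX', hY', hh, ← hm', ht, hdm, ← hl', hl2]
  omega

theorem wp_fill {b : Arr} {i e : Ex} {i' : ℕ} (f : ℕ → ℤ) (hN : σ.v .N = C.N) (hi' : i' < C.N)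
    (h : ∀ (τ : St) (k : ℕ), k < C.N → τ.v .p = k → (∀ x, x ≠ .p → τ.v x = σ.v x) →
      (∀ b', b' ≠ b → τ.a b' = σ.a b') → τ.io = σ.io →
      (i.Ok C.N τ ∧ i.eval τ = i') ∧ e.Ok C.N τ ∧ e.eval τ = f k) :
    (fill b i e).wp C.dims σ fun τ => (∀ j < C.N, τ.a b i' j = f j) ∧
      ∀ k j, k ≠ i' → τ.a b k j = σ.a b k j := by
  refine wp_loop (fun k τ => (∀ j < k, τ.a b i' j = f j) ∧ ∀ k j, k ≠ i' → τ.a b k j = σ.a b k j)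
    C.N hN le_rfl (by simp) ?_ fun τ _ h => h
  intro k hk τ hkτ g ⟨h1, h2⟩
  obtain ⟨⟨o1, o2⟩, o3, o4⟩ := h τ k hk hkτ (fun x hx => g.v x (by simp [wv, Ne.symm hx]))
    (fun b' hb => g.a b' (by simp [wa, Ne.symm hb])) (g.io rfl)
  simp [o1, o2, o3, o4, hkτ]
  refine ⟨by omega, fun j hj => ?_, fun k' j hk' => ?_⟩
  · by_cases hjk : j = k
    · simp [hjk]
    · simp [hjk, h1 j (by omega)]
  · simp [hk', h2 k' j hk']

/-- Between two exponents of the pool the summands have no digits, so a carry can be pending only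
directly above the current exponent. If it falls on a missing exponent, that exponent is inserted
and is treated in the next round. -/
theorem wp_add (hP : Pool C P σ) (hJ : P.Base (C.K + 1)) {a b : ℤ}
    (hX : P.Vec C.N (σ.a .X 0) a) (hY : P.Vec C.N (σ.a .Y 0) b) (hG : supp (a + b) ⊆ C.G) :
    add.wp C.dims σ (Grows C P fun P' τ => P'.Vec C.N (τ.a .R 0) (a + b)) := by
  have hC := C.le_N
  rw [add, wp_block_cons]
  refine wp_call (wp_fill (fun _ => 0) hP.N (i' := 0) (by omega) (fun τ _ _ _ _ _ _ =>
      ⟨⟨trivial, rfl⟩, trivial, rfl⟩))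
    fun σ₁ f₁ ⟨hR, _⟩ => ?_
  have hP₁ := hP.frame f₁
  rw [wp_block_cons, wp_asg, wp_block_single]
  refine ⟨trivial, ?_⟩
  -- `B` is the place up to which the sum is settled: while exponents remain it is the exponent of
  -- rank `k`, and afterwards it is a place above all of them without a carry.
  refine wp_loop (fun k τ => ∃ P' B, P.Le P' ∧ Pool C P' τ ∧ τ.v .cy = carry a b B ∧
    (k < P'.n → B = P'.x (P'.o k)) ∧ (P'.n ≤ k → carry a b B = 0) ∧
    (∀ r < k, r < P'.n → P'.x (P'.o r) < B) ∧
    (∀ p < B, naf (a + b) p ≠ 0 → ∃ j < P'.n, P'.x j = p) ∧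
    (∀ r < k, r < P'.n → τ.a .R 0 (P'.o r) = naf (a + b) (P'.x (P'.o r))) ∧
    ∀ j < C.N, (∀ r < k, r < P'.n → P'.o r ≠ j) → τ.a .R 0 j = 0) C.N
    (by simpa using hP₁.N) le_rfl ?_ ?_ ?_
  · have hgap : ∃ B, carry a b B = 0 ∧ (∀ i < B, naf (a + b) i = 0) ∧
        (0 < P.n → B = P.x (P.o 0)) := by
      by_cases h0 : 0 < P.n
      · have := Pl.carry_gap hX hY (Nat.zero_le (P.x (P.o 0))) (by simp) fun j hj _ => by
          obtain ⟨r, hr, rfl⟩ := hP.valid.exists_rank hj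
          rcases r.eq_zero_or_pos with rfl | hr0
          · exact le_rfl
          · exact (hP.valid.srt 0 r hr0 hr).le
        exact ⟨_, this.1, fun i hi => this.2 i (Nat.zero_le i) hi, fun _ => rfl⟩
      · exact ⟨0, by simp, by simp, fun h => absurd h h0⟩
    obtain ⟨B, hB1, hB2, hB3⟩ := hgap
    exact ⟨P, B, .refl P, (hP₁.setv _ _).setv _ _, by simp [hB1], hB3, fun _ => hB1,
      by simp, fun p hp h => absurd (hB2 p hp) h, by simp, fun j hj _ => by simpa using hR j hj⟩
  · rintro k hk τ hkτ f ⟨P', B, i1, i2, i3, i4, i5, i6, i7, i8, i9⟩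
    have hX' : P'.Vec C.N (τ.a .X 0) a := by
      rw [show τ.a .X = σ.a .X from (f.a _ rfl).trans (f₁.a _ rfl)]; exact i2.vec_mono hX i1
    have hY' : P'.Vec C.N (τ.a .Y 0) b := by
      rw [show τ.a .Y = σ.a .Y from (f.a _ rfl).trans (f₁.a _ rfl)]; exact i2.vec_mono hY i1
    have hn := i2.n_lt
    rw [wp_ifp]
    refine ⟨by simp, fun hlt => ?_, fun hge => ?_⟩
    · have hkn : k < P'.n := by simp [i2.n, hkτ] at hlt; exact hlt
      have ho := i2.valid.olt k hkn
      obtain ⟨e, he⟩ : ∃ e, P'.x (P'.o k) = e := ⟨_, rfl⟩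
      have hBe : B = e := (i4 hkn).trans he
      subst hBe
      have heG : B ∈ C.G := he ▸ i2.valid.mem _ ho
      rw [wp_block_cons, wp_asg, wp_block_cons]
      refine ⟨by simp [hkτ]; omega, ?_⟩
      have hJ' := hJ.mono i1
      refine wp_call (wp_inc (i2.setv _ _) ho (by simp [hkτ, i2.ord k hkn])
        (J := C.K) ⟨by have := hJ'.1; omega, fun i hi => hJ'.2 i (by omega)⟩
        (by rw [St.a_setv, (i2.row _ ho).dig _ (by have := hJ'.1; omega), hJ'.2 C.K (by omega)])
        (by rw [he]; exact C.carry B heG)) fun τ₁ f₁ hU => ?_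
      have p1 : Pool C P' τ₁ := (i2.setv _ _).frame f₁
      have r1 : τ₁.v .r = k := (f₁.v .r rfl).trans (by simpa using hkτ)
      have v1 : τ₁.v .i = P'.o k := (f₁.v .i rfl).trans (by simp [hkτ, i2.ord k hkn])
      have cy1 : τ₁.v .cy = carry a b B := (f₁.v .cy rfl).trans (by simpa using i3)
      have R1 : τ₁.a .R = τ.a .R := f₁.a _ rfl
      have X1 : P'.Vec C.N (τ₁.a .X 0) a := by
        rw [show τ₁.a .X = τ.a .X from f₁.a _ rfl]; exact hX'
      have Y1 : P'.Vec C.N (τ₁.a .Y 0) b := by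
        rw [show τ₁.a .Y = τ.a .Y from f₁.a _ rfl]; exact hY'
      rw [he] at hU
      rw [wp_block_cons]
      refine wp_call (wp_look p1 hkn r1 he hU X1 Y1) fun τ₂ f₂ ⟨hfl, hh⟩ => ?_
      have p2 : Pool C P' τ₂ := p1.frame f₂
      rw [wp_block_cons]
      refine wp_call (wp_addDigit p2 ho ((f₂.v .i rfl).trans v1) he
        (by rw [show τ₂.a .X = τ₁.a .X from f₂.a _ rfl]; exact X1)
        (by rw [show τ₂.a .Y = τ₁.a .Y from f₂.a _ rfl]; exact Y1)
        ((f₂.v .cy rfl).trans cy1) hh) fun τ₃ f₃ ⟨hcy, hR3⟩ => ?_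
      have p3 : Pool C P' τ₃ := p2.frame f₃
      have fl3 : τ₃.v .fl = τ₂.v .fl := f₃.v .fl rfl
      have r3 : τ₃.v .r = k := (f₃.v .r rfl).trans ((f₂.v .r rfl).trans r1)
      have U3 : τ₃.a .U = τ₁.a .U := (f₃.a _ rfl).trans (f₂.a _ rfl)
      have R3 : ∀ j, τ₃.a .R 0 j = if j = P'.o k then naf (a + b) B else τ.a .R 0 j := by
        intro j; rw [hR3, show τ₂.a .R = τ.a .R from (f₂.a _ rfl).trans R1]
      have Rdig : ∀ r < k + 1, r < P'.n → τ₃.a .R 0 (P'.o r) = naf (a + b) (P'.x (P'.o r)) := by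
        intro r hr hr'
        rw [R3]
        split_ifs with h
        · rw [h, he]
        · exact i8 r (by rcases (show r < k ∨ r = k by omega) with h' | rfl
                         · exact h'
                         · exact absurd rfl h) hr'
      have Rzero : ∀ j < C.N, (∀ r < k + 1, r < P'.n → P'.o r ≠ j) → τ₃.a .R 0 j = 0 := by
        intro j hj h
        rw [R3, if_neg (Ne.symm (h k (by omega) hkn))]
        exact i9 j hj fun r hr hr' => h r (by omega) hr'
      have below : ∀ r < k + 1, r < P'.n → P'.x (P'.o r) < B + 1 := by
        intro r hr hr'
        rcases (show r < k ∨ r = k by omega) with h' | rfl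
        · exact (i6 r h' hr').trans (by omega)
        · omega
      have occ : ∀ p < B + 1, naf (a + b) p ≠ 0 → ∃ j < P'.n, P'.x j = p := by
        intro p hp h
        rcases (show p < B ∨ p = B by omega) with h' | rfl
        · exact i7 p h' h
        · exact ⟨_, ho, he⟩
      -- Without insertion the round ends in one of two ways: the carry has died, and the gap up to
      -- the next exponent is empty, or there is no gap.
      have rest : (carry a b (B + 1) = 0 ∨ ∃ j < P'.n, P'.x j = B + 1) → ∃ P'' B'', P.Le P'' ∧
          Pool C P'' (τ₃.setv .r (k + 1)) ∧ τ₃.v .cy = carry a b B'' ∧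
          (k + 1 < P''.n → B'' = P''.x (P''.o (k + 1))) ∧ (P''.n ≤ k + 1 → carry a b B'' = 0) ∧
          (∀ r < k + 1, r < P''.n → P''.x (P''.o r) < B'') ∧
          (∀ p < B'', naf (a + b) p ≠ 0 → ∃ j < P''.n, P''.x j = p) ∧
          (∀ r < k + 1, r < P''.n → τ₃.a .R 0 (P''.o r) = naf (a + b) (P''.x (P''.o r))) ∧
          ∀ j < C.N, (∀ r < k + 1, r < P''.n → P''.o r ≠ j) → τ₃.a .R 0 j = 0 := by
        intro hcase
        by_cases hk1 : k + 1 < P'.n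
        · have hs := i2.valid.srt k (k + 1) (by omega) hk1
          have hgap : carry a b (P'.x (P'.o (k + 1))) = carry a b (B + 1) ∧
              ∀ p, B + 1 ≤ p → p < P'.x (P'.o (k + 1)) → naf (a + b) p = 0 := by
            rcases hcase with h0 | ⟨j, hj, hjB⟩
            · have := Pl.carry_gap hX' hY' (by omega : B + 1 ≤ P'.x (P'.o (k + 1))) h0
                fun j hj hBj => (i2.valid.not_between hkn hj (by omega)).2
              exact ⟨this.1.trans h0.symm, this.2⟩
            · have := (i2.valid.not_between hkn hj (by omega)).2
              have : P'.x (P'.o (k + 1)) = B + 1 := by omega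
              rw [this]
              exact ⟨rfl, fun p _ _ => by omega⟩
          refine ⟨P', _, i1, p3.setv _ _, hcy.trans hgap.1.symm, fun _ => rfl, by omega,
            fun r hr hr' => (below r hr hr').trans_le (by omega), fun p hp h => ?_, Rdig, Rzero⟩
          rcases lt_or_ge p (B + 1) with h' | h'
          · exact occ p h' h
          · exact absurd (hgap.2 p h' hp) h
        · have h0 : carry a b (B + 1) = 0 := by
            rcases hcase with h0 | ⟨j, hj, hjB⟩
            · exact h0
            · exact absurd (i2.valid.not_between hkn hj (by omega)).1 hk1
          exact ⟨P', B + 1, i1, p3.setv _ _, hcy, fun h => absurd h hk1, fun _ => h0, below, occ,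
            Rdig, Rzero⟩
      rw [wp_block_single, wp_ifz]
      refine ⟨trivial, fun h0 => ?_, fun h0 => ?_⟩
      · simp only [Ex.eval_var, hcy] at h0
        simpa using rest (Or.inl h0)
      · simp only [Ex.eval_var, hcy] at h0
        rw [wp_ifz]
        refine ⟨trivial, fun h1 => ?_, fun h1 => ?_⟩
        · simp only [Ex.eval_var, fl3] at h1
          have hnin : ¬ ∃ j < P'.n, P'.x j = B + 1 := fun h => hfl.2 h h1
          have hnin' : ∀ j < P'.n, P'.x j ≠ B + 1 := by simpa using hnin
          -- A carry into a place without digits makes the digit of the sum there nonzero, since the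
          -- look-ahead only contributes an even number. So the inserted exponent belongs to `supp
          -- (a + b)`, hence to `G`.
          have hG1 : B + 1 ∈ C.G := by
            refine hG (mem_supp.2 fun h => ?_)
            have c1 := naf_add a b (B + 1)
            rw [hX'.naf_eq_zero hnin', hY'.naf_eq_zero hnin', h] at c1
            have c2 := carry_bound a b (B + 1)
            have c3 := dig_cases (carry a b (B + 1) + (0 + 0) +
              2 * (naf a (B + 1 + 1) + naf b (B + 1 + 1)))
            omega
          rw [wp_block_cons, wp_asg, wp_block_single]
          refine ⟨by simp, ?_⟩
          refine wp_call (wp_ins (p3.setv _ _) (q := k + 1) (u := B + 1) (by simp [r3]) (by omega) hG1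
            (fun r hr => below r hr (by omega)) (fun r hr hr' => ?_) (by simpa [U3] using hU))
            fun τ₄ f₄ p4 => ?_
          · have h2 := i2.valid.srt k r (by omega) hr'
            have h3 := hnin' _ (i2.valid.olt r hr')
            omega
          · have ho' : ∀ r < k + 1, (P'.ins (k + 1) (B + 1)).o r = P'.o r := fun r hr => if_pos hr
            have hx' : ∀ r < k + 1, (P'.ins (k + 1) (B + 1)).x (P'.o r) = P'.x (P'.o r) :=
              fun r hr => (P'.le_ins _ _).2 _ (i2.valid.olt r (by omega))
            have R4 : τ₄.a .R = τ₃.a .R := f₄.a _ rfl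
            refine ⟨P'.ins (k + 1) (B + 1), B + 1, i1.trans (P'.le_ins _ _), p4.setv _ _, ?_, ?_, ?_,
              ?_, ?_, ?_, ?_⟩
            · simpa using (f₄.v .cy rfl).trans (by simpa using hcy)
            · intro _
              have : (P'.ins (k + 1) (B + 1)).o (k + 1) = P'.n :=
                (if_neg (lt_irrefl _)).trans (if_pos rfl)
              rw [this]
              exact (Function.update_self P'.n (B + 1) P'.x).symm
            · intro h
              have : P'.n + 1 ≤ k + 1 := h
              omega
            · intro r hr _
              rw [ho' r hr, hx' r hr]
              exact below r hr (by omega)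
            · intro p hp h
              obtain ⟨j, hj, rfl⟩ := occ p hp h
              exact ⟨j, hj.trans (Nat.lt_succ_self _), (P'.le_ins _ _).2 j hj⟩
            · intro r hr _
              rw [ho' r hr, hx' r hr, St.a_setv, R4]
              exact Rdig r hr (by omega)
            · intro j hj h
              rw [St.a_setv, R4]
              exact Rzero j hj fun r hr hr' => by
                rw [← ho' r hr]; exact h r hr (hr'.trans (Nat.lt_succ_self _))
        · simp only [Ex.eval_var, fl3] at h1
          simpa using rest (Or.inr (hfl.1 h1))
    · have hkn : P'.n ≤ k := by simp [i2.n, hkτ] at hge; exact hge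
      rw [wp_skip]
      refine ⟨P', B, i1, i2.setv _ _, by simpa using i3, by omega, fun _ => i5 hkn,
        fun r _ hr => i6 r (by omega) hr, i7, fun r _ hr => by simpa using i8 r (by omega) hr,
        fun j hj h => by simpa using i9 j hj fun r hr hr' => h r (by omega) hr'⟩
  · rintro τ f ⟨P', B, i1, i2, i3, i4, i5, i6, i7, i8, i9⟩
    have hn := i2.n_lt
    have hX' : P'.Vec C.N (σ.a .X 0) a := i2.vec_mono hX i1
    have hY' : P'.Vec C.N (σ.a .Y 0) b := i2.vec_mono hY i1
    refine ⟨P', i1, i2, fun p hp => ?_, fun i hi => ?_, fun i hi hi' => ?_⟩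
    · rcases lt_or_ge p B with h | h
      · exact i7 p h hp
      -- All exponents have been passed and no carry is left, so the sum has no digits from `B` on.
      · refine absurd ((Pl.carry_gap hX' hY' (by omega : B ≤ p + 1) (i5 hn.le)
          fun j hj hBj => ?_).2 p h (by omega)) hp
        obtain ⟨r, hr, rfl⟩ := i2.valid.exists_rank hj
        have := i6 r (by omega) hr
        omega
    · obtain ⟨r, hr, rfl⟩ := i2.valid.exists_rank hi
      exact i8 r (by omega) hr
    · exact i9 i hi' fun r _ hr h => by
        have := i2.valid.olt r hr; omega

end
end Cmd

/-! ### Multiplication by powers of two -/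

namespace Cmd

/-- Computes in `Z` the product of `S` and the power of two with the exponent `Y`; sets the flag
`fail` if this is not an integer. -/
def mul : Cmd :=
  block [fill .Z (.num 0) (.num 0), loop false .m .N <| ifz (.get .S (.num 0) (.var .m)) skip
    (block [fill .X (.num 0) (.get .E (.var .m) (.var .p)), add,
      fill .U (.num 0) (.get .R (.num 0) (.var .p)), asg .i (.num 0), cmp,
      ifp (.var .s) (asg .fail (.num 1))
        (block [find, put .Z (.num 0) (.var .z) (.get .S (.num 0) (.var .m))])])]

section
variable {C : Ctx} {P : Pl} {σ : St}

/-- Each nonzero digit of `a` at `q` is copied to `q + c`. The loop is not left after a failure: the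
later sums are still formed, which is harmless because their exponents are allowed by `hG` whatever
their sign. -/
theorem wp_mul (hP : Pool C P σ) (hJ : P.Base (C.K + 1)) {a c : ℤ}
    (hS : P.Vec C.N (σ.a .S 0) a) (hY : P.Vec C.N (σ.a .Y 0) c)
    (hG : ∀ q ∈ supp a, supp (q + c) ⊆ C.G ∧ (0 ≤ q + c → (q + c).toNat ∈ C.G))
    (hf : σ.v .fail = 0) :
    mul.wp C.dims σ (Grows C P fun P' τ =>
      (∀ z, shift a c = some z → τ.v .fail = 0 ∧ P'.Vec C.N (τ.a .Z 0) z) ∧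
      (shift a c = none → τ.v .fail = 1)) := by
  have hC := C.le_N
  have hn := hP.n_lt
  have hsupp : ∀ j < P.n, σ.a .S 0 j ≠ 0 → P.x j ∈ supp a := fun j hj h => by
    rwa [mem_supp, ← hS.dig j hj]
  rw [mul, wp_block_cons]
  refine wp_call (wp_fill (fun _ => 0) hP.N (i' := 0) (by omega) (fun τ _ _ _ _ _ _ =>
      ⟨⟨trivial, rfl⟩, trivial, rfl⟩)) fun σ₁ f₁ ⟨hZ, _⟩ => ?_
  have hP₁ := hP.frame f₁
  rw [wp_block_single]
  -- The second and third conditions say that `Z` consists exactly of the digits moved so far. The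
  -- pool may grow meanwhile, but the numbers `j` of the digits of `a` remain those in the initial
  -- pool `P`.
  refine wp_loop (fun k τ => ∃ P', P.Le P' ∧ Pool C P' τ ∧
    ((τ.v .fail = 0 ∧ ∀ j < k, j < P.n → σ.a .S 0 j ≠ 0 → 0 ≤ P.x j + c) ∨
      (τ.v .fail = 1 ∧ ∃ j < P.n, σ.a .S 0 j ≠ 0 ∧ P.x j + c < 0)) ∧
    (∀ i < C.N, τ.a .Z 0 i ≠ 0 → i < P'.n ∧ ∃ j < k, j < P.n ∧ σ.a .S 0 j ≠ 0 ∧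
      (P'.x i : ℤ) = P.x j + c ∧ τ.a .Z 0 i = σ.a .S 0 j) ∧
    ∀ j < k, j < P.n → σ.a .S 0 j ≠ 0 → 0 ≤ P.x j + c →
      ∃ i < P'.n, (P'.x i : ℤ) = P.x j + c ∧ τ.a .Z 0 i = σ.a .S 0 j) C.N
    (by simpa using hP₁.N) le_rfl ?_ ?_ ?_
  · exact ⟨P, .refl P, hP₁.setv _ _, Or.inl ⟨(f₁.v _ rfl).trans hf, by omega⟩,
      fun i hi h => absurd (by simpa using hZ i hi) h, by omega⟩
  · rintro k hk τ hkτ f ⟨P', i1, i2, i3, i4, i5⟩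
    have S1 : τ.a .S = σ.a .S := (f.a _ rfl).trans (f₁.a _ rfl)
    have hn' := i2.n_lt
    rw [wp_ifz]
    refine ⟨by simp [hkτ]; omega, fun h0 => ?_, fun h0 => ?_⟩
    · simp only [Ex.eval_get, Ex.eval_num, Ex.eval_var, hkτ, S1, Int.toNat_natCast, Int.toNat_zero] at h0
      have hjk : ∀ j, j < k + 1 → σ.a .S 0 j ≠ 0 → j < k := fun j hj h => by
        rcases (show j < k ∨ j = k by omega) with h' | rfl
        · exact h'
        · exact absurd h0 h
      refine ⟨P', i1, i2.setv _ _, ?_, fun i hi h => ?_, fun j hj hj' h => ?_⟩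
      · exact i3.imp_left fun ⟨h1, h2⟩ => ⟨h1, fun j hj hj' h => h2 j (hjk j hj h) hj' h⟩
      · obtain ⟨h1, j, h2, h3⟩ := i4 i hi h
        exact ⟨h1, j, by omega, h3⟩
      · exact i5 j (hjk j hj h) hj' h
    · simp only [Ex.eval_get, Ex.eval_num, Ex.eval_var, hkτ, S1, Int.toNat_natCast, Int.toNat_zero, ne_eq] at h0
      have hkn := hS.lt_of_ne hk h0
      have hkn' : k < P'.n := hkn.trans_le i1.1
      have hx := i1.2 k hkn
      rw [wp_block_cons]
      refine wp_call (wp_fill (fun j => τ.a .E k j) i2.N (i' := 0) (by omega)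
        (fun υ j hj hυ hv ha _ => ⟨⟨trivial, rfl⟩, by simp [hυ, hv .m, hkτ]; omega,
          by simp [hυ, hv .m, hkτ, ha .E]⟩)) fun τ₁ g₁ ⟨hX, _⟩ => ?_
      have p1 := i2.frame g₁
      have hX1 : P'.Vec C.N (τ₁.a .X 0) (P.x k : ℤ) := by
        rw [← hx]; exact (i2.row k hkn').congr hX hn'.le
      have hY1 : P'.Vec C.N (τ₁.a .Y 0) c := by
        rw [show τ₁.a .Y = σ.a .Y from (g₁.a _ rfl).trans ((f.a _ rfl).trans (f₁.a _ rfl))]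
        exact i2.vec_mono hY i1
      rw [wp_block_cons]
      obtain ⟨G1, G2⟩ := hG _ (hsupp k hkn h0)
      refine wp_call (wp_add p1 (hJ.mono i1) hX1 hY1 G1) ?_
      rintro τ₂ g₂ ⟨P₂, l2, p2, hR⟩
      have hn2 := p2.n_lt
      rw [wp_block_cons]
      refine wp_call (wp_fill (fun j => τ₂.a .R 0 j) p2.N (i' := 0) (by omega)
        (fun υ j hj hυ hv ha _ => ⟨⟨trivial, rfl⟩, by simp [hυ]; omega,
          by simp [hυ, ha .R]⟩)) fun τ₃ g₃ ⟨hU, _⟩ => ?_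
      have p3 := p2.frame g₃
      have hU3 : P₂.Vec C.N (τ₃.a .U 0) (P.x k + c) := hR.congr hU hn2.le
      have hJ2 := hJ.mono (i1.trans l2)
      rw [wp_block_cons, wp_asg, wp_block_cons]
      refine ⟨trivial, ?_⟩
      -- The exponent with the number `0` is `0`, so this comparison is a test of the sign.
      refine wp_call (wp_cmp (i := 0) (u := P.x k + c) (p3.setv _ _) (by have := hJ2.1; omega) (by simp)
        (by simpa using hU3)) fun τ₄ g₄ ⟨s1, s2, s3⟩ => ?_
      have p4 : Pool C P₂ τ₄ := (p3.setv _ _).frame g₄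
      rw [hJ2.2 0 (by omega), Nat.cast_zero] at s1 s2 s3
      have Z4 : τ₄.a .Z = τ.a .Z := (g₄.a _ rfl).trans ((g₃.a _ rfl).trans ((g₂.a _ rfl).trans
        (g₁.a _ rfl)))
      have S4 : τ₄.a .S = σ.a .S := (g₄.a _ rfl).trans ((g₃.a _ rfl).trans ((g₂.a _ rfl).trans
        ((g₁.a _ rfl).trans S1)))
      have m4 : τ₄.v .m = k := (g₄.v _ rfl).trans ((g₃.v .m rfl).trans ((g₂.v .m rfl).trans
        ((g₁.v .m rfl).trans hkτ)))
      have F4 : τ₄.v .fail = τ.v .fail := (g₄.v _ rfl).trans ((g₃.v .fail rfl).trans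
        ((g₂.v .fail rfl).trans (g₁.v .fail rfl)))
      have j4 : ∀ i < C.N, τ₄.a .Z 0 i ≠ 0 → i < P₂.n ∧ ∃ j < k, j < P.n ∧ σ.a .S 0 j ≠ 0 ∧
          (P₂.x i : ℤ) = P.x j + c ∧ τ₄.a .Z 0 i = σ.a .S 0 j := fun i hi h => by
        rw [Z4] at h ⊢
        obtain ⟨h1, j, h2, h3, h4, h5, h6⟩ := i4 i hi h
        exact ⟨h1.trans_le l2.1, j, h2, h3, h4, by rw [l2.2 i h1, h5], h6⟩
      have j5 : ∀ j < k, j < P.n → σ.a .S 0 j ≠ 0 → 0 ≤ P.x j + c →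
          ∃ i < P₂.n, (P₂.x i : ℤ) = P.x j + c ∧ τ₄.a .Z 0 i = σ.a .S 0 j := fun j h1 h2 h3 h4 => by
        obtain ⟨i, h5, h6, h7⟩ := i5 j h1 h2 h3 h4
        exact ⟨i, h5.trans_le l2.1, by rw [l2.2 i h5, h6], by rw [Z4, h7]⟩
      rw [wp_block_single, wp_ifp]
      refine ⟨trivial, fun hs => ?_, fun hs => ?_⟩
      · have hneg := s3 hs
        refine ⟨trivial, P₂, i1.trans l2, (p4.setv _ _).setv _ _,
          Or.inr ⟨by simp, k, hkn, h0, hneg⟩, fun i hi h => ?_, fun j hj hj' h1 h2 => ?_⟩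
        · obtain ⟨h1, j, h2, h3⟩ := j4 i hi h
          exact ⟨h1, j, by omega, h3⟩
        · rcases (show j < k ∨ j = k by omega) with h' | rfl
          · exact j5 j h' hj' h1 h2
          · omega
      · have hpos : 0 ≤ P.x k + c := by
          have hs : τ₄.v .s ≤ 0 := hs
          rcases hs.lt_or_eq with h | h
          · exact (s2 h).le
          · rw [← s1 h]
        have hu : (((P.x k + c).toNat : ℕ) : ℤ) = P.x k + c := Int.toNat_of_nonneg hpos
        rw [wp_block_cons]
        refine wp_call (wp_find p4 (u := (P.x k + c).toNat) (G2 hpos)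
          (by rw [hu, show τ₄.a .U = τ₃.a .U from g₄.a _ rfl]; exact hU3)) ?_
        rintro τ₅ g₅ ⟨P₃, l3, p5, i, hi, hxi, hz⟩
        have hn3 := p5.n_lt
        have Z5 : τ₅.a .Z = τ₄.a .Z := g₅.a _ rfl
        have S5 : τ₅.a .S = σ.a .S := (g₅.a _ rfl).trans S4
        have m5 : τ₅.v .m = k := (g₅.v _ rfl).trans m4
        have F5 : τ₅.v .fail = τ.v .fail := (g₅.v _ rfl).trans F4
        have hxi' : (P₃.x i : ℤ) = P.x k + c := by rw [hxi, hu]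
        rw [wp_block_single, wp_put]
        refine ⟨by simp [hz]; omega, by simp [m5]; omega, P₃, (i1.trans l2).trans l3,
          (p5.seta _ _ _ _).setv _ _, ?_, ?_, ?_⟩
        · simp only [St.v_setv, St.v_seta, reduceCtorEq, if_false, F5]
          refine i3.imp_left fun ⟨h1, h2⟩ => ⟨h1, fun j hj hj' h => ?_⟩
          rcases (show j < k ∨ j = k by omega) with h' | rfl
          · exact h2 j h' hj' h
          · exact hpos
        · intro i' hi' h
          simp [hz, Z5, S5, m5] at h ⊢
          by_cases hii : i' = i
          · subst hii
            exact ⟨hi, k, by omega, hkn, h0, hxi', by simp⟩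
          · simp [hii] at h ⊢
            obtain ⟨h1, j, h2, h3, h4, h5, h6⟩ := j4 i' hi' h
            exact ⟨h1.trans_le l3.1, j, by omega, h3, h4, by rw [l3.2 i' h1, h5], h6⟩
        · intro j hj hj' h1 h2
          simp [hz, Z5, S5, m5]
          rcases (show j < k ∨ j = k by omega) with h' | rfl
          · obtain ⟨i', h3, h4, h5⟩ := j5 j h' hj' h1 h2
            refine ⟨i', h3.trans_le l3.1, by rw [l3.2 i' h3, h4], ?_⟩
            rw [if_neg, h5]
            rintro rfl
            -- Different exponents `q` give different `q + c`, so an entry written earlier is not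
            -- overwritten.
            rw [← l3.2 i' h3, hxi'] at h4
            have := hP.valid.inj j hj' k hkn (by omega)
            omega
          · exact ⟨i, hi, hxi', by simp⟩
  · rintro τ f ⟨P', i1, i2, i3, i4, i5⟩
    have hn' := i2.n_lt
    refine ⟨P', i1, i2, fun z hz => ?_, fun h0 => ?_⟩
    · obtain ⟨h1, -, h2, h3⟩ := shift_eq_some hz
      have hnn : ∀ j < P.n, σ.a .S 0 j ≠ 0 → 0 ≤ P.x j + c := fun j hj h =>
        h1 _ (hsupp j hj h)
      have hex : ∀ p, naf z p ≠ 0 → ∃ i < P'.n, P'.x i = p ∧ τ.a .Z 0 i = naf z p := fun p hp => by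
        obtain ⟨q, hq, hpq⟩ := h3 p hp
        obtain ⟨j, hj, rfl⟩ := hS.mem q (mem_supp.1 hq)
        have hSj : σ.a .S 0 j ≠ 0 := by rw [hS.dig j hj]; exact mem_supp.1 hq
        obtain ⟨i, hi, hxi, hZi⟩ := i5 j (by omega) hj hSj (hnn j hj hSj)
        refine ⟨i, hi, by omega, ?_⟩
        rw [hZi, hS.dig j hj, ← h2 _ hq, show ((P.x j : ℤ) + c).toNat = p by omega]
      refine ⟨?_, fun p hp => ?_, fun i hi => ?_, fun i hi hi' => ?_⟩
      · rcases i3 with h | ⟨-, j, hj, hSj, hneg⟩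
        · exact h.1
        · have := hnn j hj hSj; omega
      · obtain ⟨i, hi, hxi, -⟩ := hex p hp
        exact ⟨i, hi, hxi⟩
      · by_cases hz0 : τ.a .Z 0 i = 0
        · rw [hz0]
          by_contra hne
          obtain ⟨i', hi', hxi, hZi⟩ := hex _ (Ne.symm hne)
          obtain rfl := i2.valid.inj i' hi' i hi hxi
          exact hne (hz0.symm.trans hZi)
        · obtain ⟨-, j, -, hj, hSj, hxj, hZj⟩ := i4 i (by omega) hz0
          rw [hZj, hS.dig j hj, ← h2 _ (hsupp j hj hSj), ← hxj, Int.toNat_natCast]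
      · by_contra hne
        have := (i4 i hi' hne).1
        omega
    · rcases i3 with h | h
      · unfold shift at h0
        rw [if_pos] at h0
        · cases h0
        · intro q hq
          obtain ⟨j, hj, rfl⟩ := hS.mem q (mem_supp.1 hq)
          exact h.2 j (by omega) hj (by rw [hS.dig j hj]; exact mem_supp.1 hq)
      · exact h.1

end
end Cmd

/-! ### Loading the circuits of the variables -/

/-- The circuit `Q` is stored from the address `adr` on. -/
structure Stored (Q : Circuit) (adr : ℤ) (io : ℤ → ℤ) : Prop where
  nonneg : 0 ≤ adr
  n : io adr = Q.n
  mark : ∀ v : Fin Q.n, io (adr + 1 + v) = Q.mark v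
  edge : ∀ v w : Fin Q.n, io (adr + 1 + Q.n + v * Q.n + w) = Q.edge v w

/-- `m v` is `0` for the vertices that have not been treated, `1` for leaves, and `i + 2` for the
vertices whose exponent has the number `i`. -/
def IsMap (Q : Circuit) (ex : Fin Q.n → ℕ) (P : Pl) (m : ℕ → ℤ) : Prop :=
  ∀ v : Fin Q.n, m v = 0 ∨ (m v = 1 ∧ Q.IsLeaf v) ∨
    (¬ Q.IsLeaf v ∧ ∃ i < P.n, m v = i + 2 ∧ P.x i = ex v)

theorem IsMap.mono {Q : Circuit} {ex : Fin Q.n → ℕ} {P P' : Pl} {m : ℕ → ℤ} (h : IsMap Q ex P m)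
    (hP : P.Le P') : IsMap Q ex P' m := fun v => by
  rcases h v with h | h | ⟨h, i, hi, h1, h2⟩
  · exact Or.inl h
  · exact Or.inr (Or.inl h)
  · exact Or.inr (Or.inr ⟨h, i, hi.trans_le hP.1, h1, by rw [hP.2 i hi, h2]⟩)

namespace Cmd

/-- Checks whether all successors of the vertex with the edge labels from the address `row` on have
been treated. -/
def test : Cmd :=
  block [asg .good (.num 1), loop false .w .nv <| ifz (.io (.var .row + .var .w)) skip
    (ifz (.get .map (.num 0) (.var .w)) (asg .good (.num 0)) skip)]

/-- Searches a vertex all whose successors have been treated. -/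
def search : Cmd :=
  block [asg .row (.var .adr + .num 1 + .var .nv), loop false .v .nv
    (block [ifz (.get .map (.num 0) (.var .v))
        (block [test, ifz (.var .good) skip (block [asg .cand (.var .v), asg .rd (.var .row)])]) skip,
      asg .row (.var .row + .var .nv)])]

/-- Writes a vector of labels, from the address `rd` on, into the row `e` of a matrix. -/
def gather (b : Arr) : Cmd :=
  block [fill b (.var .e) (.num 0), loop false .w .nv
    (block [ifz (.io (.var .rd + .var .w)) skip (asg .leaf (.num 0)),
      ifp (.get .map (.num 0) (.var .w) - .num 1)
        (put b (.var .e) (.get .map (.num 0) (.var .w) - .num 2) (.io (.var .rd + .var .w))) skip])]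

/-- Treats one vertex of a circuit. -/
def round : Cmd :=
  block [search, asg .e (.num 0), asg .leaf (.num 1), gather .U, ifz (.var .leaf)
    (block [find, put .map (.num 0) (.var .cand) (.var .z + .num 2)])
    (put .map (.num 0) (.var .cand) (.num 1))]

/-- Loads the circuit for the variable with the symbol `sym`. -/
def load : Cmd :=
  block [asg .adr (.io (.var .L + .var .sym - .num 4)), asg .nv (.io (.var .adr)),
    fill .map (.num 0) (.num 0), loop false .f .nv round, asg .rd (.var .adr + .num 1),
    asg .e (.var .sp), asg .leaf (.num 1), gather .stk, asg .sp (.var .sp + .num 1)]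

section
variable {C : Ctx} {P : Pl} {σ : St}

theorem wp_test {Q : Circuit} (hQ : Q.n ≤ C.N) (hnv : σ.v .nv = Q.n) {s : Fin Q.n → ℤ} {row : ℤ}
    (hrow : σ.v .row = row) (hrow' : 0 ≤ row) (hs : ∀ w : Fin Q.n, σ.io (row + w) = s w) :
    test.wp C.dims σ fun τ => τ.v .good ≠ 0 ↔ ∀ w, s w ≠ 0 → σ.a .map 0 w ≠ 0 := by
  have hC := C.le_N
  rw [test, wp_block_cons, wp_asg, wp_block_single]
  refine ⟨trivial, ?_⟩
  refine wp_loop (fun k τ => τ.v .good ≠ 0 ↔ ∀ w : Fin Q.n, w.1 < k → s w ≠ 0 → σ.a .map 0 w ≠ 0)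
    Q.n (by simpa using hnv) hQ (by simp) ?_ ?_
  · intro k hk τ hkτ f hI
    have e1 : τ.v .row = row := (f.v .row rfl).trans (by simpa using hrow)
    have e2 : τ.io = σ.io := f.io rfl
    have e3 : τ.a .map = σ.a .map := f.a _ rfl
    have hs' : σ.io (row + (k : ℤ)) = s ⟨k, hk⟩ := hs ⟨k, hk⟩
    have split : ∀ p : Fin Q.n → Prop, (∀ w : Fin Q.n, w.1 < k + 1 → p w) ↔
        (∀ w : Fin Q.n, w.1 < k → p w) ∧ p ⟨k, hk⟩ := fun p =>
      ⟨fun h => ⟨fun w hw => h w (by omega), h ⟨k, hk⟩ (by simp)⟩, fun h w hw => by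
        rcases (show w.1 < k ∨ w.1 = k by omega) with h' | h'
        · exact h.1 w h'
        · obtain rfl : w = ⟨k, hk⟩ := Fin.ext h'
          exact h.2⟩
    simp only [wp_ifz, wp_skip, wp_asg, Ex.ok_io, Ex.ok_add, Ex.ok_var, Ex.eval_io, Ex.eval_add, Ex.eval_var, e1,
      e2, e3, hkτ, hs', Ex.ok_get, Ex.ok_num, Ex.eval_get, Ex.eval_num, Int.toNat_zero,
      Int.toNat_natCast, St.v_setv, split, reduceCtorEq, if_false, Ctx.dims_lay, if_true, true_and]
    refine ⟨Or.inr (by omega), fun h => ?_, fun h => ⟨by omega, fun h' => ?_, fun h' => ?_⟩⟩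
    · rw [hI]; exact ⟨fun h1 => ⟨h1, fun h2 => absurd h h2⟩, fun h1 => h1.1⟩
    · exact ⟨fun h1 => absurd rfl h1, fun h1 => absurd h' (h1.2 h)⟩
    · rw [hI]; exact ⟨fun h1 => ⟨h1, fun _ => h'⟩, fun h1 => h1.1⟩
  · intro τ _ hI
    exact hI.trans ⟨fun h w => h w w.2, fun h w _ => h w⟩

theorem wp_search {Q : Circuit} (hQ : Q.n ≤ C.N) (hnv : σ.v .nv = Q.n) {adr : ℤ}
    (hadr : σ.v .adr = adr) (hst : Stored Q adr σ.io)
    (hex : ∃ v : Fin Q.n, σ.a .map 0 v = 0 ∧ ∀ w, Q.Adj v w → σ.a .map 0 w ≠ 0) :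
    search.wp C.dims σ fun τ => ∃ v : Fin Q.n, σ.a .map 0 v = 0 ∧
      (∀ w, Q.Adj v w → σ.a .map 0 w ≠ 0) ∧ τ.v .cand = v ∧
      τ.v .rd = adr + 1 + Q.n + v * Q.n := by
  have hC := C.le_N
  have hadr0 := hst.nonneg
  rw [search, wp_block_cons, wp_asg, wp_block_single]
  refine ⟨by simp, ?_⟩
  refine wp_loop (fun k τ => τ.v .row = adr + 1 + Q.n + k * Q.n ∧
    ((∃ v : Fin Q.n, σ.a .map 0 v = 0 ∧ (∀ w, Q.Adj v w → σ.a .map 0 w ≠ 0) ∧ τ.v .cand = v ∧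
      τ.v .rd = adr + 1 + Q.n + v * Q.n) ∨ ∀ v : Fin Q.n, v.1 < k →
        ¬ (σ.a .map 0 v = 0 ∧ ∀ w, Q.Adj v w → σ.a .map 0 w ≠ 0)))
    Q.n (by simpa using hnv) hQ (by simp [hadr, hnv]) ?_ ?_
  · rintro k hk τ hkτ f ⟨i1, i2⟩
    have e1 : τ.v .nv = Q.n := (f.v .nv rfl).trans (by simpa using hnv)
    have e2 : τ.io = σ.io := f.io rfl
    have e3 : τ.a .map = σ.a .map := f.a _ rfl
    have hrow : adr + 1 + Q.n + ((k + 1 : ℕ) : ℤ) * Q.n = adr + 1 + Q.n + k * Q.n + Q.n := by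
      push_cast; ring
    have no : ¬ (σ.a .map 0 k = 0 ∧ ∀ w, Q.Adj ⟨k, hk⟩ w → σ.a .map 0 w ≠ 0) →
        ((∃ v : Fin Q.n, σ.a .map 0 v = 0 ∧ (∀ w, Q.Adj v w → σ.a .map 0 w ≠ 0) ∧ τ.v .cand = v ∧
      τ.v .rd = adr + 1 + Q.n + v * Q.n) ∨ ∀ v : Fin Q.n, v.1 < k + 1 →
        ¬ (σ.a .map 0 v = 0 ∧ ∀ w, Q.Adj v w → σ.a .map 0 w ≠ 0)) := fun h => by
      refine i2.imp_right fun h2 v hv => ?_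
      rcases (show v.1 < k ∨ v.1 = k by omega) with h' | h'
      · exact h2 v h'
      · obtain rfl : v = ⟨k, hk⟩ := Fin.ext h'
        exact h
    rw [wp_block_cons, wp_ifz]
    refine ⟨by simp [hkτ]; omega, fun h0 => ?_, fun h0 => ?_⟩
    · simp only [Ex.eval_get, Ex.eval_num, Ex.eval_var, hkτ, e3, Int.toNat_natCast, Int.toNat_zero] at h0
      rw [wp_block_cons]
      refine wp_call (wp_test (s := fun w => Q.edge ⟨k, hk⟩ w) hQ e1 i1 (by positivity) (fun w => by
        rw [e2]; exact hst.edge ⟨k, hk⟩ w)) fun τ₁ f₁ hg => ?_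
      have d1 : τ₁.v .v = k := (f₁.v .v rfl).trans hkτ
      have d2 : τ₁.v .row = adr + 1 + Q.n + k * Q.n := (f₁.v .row rfl).trans i1
      have d3 : τ₁.v .nv = Q.n := (f₁.v .nv rfl).trans e1
      have d4 : τ₁.v .cand = τ.v .cand := f₁.v .cand rfl
      have d5 : τ₁.v .rd = τ.v .rd := f₁.v .rd rfl
      have hg' : τ₁.v .good ≠ 0 ↔ ∀ w, Q.Adj ⟨k, hk⟩ w → σ.a .map 0 w ≠ 0 := by
        rw [hg, e3]
        refine forall_congr' fun w => ?_
        have : ((Q.edge ⟨k, hk⟩ w : SignType) : ℤ) ≠ 0 ↔ Q.Adj ⟨k, hk⟩ w := by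
          unfold Circuit.Adj; cases Q.edge ⟨k, hk⟩ w <;> simp
        rw [this]
      simp only [wp_block_single, wp_block_cons, wp_ifz, wp_skip, wp_asg, Ex.ok_var, Ex.eval_var,
        Ex.ok_add, Ex.eval_add, St.v_setv, d1, d2, d3, d4, d5, true_and, if_true, if_false,
        reduceCtorEq]
      refine ⟨fun h => ⟨hrow.symm, no fun h' => hg'.2 h'.2 h⟩,
        fun h => ⟨hrow.symm, Or.inl ⟨⟨k, hk⟩, h0, hg'.1 h, rfl, rfl⟩⟩⟩
    · simp only [Ex.eval_get, Ex.eval_num, Ex.eval_var, hkτ, e3, Int.toNat_natCast, Int.toNat_zero] at h0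
      rw [wp_skip, wp_block_single, wp_asg]
      refine ⟨by simp, by simp [i1, e1]; ring, ?_⟩
      simpa using no fun h => h0 h.1
  · rintro τ f ⟨-, h | h⟩
    · exact h
    · obtain ⟨v, hv⟩ := hex
      exact absurd hv (h v v.2)

/-- The number `z` is known only through its digits at the vertices: it is the exponent of a vertex
when its row of labels is read, and the value of the circuit when the marks are read. All vertices
with nonzero labels must have been treated, so that their exponents have numbers. -/
theorem wp_gather {b : Arr} (hb : b ≠ .map) (hN : σ.v .N = C.N) {e : ℕ} (he : σ.v .e = e)
    (heN : e < C.N) (hnP : P.n ≤ C.N)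
    {Q : Circuit} (hQ : Q.n ≤ C.N) (hnv : σ.v .nv = Q.n) {ex : Fin Q.n → ℕ} {rd z : ℤ}
    (hrd : σ.v .rd = rd) (hrd0 : 0 ≤ rd) {s : Fin Q.n → SignType}
    (hs : ∀ w : Fin Q.n, σ.io (rd + w) = s w)
    (hinj : ∀ i < P.n, ∀ j < P.n, P.x i = P.x j → i = j)
    (hm : IsMap Q ex P (σ.a .map 0)) (hm' : ∀ w, s w ≠ 0 → σ.a .map 0 w ≠ 0)
    (hinj' : ∀ v w, ¬ Q.IsLeaf v → ¬ Q.IsLeaf w → ex v = ex w → v = w)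
    (h1 : ∀ w, ¬ Q.IsLeaf w → naf z (ex w) = s w)
    (h2 : ∀ p, naf z p ≠ 0 → ∃ w, ¬ Q.IsLeaf w ∧ ex w = p) (hl : σ.v .leaf = 1) :
    (gather b).wp C.dims σ fun τ => P.Vec C.N (τ.a b e) z ∧ (∀ k j, k ≠ e → τ.a b k j = σ.a b k j) ∧
      (τ.v .leaf ≠ 0 ↔ ∀ w, s w = 0) := by
  have hC := C.le_N
  rw [gather, wp_block_cons]
  refine wp_call (wp_fill (fun _ => 0) hN heN (fun τ _ _ _ hv _ _ =>
      ⟨⟨trivial, by simp [hv .e, he]⟩, trivial, rfl⟩)) fun σ₁ f₁ ⟨hz, hz'⟩ => ?_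
  have ff : ∀ x, x ≠ .p → σ₁.v x = σ.v x := fun x hx => f₁.v x (by simp [fill, wv, Ne.symm hx])
  have fm : σ₁.a .map = σ.a .map := f₁.a _ (by simp [fill, wa, hb])
  have fi : σ₁.io = σ.io := f₁.io rfl
  rw [wp_block_single]
  refine wp_loop (fun k τ => (∀ k j, k ≠ e → τ.a b k j = σ.a b k j) ∧
    (τ.v .leaf ≠ 0 ↔ ∀ w : Fin Q.n, w.1 < k → s w = 0) ∧
    (∀ i < C.N, τ.a b e i ≠ 0 → ∃ w : Fin Q.n, ¬ Q.IsLeaf w ∧ σ.a .map 0 w = i + 2 ∧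
      τ.a b e i = s w) ∧
    ∀ w : Fin Q.n, w.1 < k → ∀ i < C.N, σ.a .map 0 w = i + 2 → τ.a b e i = s w)
    Q.n (by rw [ff _ (by decide), hnv]) hQ ?_ ?_ ?_
    (by simp [wv, block])
  · refine ⟨fun k j hk => hz' k j hk, by simp [ff .leaf, hl], fun i hi h => absurd (hz i hi) h, ?_⟩
    intro w hw; omega
  · rintro k hk τ hkτ f ⟨i1, i2, i3, i4⟩
    have e1 : τ.v .rd = rd := (f.v .rd (by simp [wv, block])).trans ((ff _ (by decide)).trans hrd)
    have e2 : τ.v .e = e := (f.v .e (by simp [wv, block])).trans ((ff _ (by decide)).trans he)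
    have e3 : τ.a .map = σ.a .map := (f.a _ (by simp [wa, block, hb])).trans fm
    have e4 : τ.io = σ.io := (f.io rfl).trans fi
    have hs' : σ.io (rd + (k : ℤ)) = s ⟨k, hk⟩ := hs ⟨k, hk⟩
    have hsk : ((s ⟨k, hk⟩ : SignType) : ℤ) = 0 ↔ s ⟨k, hk⟩ = 0 := by
      cases s ⟨k, hk⟩ <;> simp
    have split : ∀ p : Fin Q.n → Prop, (∀ w : Fin Q.n, w.1 < k + 1 → p w) ↔
        (∀ w : Fin Q.n, w.1 < k → p w) ∧ p ⟨k, hk⟩ := fun p =>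
      ⟨fun h => ⟨fun w hw => h w (by omega), h ⟨k, hk⟩ (by simp)⟩, fun h w hw => by
        rcases (show w.1 < k ∨ w.1 = k by omega) with h' | h'
        · exact h.1 w h'
        · obtain rfl : w = ⟨k, hk⟩ := Fin.ext h'
          exact h.2⟩
    have main : ∀ υ : St, υ.v .rd = rd → υ.v .e = e → υ.a = τ.a → υ.io = τ.io → υ.v .w = k →
        (υ.v .leaf ≠ 0 ↔ ∀ w : Fin Q.n, w.1 < k + 1 → s w = 0) →
        (ifp (.get .map (.num 0) (.var .w) - .num 1)
          (put b (.var .e) (.get .map (.num 0) (.var .w) - .num 2) (.io (.var .rd + .var .w)))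
          skip).wp C.dims υ fun υ => (∀ k j, k ≠ e → (υ.setv .w (k + 1)).a b k j = σ.a b k j) ∧
    ((υ.setv .w (k + 1)).v .leaf ≠ 0 ↔ ∀ w : Fin Q.n, w.1 < k + 1 → s w = 0) ∧
    (∀ i < C.N, (υ.setv .w (k + 1)).a b e i ≠ 0 → ∃ w : Fin Q.n, ¬ Q.IsLeaf w ∧
      σ.a .map 0 w = i + 2 ∧ (υ.setv .w (k + 1)).a b e i = s w) ∧
    ∀ w : Fin Q.n, w.1 < k + 1 → ∀ i < C.N, σ.a .map 0 w = i + 2 →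
      (υ.setv .w (k + 1)).a b e i = s w := by
      intro υ u1 u2 u3 u4 u5 u6
      have u3' : υ.a .map = σ.a .map := by rw [u3, e3]
      have u3'' : υ.a b = τ.a b := by rw [u3]
      rw [wp_ifp]
      refine ⟨by simp [u5]; omega, fun hp => ?_, fun hp => ?_⟩
      · simp only [Ex.eval_sub, Ex.eval_get, Ex.eval_num, Ex.eval_var, u5, u3', Int.toNat_natCast,
          Int.toNat_zero] at hp
        obtain ⟨hk', i, hi, hmk, hxi⟩ : ¬ Q.IsLeaf ⟨k, hk⟩ ∧ ∃ i < P.n, σ.a .map 0 k = i + 2 ∧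
            P.x i = ex ⟨k, hk⟩ := by
          rcases hm ⟨k, hk⟩ with h | h | h
          · simp only at h; omega
          · simp only at h; omega
          · exact h
        rw [wp_put]
        simp only [Ex.ok_get, Ex.ok_var, Ex.ok_sub, Ex.ok_num, Ex.ok_io, Ex.ok_add, Ex.eval_sub,
          Ex.eval_get, Ex.eval_num, Ex.eval_var, Ex.eval_io, Ex.eval_add, u1, u2, u3', u4, e4, u5,
          Int.toNat_natCast, Int.toNat_zero, hmk, add_sub_cancel_right, Ctx.dims_lay, true_and,
          St.a_setv, St.a_seta, St.v_setv, St.v_seta, hs', reduceCtorEq, if_false, u3'', and_true]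
        refine ⟨by omega, Or.inr (by omega), fun k' j hk' => ?_, u6, fun j hj h => ?_,
          (split _).2 ⟨fun w hw j hj hwj => ?_, fun j hj hwj => ?_⟩⟩
        · rw [if_neg (by tauto)]; exact i1 k' j hk'
        · by_cases hji : j = i
          · subst hji
            exact ⟨⟨k, hk⟩, hk', hmk, by simp⟩
          · rw [if_neg hji] at h ⊢
            exact i3 j hj h
        -- Different vertices have different exponents, hence different numbers, and the entry
        -- written for an earlier vertex survives.
        · rw [if_neg, i4 w hw j hj hwj]
          intro hji
          rcases hm w with h | h | ⟨h, l, hl, hml, hxl⟩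
          · omega
          · omega
          · obtain rfl : l = j := by omega
            subst hji
            have := hinj' w ⟨k, hk⟩ h hk' (hxl.symm.trans hxi)
            rw [this] at hw
            exact absurd hw (lt_irrefl _)
        · have hwj : σ.a .map 0 k = j + 2 := hwj
          rw [if_pos (by omega)]
      · simp only [Ex.eval_sub, Ex.eval_get, Ex.eval_num, Ex.eval_var, u5, u3', Int.toNat_natCast,
          Int.toNat_zero] at hp
        simp only [wp_skip, St.a_setv, St.v_setv, reduceCtorEq, if_false, u3'']
        refine ⟨i1, u6, i3, (split _).2 ⟨i4, fun j hj hwj => ?_⟩⟩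
        simp only at hwj
        omega
    rw [wp_block_cons, wp_ifz]
    refine ⟨by simp [e1, hkτ]; omega, fun h0 => ?_, fun h0 => ?_⟩ <;>
      simp only [Ex.eval_io, Ex.eval_add, Ex.eval_var, e1, e4, hkτ, hs', ne_eq, hsk] at h0
    · rw [wp_skip, wp_block_single]
      exact main τ e1 e2 rfl rfl hkτ (by rw [split, i2]; simp [h0])
    · rw [wp_asg, wp_block_single]
      exact ⟨trivial, main _ (by simpa using e1) (by simpa using e2) rfl rfl (by simpa using hkτ)
        (by rw [split]; simp [h0])⟩
  · rintro τ f ⟨i1, i2, i3, i4⟩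
    refine ⟨⟨fun p hp => ?_, fun i hi => ?_, fun i hi hi' => ?_⟩, i1,
      i2.trans ⟨fun h w => h w w.2, fun h w _ => h w⟩⟩
    · obtain ⟨w, hw, rfl⟩ := h2 p hp
      rcases hm w with h | h | ⟨h, l, hl, hml, hxl⟩
      · rw [h1 w hw] at hp
        exact absurd h (hm' w fun h => hp (by simp [h]))
      · exact absurd h.2 hw
      · exact ⟨l, hl, hxl⟩
    · by_cases h0 : τ.a b e i = 0
      · rw [h0]
        by_contra hne
        obtain ⟨w, hw, hwi⟩ := h2 _ (Ne.symm hne)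
        rw [← hwi, h1 w hw] at hne
        rcases hm w with h | h | ⟨h, l, hl, hml, hxl⟩
        · exact hm' w (fun h => hne (by simp [h])) h
        · exact absurd h.2 hw
        · obtain rfl := hinj l hl i hi (hxl.trans hwi)
          exact hne (h0.symm.trans (i4 w w.2 l (by omega) hml))
      · obtain ⟨w, hw, hwi, h⟩ := i3 i (by omega) h0
        rcases hm w with h' | h' | ⟨-, l, hl, hml, hxl⟩
        · omega
        · omega
        · obtain rfl : l = i := by omega
          rw [h, hxl, h1 w hw]
    · by_contra hne
      obtain ⟨w, hw, hwi, h⟩ := i3 i hi' hne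
      rcases hm w with h' | h' | ⟨-, l, hl, hml, hxl⟩
      · omega
      · omega
      · omega

theorem wp_round (hP : Pool C P σ) {Q : Circuit} (hQ : Q.n ≤ C.N) (hnv : σ.v .nv = Q.n) {adr : ℤ}
    (hadr : σ.v .adr = adr) (hst : Stored Q adr σ.io) {ex : Fin Q.n → ℕ} {z : ℤ}
    (hex : Q.HasExp ex z) (hG : ∀ v, ¬ Q.IsLeaf v → ex v ∈ C.G) (hm : IsMap Q ex P (σ.a .map 0))
    (hc : ∃ v : Fin Q.n, σ.a .map 0 v = 0 ∧ ∀ w, Q.Adj v w → σ.a .map 0 w ≠ 0) :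
    round.wp C.dims σ (Grows C P fun P' τ => ∃ v : Fin Q.n, σ.a .map 0 v = 0 ∧ τ.a .map 0 v ≠ 0 ∧
      (∀ w, w ≠ v.1 → τ.a .map 0 w = σ.a .map 0 w) ∧ IsMap Q ex P' (τ.a .map 0)) := by
  have hC := C.le_N
  have hn := hP.n_lt
  have hadr0 := hst.nonneg
  rw [round, wp_block_cons]
  refine wp_call (wp_search hQ hnv hadr hst hc) ?_
  rintro σ₁ f₁ ⟨v, hv1, hv2, hv3, hv4⟩
  have p1 := hP.frame f₁
  have m1 : σ₁.a .map = σ.a .map := f₁.a _ rfl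
  rw [wp_block_cons, wp_asg, wp_block_cons, wp_asg, wp_block_cons]
  refine ⟨trivial, trivial, ?_⟩
  have finish : ∀ {P'} {τ υ : St} (c : ℤ), P.Le P' → τ.a .map = σ.a .map → c ≠ 0 →
      (∀ i j, υ.a .map i j = if i = 0 ∧ j = v then c else τ.a .map i j) →
      ((c = 1 ∧ Q.IsLeaf v) ∨ (¬ Q.IsLeaf v ∧ ∃ i < P'.n, c = i + 2 ∧ P'.x i = ex v)) →
      ∃ v : Fin Q.n, σ.a .map 0 v = 0 ∧ υ.a .map 0 v ≠ 0 ∧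
      (∀ w, w ≠ v.1 → υ.a .map 0 w = σ.a .map 0 w) ∧ IsMap Q ex P' (υ.a .map 0) := by
    intro P' τ υ c hl hτ hc0 hυ hcv
    refine ⟨v, hv1, by rw [hυ, if_pos ⟨rfl, rfl⟩]; exact hc0, fun w hw => by
      rw [hυ, if_neg (by tauto), hτ], fun w => ?_⟩
    by_cases hw : w = v
    · subst hw
      rw [hυ, if_pos ⟨rfl, rfl⟩]
      exact Or.inr hcv
    · rw [hυ, if_neg (fun h => hw (Fin.ext h.2)), hτ]
      exact (hm.mono hl) w
  -- A leaf has no exponent; as all its labels vanish, `0` serves as the number that is gathered.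
  obtain ⟨z', hz1, hz2, hz3⟩ : ∃ z' : ℤ, (∀ w, ¬ Q.IsLeaf w → naf z' (ex w) = Q.edge v w) ∧
      (∀ p, naf z' p ≠ 0 → ∃ w, ¬ Q.IsLeaf w ∧ ex w = p) ∧ (¬ Q.IsLeaf v → z' = ex v) := by
    by_cases hleaf : Q.IsLeaf v
    · refine ⟨0, fun w _ => ?_, fun p hp => absurd (naf_zero p) hp, fun h => absurd hleaf h⟩
      rw [naf_zero, not_not.1 (hleaf w)]; rfl
    · exact ⟨ex v, fun w hw => hex.edge v w hleaf hw, fun p hp => hex.exists_edge v p hleaf hp,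
        fun _ => rfl⟩
  refine wp_call (wp_gather (b := .U) (e := 0) (P := P) (ex := ex) (z := z')
    (s := fun w => Q.edge v w) (by decide) (by simpa using p1.N) (by simp) (by omega) hn.le hQ
    (by simpa using (f₁.v .nv rfl).trans hnv) (by simpa using hv4) (by positivity)
    (by rw [St.io_setv, St.io_setv, f₁.io rfl]; exact hst.edge v) hP.valid.inj
    (by simpa [m1] using hm) (fun w h => by simpa [m1] using hv2 w h) hex.inj hz1 hz2 (by simp))
    fun σ₂ f₂ ⟨hU, _, hl⟩ => ?_
  have p2 : Pool C P σ₂ := ((p1.setv _ _).setv _ _).frame f₂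
  have m2 : σ₂.a .map = σ.a .map := (f₂.a _ rfl).trans m1
  have c2 : σ₂.v .cand = v := (f₂.v _ rfl).trans (by simpa using hv3)
  have hvN : (v : ℕ) < C.N := v.2.trans_le hQ
  rw [wp_block_single, wp_ifz]
  refine ⟨trivial, fun h0 => ?_, fun h0 => ?_⟩
  · have hleaf : ¬ Q.IsLeaf v := fun h => hl.2 (fun w => not_not.1 (h w)) h0
    rw [hz3 hleaf] at hU
    rw [wp_block_cons]
    refine wp_call (wp_find p2 (hG v hleaf) hU) ?_
    rintro σ₃ f₃ ⟨P', l3, p3, i, hi, hxi, hz⟩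
    have c3 : σ₃.v .cand = v := (f₃.v _ rfl).trans c2
    rw [wp_block_single, wp_put]
    refine ⟨by simp [c3]; omega, by simp, P', l3, p3.seta _ _ _ _,
      finish (τ := σ₃) (i + 2) l3 ((f₃.a _ rfl).trans m2) (by omega) (fun k j => by
        simp [c3, hz]) (Or.inr ⟨hleaf, i, hi, rfl, hxi⟩)⟩
  · have hleaf : Q.IsLeaf v := fun w => not_not.2 (hl.1 h0 w)
    rw [wp_put]
    refine ⟨by simp [c2]; omega, by simp, P, .refl P, p2.seta _ _ _ _,
      finish (τ := σ₂) 1 (.refl P) m2 (by omega) (fun k j => by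
        simp [c2]) (Or.inl ⟨rfl, hleaf⟩)⟩

/-- Each round treats one vertex, so as many rounds as there are vertices suffice. Afterwards the
marks are gathered into a new row of the stack. -/
theorem wp_load (hP : Pool C P σ) {Q : Circuit} (hQ : Q.n ≤ C.N) {adr : ℤ}
    (hL : 0 ≤ σ.v .L + σ.v .sym - 4) (hadr : σ.io (σ.v .L + σ.v .sym - 4) = adr)
    (hst : Stored Q adr σ.io) {ex : Fin Q.n → ℕ} {z : ℤ}
    (hex : Q.HasExp ex z) (hG : ∀ v, ¬ Q.IsLeaf v → ex v ∈ C.G) {h : ℕ} (hsp : σ.v .sp = h)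
    (hh : h < C.N) :
    load.wp C.dims σ (Grows C P fun P' τ => P'.Vec C.N (τ.a .stk h) z ∧
      (∀ k j, k ≠ h → τ.a .stk k j = σ.a .stk k j) ∧ τ.v .sp = h + 1) := by
  classical
  have hC := C.le_N
  have hadr0 := hst.nonneg
  have hn0 := hst.n
  rw [load, wp_block_cons, wp_asg, wp_block_cons, wp_asg, wp_block_cons]
  refine ⟨by simp; omega, by simp [hadr]; omega, ?_⟩
  refine wp_call (wp_fill (i' := 0) (fun _ => 0) (by simpa using hP.N) (by omega) (fun τ _ _ _ _ _ _ =>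
      ⟨⟨trivial, rfl⟩, trivial, rfl⟩)) fun σ₁ f₁ ⟨hZ, _⟩ => ?_
  have p1 : Pool C P σ₁ := ((hP.setv _ _).setv _ _).frame f₁
  have adr1 : σ₁.v .adr = adr := (f₁.v _ rfl).trans (by simp [hadr])
  have nv1 : σ₁.v .nv = Q.n := (f₁.v _ rfl).trans (by simp [hadr, hn0])
  have io1 : σ₁.io = σ.io := f₁.io rfl
  have sp1 : σ₁.v .sp = h := (f₁.v _ rfl).trans (by simp [hsp])
  have stk1 : σ₁.a .stk = σ.a .stk := f₁.a _ rfl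
  rw [wp_block_cons]
  refine wp_loop (fun k τ => ∃ P', P.Le P' ∧ Pool C P' τ ∧ IsMap Q ex P' (τ.a .map 0) ∧
    (Finset.univ.filter fun v : Fin Q.n => τ.a .map 0 v = 0).card + k = Q.n)
    Q.n nv1 hQ ?_ ?_ ?_
  · have hZ' : ∀ v : Fin Q.n, σ₁.a .map 0 v = 0 := fun v => hZ v (v.2.trans_le hQ)
    exact ⟨P, .refl P, p1.setv _ _, fun v => Or.inl (hZ' v), by simp [hZ']⟩
  · rintro k hk τ hkτ f ⟨P', i1, i2, i3, i4⟩
    have hne : (Finset.univ.filter fun v : Fin Q.n => τ.a .map 0 v = 0).Nonempty := by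
      rw [← Finset.card_pos]; omega
    -- Acyclicity provides an untreated vertex all of whose successors have been treated.
    obtain ⟨v, hv, hmin⟩ := Q.wellFounded_adj.has_min {v | τ.a .map 0 v = 0}
      (let ⟨v, hv⟩ := hne; ⟨v, (Finset.mem_filter.1 hv).2⟩)
    refine wp_call (wp_round i2 hQ ((f.v .nv rfl).trans nv1) ((f.v .adr rfl).trans adr1)
      (by rw [f.io rfl, io1]; exact hst) hex hG i3
      ⟨v, hv, fun w hw hw' => hmin w hw' hw⟩) ?_
    rintro υ g ⟨P'', l, q, u, hu1, hu2, hu3, hu4⟩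
    refine ⟨P'', i1.trans l, q.setv _ _, hu4, ?_⟩
    have : (Finset.univ.filter fun v : Fin Q.n => υ.a .map 0 v = 0) =
        (Finset.univ.filter fun v : Fin Q.n => τ.a .map 0 v = 0).erase u := by
      ext w
      simp only [Finset.mem_filter, Finset.mem_univ, true_and, Finset.mem_erase]
      by_cases hw : w = u
      · subst hw; simp [hu2]
      · rw [hu3 w fun h => hw (Fin.ext h)]; simp [hw]
    have h1 := congrArg Finset.card this
    rw [Finset.card_erase_of_mem (by simp [hu1])] at h1
    have h2 := Finset.card_pos.2 hne
    have h3 : (Finset.univ.filter fun v : Fin Q.n => υ.a .map 0 v = 0).card + (k + 1) = Q.n := by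
      omega
    exact h3
  · rintro τ f ⟨P', i1, i2, i3, i4⟩
    have hempty : ∀ v : Fin Q.n, τ.a .map 0 v ≠ 0 := fun v hv => by
      have : 0 < (Finset.univ.filter fun v : Fin Q.n => τ.a .map 0 v = 0).card :=
        Finset.card_pos.2 ⟨v, by simp [hv]⟩
      omega
    have adr2 : τ.v .adr = adr := (f.v .adr rfl).trans adr1
    have io2 : τ.io = σ.io := (f.io rfl).trans io1
    have sp2 : τ.v .sp = h := (f.v .sp rfl).trans sp1
    have stk2 : τ.a .stk = σ.a .stk := (f.a _ rfl).trans stk1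
    rw [wp_block_cons, wp_asg, wp_block_cons, wp_asg, wp_block_cons]
    refine ⟨by simp, trivial, trivial, ?_⟩
    refine wp_block_cons.2 ?_
    refine wp_call (wp_gather (b := .stk) (e := h) (P := P') (ex := ex) (z := z)
      (s := fun w => Q.mark w) (rd := adr + 1) (by decide) (by simpa using i2.N) (by simp [sp2]) hh
      i2.n_lt.le hQ (by simpa using (f.v .nv rfl).trans nv1) (by simp [adr2]) (by positivity)
      (by simpa [io2] using hst.mark) i2.valid.inj (by simpa using i3)
      (fun w _ => by simpa using hempty w) hex.inj hex.mark hex.exists_mark (by simp))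
      fun υ g ⟨hV, hrow, _⟩ => ?_
    have q : Pool C P' υ := (((i2.setv _ _).setv _ _).setv _ _).frame g
    rw [wp_block_single, wp_asg]
    refine ⟨by simp, P', i1, q.setv _ _, by simpa using hV, fun k j hk => ?_, ?_⟩
    · rw [St.a_setv, hrow k j hk, St.a_setv, St.a_setv, St.a_setv, stk2]
    · simpa using (g.v .sp rfl).trans (by simp [sp2])

end
end Cmd

/-! ### Evaluation of terms in reverse Polish notation -/

namespace Cmd

/-- Pushes the constant `0` on the stack. -/
def pushZero : Cmd := block [fill .stk (.var .sp) (.num 0), asg .sp (.var .sp + .num 1)]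

/-- Pushes the constant `1` on the stack. -/
def pushOne : Cmd :=
  block [fill .stk (.var .sp) (.num 0), put .stk (.var .sp) (.num 0) (.num 1),
    asg .sp (.var .sp + .num 1)]

/-- The entry `p` of the topmost row of the stack. -/
def top : Ex := .get .stk (.var .sp + .num 1) (.var .p)

/-- Applies the operation `c`, with the operands in `b` and `Y` and the result in `b'`. -/
def binary (b b' : Arr) (e : Ex) (c : Cmd) : Cmd :=
  block [asg .sp (.var .sp - .num 2), fill b (.num 0) (.get .stk (.var .sp) (.var .p)),
    fill .Y (.num 0) e, c, fill .stk (.var .sp) (.get b' (.num 0) (.var .p)),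
    asg .sp (.var .sp + .num 1)]

/-- Treats one symbol of a term. -/
def step : Cmd :=
  ifz (.var .fail) (block [asg .sym (.io (.var .idx + .num 2)),
    ifz (.var .sym) pushZero <| ifz (.var .sym - .num 1) pushOne <|
    ifz (.var .sym - .num 2) (binary .X .R top add) <|
    ifz (.var .sym - .num 3) (binary .X .R (.num 0 - top) add) <|
    ifz (.var .sym - .num 4) (binary .S .Z top mul) <|
    ifz (.var .sym - .num 5) (binary .S .Z (.num 0 - top) mul) load]) skip

end Cmd

/-- The state during the evaluation of a term, with the stack `st`. -/
structure Run (C : Ctx) (io : ℤ → ℤ) (P : Pl) (st : List ℤ) (σ : St) : Prop where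
  pool : Pool C P σ
  base : P.Base (C.K + 1)
  sp : σ.v .sp = st.length
  vec : ∀ i z, st[i]? = some z → P.Vec C.N (σ.a .stk i) z
  io : σ.io = io
  L : σ.v .L = C.L
  fail : σ.v .fail = 0

/-- The state after the evaluation of a term, with the stack `st` before it and the result `r`. -/
def Result (C : Ctx) (io : ℤ → ℤ) (st : List ℤ) (r : Option ℤ) (σ : St) : Prop :=
  (∀ z, r = some z → ∃ P, Run C io P (st ++ [z]) σ) ∧ (r = none → σ.v .fail = 1 ∧ σ.v .L = C.L)

section
variable {C : Ctx} {P : Pl} {σ : St} {io : ℤ → ℤ} {st : List ℤ}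

theorem Run.push {P P' : Pl} {σ τ : St} (h : Run C io P st σ) (hP : P.Le P') (hp : Pool C P' τ)
    (hrow : ∀ k j, k ≠ st.length → τ.a .stk k j = σ.a .stk k j) {z : ℤ}
    (hz : P'.Vec C.N (τ.a .stk st.length) z) (hsp : τ.v .sp = st.length + 1) (hio : τ.io = io)
    (hL : τ.v .L = C.L) (hf : τ.v .fail = 0) : Run C io P' (st ++ [z]) τ := by
  refine ⟨hp, h.base.mono hP, by simp [hsp], fun i w hw => ?_, hio, hL, hf⟩
  rcases lt_trichotomy i st.length with hi | rfl | hi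
  · rw [List.getElem?_append_left hi] at hw
    rw [show τ.a .stk i = σ.a .stk i from funext fun j => hrow i j hi.ne]
    exact hp.vec_mono (h.vec i w hw) hP
  · simp at hw
    rwa [← hw]
  · rw [List.getElem?_eq_none (by simp; omega)] at hw
    cases hw

theorem Run.setSym (h : Run C io P st σ) (z : ℤ) : Run C io P st (σ.setv .sym z) :=
  ⟨h.pool.setv _ _, h.base, by simp [h.sp], h.vec, h.io, by simp [h.L], by simp [h.fail]⟩

theorem Run.setIdx (h : Run C io P st σ) (z : ℤ) : Run C io P st (σ.setv .idx z) :=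
  ⟨h.pool.setv _ _, h.base, by simp [h.sp], h.vec, h.io, by simp [h.L], by simp [h.fail]⟩

theorem Result.setIdx {r : Option ℤ} (h : Result C io st r σ) (z : ℤ) :
    Result C io st r (σ.setv .idx z) :=
  ⟨fun w hw => let ⟨P, hP⟩ := h.1 w hw; ⟨P, hP.setIdx z⟩, fun hr => by simpa using h.2 hr⟩

namespace Cmd

theorem wp_pushZero (h : Run C io P st σ) (hst : st.length < C.N) :
    pushZero.wp C.dims σ (Result C io st (some 0)) := by
  rw [pushZero, wp_block_cons]
  refine wp_call (wp_fill (fun _ => 0) h.pool.N hst (fun τ _ _ _ hv _ _ =>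
    ⟨⟨trivial, by simp [hv .sp, h.sp]⟩, trivial, rfl⟩)) fun τ f ⟨hZ, hrow⟩ => ?_
  rw [wp_block_single, wp_asg]
  have hp := h.pool.frame f
  refine ⟨by simp, fun z hz => ⟨P, ?_⟩, fun h => by cases h⟩
  obtain rfl := Option.some.inj hz
  exact h.push (.refl P) (hp.setv _ _) hrow (Pl.vec_zero hZ hp.n_lt.le)
    (by simpa using (f.v _ rfl).trans h.sp) ((f.io rfl).trans h.io)
    (by simpa using (f.v _ rfl).trans h.L) (by simpa using (f.v _ rfl).trans h.fail)

theorem wp_pushOne (h : Run C io P st σ) (hst : st.length < C.N) :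
    pushOne.wp C.dims σ (Result C io st (some 1)) := by
  have hC := C.le_N
  rw [pushOne, wp_block_cons]
  refine wp_call (wp_fill (fun _ => 0) h.pool.N hst (fun τ _ _ _ hv _ _ =>
    ⟨⟨trivial, by simp [hv .sp, h.sp]⟩, trivial, rfl⟩)) fun τ f ⟨hZ, hrow⟩ => ?_
  have hp := h.pool.frame f
  have hsp : τ.v .sp = st.length := (f.v _ rfl).trans h.sp
  rw [wp_block_cons, wp_put, wp_block_single, wp_asg]
  refine ⟨by simp [hsp]; omega, by simp, by simp, fun z hz => ⟨P, ?_⟩, fun h => by cases h⟩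
  obtain rfl := Option.some.inj hz
  have hb := h.base
  have hn := hp.n_lt
  have h0 : P.x 0 = 0 := hb.2 0 (by omega)
  refine h.push (.refl P) ((hp.seta _ _ _ _).setv _ _) (fun k j hk => ?_) ⟨fun p hp => ?_, fun i hi => ?_,
    fun i hi hi' => ?_⟩ (by simpa using hsp) ((f.io rfl).trans h.io)
    (by simpa using (f.v _ rfl).trans h.L) (by simpa using (f.v _ rfl).trans h.fail)
  · simp [hsp, hk, hrow k j hk]
  · rw [naf_one] at hp
    exact ⟨0, by have := hb.1; omega, by rw [h0]; by_contra h; exact hp (if_neg (Ne.symm h))⟩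
  · rw [naf_one]
    by_cases hi0 : i = 0
    · subst hi0; simp [hsp, h0]
    · have : P.x i ≠ 0 := fun h' => hi0 (hp.valid.inj i hi 0 (by have := hb.1; omega) (by rw [h', h0]))
      simp [hsp, hi0, this, hZ i (by omega)]
  · have : i ≠ 0 := by have := hb.1; omega
    simp [hsp, this, hZ i hi']

/-- The expression `e` reads the second operand `y` and may negate it; `z` is the number actually
passed to the operation. Thus `+` and `-`, and likewise the two shifts, share one treatment. -/
theorem wp_binary {b b' : Arr} {e : Ex} {c : Cmd} {r : Option ℤ} {x y z : ℤ}
    (h : Run C io P (st ++ [x, y]) σ) (hst : st.length + 2 ≤ C.N) (hb : b ≠ .Y ∧ b ≠ .stk)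
    (hk : Cmd.keeps (fill b (.num 0) (.get .stk (.var .sp) (.var .p))) = true)
    (he : ∀ τ : St, 0 ≤ τ.v .sp + 1 → τ.v .sp + 1 < C.N → 0 ≤ τ.v .p → τ.v .p < C.N → e.Ok C.N τ)
    (hez : ∀ τ : St, P.Vec C.N (τ.a .stk (τ.v .sp + 1).toNat) y → ∃ v, P.Vec C.N v z ∧
      ∀ υ : St, υ.v .sp = τ.v .sp → υ.a .stk = τ.a .stk → e.eval υ = v (υ.v .p).toNat)
    (hc : ∀ τ, Pool C P τ → P.Vec C.N (τ.a b 0) x → P.Vec C.N (τ.a .Y 0) z → τ.v .fail = 0 →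
      c.wp C.dims τ (Grows C P fun P' τ => (∀ w, r = some w → τ.v .fail = 0 ∧
        P'.Vec C.N (τ.a b' 0) w) ∧ (r = none → τ.v .fail = 1)))
    (hcw : (c.wv .sp || c.wv .L || c.wa .stk || c.wo) = false) (hb' : b' ≠ .stk) :
    (binary b b' e c).wp C.dims σ (Result C io st r) := by
  simp only [Bool.or_eq_false_iff] at hcw
  obtain ⟨⟨⟨w1, w2⟩, w3⟩, w4⟩ := hcw
  have hC := C.le_N
  have hp := h.pool
  have hn := hp.n_lt
  have hx : P.Vec C.N (σ.a .stk st.length) x := h.vec _ x (by simp)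
  have hy : P.Vec C.N (σ.a .stk (st.length + 1)) y := h.vec _ y (by simp)
  have hsp : σ.v .sp - 2 = st.length := by rw [h.sp]; simp
  have hst' : Run C io P st (σ.setv .sp (σ.v .sp - 2)) := ⟨hp.setv _ _, h.base, by simp [hsp],
    fun i w hw => by
      have hi : i < st.length := by
        by_contra hi
        rw [List.getElem?_eq_none (by omega)] at hw; cases hw
      exact h.vec i w (by rw [List.getElem?_append_left hi, hw]), h.io, by simp [h.L],
    by simp [h.fail]⟩
  rw [binary, wp_block_cons, wp_asg, wp_block_cons]
  refine ⟨by simp, ?_⟩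
  refine wp_call (wp_fill (fun j => σ.a .stk st.length j) (by simpa using hp.N) (i' := 0) (by omega)
    (fun τ k hk hτ hv ha _ => ⟨⟨trivial, rfl⟩, by simp [hv .sp, hsp, hτ]; omega,
      by simp [hv .sp, hsp, hτ, ha .stk hb.2.symm]⟩)) fun τ₁ f₁ ⟨hX, _⟩ => ?_
  have p1 : Pool C P τ₁ := (hp.setv _ _).frame f₁ hk
  have sp1 : τ₁.v .sp = st.length := (f₁.v _ rfl).trans (by simpa using hsp)
  have stk1 : τ₁.a .stk = σ.a .stk := f₁.a _ (by simp [fill, wa, hb.2])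
  have sp1' : (τ₁.v .sp + 1).toNat = st.length + 1 := by omega
  obtain ⟨v, hv1, hv2⟩ := hez τ₁ (by rw [stk1, sp1']; exact hy)
  rw [wp_block_cons]
  refine wp_call (wp_fill v p1.N (i' := 0) (by omega)
    (fun τ k hk hτ hv ha _ => ⟨⟨trivial, rfl⟩, he τ (by rw [hv .sp (by decide)]; omega)
      (by rw [hv .sp (by decide)]; omega) (by omega) (by omega),
      by rw [hv2 τ (hv .sp (by decide)) (ha .stk (by decide)), hτ, Int.toNat_natCast]⟩))
    fun τ₂ f₂ ⟨hY, _⟩ => ?_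
  have p2 : Pool C P τ₂ := p1.frame f₂
  have f2 : τ₂.v .fail = 0 := (f₂.v _ rfl).trans ((f₁.v _ rfl).trans (by simpa using h.fail))
  rw [wp_block_cons]
  refine wp_call (hc τ₂ p2 ?_ ?_ f2) ?_
  · rw [show τ₂.a b = τ₁.a b from f₂.a _ (by simp [fill, wa, hb.1.symm])]
    exact hx.congr (fun i hi => hX i hi) hn.le
  · exact hv1.congr hY hn.le
  · rintro τ₃ f₃ ⟨P', l, p3, h1, h2⟩
    have sp3 : τ₃.v .sp = st.length := (f₃.v _ w1).trans ((f₂.v _ rfl).trans sp1)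
    have L3 : τ₃.v .L = C.L := (f₃.v _ w2).trans ((f₂.v _ rfl).trans ((f₁.v _ rfl).trans
      (by simpa using h.L)))
    have stk3 : τ₃.a .stk = σ.a .stk := (f₃.a _ w3).trans ((f₂.a _ rfl).trans stk1)
    have io3 : τ₃.io = io := (f₃.io w4).trans ((f₂.io rfl).trans ((f₁.io rfl).trans h.io))
    rw [wp_block_cons]
    refine wp_call (wp_fill (fun j => τ₃.a b' 0 j) p3.N (i' := st.length) (by omega)
      (fun τ k hk hτ hv ha _ => ⟨⟨trivial, by simp [hv .sp, sp3]⟩, by simp [hτ]; omega,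
        by simp [hτ, ha b' hb']⟩)) fun τ₄ f₄ ⟨hR, hrow⟩ => ?_
    have p4 : Pool C P' τ₄ := p3.frame f₄
    rw [wp_block_single, wp_asg]
    refine ⟨by simp, fun w hw => ⟨P', ?_⟩, fun hr => ⟨?_, ?_⟩⟩
    · obtain ⟨e1, e2⟩ := h1 w hw
      refine hst'.push l (p4.setv _ _) (fun k j hk => ?_) (e2.congr hR p4.n_lt.le)
        (by simpa using (f₄.v _ rfl).trans sp3) ((f₄.io rfl).trans io3)
        (by simpa using (f₄.v _ rfl).trans L3) (by simpa using (f₄.v _ rfl).trans e1)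
      rw [St.a_setv, hrow k j hk, stk3, St.a_setv]
    · simpa using (f₄.v _ rfl).trans (h2 hr)
    · simpa using (f₄.v _ rfl).trans L3

theorem top_vec {y : ℤ} (τ : St) (h : P.Vec C.N (τ.a .stk (τ.v .sp + 1).toNat) y) :
    ∃ v, P.Vec C.N v y ∧ ∀ υ : St, υ.v .sp = τ.v .sp → υ.a .stk = τ.a .stk →
      top.eval υ = v (υ.v .p).toNat :=
  ⟨_, h, fun υ h1 h2 => by simp [top, h1, h2]⟩

/-- Negation changes the signs of the digits and involves no new exponents. -/
theorem neg_top_vec {y : ℤ} (τ : St) (h : P.Vec C.N (τ.a .stk (τ.v .sp + 1).toNat) y) :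
    ∃ v, P.Vec C.N v (-y) ∧ ∀ υ : St, υ.v .sp = τ.v .sp → υ.a .stk = τ.a .stk →
      (.num 0 - top : Ex).eval υ = v (υ.v .p).toNat :=
  ⟨fun i => -τ.a .stk (τ.v .sp + 1).toNat i,
    ⟨fun p hp => h.mem p fun h0 => hp (by rw [naf_neg, h0, neg_zero]),
      fun i hi => by rw [h.dig i hi, naf_neg], fun i hi hi' => by rw [h.zero i hi hi', neg_zero]⟩,
    fun υ h1 h2 => by simp [top, h1, h2]⟩

theorem wp_binary_add {e : Ex} {x y z : ℤ}
    (h : Run C io P (st ++ [x, y]) σ) (hst : st.length + 2 ≤ C.N)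
    (he : ∀ τ : St, 0 ≤ τ.v .sp + 1 → τ.v .sp + 1 < C.N → 0 ≤ τ.v .p → τ.v .p < C.N → e.Ok C.N τ)
    (hez : ∀ τ : St, P.Vec C.N (τ.a .stk (τ.v .sp + 1).toNat) y → ∃ v, P.Vec C.N v z ∧
      ∀ υ : St, υ.v .sp = τ.v .sp → υ.a .stk = τ.a .stk → e.eval υ = v (υ.v .p).toNat)
    (hG : supp (x + z) ⊆ C.G) :
    (binary .X .R e add).wp C.dims σ (Result C io st (some (x + z))) := by
  refine wp_binary h hst (by decide) rfl he hez (fun τ hp hX hY hf => ?_) rfl (by decide)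
  refine wp_call (wp_add hp h.base hX hY hG) ?_
  rintro τ' f ⟨P', l, p, hR⟩
  exact ⟨P', l, p, fun w hw => ⟨(f.v _ rfl).trans hf, by rwa [← Option.some.inj hw]⟩,
    fun h => by cases h⟩

theorem wp_binary_mul {e : Ex} {x y z : ℤ}
    (h : Run C io P (st ++ [x, y]) σ) (hst : st.length + 2 ≤ C.N)
    (he : ∀ τ : St, 0 ≤ τ.v .sp + 1 → τ.v .sp + 1 < C.N → 0 ≤ τ.v .p → τ.v .p < C.N → e.Ok C.N τ)
    (hez : ∀ τ : St, P.Vec C.N (τ.a .stk (τ.v .sp + 1).toNat) y → ∃ v, P.Vec C.N v z ∧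
      ∀ υ : St, υ.v .sp = τ.v .sp → υ.a .stk = τ.a .stk → e.eval υ = v (υ.v .p).toNat)
    (hG : ∀ q ∈ supp x, supp (q + z) ⊆ C.G ∧ (0 ≤ q + z → (q + z).toNat ∈ C.G)) :
    (binary .S .Z e mul).wp C.dims σ (Result C io st (shift x z)) :=
  wp_binary h hst (by decide) rfl he hez (fun _ hp hX hY hf => wp_mul hp h.base hX hY hG hf) rfl
    (by decide)

/-- The circuits for the variables are stored, with the table of their addresses. -/
structure Env {k : ℕ} (C : Ctx) (η : Fin k → Circuit) (ρ : Fin k → ℤ)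
    (ex : ∀ x, Fin (η x).n → ℕ) (io : ℤ → ℤ) : Prop where
  stored : ∀ x : Fin k, Stored (η x) (io (2 + C.L + x)) io
  hasExp : ∀ x, (η x).HasExp (ex x) (ρ x)

theorem wp_step_of {σ : St} {Q : St → Prop} {idx : ℕ} (hi : σ.v .idx = idx) (hf : σ.v .fail = 0)
    {s : ℕ} (hs : σ.io (2 + idx) = s)
    (h0 : s = 0 → pushZero.wp C.dims (σ.setv .sym s) Q)
    (h1 : s = 1 → pushOne.wp C.dims (σ.setv .sym s) Q)
    (h2 : s = 2 → (binary .X .R top add).wp C.dims (σ.setv .sym s) Q)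
    (h3 : s = 3 → (binary .X .R (.num 0 - top) add).wp C.dims (σ.setv .sym s) Q)
    (h4 : s = 4 → (binary .S .Z top mul).wp C.dims (σ.setv .sym s) Q)
    (h5 : s = 5 → (binary .S .Z (.num 0 - top) mul).wp C.dims (σ.setv .sym s) Q)
    (h6 : 6 ≤ s → load.wp C.dims (σ.setv .sym s) Q) : step.wp C.dims σ Q := by
  have hs' : σ.io (idx + 2) = s := by rw [add_comm, hs]
  rw [step, wp_ifz]
  refine ⟨trivial, fun _ => ?_, fun h => absurd hf h⟩
  rw [wp_block_cons, wp_asg, wp_block_single]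
  refine ⟨by simp [hi]; omega, ?_⟩
  simp only [Ex.eval_io, Ex.eval_add, Ex.eval_var, Ex.eval_num, hi, hs', wp_ifz, Ex.ok_var,
    Ex.ok_sub, Ex.ok_num, Ex.eval_sub, St.v_setv, if_true, true_and, and_true]
  refine ⟨fun h => h0 (by omega), fun _ => ⟨fun h => h1 (by omega), fun _ => ⟨fun h => h2 (by omega),
    fun _ => ⟨fun h => h3 (by omega), fun _ => ⟨fun h => h4 (by omega), fun _ =>
      ⟨fun h => h5 (by omega), fun _ => h6 (by omega)⟩⟩⟩⟩⟩⟩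

theorem iter_one {σ : St} {idx : ℕ} (hi : σ.v .idx = idx) (hL : σ.v .L = C.L) {r : Option ℤ}
    (h : step.wp C.dims σ (Result C io st r)) :
    iter (step.wp C.dims) .idx .L C.L 1 idx σ (Result C io st r) :=
  wp_call h fun _ f hτ => ⟨(f.v _ rfl).trans hi, (f.v _ rfl).trans hL, hτ.setIdx _⟩

/-- Once the flag is set, the remaining symbols are passed over without effect. -/
theorem iter_fail (m : ℕ) : ∀ (idx : ℕ) (σ : St), σ.v .idx = idx → σ.v .fail = 1 ∧ σ.v .L = C.L →
    iter (step.wp C.dims) .idx .L C.L m idx σ fun τ => τ.v .fail = 1 ∧ τ.v .L = C.L := by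
  induction m with
  | zero => exact fun _ _ _ h => h
  | succ m ih =>
    intro idx σ hi ⟨hf, hL⟩
    refine ⟨trivial, fun h => ?_, fun _ => ⟨hi, hL, ih _ _ (by simp) (by simpa using ⟨hf, hL⟩)⟩⟩
    simp [hf] at h

theorem iter_index {b : St → (St → Prop) → Prop} {x y : Var} {n : ℕ}
    (hb : ∀ σ Q R, b σ Q → (∀ τ, Q τ → R τ) → b σ R) (m : ℕ) :
    ∀ (k : ℕ) (σ : St) (Q : St → Prop), σ.v x = k → iter b x y n m k σ Q →
      iter b x y n m k σ fun τ => τ.v x = (k + m : ℕ) ∧ Q τ := by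
  induction m with
  | zero => exact fun k σ Q hk h => ⟨hk, h⟩
  | succ m ih =>
    intro k σ Q hk h
    refine hb _ _ _ h fun τ ⟨h1, h2, h3⟩ => ⟨h1, h2, iter_mono hb _ _ _ _ _
      (ih _ _ _ (by simp) h3) fun υ ⟨h4, h5⟩ => ⟨by rw [h4]; push_cast; ring, h5⟩⟩

theorem step_mono (C : Ctx) (σ : St) (Q R : St → Prop) (h : step.wp C.dims σ Q)
    (hQ : ∀ τ, Q τ → R τ) : step.wp C.dims σ R := wp_mono h hQ

end Cmd

open Cmd

theorem Term.encode_length {k : ℕ} (t : Term (Fin k)) : t.encode.length = 2 * t.size + 1 := by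
  induction t <;> simp [encode, size, *] <;> ring

/-- The rounds of the main loop for the symbols of `t`, from the index `idx` on, push the value
of `t` on the stack. -/
def Evaluates {k : ℕ} (C : Ctx) (io : ℤ → ℤ) (ρ : Fin k → ℤ) (t : Term (Fin k)) : Prop :=
  ∀ (idx : ℕ) (P : Pl) (st : List ℤ) (σ : St), (∀ i z, t.encode[i]? = some z → io (2 + (idx + i : ℕ)) = z) →
    σ.v .idx = idx → Run C io P st σ → st.length ≤ idx → idx + t.encode.length ≤ C.L →
    iter (step.wp C.dims) .idx .L C.L t.encode.length idx σ (Result C io st (t.ev ρ))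

/-- The rounds split into those for `s`, those for `t` and one for the operator. The stack is never
higher than the number of symbols read, which keeps its rows within the dimension of the matrices.
-/
theorem Evaluates.binary {k : ℕ} {ρ : Fin k → ℤ} {r s t : Term (Fin k)} {c : ℤ}
    (hs : Evaluates C io ρ s) (ht : Evaluates C io ρ t) (hr : r.encode = s.encode ++ t.encode ++ [c])
    {f : ℤ → ℤ → Option ℤ} (hev : r.ev ρ = (s.ev ρ).bind fun a => (t.ev ρ).bind fun b => f a b)
    (hop : ∀ (a b : ℤ), s.ev ρ = some a → t.ev ρ = some b → ∀ (idx : ℕ) (P : Pl) (st : List ℤ) (σ : St),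
      σ.v .idx = idx → σ.io (2 + idx) = c → Run C io P (st ++ [a, b]) σ → st.length + 2 ≤ C.N →
      step.wp C.dims σ (Result C io st (f a b))) : Evaluates C io ρ r := by
  intro idx P st σ hio hi h hst hlen
  have ls := s.encode_length
  have lt := t.encode_length
  have hL := C.L_lt
  have hlr : r.encode.length = s.encode.length + t.encode.length + 1 := by simp [hr, add_assoc]
  rw [hlr] at hlen ⊢
  have hmono := step_mono C
  have fails : ∀ (m idx : ℕ) (τ : St), τ.v .idx = idx → τ.v .fail = 1 ∧ τ.v .L = C.L → r.ev ρ = none →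
      iter (step.wp C.dims) .idx .L C.L m idx τ (Result C io st (r.ev ρ)) := fun m idx τ h1 h2 h3 =>
    iter_mono hmono _ _ _ _ _ (iter_fail m idx τ h1 h2) fun υ h4 =>
      ⟨fun z hz => absurd (h3.symm.trans hz) (by simp), fun _ => h4⟩
  rw [add_assoc]
  refine iter_add _ _ hmono _ _ _ (iter_mono hmono _ _ _ _ _ (iter_index hmono _ _ _ _ hi
    (hs idx P st σ (fun i z hz => hio i z ?_) hi h hst (by omega))) ?_)
  · rw [hr, List.append_assoc, List.getElem?_append_left (List.getElem?_eq_some_iff.1 hz).1, hz]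
  rintro τ₁ ⟨i1, r1⟩
  rcases hsev : s.ev ρ with _ | a
  · exact fails _ _ _ i1 (r1.2 hsev) (by rw [hev, hsev]; rfl)
  obtain ⟨P₁, h1⟩ := r1.1 a hsev
  refine iter_add _ _ hmono _ _ _ (iter_mono hmono _ _ _ _ _ (iter_index hmono _ _ _ _ i1
    (ht _ P₁ _ τ₁ (fun i z hz => ?_) i1 h1 (by simp; omega) (by omega))) ?_)
  · have := hio (s.encode.length + i) z (by
      rw [hr, List.append_assoc, List.getElem?_append_right (by omega), Nat.add_sub_cancel_left,
        List.getElem?_append_left (List.getElem?_eq_some_iff.1 hz).1, hz])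
    rwa [← add_assoc] at this
  rintro τ₂ ⟨i2, r2⟩
  rcases htev : t.ev ρ with _ | b
  · exact fails _ _ _ i2 (r2.2 htev) (by rw [hev, hsev, htev]; rfl)
  obtain ⟨P₂, h2⟩ := r2.1 b htev
  have h2L := h2.L
  refine iter_one i2 h2L ?_
  rw [hev, hsev, htev]
  rw [List.append_assoc] at h2
  refine hop a b hsev htev _ P₂ st τ₂ i2 ?_ h2 (by omega)
  rw [h2.io]
  exact hio (s.encode.length + t.encode.length) c (by
    rw [hr, List.getElem?_append_right (by simp)]; simp)  |> fun h => by rwa [← add_assoc] at h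

theorem evaluates {k : ℕ} {η : Fin k → Circuit} {ρ : Fin k → ℤ} {ex : ∀ x, Fin (η x).n → ℕ}
    (hE : Env C η ρ ex io) (t : Term (Fin k)) (ht : t.Within ρ (fun x => (η x).exps (ex x)) C.G)
    (hN : ∀ x, t.countVar x ≠ 0 → (η x).n ≤ C.N) : Evaluates C io ρ t := by
  have hL := C.L_lt
  induction t with
  | zero =>
    intro idx P st σ hio hi h hst hlen
    simp only [Term.encode, List.length_singleton] at hlen ⊢
    refine iter_one hi h.L (wp_step_of hi h.fail (s := 0) (by rw [h.io]; simpa using hio 0 0 rfl)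
      (fun _ => wp_pushZero (h.setSym _) (by omega)) ?_ ?_ ?_ ?_ ?_ ?_) <;> intro h <;> omega
  | one =>
    intro idx P st σ hio hi h hst hlen
    simp only [Term.encode, List.length_singleton] at hlen ⊢
    refine iter_one hi h.L (wp_step_of hi h.fail (s := 1) (by rw [h.io]; simpa using hio 0 1 rfl)
      ?_ (fun _ => wp_pushOne (h.setSym _) (by omega)) ?_ ?_ ?_ ?_ ?_) <;> intro h <;> omega
  | var x =>
    intro idx P st σ hio hi h hst hlen
    simp only [Term.encode, List.length_singleton] at hlen ⊢
    refine iter_one hi h.L (wp_step_of hi h.fail (s := 6 + x)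
      (by rw [h.io]; simpa using hio 0 (6 + x) rfl) ?_ ?_ ?_ ?_ ?_ ?_ fun _ => ?_) <;>
      try (intro h; omega)
    -- The table of addresses follows the two header cells and the `L` symbols, and variable `x` has
    -- the symbol `6 + x`; hence the offset `-4`.
    have hsx : (C.L : ℤ) + (6 + x : ℕ) - 4 = 2 + C.L + x := by push_cast; ring
    have h' := h.setSym (6 + x : ℕ)
    refine wp_call (wp_load (adr := io (2 + C.L + x)) h'.pool (hN x (by simp [Term.countVar])) ?_ ?_ ?_ (hE.hasExp x)
      (fun v hv => ht (Circuit.mem_exps.2 ⟨v, hv, rfl⟩)) h'.sp (by omega)) ?_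
    · rw [h'.L]; simp; omega
    · rw [h'.L, h'.io]; simp only [St.v_setv, if_true, hsx]
    · rw [h'.io]; exact hE.stored x
    · rintro τ f ⟨P', l, p, hv, hrow, hsp⟩
      refine ⟨fun z hz => ⟨P', ?_⟩, fun h => by cases h⟩
      obtain rfl := Option.some.inj hz
      exact h'.push l p hrow hv hsp ((f.io rfl).trans h'.io) ((f.v _ rfl).trans h'.L)
        ((f.v _ rfl).trans h'.fail)
  | add s t ihs iht =>
    refine Evaluates.binary (ihs ht.1 fun x hx => hN x (by simp [Term.countVar, hx]))
      (iht ht.2.1 fun x hx => hN x (by simp [Term.countVar, hx])) rfl rfl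
      fun a b ha hb idx P st σ hi hc h hst => wp_step_of hi h.fail (s := 2) hc ?_ ?_
        (fun _ => wp_binary_add (h.setSym _) hst (fun τ _ _ _ _ => ?_) top_vec
          (ht.2.2 a b ha hb)) ?_ ?_ ?_ ?_ <;> try (intro h; omega)
    simp [top]; omega
  | sub s t ihs iht =>
    refine Evaluates.binary (ihs ht.1 fun x hx => hN x (by simp [Term.countVar, hx]))
      (iht ht.2.1 fun x hx => hN x (by simp [Term.countVar, hx])) rfl rfl
      fun a b ha hb idx P st σ hi hc h hst => wp_step_of hi h.fail (s := 3) hc ?_ ?_ ?_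
        (fun _ => ?_) ?_ ?_ ?_ <;> try (intro h; omega)
    rw [sub_eq_add_neg]
    refine wp_binary_add (h.setSym _) hst (fun τ _ _ _ _ => ?_) neg_top_vec ?_
    · simp [top]; omega
    · rw [← sub_eq_add_neg]; exact ht.2.2 a b ha hb
  | mulPow s t ihs iht =>
    refine Evaluates.binary (ihs ht.1 fun x hx => hN x (by simp [Term.countVar, hx]))
      (iht ht.2.1 fun x hx => hN x (by simp [Term.countVar, hx])) rfl rfl
      fun a b ha hb idx P st σ hi hc h hst => wp_step_of hi h.fail (s := 4) hc ?_ ?_ ?_ ?_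
        (fun _ => wp_binary_mul (h.setSym _) hst (fun τ _ _ _ _ => ?_) top_vec
          (ht.2.2 a b ha hb)) ?_ ?_ <;> try (intro h; omega)
    simp [top]; omega
  | divPow s t ihs iht =>
    refine Evaluates.binary (ihs ht.1 fun x hx => hN x (by simp [Term.countVar, hx]))
      (iht ht.2.1 fun x hx => hN x (by simp [Term.countVar, hx])) rfl rfl
      fun a b ha hb idx P st σ hi hc h hst => wp_step_of hi h.fail (s := 5) hc ?_ ?_ ?_ ?_ ?_
        (fun _ => wp_binary_mul (h.setSym _) hst (fun τ _ _ _ _ => ?_) neg_top_vec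
          (ht.2.2 a b ha hb)) ?_ <;> try (intro h; omega)
    simp [top]; omega

end

/-! ### Setting up the pool -/

namespace Cmd

/-- Writes the tables for `dig` and for the division by two. -/
def tables : Cmd :=
  block [put .tab (.num 0) (.num 0) (.num 1), put .tab (.num 0) (.num 1) (.num 0),
    put .tab (.num 0) (.num 2) (.num (-1)), put .tab (.num 0) (.num 3) (.num 0),
    put .tab (.num 0) (.num 4) (.num 1), put .tab (.num 0) (.num 5) (.num 0),
    put .tab (.num 0) (.num 6) (.num (-1)), put .tab (.num 0) (.num 7) (.num 0),
    put .tab (.num 0) (.num 8) (.num 1), put .tab (.num 0) (.num 9) (.num 0),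
    put .tab (.num 0) (.num 10) (.num (-1)), put .tab (.num 0) (.num 11) (.num 0),
    put .tab (.num 0) (.num 12) (.num 1), put .tab (.num 0) (.num 13) (.num 0),
    put .tab (.num 0) (.num 14) (.num (-1)),
    put .hlf (.num 0) (.num 0) (.num (-1)), put .hlf (.num 0) (.num 2) (.num 0),
    put .hlf (.num 0) (.num 4) (.num 1)]

/-- Sets up a pool with the exponents `0, …, K`, and the empty stack. -/
def init : Cmd :=
  block [tables, asg .n (.num 0), asg .q (.num 0), fill .U (.num 0) (.num 0), ins,
    loop false .m .K (block [asg .i (.var .m), inc, asg .q (.var .n), ins]),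
    asg .sp (.num 0), asg .fail (.num 0)]

theorem wp_tables {C : Ctx} {σ : St} : tables.wp C.dims σ fun τ =>
    (∀ k : ℕ, k ≤ 14 → τ.a .tab 0 k = dig (k - 7)) ∧
    (τ.a .hlf 0 0 = -1 ∧ τ.a .hlf 0 2 = 0 ∧ τ.a .hlf 0 4 = 1) := by
  have hC := C.le_N
  simp only [tables, wp_block_cons, wp_block_single, wp_put, Ex.ok_get, Ex.ok_num, Ex.eval_num,
    Ctx.dims_lay, true_and]
  iterate 18 refine And.intro (by omega) ?_
  refine ⟨fun k hk => ?_, by simp⟩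
  interval_cases k <;> simp <;> decide

/-- The exponents `0, …, K` are produced one after the other by adding `1`, each being larger than
all before it. No digit or carry gets in the way: `k + 1 ≤ 2 ^ k`, so in the step from `k` the place
`k + 1` is empty. -/
theorem wp_init {C : Ctx} {σ : St} (hN : σ.v .N = C.N) (hK : σ.v .K = C.K) (hL : σ.v .L = C.L) :
    init.wp C.dims σ fun τ => ∃ P, Run C σ.io P [] τ := by
  have hC := C.le_N
  rw [init, wp_block_cons]
  refine wp_call wp_tables fun σ₁ f₁ ⟨t1, t2⟩ => ?_
  rw [wp_block_cons, wp_asg, wp_block_cons, wp_asg, wp_block_cons]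
  refine ⟨trivial, trivial, ?_⟩
  refine wp_call (wp_fill (i' := 0) (fun _ => 0) (by simpa using (f₁.v _ rfl).trans hN) (by omega)
    (fun τ _ _ _ _ _ _ => ⟨⟨trivial, rfl⟩, trivial, rfl⟩)) fun σ₂ f₂ ⟨hZ, _⟩ => ?_
  have p2 : Pool C ⟨0, id, id⟩ σ₂ := by
    refine Pool.frame (σ := (σ₁.setv .n 0).setv .q 0) ?_ f₂
    exact ⟨by simpa using (f₁.v _ rfl).trans hN, by simp, ⟨by simp, by simp, by simp, by simp⟩,
      by simp, by simp, t1, t2⟩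
  have K2 : σ₂.v .K = C.K := (f₂.v _ rfl).trans (by simpa using (f₁.v _ rfl).trans hK)
  have L2 : σ₂.v .L = C.L := (f₂.v _ rfl).trans (by simpa using (f₁.v _ rfl).trans hL)
  have io2 : σ₂.io = σ.io := (f₂.io rfl).trans (f₁.io rfl)
  have q2 : σ₂.v .q = (0 : ℕ) := (f₂.v _ rfl).trans (by simp)
  rw [wp_block_cons]
  refine wp_call (wp_ins (u := 0) p2 q2 le_rfl (C.mem_G 0 (by omega)) (by simp) (by simp)
    (Pl.vec_zero hZ (by simp))) fun σ₃ f₃ p3 => ?_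
  rw [wp_block_cons]
  refine wp_loop (fun k τ => ∃ P : Pl, Pool C P τ ∧ P.n = k + 1 ∧ P.Base (k + 1)) C.K
    ((f₃.v _ rfl).trans K2) C.K_lt.le ⟨_, p3.setv _ _, rfl, le_rfl, ?_⟩ ?_ ?_
  · intro i hi
    obtain rfl : i = 0 := by omega
    simp [Pl.ins]
  · rintro k hk τ hkτ f ⟨P, hP, hn, hb⟩
    have hKN := C.K_lt
    rw [wp_block_cons, wp_asg, wp_block_cons]
    refine ⟨trivial, ?_⟩
    have hP' := hP.setv .i (τ.v .m)
    have hxk : P.x k = k := hb.2 k (by omega)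
    have two : k + 1 ≤ 2 ^ k := Nat.lt_two_pow_self
    refine wp_call (wp_inc hP' (i := k) (by omega) (by simp [hkτ]) hb ?_ ?_) fun τ₁ g₁ hU => ?_
    · rw [(hP'.row k (by omega)).zero (k + 1) (by omega) (by omega), hxk]
      exact (naf_eq_zero_of_rest (rest_natAbs _ (by simp))).symm
    · rw [hxk, incCarry, rest_eq_zero (m := k) _ (by omega), rest_eq_zero (m := k) _ (by omega), sub_zero]
      · rw [abs_of_nonneg (by positivity)]; exact_mod_cast (by omega : k ≤ 2 ^ k)
      · rw [abs_of_nonneg (by positivity)]; exact_mod_cast two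
    have p := hP'.frame g₁
    rw [wp_block_cons, wp_asg, wp_block_single]
    refine ⟨trivial, ?_⟩
    rw [hxk] at hU
    have ho : ∀ r < P.n, P.x (P.o r) < k + 1 := fun r hr => by
      have := p.valid.olt r hr
      rw [hb.2 _ (by omega)]; omega
    refine wp_call (wp_ins (p.setv _ _) (q := P.n) (u := k + 1) (by simp [p.n]) le_rfl
      (C.mem_G _ (by omega)) ho (fun r h1 h2 => by omega) hU) fun τ₂ g₂ p₂ => ?_
    refine ⟨_, p₂.setv _ _, by simp [Pl.ins, hn], by simp [Pl.ins, hn], fun i hi => ?_⟩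
    simp only [Pl.ins, Function.update_apply]
    split_ifs with h
    · omega
    · exact hb.2 i (by omega)
  · rintro τ f ⟨P, hP, hn, hb⟩
    simp only [wp_block_cons, wp_block_single, wp_asg, Ex.ok_num, true_and]
    refine ⟨P, (hP.setv _ _).setv _ _, hb, by simp, by simp, ?_, ?_, by simp⟩
    · simpa using (f.io rfl).trans ((f₃.io rfl).trans io2)
    · simpa using (f.v _ rfl).trans ((f₃.v _ rfl).trans L2)

end Cmd

/-! ### Writing the resulting circuit -/

namespace Cmd

/-- Marks in `reach` the exponents that occur in the circuit for the number on the stack. -/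
def reachAll : Cmd :=
  block [fill .reach (.num 0) (.get .stk (.num 0) (.var .p)), loop false .r .N <|
    ifp (.var .n - .var .r) (block [asg .i (.get .ord (.num 0) (.var .n - .var .r - .num 1)),
      ifz (.get .reach (.num 0) (.var .i)) skip (loop false .p .N <|
        ifz (.get .E (.var .i) (.var .p)) skip (put .reach (.num 0) (.var .p) (.num 1)))]) skip]

/-- Lists in `back` the exponents that occur. -/
def number : Cmd :=
  block [asg .cnt (.num 0), loop false .p .N <| ifz (.get .reach (.num 0) (.var .p)) skip
    (block [put .back (.num 0) (.var .cnt) (.var .p), asg .cnt (.var .cnt + .num 1)])]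

/-- Writes at the address `adr`. -/
def emit (e : Ex) : Cmd := block [out (.var .adr) e, asg .adr (.var .adr + .num 1)]

/-- Writes a sequence of `cnt` entries. -/
def emits (e : Ex) : Cmd := loop false .p .cnt (emit e)

section
variable {C : Ctx} {P : Pl} {σ : St} {z : ℤ}

/-- The digits of an exponent sit at smaller exponents, so one pass through the pool in descending
order finds everything reachable. -/
theorem wp_reachAll (hP : Pool C P σ) (hz : P.Vec C.N (σ.a .stk 0) z) :
    reachAll.wp C.dims σ fun τ =>
      (∀ i < C.N, τ.a .reach 0 i ≠ 0 → i < P.n ∧ Occurs z (P.x i)) ∧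
      ∀ p, Occurs z p → ∃ i < P.n, P.x i = p ∧ τ.a .reach 0 i ≠ 0 := by
  have hC := C.le_N
  have hn := hP.n_lt
  rw [reachAll, wp_block_cons]
  refine wp_call (wp_fill (i' := 0) (fun j => σ.a .stk 0 j) hP.N (by omega)
    (fun τ k hk hτ _ ha _ => ⟨⟨trivial, rfl⟩, by simp [hτ]; omega,
      by simp [hτ, ha .stk (by decide)]⟩)) fun σ₁ f₁ ⟨hZ, _⟩ => ?_
  have p1 : Pool C P σ₁ := hP.frame f₁
  rw [wp_block_single]
  -- Sound at all times; all marked exponents are included; and the successors of the reached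
  -- exponents among the top `k` ranks are included.
  refine wp_loop (fun k τ => (∀ i < C.N, τ.a .reach 0 i ≠ 0 → i < P.n ∧ Occurs z (P.x i)) ∧
    (∀ i < P.n, naf z (P.x i) ≠ 0 → τ.a .reach 0 i ≠ 0) ∧
    ∀ s < P.n, P.n ≤ s + k → τ.a .reach 0 (P.o s) ≠ 0 → ∀ i < P.n,
      naf (P.x (P.o s)) (P.x i) ≠ 0 → τ.a .reach 0 i ≠ 0) C.N p1.N le_rfl ⟨?_, ?_, ?_⟩ ?_ ?_
  · intro i hi h
    rw [St.a_setv, hZ i hi] at h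
    have hin := hz.lt_of_ne hi h
    exact ⟨hin, .mark (by rwa [← hz.dig i hin])⟩
  · intro i hi h
    rwa [St.a_setv, hZ i (by omega), hz.dig i hi]
  · intro s hs h; omega
  · rintro k hk τ hkτ f ⟨h1, h2, h3⟩
    have p : Pool C P τ := p1.frame f
    rw [wp_ifp]
    refine ⟨by simp, fun hpos => ?_, fun hneg => ?_⟩
    · simp only [Ex.eval_sub, Ex.eval_var, p.n, hkτ] at hpos
      obtain ⟨s, hs⟩ : ∃ s, P.n = s + k + 1 := ⟨P.n - k - 1, by omega⟩
      have hval := p.valid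
      have hos := hval.olt s (by omega)
      have hsn : (P.n : ℤ) - k - 1 = s := by omega
      rw [wp_block_cons, wp_asg, wp_block_single, wp_ifz]
      simp only [Ex.ok_get, Ex.ok_num, Ex.ok_sub, Ex.ok_var, Ex.eval_num, Ex.eval_sub, Ex.eval_var,
        p.n, hkτ, hsn, Ex.eval_get, Ctx.dims_lay, Int.toNat_zero, Int.toNat_natCast, p.ord s (by omega),
        St.v_setv, if_true, St.a_setv, true_and]
      refine ⟨by omega, by omega, fun h0 => ⟨fun i hi h => h1 i hi h, fun i hi h => h2 i hi h, ?_⟩,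
        fun h0 => ?_⟩
      · intro s' hs' hk' h i hi hne
        rcases (show s ≤ s' by omega).lt_or_eq with h' | rfl
        · exact h3 s' hs' (by omega) h i hi hne
        · exact absurd h0 h
      · refine wp_loop (fun j υ => ∀ i < C.N, υ.a .reach 0 i ≠ 0 ↔
          τ.a .reach 0 i ≠ 0 ∨ (i < j ∧ i < P.n ∧ naf (P.x (P.o s)) (P.x i) ≠ 0)) C.N
          (by simpa using p.N) le_rfl (by simp) ?_ ?_
        · intro j hj υ hjυ g hI
          have e1 : υ.v .i = P.o s := (g.v _ rfl).trans (by simp)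
          have e2 : υ.a .E = τ.a .E := g.a _ rfl
          have hrow := p.row (P.o s) hos
          simp [e1, e2, hjυ]
          refine ⟨by omega, fun h => ?_, fun h => ⟨by omega, ?_⟩⟩
          · intro i hi
            have := hI i hi
            simp only [ne_eq] at this
            rw [this]
            by_cases hij : i = j
            · subst hij
              by_cases hin : i < P.n
              · rw [hrow.dig i hin] at h
                simp [h]
              · simp [hin]
            · have : i ≤ j ↔ i < j := by omega
              rw [this]
          · intro i hi
            have hjn := hrow.lt_of_ne hj h
            rw [hrow.dig j hjn] at h
            have := hI i hi
            simp only [ne_eq] at this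
            by_cases hij : i = j
            · subst hij; simp [h, hjn]
            · have h' : i ≤ j ↔ i < j := by omega
              simp [hij, this, h']
        · intro υ g hI
          have hN : ∀ i < P.n, i < C.N := fun i hi => by omega
          refine ⟨fun i hi h => ?_, fun i hi h => (hI i (hN i hi)).2 (Or.inl (h2 i hi h)), ?_⟩
          · rcases (hI i hi).1 h with h | ⟨_, h, h'⟩
            · exact h1 i hi h
            · exact ⟨h, .edge (h1 _ (by omega) h0).2 h'⟩
          · intro s' hs' hk' h i hi hne
            rcases (show s ≤ s' by omega).lt_or_eq with h' | rfl
            · have hos' := hval.olt s' hs'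
              refine (hI i (hN i hi)).2 (Or.inl (h3 s' hs' (by omega) ?_ i hi hne))
              rcases (hI _ (hN _ hos')).1 h with h | ⟨_, _, h⟩
              · exact h
              -- This round only marks exponents below the current one, so none of those treated
              -- before becomes reachable afterwards.
              · have := lt_of_mem_supp (mem_supp.2 h)
                have := hval.srt s s' h' hs'
                omega
            · exact (hI i (hN i hi)).2 (Or.inr ⟨hN i hi, hi, hne⟩)
    · simp only [Ex.eval_sub, Ex.eval_var, p.n, hkτ] at hneg
      exact ⟨h1, h2, fun s hs _ => h3 s hs (by omega)⟩
  · rintro τ f ⟨h1, h2, h3⟩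
    refine ⟨h1, fun p hp => ?_⟩
    induction hp with
    | mark h =>
      obtain ⟨i, hi, rfl⟩ := hz.mem _ h
      exact ⟨i, hi, rfl, h2 i hi h⟩
    | edge _ h ih =>
      obtain ⟨i, hi, rfl, hr⟩ := ih
      obtain ⟨j, hj, rfl⟩ := (hP.row i hi).mem _ h
      obtain ⟨s, hs, rfl⟩ := hP.valid.exists_rank hi
      exact ⟨j, hj, rfl, h3 s hs (by omega) hr j hj h⟩

theorem wp_number (hN : σ.v .N = C.N) : number.wp C.dims σ fun τ =>
    ∃ (c : ℕ) (b : ℕ → ℕ), c ≤ C.N ∧ τ.v .cnt = c ∧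
      (∀ j < c, τ.a .back 0 j = b j ∧ b j < C.N ∧ σ.a .reach 0 (b j) ≠ 0) ∧
      (∀ j < c, ∀ j' < c, b j = b j' → j = j') ∧
      ∀ i < C.N, σ.a .reach 0 i ≠ 0 → ∃ j < c, b j = i := by
  rw [number, wp_block_cons, wp_asg, wp_block_single]
  refine ⟨trivial, ?_⟩
  refine wp_loop (fun k τ => ∃ (c : ℕ) (b : ℕ → ℕ), c ≤ k ∧ τ.v .cnt = c ∧
      (∀ j < c, τ.a .back 0 j = b j ∧ b j < k ∧ σ.a .reach 0 (b j) ≠ 0) ∧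
      (∀ j < c, ∀ j' < c, b j = b j' → j = j') ∧
      ∀ i < k, σ.a .reach 0 i ≠ 0 → ∃ j < c, b j = i) C.N (by simpa using hN) le_rfl
    ⟨0, id, by simp⟩ ?_ fun τ _ h => h
  rintro k hk τ hkτ f ⟨c, b, hc, hcnt, h1, h2, h3⟩
  have e1 : τ.a .reach = σ.a .reach := f.a _ rfl
  simp only [wp_ifz, wp_skip, wp_block_cons, wp_block_single, wp_put, wp_asg, Ex.ok_get, Ex.ok_num,
    Ex.ok_var, Ex.ok_add, Ex.eval_num, Ex.eval_var, Ex.eval_get, Ex.eval_add, Ctx.dims_lay, hkτ, hcnt,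
    e1, Int.toNat_zero, Int.toNat_natCast, true_and, St.v_seta]
  refine ⟨by omega, fun h0 => ⟨c, b, by omega, by simp [hcnt], fun j hj => ?_, h2, fun i hi h => ?_⟩,
    fun h0 => ⟨by omega, c + 1, Function.update b c k, by omega, by simp, fun j hj => ?_,
      fun j hj j' hj' h => ?_, fun i hi h => ?_⟩⟩
  · obtain ⟨a1, a2, a3⟩ := h1 j hj
    exact ⟨a1, by omega, a3⟩
  · rcases (Nat.lt_succ_iff.1 hi).lt_or_eq with hi | rfl
    · exact h3 i hi h
    · exact absurd h0 h
  · by_cases hjc : j = c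
    · subst hjc; simpa using h0
    · obtain ⟨a1, a2, a3⟩ := h1 j (by omega)
      simp only [Function.update_apply, hjc, if_false]
      exact ⟨by simp [hjc, a1], by omega, a3⟩
  · simp only [Function.update_apply] at h
    split_ifs at h with a1 a2 a2
    · omega
    · have := (h1 j' (by omega)).2.1; omega
    · have := (h1 j (by omega)).2.1; omega
    · exact h2 j (by omega) j' (by omega) h
  · rcases (Nat.lt_succ_iff.1 hi).lt_or_eq with hi | rfl
    · obtain ⟨j, hj, rfl⟩ := h3 i hi h
      exact ⟨j, by omega, by simp [hj.ne]⟩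
    · exact ⟨c, by omega, by simp⟩

theorem wp_emits {e : Ex} {c a : ℕ} (f : ℕ → ℤ) (hcnt : σ.v .cnt = c) (hc : c ≤ C.N)
    (ha : σ.v .adr = a)
    (h : ∀ (τ : St) (k : ℕ), k < c → τ.v .p = k → (∀ x, x ≠ .p → x ≠ .adr → τ.v x = σ.v x) →
      τ.a = σ.a → e.Ok C.N τ ∧ e.eval τ = f k) :
    (emits e).wp C.dims σ fun τ => τ.v .adr = (a + c : ℕ) ∧ (∀ j < c, τ.io (a + j : ℕ) = f j) ∧
      ∀ y < (a : ℤ), τ.io y = σ.io y := by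
  refine wp_loop (fun k τ => τ.v .adr = (a + k : ℕ) ∧ (∀ j < k, τ.io (a + j : ℕ) = f j) ∧
      ∀ y < (a : ℤ), τ.io y = σ.io y) c hcnt hc (by simp [ha]) ?_ fun τ _ h => h
  intro k hk τ hkτ g ⟨h1, h2, h3⟩
  obtain ⟨o1, o2⟩ := h τ k hk hkτ (fun x hx hx' => g.v x (by
    simp [emit, block, wv, Ne.symm hx, Ne.symm hx'])) (funext fun b => g.a b rfl)
  simp [emit, o1, o2, h1]
  refine ⟨by omega, by ring, fun j hj => ?_, fun y hy => ?_⟩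
  · by_cases hjk : j = k
    · simp [hjk]
    · have := h2 j (by omega)
      push_cast at this
      simp [hjk, this]
  · have : ¬ y = a + k := by omega
    simp [this, h3 y hy]

end
end Cmd

namespace Cmd

/-- Writes the normal circuit for the nonzero number on the stack. -/
def writeCircuit : Cmd :=
  block [reachAll, number, out (.num 0) (.var .cnt + .num 1), out (.num 1) (.num 0), asg .adr (.num 2),
    emits (.get .stk (.num 0) (.get .back (.num 0) (.var .p))), emit (.num 0), emits (.num 0),
    loop false .r .cnt (block [asg .i (.get .back (.num 0) (.var .r)),
      ifz (.var .i) (emit (.num 1)) (emit (.num 0)),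
      emits (.get .E (.var .i) (.get .back (.num 0) (.var .p)))])]

/-- Writes the normal circuit for the number on the stack, and sets `N` to `1`; in case of failure,
sets `N` to `0`. -/
def output : Cmd :=
  ifz (.var .fail) (block [asg .fl (.num 0),
    loop false .p .N (ifz (.get .stk (.num 0) (.var .p)) skip (asg .fl (.num 1))),
    ifz (.var .fl) (block [out (.num 0) (.num 1), out (.num 1) (.num 1), out (.num 2) (.num 0)])
      writeCircuit, asg .N (.num 1)]) (asg .N (.num 0))

section
variable {C : Ctx} {P : Pl} {σ : St} {z : ℤ}

theorem wp_emit {e : Ex} {a : ℕ} (ha : σ.v .adr = a) (he : e.Ok C.N σ) :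
    (emit e).wp C.dims σ fun τ => τ.v .adr = (a + 1 : ℕ) ∧ τ.io a = e.eval σ ∧
      ∀ y < (a : ℤ), τ.io y = σ.io y := by
  simp only [emit, wp_block_cons, wp_block_single, wp_out, wp_asg, Ex.ok_io, Ex.ok_var, Ex.ok_add,
    Ex.ok_num, Ex.eval_add, Ex.eval_var, Ex.eval_num, ha, St.v_seto, St.v_setv, St.io_setv,
    St.io_seto, Ctx.dims_lay, he, true_and, if_true, and_true]
  exact ⟨by omega, by push_cast; rfl, fun y hy => if_neg (by omega)⟩

theorem wp_writeRows {c : ℕ} {b : ℕ → ℕ} {a : ℕ} (hP : Pool C P σ) (hP1 : P.Base 1)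
    (hc : c ≤ C.N) (hcnt : σ.v .cnt = c)
    (hb : ∀ j < c, σ.a .back 0 j = b j ∧ b j < P.n) (ha : σ.v .adr = a) :
    (loop false .r .cnt (block [asg .i (.get .back (.num 0) (.var .r)),
      ifz (.var .i) (emit (.num 1)) (emit (.num 0)),
      emits (.get .E (.var .i) (.get .back (.num 0) (.var .p)))])).wp C.dims σ fun τ =>
      (∀ y < (a : ℤ), τ.io y = σ.io y) ∧ ∀ i < c,
        τ.io (a + i * (c + 1) : ℕ) = (if P.x (b i) = 0 then 1 else 0) ∧
        ∀ j < c, τ.io (a + i * (c + 1) + 1 + j : ℕ) = naf (P.x (b i)) (P.x (b j)) := by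
  have hn := hP.n_lt
  have hC := C.le_N
  refine wp_loop (fun k τ => τ.v .adr = (a + k * (c + 1) : ℕ) ∧ (∀ y < (a : ℤ), τ.io y = σ.io y) ∧
    ∀ i < k, τ.io (a + i * (c + 1) : ℕ) = (if P.x (b i) = 0 then 1 else 0) ∧
        ∀ j < c, τ.io (a + i * (c + 1) + 1 + j : ℕ) = naf (P.x (b i)) (P.x (b j))) c hcnt hc
    (by simp [ha]) ?_ fun τ _ h => h.2
  rintro k hk τ hkτ f ⟨h1, h2, h3⟩
  have p : Pool C P τ := hP.frame f
  have e1 : τ.a .back = σ.a .back := f.a _ rfl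
  have e2 : τ.v .cnt = c := (f.v _ rfl).trans hcnt
  have hbk := hb k hk
  set B := a + k * (c + 1) with hB
  have hlt : ∀ i < k, a + i * (c + 1) + (c + 1) ≤ B := fun i hi => by
    have := Nat.mul_le_mul_right (c + 1) hi
    rw [Nat.succ_mul] at this; omega
  have haB : a ≤ B := Nat.le_add_right _ _
  -- The exponent `0` has the number `0`, so the machine recognizes the vertex with an edge to the
  -- leaf by its number.
  have hleaf : P.x (b k) = 0 ↔ b k = 0 := by
    have h0 := hP1.2 0 (by omega)
    have := hP1.1
    exact ⟨fun h => hP.valid.inj _ hbk.2 0 (by omega) (by rw [h, h0]), fun h => by rw [h, h0]⟩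
  rw [wp_block_cons, wp_asg, wp_block_cons]
  refine ⟨by simp [hkτ]; omega, ?_⟩
  have hi : (Ex.get .back (.num 0) (.var .r)).eval τ = b k := by simp [hkτ, e1, hbk.1]
  rw [hi]
  set τ' := τ.setv .i (b k)
  have adr' : τ'.v .adr = B := by simp [τ', h1, hB]
  have hif : (ifz (.var .i) (emit (.num 1)) (emit (.num 0))).wp C.dims τ' fun υ =>
      υ.v .adr = (B + 1 : ℕ) ∧ υ.io B = (if P.x (b k) = 0 then 1 else 0) ∧
      ∀ y < (B : ℤ), υ.io y = τ.io y := by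
    rw [wp_ifz]
    refine ⟨trivial, fun h => ?_, fun h => ?_⟩
    · rw [if_pos (hleaf.2 (by simpa [τ'] using h))]
      exact wp_emit adr' trivial
    · rw [if_neg fun h' => h (by simpa [τ'] using hleaf.1 h')]
      exact wp_emit adr' trivial
  refine wp_call hif fun υ g ⟨a1, a2, a3⟩ => ?_
  have e3 : υ.v .i = b k := (g.v _ rfl).trans (by simp [τ'])
  have e4 : υ.a .back = σ.a .back := (g.a _ rfl).trans e1
  have p' : Pool C P υ := (p.setv .i _).frame g
  have hrow := p'.row (b k) hbk.2
  rw [wp_block_single]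
  refine wp_call (wp_emits (fun j => naf (P.x (b k)) (P.x (b j))) (c := c) ((g.v _ rfl).trans e2) hc a1
    (fun ω j hj hjω hv hA => ?_)) fun ω g' ⟨a4, a5, a6⟩ => ?_
  · have hbj := hb j hj
    have e5 : ω.v .i = b k := (hv _ (by decide) (by decide)).trans e3
    simp [e5, hA, hjω, e4, hbj.1, hrow.dig _ hbj.2]
    omega
  · refine ⟨?_, fun y hy => ?_, fun i hi => ?_⟩
    · rw [St.v_setv, if_neg (by decide), a4, hB]; push_cast; ring
    · rw [St.io_setv, a6 y (by push_cast; omega), a3 y (by omega), h2 y hy]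
    · rw [St.io_setv]
      rcases (Nat.lt_succ_iff.1 hi).lt_or_eq with hi | rfl
      · have := hlt i hi
        obtain ⟨b1, b2⟩ := h3 i hi
        refine ⟨?_, fun j hj => ?_⟩
        · rw [a6 _ (by omega), a3 _ (by omega), b1]
        · rw [a6 _ (by omega), a3 _ (by omega), b2 j hj]
      · refine ⟨?_, fun j hj => ?_⟩
        · rw [← hB, a6 _ (by omega), a2]
        · rw [← hB, a5 j hj]

/-- Vertex `0` of the output is the leaf and the others are the reached exponents. The cells hold
the number `c + 1` of vertices, the mark `0` of the leaf, the `c` digits of `z`, the zero row of the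
leaf, and one row for each exponent, beginning with its edge to the leaf. -/
theorem wp_writeCircuit (hP : Pool C P σ) (hP1 : P.Base 1) (hz : P.Vec C.N (σ.a .stk 0) z)
    (hz0 : z ≠ 0) : writeCircuit.wp C.dims σ fun τ => ∃ Q : Circuit, Stored Q 0 τ.io ∧ Q.IsNormal ∧
      Q.Represents z ∧ Q.numMarked ≤ (supp z).card ∧
      ∀ H : Finset ℕ, (∀ p, Occurs z p → p ∈ H) → Q.n ≤ H.card + 1 := by
  have hC := C.le_N
  have hn := hP.n_lt
  rw [writeCircuit, wp_block_cons]
  refine wp_call (wp_reachAll hP hz) fun σ₁ f₁ ⟨r1, r2⟩ => ?_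
  have p1 : Pool C P σ₁ := hP.frame f₁
  rw [wp_block_cons]
  refine wp_call (wp_number p1.N) fun σ₂ f₂ ⟨c, b, hc, hcnt, n1, n2, n3⟩ => ?_
  have p2 : Pool C P σ₂ := p1.frame f₂
  have stk2 : σ₂.a .stk = σ.a .stk := (f₂.a _ rfl).trans (f₁.a _ rfl)
  have hb : ∀ j < c, σ₂.a .back 0 j = b j ∧ b j < P.n := fun j hj =>
    ⟨(n1 j hj).1, (r1 _ (n1 j hj).2.1 (n1 j hj).2.2).1⟩
  have hocc : ∀ p, Occurs z p ↔ ∃ i : Fin c, P.x (b i) = p := fun p => by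
    constructor
    · intro hp
      obtain ⟨i, hi, rfl, h⟩ := r2 p hp
      obtain ⟨j, hj, rfl⟩ := n3 i (by omega) h
      exact ⟨⟨j, hj⟩, rfl⟩
    · rintro ⟨i, rfl⟩
      exact (r1 _ (n1 i i.2).2.1 (n1 i i.2).2.2).2
  have hg : Function.Injective fun i : Fin c => P.x (b i) := fun i j h =>
    Fin.ext (n2 i i.2 j j.2 (hP.valid.inj _ (hb i i.2).2 _ (hb j j.2).2 h))
  have hne : ∃ i : Fin c, naf z (P.x (b i)) ≠ 0 := by
    obtain ⟨p, hp⟩ := Circuit.exists_naf_ne hz0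
    obtain ⟨i, rfl⟩ := (hocc p).1 (.mark hp)
    exact ⟨i, hp⟩
  simp only [wp_block_cons, wp_out, wp_asg, Ex.ok_io, Ex.ok_var, Ex.ok_add,
    Ex.ok_num, Ex.eval_add, Ex.eval_var, Ex.eval_num, hcnt, Ctx.dims_lay, true_and]
  refine ⟨by omega, by omega, ?_⟩
  set σ₃ := ((σ₂.seto 0 (c + 1)).seto 1 0).setv .adr 2
  have p3 : Pool C P σ₃ := ⟨p2.N, p2.n, p2.valid, p2.row, p2.ord, p2.tab, p2.hlf⟩
  have cnt3 : σ₃.v .cnt = c := by simp [σ₃, hcnt]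
  refine wp_call (wp_emits (a := 2) (fun j => naf z (P.x (b j))) cnt3 hc (by simp [σ₃])
    (fun τ j hj hjτ hv hA => ?_)) fun σ₄ f₄ ⟨a1, a2, a3⟩ => ?_
  · have hbj := hb j hj
    simp [hA, hjτ, σ₃, stk2, hbj.1, hz.dig _ hbj.2]
    omega
  have p4 : Pool C P σ₄ := p3.frame f₄
  refine wp_call (wp_emit a1 trivial) fun σ₅ f₅ ⟨a4, a5, a6⟩ => ?_
  have p5 : Pool C P σ₅ := p4.frame f₅
  have cnt5 : σ₅.v .cnt = c := (f₅.v _ rfl).trans ((f₄.v _ rfl).trans cnt3)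
  refine wp_call (wp_emits (fun _ => 0) cnt5 hc a4 (fun τ j _ _ _ _ => ⟨trivial, rfl⟩))
    fun σ₆ f₆ ⟨a7, a8, a9⟩ => ?_
  have p6 : Pool C P σ₆ := p5.frame f₆
  have cnt6 : σ₆.v .cnt = c := (f₆.v _ rfl).trans cnt5
  have back6 : σ₆.a .back = σ₂.a .back :=
    (f₆.a _ rfl).trans ((f₅.a _ rfl).trans ((f₄.a _ rfl).trans rfl))
  rw [wp_block_single]
  refine wp_call (wp_writeRows (b := b) p6 hP1 hc cnt6 (by rwa [back6]) a7) fun τ _ ⟨b1, b2⟩ => ?_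
  refine ⟨Circuit.nafCircuit (fun i : Fin c => P.x (b i)) z hne, ⟨le_rfl, ?_, fun v => ?_, fun v w => ?_⟩,
    Circuit.isNormal_nafCircuit hg hocc, Circuit.represents_nafCircuit hg hocc,
    Circuit.numMarked_nafCircuit hg, fun H hH => ?_⟩
  · rw [b1 _ (by positivity), a9 _ (by positivity), a6 _ (by positivity), a3 _ (by norm_num)]
    simp [σ₃]
  · cases v using Fin.cases with
    | zero =>
      have h : (0 + 1 + ((0 : Fin (c + 1)) : ℕ) : ℤ) = 1 := by simp
      change τ.io (0 + 1 + ((0 : Fin (c + 1)) : ℕ) : ℤ) = _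
      rw [h, b1 _ (by push_cast; omega), a9 _ (by push_cast; omega), a6 _ (by push_cast; omega),
        a3 _ (by norm_num)]
      simp [σ₃]
    | succ i =>
      have h : (0 + 1 + (i.succ : ℕ) : ℤ) = (2 + i : ℕ) := by simp; ring
      change τ.io (0 + 1 + (i.succ : ℕ) : ℤ) = _
      have := i.2
      rw [h, b1 _ (by omega), a9 _ (by omega), a6 _ (by omega), a2 i i.2]
      exact (Circuit.sign_naf _ _).symm
  · change τ.io (0 + 1 + ((c + 1 : ℕ) : ℤ) + (v : ℕ) * ((c + 1 : ℕ) : ℤ) + (w : ℕ)) =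
      (Circuit.nafEdge (fun i : Fin c => P.x (b i)) v w : ℤ)
    cases v using Fin.cases with
    | zero =>
      cases w using Fin.cases with
      | zero =>
        have h : (0 + 1 + ((c + 1 : ℕ) : ℤ) + ((0 : Fin (c + 1)) : ℕ) * ((c + 1 : ℕ) : ℤ) +
          ((0 : Fin (c + 1)) : ℕ)) = (2 + c : ℕ) := by simp; ring
        rw [h, b1 _ (by omega), a9 _ (by omega), a5]; rfl
      | succ j =>
        have := j.2
        have h : (0 + 1 + ((c + 1 : ℕ) : ℤ) + ((0 : Fin (c + 1)) : ℕ) * ((c + 1 : ℕ) : ℤ) +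
          (j.succ : ℕ)) = (2 + c + 1 + j : ℕ) := by simp; ring
        rw [h, b1 _ (by omega), a8 j j.2]; rfl
    | succ i =>
      obtain ⟨c1, c2⟩ := b2 i i.2
      cases w using Fin.cases with
      | zero =>
        have h : (0 + 1 + ((c + 1 : ℕ) : ℤ) + (i.succ : ℕ) * ((c + 1 : ℕ) : ℤ) +
          ((0 : Fin (c + 1)) : ℕ)) = (2 + c + 1 + c + i * (c + 1) : ℕ) := by simp; ring
        rw [h, c1]
        simp only [Circuit.nafEdge, Fin.cases_succ, Fin.cases_zero]
        split_ifs <;> rfl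
      | succ j =>
        have h : (0 + 1 + ((c + 1 : ℕ) : ℤ) + (i.succ : ℕ) * ((c + 1 : ℕ) : ℤ) + (j.succ : ℕ)) =
          (2 + c + 1 + c + i * (c + 1) + 1 + j : ℕ) := by simp; ring
        rw [h, c2 j j.2]
        exact (Circuit.sign_naf _ _).symm
  · change c + 1 ≤ H.card + 1
    have : (Finset.univ.image fun i : Fin c => P.x (b i)).card = c := by
      rw [Finset.card_image_of_injective _ hg, Finset.card_univ, Fintype.card_fin]
    have := Finset.card_le_card (s := Finset.univ.image fun i : Fin c => P.x (b i)) (t := H) fun p hp => by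
      obtain ⟨i, _, rfl⟩ := Finset.mem_image.1 hp
      exact hH _ ((hocc _).2 ⟨i, rfl⟩)
    omega

theorem wp_output {io : ℤ → ℤ} {r : Option ℤ} (h : Result C io [] r σ) :
    output.wp C.dims σ fun τ => (r = none → τ.v .N = 0) ∧ ∀ z, r = some z → τ.v .N = 1 ∧
      ∃ Q : Circuit, Stored Q 0 τ.io ∧ Q.IsNormal ∧ Q.Represents z ∧
        Q.numMarked ≤ max 1 (supp z).card ∧
        ∀ H : Finset ℕ, (∀ p, Occurs z p → p ∈ H) → Q.n ≤ H.card + 1 := by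
  have hC := C.le_N
  rw [output, wp_ifz]
  rcases r with _ | z
  · have := (h.2 rfl).1
    refine ⟨trivial, fun h0 => ?_, fun _ => ⟨trivial, fun _ => by simp, by simp⟩⟩
    rw [Ex.eval_var, this] at h0
    omega
  obtain ⟨P, hR⟩ := h.1 z rfl
  have hP := hR.pool
  have hz : P.Vec C.N (σ.a .stk 0) z := hR.vec 0 z rfl
  refine ⟨trivial, fun _ => ?_, fun h0 => absurd hR.fail h0⟩
  rw [wp_block_cons, wp_asg, wp_block_cons]
  refine ⟨trivial, wp_loop (fun k τ => τ.v .fl = 0 ↔ ∀ i < k, σ.a .stk 0 i = 0) C.N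
    (by simpa using hP.N) le_rfl (by simp) ?_ ?_⟩
  · intro k hk τ hkτ f hI
    have e : τ.a .stk = σ.a .stk := f.a _ rfl
    simp [hkτ, e]
    refine ⟨by omega, fun h0 => ?_, fun h0 => ⟨k, le_rfl, h0⟩⟩
    rw [hI]
    refine ⟨fun h i hi => ?_, fun h i hi => h i hi.le⟩
    rcases hi.lt_or_eq with hi | rfl
    · exact h i hi
    · exact h0
  · intro τ f hI
    have p : Pool C P τ := (hP.setv _ _).frame f
    have e : τ.a .stk = σ.a .stk := f.a _ rfl
    rw [wp_block_cons]
    suffices hs : (ifz (.var .fl) (block [out (.num 0) (.num 1), out (.num 1) (.num 1),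
        out (.num 2) (.num 0)]) writeCircuit).wp C.dims τ fun τ =>
        ∃ Q : Circuit, Stored Q 0 τ.io ∧ Q.IsNormal ∧ Q.Represents z ∧
          Q.numMarked ≤ max 1 (supp z).card ∧
          ∀ H : Finset ℕ, (∀ p, Occurs z p → p ∈ H) → Q.n ≤ H.card + 1 by
      refine wp_mono hs fun υ hυ => ?_
      rw [wp_block_single, wp_asg]
      refine ⟨trivial, by simp, fun w hw => ?_⟩
      obtain rfl := Option.some.inj hw
      exact ⟨by simp, hυ⟩
    rw [wp_ifz]
    refine ⟨trivial, fun h0 => ?_, fun h0 => ?_⟩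
    -- The number `0` has no exponents and is represented by the circuit with one vertex, which has
    -- to be marked; this accounts for the maximum with `1`.
    · have hz0 : z = 0 := hz.ext (Pl.vec_zero (P := P) (v := fun _ => 0) (fun _ _ => rfl) hP.n_lt.le)
        fun i hi => hI.1 h0 i (hi.trans hP.n_lt)
      subst hz0
      simp only [wp_block_cons, wp_block_single, wp_out, Ex.ok_io, Ex.ok_num, Ex.eval_num,
        Ctx.dims_lay, true_and]
      refine ⟨by omega, by omega, by omega, Circuit.trivialCircuit, ⟨le_rfl, by simp; rfl, fun v => ?_,
        fun v w => ?_⟩, Circuit.isNormal_trivialCircuit, Circuit.represents_trivialCircuit, ?_, ?_⟩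
      · obtain rfl : v = (0 : Fin 1) := Subsingleton.elim (α := Fin 1) _ _
        simp [Circuit.trivialCircuit]
      · obtain rfl : v = (0 : Fin 1) := Subsingleton.elim (α := Fin 1) _ _
        obtain rfl : w = (0 : Fin 1) := Subsingleton.elim (α := Fin 1) _ _
        simp [Circuit.trivialCircuit]
      · exact le_max_of_le_left (Finset.card_le_univ _)
      · exact fun H _ => Nat.le_add_left _ _
    · have hz0 : z ≠ 0 := fun hz0 => h0 (hI.2 fun i hi => by
        subst hz0
        by_contra hne
        have hin := hz.lt_of_ne hi hne
        exact hne (by rw [hz.dig i hin, naf_zero]))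
      have hb : P.Base 1 := ⟨by have := hR.base.1; omega, fun i hi => hR.base.2 i (by omega)⟩
      refine wp_mono (wp_writeCircuit p hb (by rwa [e]) hz0) fun υ ⟨Q, q1, q2, q3, q4, q5⟩ =>
        ⟨Q, q1, q2, q3, le_max_of_le_right q4, q5⟩

end
end Cmd

/-! ### The input -/

theorem Circuit.encode_eq (Q : Circuit) : Q.encode = (Q.n : ℤ) ::
    (List.ofFn (fun v => (Q.mark v : ℤ)) ++ List.ofFn fun t : Fin (Q.n * Q.n) =>
      (Q.edge t.divNat t.modNat : ℤ)) := by
  rw [List.ofFn_mul, encode, List.cons_append]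
  refine congrArg (fun l => (Q.n : ℤ) :: (_ ++ List.flatten l)) (congrArg List.ofFn
    (funext fun v => congrArg List.ofFn (funext fun w => ?_)))
  have hv : (v * Q.n + w : ℕ) / Q.n = v := by
    rw [mul_comm, Nat.mul_add_div (by have := w.2; omega), Nat.div_eq_of_lt w.2]; rfl
  have hw : (v * Q.n + w : ℕ) % Q.n = w := by
    rw [mul_comm, Nat.mul_add_mod, Nat.mod_eq_of_lt w.2]
  congr 2
  · exact Fin.ext hv.symm
  · exact Fin.ext hw.symm

theorem stored_iff {Q : Circuit} {adr : ℤ} {io : ℤ → ℤ} : Stored Q adr io ↔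
    0 ≤ adr ∧ ∀ (i : ℕ) z, Q.encode[i]? = some z → io (adr + i) = z := by
  rw [Q.encode_eq]
  constructor
  · refine fun h => ⟨h.nonneg, fun i z hz => ?_⟩
    rcases i with _ | i
    · simp at hz
      simpa [← hz] using h.n
    rw [List.getElem?_cons_succ, List.getElem?_append, List.getElem?_ofFn, List.getElem?_ofFn] at hz
    simp only [List.length_ofFn] at hz
    split_ifs at hz with h1 h2
    · rw [← Option.some.inj hz, ← h.mark ⟨i, h1⟩]
      congr 1; push_cast; ring
    · rw [← Option.some.inj hz, ← h.edge]
      congr 1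
      simp only [Fin.divNat, Fin.modNat]
      have := Nat.div_add_mod' (i - Q.n) Q.n
      have : ((((i - Q.n) / Q.n : ℕ) : ℤ) * Q.n + ((i - Q.n) % Q.n : ℕ)) = (i : ℤ) - Q.n := by
        rw [← Nat.cast_mul, ← Nat.cast_add, this]; omega
      push_cast at this ⊢; omega
  · rintro ⟨h0, h⟩
    refine ⟨h0, by simpa using h 0 Q.n rfl, fun v => ?_, fun v w => ?_⟩
    · rw [← h (v + 1) (Q.mark v)]
      · congr 1; push_cast; ring
      · rw [List.getElem?_cons_succ, List.getElem?_append_left (by simp), List.getElem?_ofFn,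
          dif_pos v.2]
    · have hv : (v * Q.n + w : ℕ) / Q.n = v := by
        rw [mul_comm, Nat.mul_add_div (by have := w.2; omega), Nat.div_eq_of_lt w.2]; rfl
      have hw : (v * Q.n + w : ℕ) % Q.n = w := by
        rw [mul_comm, Nat.mul_add_mod, Nat.mod_eq_of_lt w.2]
      have hlt : (v * Q.n + w : ℕ) < Q.n * Q.n := by
        have := Nat.mul_le_mul_right Q.n v.2
        have := w.2
        rw [Nat.succ_mul] at *; omega
      rw [← h (Q.n + (v * Q.n + w) + 1) (Q.edge v w)]
      · congr 1; push_cast; ring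
      · rw [List.getElem?_cons_succ, List.getElem?_append_right (by simp), List.getElem?_ofFn,
          List.length_ofFn, Nat.add_sub_cancel_left, dif_pos hlt]
        congr 4
        · exact Fin.ext hv
        · exact Fin.ext hw

theorem getElem?_flatten {α : Type*} (l : List (List α)) : ∀ (x i : ℕ) (b : List α) (z : α),
    l[x]? = some b → b[i]? = some z → l.flatten[((l.take x).map List.length).sum + i]? = some z := by
  induction l with
  | nil => intro x i b z h; simp at h
  | cons a l ih =>
    intro x i b z hx hb
    rcases x with _ | x
    · simp at hx
      subst hx
      simp [List.getElem?_append_left (List.getElem?_eq_some_iff.1 hb).1, hb]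
    · rw [List.take_succ_cons, List.map_cons, List.sum_cons, List.flatten_cons, add_assoc,
        List.getElem?_append_right (by omega), Nat.add_sub_cancel_left]
      exact ih x i b z hx hb

theorem start_mem {l : List ℤ} {i : ℕ} {z : ℤ} (h : l[i]? = some z) : (State.start l).mem i = z := by
  simp [State.start, List.getD, h]

section
variable {k : ℕ} (t : Term (Fin k)) (η : Fin k → Circuit)

theorem start_length : (State.start (encodeInput t η)).mem 1 = t.encode.length :=
  start_mem (i := 1) rfl

theorem start_symbol (i : ℕ) (z : ℤ) (h : t.encode[i]? = some z) :
    (State.start (encodeInput t η)).mem (2 + i) = z := by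
  have := (List.getElem?_eq_some_iff.1 h).1
  refine (congrArg _ (by push_cast; ring)).trans (start_mem (i := i + 2) ?_)
  rw [encodeInput, List.append_assoc, List.append_assoc, List.getElem?_append_right (by simp),
    List.getElem?_append_left (by simpa using this), ← h]
  rfl

theorem start_stored (x : Fin k) :
    Stored (η x) ((State.start (encodeInput t η)).mem (2 + t.encode.length + x))
      (State.start (encodeInput t η)).mem := by
  have hx := x.2
  set blocks : List (List ℤ) := List.ofFn fun x => (η x).encode with hbl
  set a : ℕ := 2 + t.encode.length + k + ((blocks.take x).map List.length).sum with ha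
  have h : (State.start (encodeInput t η)).mem (2 + t.encode.length + x) = a := by
    refine (congrArg _ (by push_cast; ring)).trans (start_mem (i := 2 + t.encode.length + x) ?_)
    rw [encodeInput, List.getElem?_append_left (by simp; omega),
      List.getElem?_append_right (by simp; omega)]
    have h2 : 2 + t.encode.length + (x : ℕ) - (t.encode.length + 1 + 1) = x := by omega
    simp [ha, hbl, h2]
  rw [h, stored_iff]
  refine ⟨by positivity, fun i z hz => ?_⟩
  refine (congrArg _ (by push_cast; ring)).trans (start_mem (i := a + i) ?_)
  rw [encodeInput, List.getElem?_append_right (by simp [ha]; omega)]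
  rw [← getElem?_flatten blocks x i _ z (by simp [hbl]) hz]
  congr 1
  simp [ha]; omega

end

/-! ### Counting -/

section
variable {k : ℕ}

theorem Term.sum_countVar (f : Fin k → ℕ) (x : Fin k) :
    ∑ y, (Term.var x).countVar y * f y = f x := by
  simp [countVar, ite_mul]

/-- The number which the symbol `s` contributes to the weight of a term. -/
def symWeight (io : ℤ → ℤ) (L s : ℤ) : ℤ :=
  if s = 0 then 1 else if s = 1 then 2 else if 5 < s then io (io (L + s - 4)) else 0

/-- The machine can thus compute the vertex weight in one pass over the symbols, reading the first
cell of the circuit at each variable. -/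
theorem sum_symWeight {η : Fin k → Circuit} {io : ℤ → ℤ} {L : ℤ}
    (h : ∀ x : Fin k, io (io (2 + L + x)) = (η x).n) (t : Term (Fin k)) :
    (t.encode.map (symWeight io L)).sum = vertexWeight t η := by
  induction t with
  | zero => simp [Term.encode, symWeight, vertexWeight, Term.countVar, Term.countOne, Term.countZero]
  | one => simp [Term.encode, symWeight, vertexWeight, Term.countVar, Term.countOne, Term.countZero]
  | var x =>
    have h0 : ¬ (6 + (x : ℤ) = 0) := by omega
    have h1 : ¬ (6 + (x : ℤ) = 1) := by omega
    have h5 : 5 < 6 + (x : ℤ) := by omega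
    have := Term.sum_countVar (fun x => (η x).n) x
    rw [vertexWeight]
    simp only [Circuit.numVertices, this]
    simp only [Term.encode, symWeight, List.map_cons, List.map_nil, h0, h1, h5, if_true, if_false,
      Term.countOne, Term.countZero]
    rw [show L + (6 + (x : ℤ)) - 4 = 2 + L + x by ring, h]
    simp
  | add s t ihs iht | sub s t ihs iht | mulPow s t ihs iht | divPow s t ihs iht =>
    simp only [Term.encode, List.map_append, List.sum_append, ihs, iht]
    simp [symWeight, vertexWeight, Term.countVar, Term.countOne, Term.countZero, add_mul,
      Finset.sum_add_distrib]
    ring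

/-- A binary tree has one more leaf than inner nodes. -/
theorem Term.sum_counts (t : Term (Fin k)) :
    ∑ x, t.countVar x + t.countOne + t.countZero = t.size + 1 := by
  induction t with
  | zero => simp [countVar, countOne, countZero, size]
  | one => simp [countVar, countOne, countZero, size]
  | var x => simp [countVar, countOne, countZero, size]
  | add s t ihs iht | sub s t ihs iht | mulPow s t ihs iht | divPow s t ihs iht =>
    simp only [countVar, countOne, countZero, size, Finset.sum_add_distrib]
    omega

/-- Every variable or constant in the term counts at least one more in the vertex weight than in
`weight`: for variables this is the leaf of the circuit. There are `t.size + 1` of them. -/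
theorem weight_add_le (t : Term (Fin k)) (η : Fin k → Circuit) {b : Fin k → Finset ℕ}
    (hb : ∀ x, (b x).card < (η x).n) : t.weight b + (t.size + 1) ≤ vertexWeight t η := by
  rw [← t.sum_counts, Term.weight, vertexWeight]
  have : ∑ x, t.countVar x * (b x).card + ∑ x, t.countVar x ≤ ∑ x, t.countVar x * (η x).numVertices := by
    rw [← Finset.sum_add_distrib]
    refine Finset.sum_le_sum fun x _ => ?_
    have := Nat.mul_le_mul_left (t.countVar x) (hb x)
    rwa [Nat.succ_eq_add_one, Nat.mul_succ] at this
  omega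

/-- Sums have subadditive weight and shifts only move digits, so the right operand of a shift
contributes nothing. -/
theorem card_supp_ev_le {ρ : Fin k → ℤ} {η : Fin k → Circuit}
    (h : ∀ x, (supp (ρ x)).card ≤ (η x).numMarked) (t : Term (Fin k)) :
    ∀ N, t.ev ρ = some N → (supp N).card ≤ markedWeight t η := by
  have comb : ∀ (s t r : Term (Fin k)), (∀ x, r.countVar x = s.countVar x + t.countVar x) →
      r.countOne = s.countOne + t.countOne →
      markedWeight r η = markedWeight s η + markedWeight t η := fun s t r h1 h2 => by
    simp only [markedWeight, h1, h2, add_mul, Finset.sum_add_distrib]; ring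
  have hshift : ∀ {a c N : ℤ}, shift a c = some N → (supp N).card ≤ (supp a).card := fun h =>
    (Finset.card_le_card (supp_shift_subset h)).trans Finset.card_image_le
  induction t with
  | zero => intro N hN; cases hN; simp
  | one => intro N hN; cases hN; simp [supp_one, markedWeight, Term.countOne]
  | var x =>
    intro N hN; cases hN
    have := Term.sum_countVar (fun x => (η x).numMarked) x
    rw [markedWeight, this]
    exact (h x).trans (Nat.le_add_right _ _)
  | add s t ihs iht =>
    intro N hN
    simp only [Term.ev, Option.bind_eq_some_iff] at hN
    obtain ⟨a, ha, c, hc, hN⟩ := hN; cases hN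
    rw [comb s t _ (fun _ => rfl) rfl]
    exact (card_supp_add _ _).trans (Nat.add_le_add (ihs a ha) (iht c hc))
  | sub s t ihs iht =>
    intro N hN
    simp only [Term.ev, Option.bind_eq_some_iff] at hN
    obtain ⟨a, ha, c, hc, hN⟩ := hN; cases hN
    rw [comb s t _ (fun _ => rfl) rfl, sub_eq_add_neg]
    refine (card_supp_add _ _).trans (Nat.add_le_add (ihs a ha) ?_)
    rw [supp_neg]
    exact iht c hc
  | mulPow s t ihs iht | divPow s t ihs iht =>
    intro N hN
    simp only [Term.ev, Option.bind_eq_some_iff] at hN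
    obtain ⟨a, ha, c, hc, hN⟩ := hN
    rw [comb s t _ (fun _ => rfl) rfl]
    exact (hshift hN).trans ((ihs a ha).trans (Nat.le_add_right _ _))

end

/-! ### The preparatory phase and the main program -/

namespace Cmd

/-- Reads the length of the term, computes the parameters, and sets up the table of the multiples of
the dimension. -/
def pre : Cmd :=
  block [asg .L (.io (.num 1)), asg .tot (.num 0),
    loop true .idx .L (block [asg .sym (.io (.var .idx + .num 2)),
      ifz (.var .sym) (asg .tot (.var .tot + .num 1)) <|
      ifz (.var .sym - .num 1) (asg .tot (.var .tot + .num 2)) <|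
      ifp (.var .sym - .num 5)
        (asg .tot (.var .tot + .io (.io (.var .L + .var .sym - .num 4)))) skip]),
    asg .cnt (.num 0), loop true .idx .L (asg .cnt (.var .cnt + .var .tot)),
    asg .K (.var .cnt + .var .cnt + .var .cnt + .var .cnt + .num 4), asg .N (.var .K + .var .K),
    asg .u (.num 0), asg .w (.num (-32)),
    loop false .i .N (block [out (.var .w) (.var .u), asg .u (.var .u + .var .N),
      asg .w (.var .w - .num 32)])]

/-- The evaluation of a term, when the dimension of the matrices is known. -/
def main : Cmd := block [init, loop true .idx .L step, output]

/-- The product of `L` and the weight is obtained by repeated addition. The dimension is `0` here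
because the table of multiples is being written at negative addresses. -/
theorem wp_pre {σ : St} {l : List ℤ} {W N : ℕ} (hL : σ.io 1 = l.length)
    (hl : ∀ (i : ℕ) z, l[i]? = some z → σ.io (2 + i) = z)
    (hW : (l.map (symWeight σ.io l.length)).sum = W) (hN : 2 * (4 * (l.length * W) + 4) = N) :
    pre.wp ⟨0, N, l.length⟩ σ fun τ => τ.v .L = l.length ∧ τ.v .K = (4 * (l.length * W) + 4 : ℕ) ∧
      τ.v .N = N ∧ (∀ y, 0 ≤ y → τ.io y = σ.io y) ∧ ∀ i < N, τ.io (-32 - 32 * (i : ℤ)) = i * N := by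
  rw [pre, wp_block_cons, wp_asg, wp_block_cons, wp_asg, wp_block_cons]
  refine ⟨by simp, trivial, wp_loop (fun k τ => τ.v .tot =
    ((l.take k).map (symWeight σ.io l.length)).sum) l.length (by simp [hL]) le_rfl (by simp) ?_ ?_⟩
  · intro k hk τ hkτ f h
    have e1 : τ.io = σ.io := f.io rfl
    have e2 : τ.v .L = l.length := (f.v _ rfl).trans (by simp [hL])
    have hs : σ.io (k + 2) = l[k] := by
      rw [add_comm]; exact hl k _ (List.getElem?_eq_getElem hk)
    have hsum : ((l.take (k + 1)).map (symWeight σ.io l.length)).sum = τ.v .tot +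
        symWeight σ.io l.length l[k] := by
      rw [List.take_add_one, List.getElem?_eq_getElem hk, List.map_append, List.sum_append, h]
      simp
    rw [hsum]
    simp only [wp_block_cons, wp_block_single, wp_asg, wp_ifz, wp_ifp, wp_skip, Ex.ok_io, Ex.ok_add,
      Ex.ok_sub, Ex.ok_var, Ex.ok_num, Ex.eval_io, Ex.eval_add, Ex.eval_sub, Ex.eval_var, Ex.eval_num,
      hkτ, e1, hs, e2, St.v_setv, St.io_setv, true_and, and_true, true_or, if_true, if_false,
      reduceCtorEq, symWeight]
    refine ⟨fun h => by rw [if_pos h], fun h0 => ⟨fun h1 => ?_, fun h1 => ⟨fun h5 => ?_, fun h5 => ?_⟩⟩⟩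
    · rw [if_neg h0, if_pos (by omega)]
    · rw [if_neg h0, if_neg (by omega), if_pos (by omega)]
    · rw [if_neg h0, if_neg (by omega), if_neg (by omega), add_zero]
  · intro τ f h
    have e1 : τ.io = σ.io := f.io rfl
    have e2 : τ.v .L = l.length := (f.v _ rfl).trans (by simp [hL])
    rw [List.take_length, hW] at h
    rw [wp_block_cons, wp_asg, wp_block_cons]
    refine ⟨trivial, wp_loop (fun k τ => τ.v .cnt = (k * W : ℕ)) l.length (by simp [e2]) le_rfl
      (by simp) ?_ ?_⟩
    · intro k hk υ hkυ g h'
      have e3 : υ.v .tot = W := (g.v _ rfl).trans (by simp [h])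
      rw [wp_asg]
      refine ⟨by simp, ?_⟩
      simp [h', e3]; ring
    · intro υ g h'
      have e3 : υ.io = σ.io := (g.io rfl).trans e1
      have e4 : υ.v .L = l.length := (g.v _ rfl).trans (by simp [e2])
      simp only [wp_block_cons, wp_asg, Ex.ok_add, Ex.ok_var, Ex.ok_num, Ex.eval_add, Ex.eval_var,
        Ex.eval_num, true_and]
      have hNz : ((2 * (4 * (l.length * W) + 4) : ℕ) : ℤ) = N := by rw [hN]
      rw [wp_block_single]
      refine wp_loop (fun k τ => τ.v .u = k * N ∧ τ.v .w = -32 - 32 * (k : ℤ) ∧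
        (∀ y, 0 ≤ y → τ.io y = σ.io y) ∧ ∀ i < k, τ.io (-32 - 32 * (i : ℤ)) = i * N) N
        (by simp [h', ← hNz]; ring) le_rfl (by simp [e3]) ?_ ?_
      · rintro k hk ω hkω g' ⟨a1, a2, a3, a4⟩
        have e5 : ω.v .N = N := (g'.v _ rfl).trans (by simp [h', ← hNz]; ring)
        simp [a1, a2, e5]
        refine ⟨by ring, by ring, fun y hy => ?_, fun i hi => ?_⟩
        · rw [if_neg (by omega), a3 y hy]
        · by_cases hik : i = k
          · simp [hik]
          · rw [if_neg (by omega), a4 i (by omega)]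
      · rintro ω g' ⟨-, -, a3, a4⟩
        refine ⟨(g'.v _ rfl).trans (by simp [e4]), (g'.v _ rfl).trans ?_, (g'.v _ rfl).trans ?_, a3, a4⟩
        · simp [h']; ring
        · simp [h', ← hNz]; ring

theorem wp_main {C : Ctx} {k : ℕ} {η : Fin k → Circuit} {ρ : Fin k → ℤ} {ex : ∀ x, Fin (η x).n → ℕ}
    {σ : St} (hE : Env C η ρ ex σ.io) (t : Term (Fin k))
    (ht : t.Within ρ (fun x => (η x).exps (ex x)) C.G) (hn : ∀ x, t.countVar x ≠ 0 → (η x).n ≤ C.N)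
    (hio : ∀ (i : ℕ) z, t.encode[i]? = some z → σ.io (2 + i) = z) (hL : t.encode.length = C.L)
    (hN : σ.v .N = C.N) (hK : σ.v .K = C.K) (hL' : σ.v .L = C.L) :
    main.wp C.dims σ fun τ => (t.ev ρ = none → τ.v .N = 0) ∧ ∀ z, t.ev ρ = some z → τ.v .N = 1 ∧
      ∃ Q : Circuit, Stored Q 0 τ.io ∧ Q.IsNormal ∧ Q.Represents z ∧
        Q.numMarked ≤ max 1 (supp z).card ∧
        ∀ H : Finset ℕ, (∀ p, Occurs z p → p ∈ H) → Q.n ≤ H.card + 1 := by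
  rw [main, wp_block_cons]
  refine wp_call (wp_init hN hK hL') fun τ f ⟨P, h⟩ => ?_
  rw [wp_block_cons]
  refine ⟨C.L, h.L, le_rfl, by decide, ?_⟩
  have := evaluates hE t ht hn 0 P [] (τ.setv .idx 0) (by simpa using hio) (by simp) (h.setIdx 0)
    (by simp) (by omega)
  rw [hL] at this
  exact iter_mono (step_mono C) _ _ _ _ _ this fun υ hυ => wp_output hυ

end Cmd

/-! ### The parameters and the complete program -/

/-- The parameters for the evaluation of a term. -/
theorem exists_ctx {k : ℕ} {η : Fin k → Circuit} {ρ : Fin k → ℤ} {ex : ∀ x, Fin (η x).n → ℕ}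
    (hex : ∀ x, (η x).HasExp (ex x) (ρ x)) (t : Term (Fin k)) :
    ∃ C : Ctx, C.L = t.encode.length ∧ C.K = 4 * (t.encode.length * vertexWeight t η) + 4 ∧
      C.N = 2 * (4 * (t.encode.length * vertexWeight t η) + 4) ∧
      t.Within ρ (fun x => (η x).exps (ex x)) C.G ∧
      ∀ z, t.ev ρ = some z → ∃ H : Finset ℕ, (∀ p, Occurs z p → p ∈ H) ∧
        H.card + 1 ≤ 2 * (t.size + 1) * vertexWeight t η := by
  obtain ⟨B, hB⟩ := Term.exists_base (b := fun x => (η x).exps (ex x))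
    (fun x => (hex x).isNafClosed) (fun x => (hex x).supp_subset) t
  have hw := weight_add_le t η (b := fun x => (η x).exps (ex x)) fun x => Circuit.card_exps_lt _
  have hlen := t.encode_length
  set W := vertexWeight t η
  set w := t.weight fun x => (η x).exps (ex x)
  -- From `|B| ≤ (|t| + 1) w + |t|` and `w + 1 ≤ W`. This bound serves both the choice of `K` and
  -- the number of vertices.
  have hcard : B.card + 1 ≤ (t.size + 1) * W := by
    have h1 : B.card ≤ (t.size + 1) * w + t.size := hB.card
    have h2 := Nat.mul_le_mul_left (t.size + 1) (show w + 1 ≤ W by omega)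
    rw [Nat.mul_add_one] at h2
    omega
  have hA : (t.size + 1) * W ≤ t.encode.length * W := Nat.mul_le_mul_right _ (by omega)
  have hL : t.encode.length ≤ t.encode.length * W := Nat.le_mul_of_pos_right _ (by omega)
  set A := t.encode.length * W
  -- Since `|B| + 1 ≤ A`, the value `K = 4 A + 4` satisfies the condition for carries to stop; and
  -- `2 |B| + K + 1 < 2 K`, so dimension `2 K` has room for all exponents ever used.
  refine ⟨⟨2 * (4 * A + 4), 4 * A + 4, t.encode.length,
    (B ∪ up B) ∪ Finset.range (4 * A + 4 + 1), ?_, ?_, ?_, ?_, fun p hp => ?_, fun p hp => ?_⟩,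
    rfl, rfl, rfl, hB.within.mono Finset.subset_union_left, fun z hz => ?_⟩
  · have h1 := Finset.card_union_le (B ∪ up B) (Finset.range (4 * A + 4 + 1))
    have h2 := Finset.card_union_le B (up B)
    have h3 := card_up_le B
    rw [Finset.card_range] at h1
    omega
  · omega
  · omega
  · omega
  · exact Finset.mem_union_right _ (Finset.mem_range.2 (by omega))
  · exact incCarry_eq_zero_of_mem hB.closed (by omega) hp
  · obtain ⟨H, h1, h2⟩ := exists_occurs_subset hB.closed (hB.sum z hz)
    exact ⟨H, h2, h1.trans (by rw [mul_assoc]; omega)⟩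

/-- The bound for the number of steps in terms of the size and the weight of a term. -/
theorem steps_le {s W L N a b : ℕ} (hL : L = 2 * s + 1) (hW : 1 ≤ W)
    (hN : N = 2 * (4 * (L * W) + 4)) :
    a * ((N + 1) ^ 1 * (L + 1) ^ 1) + (b * ((N + 1) ^ 3 * (L + 1) ^ 1) + 1) ≤
      (a + b + 1) * (51 ^ 3 * 4) * (max 1 s ^ 4 * W ^ 3) := by
  set m := max 1 s
  have hm : 1 ≤ m := le_max_left _ _
  have hs : s ≤ m := le_max_right _ _
  have h1 : L ≤ 3 * m := by omega
  have h2 : L * W ≤ 3 * (m * W) := by rw [← mul_assoc]; exact Nat.mul_le_mul_right _ h1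
  have h3 : 1 ≤ m * W := Nat.mul_pos hm hW
  have hLW : 1 ≤ L * W := Nat.mul_pos (by omega) hW
  -- With `L ≤ 3 m`, `N + 1 = 8 L W + 9` is at most `33 m W`; the constant is generous.
  have h4 : N + 1 ≤ 51 * (m * W) := by omega
  have h5 : (N + 1) ^ 3 * (L + 1) ^ 1 ≤ 51 ^ 3 * 4 * (m ^ 4 * W ^ 3) :=
    calc (N + 1) ^ 3 * (L + 1) ^ 1 ≤ (51 * (m * W)) ^ 3 * (4 * m) ^ 1 :=
          Nat.mul_le_mul (Nat.pow_le_pow_left h4 3) (Nat.pow_le_pow_left (by omega) 1)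
      _ = 51 ^ 3 * 4 * (m ^ 4 * W ^ 3) := by ring
  have h6 : (N + 1) ^ 1 * (L + 1) ^ 1 ≤ (N + 1) ^ 3 * (L + 1) ^ 1 :=
    Nat.mul_le_mul_right _ (Nat.pow_le_pow_right (by omega) (by omega))
  have h7 : 1 ≤ 51 ^ 3 * 4 * (m ^ 4 * W ^ 3) := Nat.mul_pos (by norm_num) (by positivity)
  have h8 := Nat.mul_le_mul_left a (h6.trans h5)
  have h9 := Nat.mul_le_mul_left b h5
  rw [mul_assoc (a + b + 1), add_mul, add_mul, one_mul]
  omega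

/-- The change of view after the preparatory phase: the negative cells outside the table become
matrix entries, with whatever contents they happen to have. -/
theorem Rep.of_mem {M : ℕ} {s : State} {σ : St} (h : Rep 0 s σ)
    (ht : ∀ i : ℕ, i < M → σ.io (-32 - 32 * (i : ℤ)) = i * M) :
    Rep M s ⟨σ.v, fun b i j => s.mem (-(b.ctorIdx + 1 : ℤ) - 32 * (i * M + j : ℤ)), σ.io⟩ :=
  ⟨h.var, fun z _ => h.io z (Or.inl rfl), fun _ _ _ _ _ => rfl,
    fun i hi => (h.io _ (Or.inl rfl)).trans (ht i hi)⟩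

/-- There is a program which evaluates terms. -/
theorem exists_program :
    ∃ (prog : Prog) (C : ℕ),
      ∀ (k : ℕ) (t : Term (Fin k)) (η : Fin k → Circuit)
        (ρ : Fin k → ℤ),
        (∀ x, (η x).IsNormal) → (∀ x, (η x).Represents (ρ x)) →
        ∃ (s : State) (T : ℕ),
          Exec prog
            (State.start (encodeInput t η)) s T ∧
          T ≤ C * (max 1 t.size ^ 4 * vertexWeight t η ^ 3) ∧
          ((¬ ∃ N : ℤ, t.Value ρ N) → s.Outputs none) ∧
          ∀ N : ℤ, t.Value ρ N →
            ∃ P : Circuit, s.Outputs (some P) ∧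
              P.IsNormal ∧ P.Represents N ∧
              P.numMarked ≤ max 1 (markedWeight t η) ∧
              P.numVertices ≤ 2 * (t.size + 1) * vertexWeight t η := by
  -- The last instruction puts the address `0` of the output into register `1`, which has served as
  -- an auxiliary register until then.
  refine ⟨.seq Cmd.pre.compile (.seq Cmd.main.compile (.set 1 0)),
    (Cmd.pre.size + Cmd.main.size + 1) * (51 ^ 3 * 4), fun k t η ρ hη hρ => ?_⟩
  choose ex hex using fun x => (hη x).exists_hasExp (hρ x)
  obtain ⟨C, hCL, hCK, hCN, hwithin, hH⟩ := exists_ctx hex t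
  have hlen := t.encode_length
  set s₀ := State.start (encodeInput t η)
  set σ₀ : St := ⟨fun _ => 0, fun _ _ _ => 0, s₀.mem⟩
  have r₀ : Rep 0 s₀ σ₀ := ⟨fun _ => rfl, fun _ _ => rfl, fun _ _ _ h => absurd h (by omega),
    fun _ h => absurd h (by omega)⟩
  have hst := start_stored t η
  have hpre := Cmd.wp_pre (σ := σ₀) (l := t.encode) (start_length t η) (start_symbol t η)
    (sum_symWeight (fun x => (hst x).n) t) hCN.symm
  obtain ⟨s₁, T₁, σ₁, e₁, c₁, r₁, p1, p2, p3, p4, p5⟩ := Cmd.wp_sound _ hpre r₀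
  have hE : Cmd.Env C η ρ ex σ₁.io := by
    refine ⟨fun x => ?_, hex⟩
    rw [p4 _ (by positivity), hCL]
    have h := hst x
    have hnn := h.nonneg
    exact ⟨hnn, (p4 _ hnn).trans h.n, fun v => (p4 _ (by positivity)).trans (h.mark v),
      fun v w => (p4 _ (by positivity)).trans (h.edge v w)⟩
  have hn : ∀ x, t.countVar x ≠ 0 → (η x).n ≤ C.N := fun x hx => by
    have h1 : t.countVar x * (η x).n ≤ ∑ y, t.countVar y * (η y).numVertices :=
      Finset.single_le_sum (f := fun y => t.countVar y * (η y).numVertices) (fun _ _ => Nat.zero_le _)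
        (Finset.mem_univ x)
    have h2 := Nat.le_mul_of_pos_left (η x).n (Nat.pos_of_ne_zero hx)
    have h3 : vertexWeight t η ≤ t.encode.length * vertexWeight t η :=
      Nat.le_mul_of_pos_left _ (by omega)
    rw [vertexWeight] at h3 hCN
    omega
  have hmain := Cmd.wp_main (σ := ⟨σ₁.v, fun b i j =>
      s₁.mem (-(b.ctorIdx + 1 : ℤ) - 32 * (i * C.N + j : ℤ)), σ₁.io⟩) hE t hwithin hn
    (fun i z hz => (p4 _ (by positivity)).trans (start_symbol t η i z hz)) hCL.symm p3
    (by rw [hCK]; exact p2) (by rw [hCL]; exact p1)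
  obtain ⟨s₂, T₂, σ₂, e₂, c₂, r₂, q1, q2⟩ := Cmd.wp_sound _ hmain (r₁.of_mem p5)
  refine ⟨_, _, .seq e₁ (.seq e₂ (.set _ 1 0)), ?_, fun hnone => ?_, fun N hN => ?_⟩
  · have b1 := c₁.trans (Cmd.cost_le _ _)
    have b2 := c₂.trans (Cmd.cost_le _ _)
    have hW := weight_add_le t η (b := fun x => (η x).exps (ex x)) fun x => Circuit.card_exps_lt _
    refine (Nat.add_le_add b1 (Nat.add_le_add_right b2 1)).trans ?_
    have := steps_le (a := Cmd.pre.size) (b := Cmd.main.size) (W := vertexWeight t η) hlen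
      (by omega) hCN
    rwa [← hCL] at this ⊢
  · have hev : t.ev ρ = none := by
      rcases h : t.ev ρ with _ | z
      · rfl
      · exact absurd ⟨z, Term.value_iff.2 h⟩ hnone
    -- Register `0` is the register of the variable `N`, which `output` has set to the success flag.
    exact (r₂.var .N).trans (q1 hev)
  · obtain ⟨hN1, Q, hQ, hnorm, hrep, hmark, hcard⟩ := q2 N (Term.value_iff.1 hN)
    obtain ⟨H, h1, h2⟩ := hH N (Term.value_iff.1 hN)
    refine ⟨Q, ⟨(r₂.var .N).trans hN1, fun i => ?_⟩, hnorm, hrep, hmark.trans (max_le_max le_rfl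
      (card_supp_ev_le (fun x => (hex x).card_supp_le) t N (Term.value_iff.1 hN))),
      (hcard H h1).trans h2⟩
    have h := (stored_iff.1 hQ).2 i _ (List.getElem?_eq_getElem i.2)
    exact (r₂.io _ (Or.inr (by simp))).trans h

end PowerCircuits

theorem mainTheorem6 :
    ∃ (prog : PowerCircuits.Prog) (C : ℕ),
      ∀ (k : ℕ) (t : PowerCircuits.Term (Fin k)) (η : Fin k → PowerCircuits.Circuit)
        (ρ : Fin k → ℤ),
        (∀ x, (η x).IsNormal) → (∀ x, (η x).Represents (ρ x)) →
        ∃ (s : PowerCircuits.State) (T : ℕ),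
          PowerCircuits.Exec prog
            (PowerCircuits.State.start (PowerCircuits.encodeInput t η)) s T ∧
          T ≤ C * (max 1 t.size ^ 4 * PowerCircuits.vertexWeight t η ^ 3) ∧
          ((¬ ∃ N : ℤ, t.Value ρ N) → s.Outputs none) ∧
          ∀ N : ℤ, t.Value ρ N →
            ∃ P : PowerCircuits.Circuit, s.Outputs (some P) ∧
              P.IsNormal ∧ P.Represents N ∧
              P.numMarked ≤ max 1 (PowerCircuits.markedWeight t η) ∧
              P.numVertices ≤ 2 * (t.size + 1) * PowerCircuits.vertexWeight t η := by
  exact PowerCircuits.exists_program
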